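/- **Setting.** A geometric planar graph is a connected graph $P=(V,E)$ drawn in the Euclidean plane with distinct vertex locations and with straight, pairwise non-crossing edges; its complexity is $p=|V|+|E|$. A trajectory $Q$ of complexity $q\ge 1$ is a sequence of $q$ points of the plane, regarded as a polygonal curve. A path $\pi$ in $P$ is a nonempty sequence of vertices in which consecutive vertices are adjacent. A $2.999$-approximate map matching query asks, for a given $Q$, for a number $v$ with $r^*\le v\le 2.999\,r^*$, where $r^*=\min_\pi d_F(\pi,Q)$ is the smallest Fréchet distance between $Q$ and a path $\pi$ in $P$. Algorithms are deterministic programs of a random access machine over the integers with logarithmic cost (every instruction costs one plus the bit lengths of the integers and addresses it handles), and a data structure answers any number of queries one after the other. The Strong Exponential Time Hypothesis (SETH) states that for every $\varepsilon>0$ there is a $k$ such that no such algorithm decides satisfiability of $k$-CNF formulas with $N$ variables and $M$ clauses in time $2^{(1-\varepsilon)N}\cdot\mathrm{poly}(N,M)$. **Theorem.** Assume SETH. There is an absolute constant $\kappa$ such that, for every $\delta>0$, there is no data structure for geometric planar graphs that can be constructed in time polynomial in the complexity $p$ of the graph and that answers $2.999$-approximate map matching queries for trajectories of complexity $q$ in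 $O((pq)^{1-\delta})$ time, even if it has to work only for graphs and trajectories whose vertices have integer coordinates of absolute value at most $p^\kappa$ (that is, $O(\log p)$-bit coordinates). This holds under any polynomial restriction $q=\Theta(p^\gamma)$: for all reals $\gamma>0$ and $0<c_1<c_2$ there is no such data structure even if it has to work only for trajectories with $c_1p^\gamma\le q\le c_2p^\gamma$. -/

import Mathlib

/-! ### Random access machines with logarithmic cost -/

namespace RAM

/-- A machine state: integer registers and integer arrays, each array indexed by the integers.
A program mentions only finitely many registers and arrays. -/
structure State where
  reg : ℕ → ℤ
  mem : ℕ → ℤ → ℤ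

/-- The state in which every register and every array cell is zero. -/
def State.zero : State := ⟨fun _ => 0, fun _ _ => 0⟩

/-- Set register `r` to `z`. -/
def State.setReg (s : State) (r : ℕ) (z : ℤ) : State :=
  { s with reg := fun r' => if r' = r then z else s.reg r' }

/-- Set cell `i` of array `a` to `z`. -/
def State.setMem (s : State) (a : ℕ) (i z : ℤ) : State :=
  { s with mem := fun a' j => if a' = a ∧ j = i then z else s.mem a' j }

/-- Write the list `l` into the cells `0, 1, …, l.length - 1` of array `a`; all other cells and
all registers keep their contents. -/
def State.write (s : State) (a : ℕ) (l : List ℤ) : State :=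
  { s with mem := fun a' j =>
      if a' = a ∧ 0 ≤ j ∧ j < (l.length : ℤ) then l.getD j.toNat 0 else s.mem a' j }

/-- Arithmetic instructions; division and remainder are Euclidean, with `x / 0 = 0`. -/
inductive Op
  | add | sub | mul | div | mod

def Op.eval : Op → ℤ → ℤ → ℤ
  | .add, x, y => x + y
  | .sub, x, y => x - y
  | .mul, x, y => x * y
  | .div, x, y => x / y
  | .mod, x, y => x % y

/-- Structured programs over registers and arrays. -/
inductive Prog
  /-- do nothing -/
  | skip
  /-- `r := z` -/
  | const (r : ℕ) (z : ℤ)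
  /-- `r := x o y` for registers `x`, `y` -/
  | arith (o : Op) (r x y : ℕ)
  /-- `r := a[i]`, the index being the content of register `i` -/
  | load (r a i : ℕ)
  /-- `a[i] := r`, the index being the content of register `i` -/
  | store (a i r : ℕ)
  /-- first `c`, then `d` -/
  | seq (c d : Prog)
  /-- if register `r` is positive then `c` else `d` -/
  | ite (r : ℕ) (c d : Prog)
  /-- while register `r` is positive do `c` -/
  | loop (r : ℕ) (c : Prog)

/-- The length of an integer: sign and binary digits. -/
def len (z : ℤ) : ℕ := z.natAbs.size + 1

/-- `Runs c s s' t`: program `c`, started in state `s`, halts in state `s'` at total cost `t`.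
Each instruction costs one plus the lengths of the integers it handles, addresses included. -/
inductive Runs : Prog → State → State → ℕ → Prop
  | skip (s : State) : Runs .skip s s 1
  | const (s : State) (r : ℕ) (z : ℤ) : Runs (.const r z) s (s.setReg r z) (1 + len z)
  | arith (s : State) (o : Op) (r x y : ℕ) :
      Runs (.arith o r x y) s (s.setReg r (o.eval (s.reg x) (s.reg y)))
        (1 + len (s.reg x) + len (s.reg y))
  | load (s : State) (r a i : ℕ) :
      Runs (.load r a i) s (s.setReg r (s.mem a (s.reg i)))
        (1 + len (s.reg i) + len (s.mem a (s.reg i)))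
  | store (s : State) (a i r : ℕ) :
      Runs (.store a i r) s (s.setMem a (s.reg i) (s.reg r))
        (1 + len (s.reg i) + len (s.reg r))
  | seq {c d : Prog} {s s' s'' : State} {t t' : ℕ} (h : Runs c s s' t) (h' : Runs d s' s'' t') :
      Runs (.seq c d) s s'' (t + t')
  | ite_pos {r : ℕ} {c d : Prog} {s s' : State} {t : ℕ} (hr : 0 < s.reg r) (h : Runs c s s' t) :
      Runs (.ite r c d) s s' (1 + len (s.reg r) + t)
  | ite_neg {r : ℕ} {c d : Prog} {s s' : State} {t : ℕ} (hr : s.reg r ≤ 0) (h : Runs d s s' t) :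
      Runs (.ite r c d) s s' (1 + len (s.reg r) + t)
  | loop_stop {r : ℕ} {c : Prog} {s : State} (hr : s.reg r ≤ 0) :
      Runs (.loop r c) s s (1 + len (s.reg r))
  | loop_step {r : ℕ} {c : Prog} {s s' s'' : State} {t t' : ℕ} (hr : 0 < s.reg r)
      (h : Runs c s s' t) (h' : Runs (.loop r c) s' s'' t') :
      Runs (.loop r c) s s'' (1 + len (s.reg r) + t + t')

end RAM

/-! ### Satisfiability and the Strong Exponential Time Hypothesis -/

namespace SAT

/-- A literal over `N` variables: a variable and its sign (`true` for a positive literal). -/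
abbrev Literal (N : ℕ) := Fin N × Bool

/-- A formula in conjunctive normal form: a list of clauses, each a list of literals. -/
abbrev CNF (N : ℕ) := List (List (Literal N))

def Satisfiable {N : ℕ} (φ : CNF N) : Prop :=
  ∃ x : Fin N → Bool, ∀ cl ∈ φ, ∃ l ∈ cl, x l.1 = l.2

/-- The variable with index `i` is written `i + 1`, its negation `-(i + 1)`. -/
def encodeLiteral {N : ℕ} (l : Literal N) : ℤ :=
  if l.2 then (l.1.val : ℤ) + 1 else -((l.1.val : ℤ) + 1)

/-- Number of variables, number of clauses, then every clause preceded by its length. -/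
def encode {N : ℕ} (φ : CNF N) : List ℤ :=
  (N : ℤ) :: (φ.length : ℤ) ::
    φ.flatMap fun cl => (cl.length : ℤ) :: cl.map encodeLiteral

/-- Some program decides satisfiability of every formula whose clauses have at most `k` literals,
with `N` variables and `M` clauses, in time `2 ^ ((1 - ε) N)` times a polynomial in `N` and `M`. -/
def KSATSolvable (k : ℕ) (ε : ℝ) : Prop :=
  ∃ (prog : RAM.Prog) (C : ℝ) (c : ℕ), ∀ (N : ℕ) (φ : CNF N), (∀ cl ∈ φ, cl.length ≤ k) →
    ∃ (s : RAM.State) (t : ℕ),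
      RAM.Runs prog (RAM.State.zero.write 0 (encode φ)) s t ∧
      (t : ℝ) ≤ C * (2 : ℝ) ^ ((1 - ε) * (N : ℝ)) * ((N : ℝ) + (φ.length : ℝ) + 1) ^ c ∧
      (s.reg 0 = 1 ↔ Satisfiable φ)

/-- The Strong Exponential Time Hypothesis. -/
def SETH : Prop := ∀ ε : ℝ, 0 < ε → ∃ k : ℕ, ¬ KSATSolvable k ε

end SAT

/-! ### Polygonal curves and the Fréchet distance -/

namespace MapMatching

abbrev Plane := EuclideanSpace ℝ (Fin 2)

/-- The polygonal curve through the vertices `a₀, …, a_{n-1}`, parametrised by `[0, n - 1]`. -/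
noncomputable def polyCurve (a : List Plane) (t : ℝ) : Plane :=
  (1 - Int.fract t) • a.getD ⌊t⌋₊ 0 + Int.fract t • a.getD (⌊t⌋₊ + 1) 0

/-- Continuous non-decreasing surjections from `[0, 1]` onto `[0, n - 1]`. -/
def IsReparam (n : ℕ) (f : ℝ → ℝ) : Prop :=
  ContinuousOn f (Set.Icc 0 1) ∧ MonotoneOn f (Set.Icc 0 1) ∧
    f '' Set.Icc 0 1 = Set.Icc 0 ((n : ℝ) - 1)

/-- The Fréchet distance of the polygonal curves with (nonempty) vertex lists `a` and `b`. -/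
noncomputable def frechetDist (a b : List Plane) : ℝ :=
  sInf {r : ℝ | ∃ f g : ℝ → ℝ, IsReparam a.length f ∧ IsReparam b.length g ∧
    r = sSup ((fun μ => dist (polyCurve a (f μ)) (polyCurve b (g μ))) '' Set.Icc 0 1)}

/-- A lattice point as a point of the Euclidean plane. -/
noncomputable def toPlane (z : ℤ × ℤ) : Plane := !₂[(z.1 : ℝ), (z.2 : ℝ)]

/-! ### Geometric planar graphs and map matching -/

/-- A graph drawn in the plane with vertices at lattice points and straight edges. -/
structure GeoGraph where
  numV : ℕ
  pos : Fin numV → ℤ × ℤ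
  edges : List (Fin numV × Fin numV)

namespace GeoGraph

/-- The complexity `|V| + |E|`. -/
def complexity (P : GeoGraph) : ℕ := P.numV + P.edges.length

/-- The underlying undirected graph. -/
def graph (P : GeoGraph) : SimpleGraph (Fin P.numV) where
  Adj u v := u ≠ v ∧ ((u, v) ∈ P.edges ∨ (v, u) ∈ P.edges)
  symm := ⟨fun _ _ h => ⟨h.1.symm, h.2.symm⟩⟩
  loopless := ⟨fun _ h => h.1 rfl⟩

/-- The location of a vertex in the Euclidean plane. -/
noncomputable def point (P : GeoGraph) (v : Fin P.numV) : Plane := toPlane (P.pos v)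

/-- The straight segment that represents an edge. -/
def seg (P : GeoGraph) (e : Fin P.numV × Fin P.numV) : Set Plane :=
  segment ℝ (P.point e.1) (P.point e.2)

/-- The drawing is a straight-line embedding: distinct vertices have distinct locations, there
are no loops, an edge contains no vertices but its ends, and two different edges meet only in
common ends (in particular, no edge is listed twice). -/
structure IsPlanar (P : GeoGraph) : Prop where
  pos_injective : Function.Injective P.pos
  ne_of_mem : ∀ e ∈ P.edges, e.1 ≠ e.2
  vertex_of_mem_seg : ∀ e ∈ P.edges, ∀ w, P.point w ∈ P.seg e → w = e.1 ∨ w = e.2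
  noncrossing : P.edges.Pairwise fun e f =>
    P.seg e ∩ P.seg f ⊆ {P.point e.1, P.point e.2} ∩ {P.point f.1, P.point f.2}

/-- Numbers of vertices and edges, then the coordinates of the vertices, then the edges. -/
def encode (P : GeoGraph) : List ℤ :=
  (P.numV : ℤ) :: (P.edges.length : ℤ) ::
    ((List.ofFn P.pos).flatMap (fun z => [z.1, z.2]) ++
      P.edges.flatMap fun e => [(e.1.val : ℤ), (e.2.val : ℤ)])

/-- The smallest Fréchet distance between `Q` and a path of `P`, a path being a nonempty sequence
of vertices in which consecutive vertices are adjacent. -/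
noncomputable def matchDist (P : GeoGraph) (Q : List (ℤ × ℤ)) : ℝ :=
  sInf {r : ℝ | ∃ π : List (Fin P.numV), π ≠ [] ∧ π.IsChain P.graph.Adj ∧
    r = frechetDist (π.map P.point) (Q.map toPlane)}

end GeoGraph

/-- The number of vertices of a trajectory, then their coordinates. -/
def encodeTraj (Q : List (ℤ × ℤ)) : List ℤ :=
  (Q.length : ℤ) :: Q.flatMap fun z => [z.1, z.2]

/-- Both coordinates have absolute value at most `b`. -/
def Bounded (b : ℕ) (z : ℤ × ℤ) : Prop := |z.1| ≤ (b : ℤ) ∧ |z.2| ≤ (b : ℤ)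

/-- There is a data structure for `ρ`-approximate map matching queries on connected geometric
planar graphs with preprocessing time polynomial in the complexity `p` of the graph and query
time `O((p q) ^ (1 - δ))` for trajectories of complexity `q`. It has to work for those graphs and
trajectories only whose vertices have integer coordinates of absolute value at most `p ^ κ`, and
for those trajectories only whose complexity satisfies `R p q`.

The preprocessing program gets the graph in array `0`. Thereafter queries are answered one after
the other: each trajectory is written into array `1` of the state left behind by what was done
before, and the query program returns a rational number, its numerator in register `0` and its
positive denominator in register `1`. The set `S` is the set of states that the data structure can
be in between two queries. -/
def HasDataStructure (κ : ℕ) (ρ δ : ℝ) (R : ℕ → ℕ → Prop) : Prop :=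
  ∃ (prep query : RAM.Prog) (C : ℝ) (α : ℕ),
    ∀ P : GeoGraph, P.IsPlanar → P.graph.Connected →
      (∀ v, Bounded (P.complexity ^ κ) (P.pos v)) →
      ∃ (s₀ : RAM.State) (t₀ : ℕ) (S : Set RAM.State),
        RAM.Runs prep (RAM.State.zero.write 0 P.encode) s₀ t₀ ∧
        (t₀ : ℝ) ≤ C * (P.complexity : ℝ) ^ α ∧
        s₀ ∈ S ∧
        ∀ s ∈ S, ∀ Q : List (ℤ × ℤ), Q ≠ [] →
          (∀ z ∈ Q, Bounded (P.complexity ^ κ) z) → R P.complexity Q.length →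
          ∃ s' ∈ S, ∃ t : ℕ,
            RAM.Runs query (s.write 1 (encodeTraj Q)) s' t ∧
            (t : ℝ) ≤ C * ((P.complexity : ℝ) * (Q.length : ℝ)) ^ (1 - δ) ∧
            0 < s'.reg 1 ∧
            P.matchDist Q ≤ (s'.reg 0 : ℝ) / (s'.reg 1 : ℝ) ∧
            (s'.reg 0 : ℝ) / (s'.reg 1 : ℝ) ≤ ρ * P.matchDist Q

end MapMatching

/-! ### Fréchet distance of zigzag curves -/

namespace MapMatching

/-! Suppose that a data structure with construction time `O(p ^ α)` and query time `O((p q) ^ (1 -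
δ))` exists. A `k`-CNF formula in `N` variables is then decided by splitting the variables into
about `N / D` low ones and the remaining high ones. An assignment of either half is turned into the
Boolean vector that marks the clauses which it leaves unsatisfied; the formula is satisfiable iff
some low vector is orthogonal to some high vector. All low vectors go into one graph, and the high
vectors are cut into batches of size `B`, each batch becoming a trajectory. Up to polynomial factors
`p` is `2 ^ (N / D)`, `q` is `B`, and there are `2 ^ (N - N / D) / B` queries, so all queries
together take `2 ^ N / (p q) ^ δ`. This saves a constant fraction of `N` in the exponent. So does
the construction, as `D` exceeds `α + 1`. Hence `SETH` fails.

The graph is a path whose abscissae alternate between valleys and peaks at a scale `S` compared with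
which the ordinates are negligible; the ordinates increase along the path, which makes the drawing
planar. The trajectory zigzags in the same way on the horizontal axis. At Fréchet distance below `3
S` two such zigzags must be traversed in step, vertex by vertex (`close_of_frechetDist_lt`). Valleys
carry identifiers eight units apart, so matched valleys have equal identifiers. Peaks carry bits: a
bit one of the graph, at `2`, and a bit one of the trajectory, at `5`, are exactly `3` apart, all
other pairs of peaks only `1`. The identifiers in a block of the graph descend, ascend and descend
again; those of the trajectory descend and ascend `B` times and descend once more. Two extreme
identifiers, which occur only at the ends of a block, force the walk to cross a whole block, hence
to climb its middle leg during one of the `B` ascents, and this compares one low vector with one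
high vector. So a match closer than `3 S` yields an orthogonal pair (`exists_pair_of_walk`), and an
orthogonal pair yields a match at distance at most `1.0001 S` (`walk_close`). As `2.999 * 1.0001 <
3`, an approximate answer tells the cases apart (`matchDist_gadget_le`, `le_matchDist_gadget`).

The rest is about machines. A batch size with `c₁ p ^ γ ≤ q ≤ c₂ p ^ γ` cannot in general be
computed, since `γ`, `c₁`, `c₂` are arbitrary reals, and for other sizes the data structure may
answer wrongly or run forever. Therefore all candidates from a geometric grid of polynomially many
batch sizes are tried. For each of them the data structure is run by a clocked simulation
(`simulates`) in a fresh residue class of the memory, and the last query answered with yes is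
confirmed by testing all its assignments. A wrong candidate can thus neither exceed the time limit
nor produce a false yes (`search_run`). At least one candidate meets the restriction on `q`
(`exists_candidate`), and for it the data structure stays within the budget and answers correctly
(`good_of_dataStructure`).

Reading an answer costs the length of its numerator and denominator, and these numbers may have been
left in their registers by an earlier query. A flag records whether a query has written either of
them: if not, the earlier comparison is still valid; otherwise one of the two is short, and so is
the other, because their quotient lies between `1` and an explicit bound (`len_numerator_le`). -/

/-- The piecewise linear function with values `a 0, a 1, …` at the natural numbers. -/
noncomputable def lin (a : ℕ → ℝ) (t : ℝ) : ℝ :=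
  (1 - Int.fract t) * a ⌊t⌋₊ + Int.fract t * a (⌊t⌋₊ + 1)

/-- The right end `t = k + 1` is included although the floor jumps there: the fractional part is
then zero, and both formulas give `a (k + 1)`. Closed intervals are what the monotonicity arguments
need. -/
theorem lin_eq (a : ℕ → ℝ) {k : ℕ} {t : ℝ} (h₁ : (k : ℝ) ≤ t) (h₂ : t ≤ k + 1) :
    lin a t = a k + (t - k) * (a (k + 1) - a k) := by
  rcases eq_or_lt_of_le h₂ with rfl | h₂
  · have h : ⌊(k : ℝ) + 1⌋₊ = k + 1 := by
      rw [show (k : ℝ) + 1 = ((k + 1 : ℕ) : ℝ) by push_cast; ring, Nat.floor_natCast]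
    have h' : Int.fract ((k : ℝ) + 1) = 0 := by
      rw [show (k : ℝ) + 1 = ((k + 1 : ℕ) : ℝ) by push_cast; ring, Int.fract_natCast]
    simp only [lin, h, h']; ring
  · have h : ⌊t⌋₊ = k := by
      rw [Nat.floor_eq_iff (le_trans (Nat.cast_nonneg k) h₁)]; exact ⟨h₁, h₂⟩
    have h' : Int.fract t = t - k := by
      rw [Int.fract_eq_iff]
      exact ⟨by linarith, by linarith, k, by push_cast; ring⟩
    simp only [lin, h, h']; ring

theorem lin_natCast (a : ℕ → ℝ) (k : ℕ) : lin a k = a k := by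
  rw [lin_eq a le_rfl (by linarith)]; ring

theorem lin_mono (a : ℕ → ℝ) {k : ℕ} {s t : ℝ} (ha : a k ≤ a (k + 1)) (h₁ : (k : ℝ) ≤ s)
    (hst : s ≤ t) (h₂ : t ≤ k + 1) : lin a s ≤ lin a t := by
  rw [lin_eq a h₁ (hst.trans h₂), lin_eq a (h₁.trans hst) h₂]; nlinarith

theorem lin_anti (a : ℕ → ℝ) {k : ℕ} {s t : ℝ} (ha : a (k + 1) ≤ a k) (h₁ : (k : ℝ) ≤ s)
    (hst : s ≤ t) (h₂ : t ≤ k + 1) : lin a t ≤ lin a s := by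
  rw [lin_eq a h₁ (hst.trans h₂), lin_eq a (h₁.trans hst) h₂]; nlinarith

/-- Among the first `n` values, those with even index lie at most at `l`, the others at
least at `h`. -/
def Zigzag (l h : ℝ) (a : ℕ → ℝ) (n : ℕ) : Prop :=
  ∀ k < n, (Even k → a k ≤ l) ∧ (¬ Even k → h ≤ a k)

theorem IsReparam.exists_eq {n : ℕ} {f : ℝ → ℝ} (hf : IsReparam n f) {k : ℕ} (hk : k < n) :
    ∃ μ ∈ Set.Icc (0 : ℝ) 1, f μ = k := by
  have : (k : ℝ) ∈ f '' Set.Icc 0 1 := by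
    rw [hf.2.2]
    have : (k : ℝ) + 1 ≤ n := by exact_mod_cast hk
    exact ⟨Nat.cast_nonneg k, by linarith⟩
  exact this

theorem IsReparam.mem {n : ℕ} {f : ℝ → ℝ} (hf : IsReparam n f) {μ : ℝ}
    (hμ : μ ∈ Set.Icc (0 : ℝ) 1) : 0 ≤ f μ ∧ f μ ≤ (n : ℝ) - 1 := by
  have : f μ ∈ Set.Icc (0 : ℝ) ((n : ℝ) - 1) := hf.2.2 ▸ Set.mem_image_of_mem f hμ
  exact this

theorem IsReparam.le_of_lt {n : ℕ} {f : ℝ → ℝ} (hf : IsReparam n f) {μ ν : ℝ}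
    (hμ : μ ∈ Set.Icc (0 : ℝ) 1) (hν : ν ∈ Set.Icc (0 : ℝ) 1) (h : f μ < f ν) : μ ≤ ν := by
  by_contra hc
  exact absurd (hf.2.1 hν hμ (le_of_not_ge hc)) (not_le.2 h)

section Sync

variable {n m : ℕ} {f g : ℝ → ℝ} {a b : ℕ → ℝ} {l h d : ℝ}

/-- A curve cannot run ahead of a zigzag that stays close to it. -/
theorem lt_of_close (hf : IsReparam n f) (hg : IsReparam m g) (hd : l + 2 * d ≤ h)
    (ha : Zigzag l h a n) (hb : Zigzag l h b m)
    (hc : ∀ μ ∈ Set.Icc (0 : ℝ) 1, |lin a (f μ) - lin b (g μ)| < d) (k : ℕ) :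
    ∀ μ ∈ Set.Icc (0 : ℝ) 1, f μ = (k : ℝ) + 1 → (k : ℝ) < g μ := by
  have hidx : ∀ μ ∈ Set.Icc (0 : ℝ) 1, ∀ j : ℕ, (j : ℝ) ≤ f μ → j < n := by
    intro μ hμ j hj
    have := (hf.mem hμ).2
    have : (j : ℝ) < n := by linarith
    exact_mod_cast this
  induction k with
  | zero =>
    intro μ hμ hfμ
    by_contra hle
    have h0 : g μ = (0 : ℕ) := le_antisymm (by simpa using hle) (by simpa using (hg.mem hμ).1)
    have h1 : f μ = ((1 : ℕ) : ℝ) := by rw [hfμ]; simp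
    have h2 := hc μ hμ
    rw [h0, h1, lin_natCast, lin_natCast, abs_lt] at h2
    have h3 := (ha 1 (hidx μ hμ 1 h1.ge)).2 (by decide)
    have hm : 0 < m := by
      have := hg.mem hμ
      have : (0 : ℝ) < m := by linarith
      exact_mod_cast this
    have h4 := (hb 0 hm).1 (by decide)
    linarith
  | succ k ih =>
    intro μ' hμ' hfμ'
    by_contra hle
    push Not at hle
    have hf2 : f μ' = ((k + 2 : ℕ) : ℝ) := by rw [hfμ']; push_cast; ring
    have hk2 := hidx μ' hμ' (k + 2) hf2.ge
    obtain ⟨μ, hμ, hfμ⟩ := hf.exists_eq (k := k + 1) (by omega)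
    have hμμ' : μ ≤ μ' := hf.le_of_lt hμ hμ' (by rw [hfμ, hf2]; push_cast; linarith)
    have hgk := ih μ hμ (by rw [hfμ]; push_cast; ring)
    have hgg := hg.2.1 hμ hμ' hμμ'
    have hk1 : k + 1 < m := by
      have := (hg.mem hμ).2
      have : (k : ℝ) + 1 < m := by linarith
      exact_mod_cast this
    have c1 := hc μ hμ
    have c2 := hc μ' hμ'
    rw [hfμ, lin_natCast, abs_lt] at c1
    rw [hf2, lin_natCast, abs_lt] at c2
    push_cast at hle
    -- Between the two times the second curve stays on its edge from `k` to `k + 1` and moves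
    -- towards the level of vertex `k + 1`, while the first one moves from that level to the
    -- opposite one. Closeness at both times would squeeze `h - l` below `2 * d`.
    by_cases he : Even k
    · have ho : ¬ Even (k + 1) := by simpa [Nat.even_add_one] using he
      have he2 : Even (k + 2) := by simpa [Nat.even_add_one] using he
      have := (ha (k + 1) (by omega)).2 ho
      have := (ha (k + 2) hk2).1 he2
      have := (hb (k + 1) hk1).2 ho
      have := (hb k (by omega)).1 he
      have hd0 : 0 < d := by linarith
      have := lin_mono b (by linarith) hgk.le hgg hle
      linarith
    · have ho : Even (k + 1) := by simpa [Nat.even_add_one] using he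
      have he2 : ¬ Even (k + 2) := by simpa [Nat.even_add_one] using he
      have := (ha (k + 1) (by omega)).1 ho
      have := (ha (k + 2) hk2).2 he2
      have := (hb (k + 1) hk1).1 ho
      have := (hb k (by omega)).2 he
      have hd0 : 0 < d := by linarith
      have := lin_anti b (by linarith) hgk.le hgg hle
      linarith

/-- If `n > m`, the first curve visits its vertex `m`, at which moment the second one would have to
be strictly beyond its last vertex `m - 1`. -/
theorem le_length_of_close (hf : IsReparam n f) (hg : IsReparam m g) (hm : 0 < m)
    (hd : l + 2 * d ≤ h) (ha : Zigzag l h a n) (hb : Zigzag l h b m)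
    (hc : ∀ μ ∈ Set.Icc (0 : ℝ) 1, |lin a (f μ) - lin b (g μ)| < d) : n ≤ m := by
  by_contra hlt
  push Not at hlt
  obtain ⟨μ, hμ, hfμ⟩ := hf.exists_eq hlt
  have h1 := lt_of_close hf hg hd ha hb hc (m - 1) μ hμ (by
    rw [hfμ, Nat.cast_sub (by omega)]; simp)
  have h2 := (hg.mem hμ).2
  rw [Nat.cast_sub (by omega)] at h1
  simp only [Nat.cast_one] at h1
  linarith

/-- When the second curve is at its vertex `k`, the first one is on an edge incident to its own
vertex `k`. On such an edge vertex `k` is the extreme point, hence it lies at least as far out as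
the current point. This gives one of the two inequalities; the other one comes from exchanging the
curves. -/
theorem vertex_close (hf : IsReparam n f) (hg : IsReparam m g)
    (hd : l + 2 * d ≤ h) (ha : Zigzag l h a n) (hb : Zigzag l h b m)
    (hc : ∀ μ ∈ Set.Icc (0 : ℝ) 1, |lin a (f μ) - lin b (g μ)| < d)
    {k : ℕ} (hkn : k < n) (hkm : k < m) :
    (Even k → a k < b k + d) ∧ (¬ Even k → b k - d < a k) := by
  have hc' : ∀ μ ∈ Set.Icc (0 : ℝ) 1, |lin b (g μ) - lin a (f μ)| < d := by
    intro μ hμ; rw [abs_sub_comm]; exact hc μ hμ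
  obtain ⟨μ, hμ, hgμ⟩ := hg.exists_eq hkm
  have hlt : f μ < k + 1 := by
    by_contra hge
    push Not at hge
    have hk1 : k + 1 < n := by
      have := (hf.mem hμ).2
      have : (k : ℝ) + 1 < n := by
        rcases lt_or_eq_of_le (show (k : ℝ) + 1 ≤ n by exact_mod_cast hkn) with h | h
        · exact h
        · linarith
      exact_mod_cast this
    obtain ⟨ν, hν, hfν⟩ := hf.exists_eq hk1
    have h1 := lt_of_close hf hg hd ha hb hc k ν hν (by rw [hfν]; push_cast; ring)
    have h2 : μ ≤ ν := hg.le_of_lt hμ hν (by rw [hgμ]; exact h1)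
    have h3 := hf.2.1 hμ hν h2
    rw [hfν] at h3
    push_cast at h3
    have h4 : f μ = f ν := by rw [hfν]; push_cast; linarith
    have h5 := lt_of_close hf hg hd ha hb hc k μ hμ (by rw [h4, hfν]; push_cast; ring)
    linarith
  have hgt : (k : ℝ) - 1 ≤ f μ ∧ 0 ≤ f μ := by
    refine ⟨?_, (hf.mem hμ).1⟩
    rcases k with _ | k
    · have := (hf.mem hμ).1; push_cast; linarith
    · have := lt_of_close hg hf hd hb ha hc' k μ hμ (by rw [hgμ]; push_cast; ring)
      push_cast; linarith
  have hcl := abs_lt.1 (hc μ hμ)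
  rw [hgμ, lin_natCast] at hcl
  rcases le_or_gt (k : ℝ) (f μ) with hk | hk
  · have e := lin_eq a hk hlt.le
    by_cases hk1 : k + 1 < n
    · have h1 := ha k hkn
      have h2 := ha (k + 1) hk1
      have hdl : 0 < d := (abs_nonneg _).trans_lt (hc μ hμ)
      constructor
      · intro he
        have := h1.1 he
        have := h2.2 (by simpa [Nat.even_add_one] using he)
        nlinarith
      · intro he
        have := h1.2 he
        have := h2.1 (by simpa [Nat.even_add_one] using he)
        nlinarith
    · have : f μ = k := by
        have h1 := (hf.mem hμ).2
        have : (n : ℝ) ≤ k + 1 := by exact_mod_cast (by omega : n ≤ k + 1)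
        linarith
      rw [this, lin_natCast] at hcl
      exact ⟨fun _ => by linarith, fun _ => by linarith⟩
  · rcases k with _ | k
    · push_cast at hk; linarith [hgt.2]
    · push_cast at hgt hk
      have e := lin_eq a (k := k) (t := f μ) (by linarith) (by linarith)
      have h1 := ha k (by omega)
      have h2 := ha (k + 1) hkn
      have hdl : 0 < d := (abs_nonneg _).trans_lt (hc μ hμ)
      have ht : f μ - k ≤ 1 := by linarith
      constructor
      · intro he
        have := h1.2 (by simpa [Nat.even_add_one] using he)
        have := h2.1 he
        nlinarith
      · intro he
        have := h1.1 (by simpa [Nat.even_add_one] using he)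
        have := h2.2 he
        nlinarith

end Sync

theorem polyCurve_apply (a : List Plane) (t : ℝ) (i : Fin 2) :
    polyCurve a t i = lin (fun k => a.getD k 0 i) t := by
  simp [polyCurve, lin]

theorem isReparam_linear {n : ℕ} (hn : 0 < n) : IsReparam n fun μ => μ * ((n : ℝ) - 1) := by
  have h1 : (0 : ℝ) ≤ (n : ℝ) - 1 := by
    have : (1 : ℝ) ≤ n := by exact_mod_cast hn
    linarith
  refine ⟨by fun_prop, fun x _ y _ h => mul_le_mul_of_nonneg_right h h1, ?_⟩
  ext y
  constructor
  · rintro ⟨x, ⟨hx0, hx1⟩, rfl⟩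
    exact ⟨mul_nonneg hx0 h1, by nlinarith⟩
  · rintro ⟨hy0, hy1⟩
    rcases eq_or_lt_of_le h1 with h | h
    · exact ⟨0, by simp, by simp; linarith⟩
    · exact ⟨y / ((n : ℝ) - 1), ⟨by positivity, by rw [div_le_one h]; exact hy1⟩,
        div_mul_cancel₀ _ h.ne'⟩

theorem frechetDist_bddBelow (a b : List Plane) :
    BddBelow {r : ℝ | ∃ f g : ℝ → ℝ, IsReparam a.length f ∧ IsReparam b.length g ∧
      r = sSup ((fun μ => dist (polyCurve a (f μ)) (polyCurve b (g μ))) '' Set.Icc 0 1)} := by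
  refine ⟨0, ?_⟩
  rintro r ⟨f, g, -, -, rfl⟩
  apply Real.sSup_nonneg
  rintro x ⟨μ, -, rfl⟩
  exact dist_nonneg

theorem frechetDist_nonneg (a b : List Plane) : 0 ≤ frechetDist a b := by
  apply Real.sInf_nonneg
  rintro r ⟨f, g, -, -, rfl⟩
  apply Real.sSup_nonneg
  rintro x ⟨μ, -, rfl⟩
  exact dist_nonneg

/-- Both curves are traversed linearly with the same parameter; on each edge the difference of the
two points is a convex combination of the differences at the vertices. -/
theorem frechetDist_le {a b : List Plane} {R : ℝ} (h0 : 0 < a.length)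
    (hlen : a.length = b.length) (h : ∀ k, dist (a.getD k 0) (b.getD k 0) ≤ R) :
    frechetDist a b ≤ R := by
  refine le_trans (csInf_le (frechetDist_bddBelow a b)
    ⟨_, _, isReparam_linear h0, isReparam_linear (hlen ▸ h0), rfl⟩) ?_
  apply csSup_le
  · exact (Set.nonempty_Icc.2 zero_le_one).image _
  rintro x ⟨μ, -, rfl⟩
  simp only [← hlen]
  generalize μ * ((a.length : ℝ) - 1) = t
  have e : polyCurve a t - polyCurve b t = (1 - Int.fract t) • (a.getD ⌊t⌋₊ 0 - b.getD ⌊t⌋₊ 0)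
      + Int.fract t • (a.getD (⌊t⌋₊ + 1) 0 - b.getD (⌊t⌋₊ + 1) 0) := by
    simp only [polyCurve]; module
  have h1 := h ⌊t⌋₊
  have h2 := h (⌊t⌋₊ + 1)
  have f0 := Int.fract_nonneg t
  have f1 := (Int.fract_lt_one t).le
  rw [dist_eq_norm] at h1 h2 ⊢
  rw [e]
  refine (norm_add_le _ _).trans ?_
  rw [norm_smul, norm_smul, Real.norm_of_nonneg f0, Real.norm_of_nonneg (by linarith)]
  nlinarith

theorem polyCurve_bounded (a : List Plane) : ∃ R, ∀ t, ‖polyCurve a t‖ ≤ R := by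
  have : ∃ R, ∀ k, ‖a.getD k 0‖ ≤ R := by
    induction a with
    | nil => exact ⟨0, by simp⟩
    | cons x l ih =>
      obtain ⟨R, hR⟩ := ih
      refine ⟨max ‖x‖ R, fun k => ?_⟩
      rcases k with _ | k
      · simp
      · simpa using Or.inr (by simpa using hR k)
  obtain ⟨R, hR⟩ := this
  refine ⟨R, fun t => ?_⟩
  have f0 := Int.fract_nonneg t
  have f1 := (Int.fract_lt_one t).le
  have h1 := hR ⌊t⌋₊
  have h2 := hR (⌊t⌋₊ + 1)
  rw [polyCurve]
  refine (norm_add_le _ _).trans ?_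
  rw [norm_smul, norm_smul, Real.norm_of_nonneg f0, Real.norm_of_nonneg (by linarith)]
  nlinarith

/-- Curves at Fréchet distance below `d` that both zigzag between two levels more than `2 d`
apart have the same number of vertices, and corresponding vertices are close. -/
theorem close_of_frechetDist_lt {a b : List Plane} {l h d : ℝ} (ha0 : 0 < a.length)
    (hb0 : 0 < b.length) (hd : l + 2 * d ≤ h)
    (ha : Zigzag l h (fun k => a.getD k 0 0) a.length ∨
      ∀ k < a.length, (Even k → h ≤ a.getD k 0 0))
    (hb : Zigzag l h (fun k => b.getD k 0 0) b.length) (hlt : frechetDist a b < d) :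
    a.length = b.length ∧ ∀ k < a.length, |a.getD k 0 0 - b.getD k 0 0| < d := by
  obtain ⟨r, ⟨f, g, hf, hg, rfl⟩, hr⟩ := exists_lt_of_csInf_lt
    (by exact ⟨_, _, _, isReparam_linear ha0, isReparam_linear hb0, rfl⟩) hlt
  have hbdd : BddAbove ((fun μ => dist (polyCurve a (f μ)) (polyCurve b (g μ))) ''
      Set.Icc 0 1) := by
    obtain ⟨R, hR⟩ := polyCurve_bounded a
    obtain ⟨R', hR'⟩ := polyCurve_bounded b
    refine ⟨R + R', ?_⟩
    rintro x ⟨μ, -, rfl⟩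
    exact (dist_le_norm_add_norm _ _).trans (add_le_add (hR _) (hR' _))
  have hc : ∀ μ ∈ Set.Icc (0 : ℝ) 1,
      |lin (fun k => a.getD k 0 0) (f μ) - lin (fun k => b.getD k 0 0) (g μ)| < d := by
    intro μ hμ
    have h1 := (le_csSup hbdd (Set.mem_image_of_mem _ hμ)).trans_lt hr
    rw [← polyCurve_apply, ← polyCurve_apply]
    refine lt_of_le_of_lt ?_ h1
    have := PiLp.norm_apply_le (polyCurve a (f μ) - polyCurve b (g μ)) 0
    simpa [dist_eq_norm] using this
  have ha' : Zigzag l h (fun k => a.getD k 0 0) a.length := by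
    rcases ha with ha | ha
    · exact ha
    -- The first curve starts on the upper level and the second one on the lower level. All
    -- reparametrisations match the two starting points, so this is already too far.
    · exfalso
      obtain ⟨μ, hμ, hfμ⟩ := hf.exists_eq ha0
      have h0 : f 0 = ((0 : ℕ) : ℝ) := le_antisymm
        (hfμ ▸ hf.2.1 (by simp) hμ hμ.1) (by simpa using (hf.mem (μ := 0) (by simp)).1)
      obtain ⟨ν, hν, hgν⟩ := hg.exists_eq hb0
      have h0' : g 0 = ((0 : ℕ) : ℝ) := le_antisymm
        (hgν ▸ hg.2.1 (by simp) hν hν.1) (by simpa using (hg.mem (μ := 0) (by simp)).1)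
      have h2 := hc 0 (by simp)
      rw [h0, h0', lin_natCast, lin_natCast, abs_lt] at h2
      have h3 := ha 0 ha0 (by decide)
      have h4 := (hb 0 hb0).1 (by decide)
      simp only at h2 h4
      linarith [h2.1, h2.2]
  have hc' : ∀ μ ∈ Set.Icc (0 : ℝ) 1,
      |lin (fun k => b.getD k 0 0) (g μ) - lin (fun k => a.getD k 0 0) (f μ)| < d := by
    intro μ hμ; rw [abs_sub_comm]; exact hc μ hμ
  have hlen : a.length = b.length := le_antisymm
    (le_length_of_close hf hg hb0 hd ha' hb hc) (le_length_of_close hg hf ha0 hd hb ha' hc')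
  refine ⟨hlen, fun k hk => ?_⟩
  have h1 := vertex_close hf hg hd ha' hb hc hk (hlen ▸ hk)
  have h2 := vertex_close hg hf hd hb ha' hc' (hlen ▸ hk) hk
  rw [abs_lt]
  by_cases he : Even k
  · have := h1.1 he
    have := h2.1 he
    constructor <;> linarith
  · have := h1.2 he
    have := h2.2 he
    constructor <;> linarith

end MapMatching

/-! ### Path graphs drawn with increasing ordinates -/

namespace MapMatching

/-- The path `0 - 1 - ⋯ - (V - 1)`, vertex `v` drawn at `(x v, v)`. -/
def lineGraph (V : ℕ) (x : ℕ → ℤ) : GeoGraph where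
  numV := V
  pos v := (x v, v)
  edges := List.ofFn fun e : Fin (V - 1) => (⟨e, by omega⟩, ⟨e + 1, by omega⟩)

theorem lineGraph_complexity (V : ℕ) (x : ℕ → ℤ) :
    (lineGraph V x).complexity = V + (V - 1) := by
  simp [GeoGraph.complexity, lineGraph]

theorem mem_lineGraph_edges {V : ℕ} {x : ℕ → ℤ} {e : Fin V × Fin V} :
    e ∈ (lineGraph V x).edges ↔ (e.2 : ℕ) = e.1 + 1 := by
  constructor
  · intro h
    obtain ⟨i, rfl⟩ := (List.mem_ofFn' _ _).1 h
    rfl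
  · intro h
    refine (List.mem_ofFn' _ _).2 ⟨⟨e.1, by have := e.2.2; omega⟩, ?_⟩
    ext <;> simp [h]

theorem lineGraph_adj {V : ℕ} {x : ℕ → ℤ} {u v : Fin V} :
    (lineGraph V x).graph.Adj u v ↔ (v : ℕ) = u + 1 ∨ (u : ℕ) = v + 1 := by
  simp only [GeoGraph.graph]
  have h1 := @mem_lineGraph_edges V x (u, v)
  have h2 := @mem_lineGraph_edges V x (v, u)
  simp only at h1 h2
  constructor
  · rintro ⟨-, h | h⟩
    · exact Or.inl (h1.1 h)
    · exact Or.inr (h2.1 h)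
  · rintro h
    refine ⟨fun e => ?_, h.imp h1.2 h2.2⟩
    rw [e] at h; omega

theorem lineGraph_connected {V : ℕ} (hV : 0 < V) (x : ℕ → ℤ) :
    (lineGraph V x).graph.Connected := by
  have key : ∀ k (hk : k < V), (lineGraph V x).graph.Reachable
      (⟨0, hV⟩ : Fin V) (⟨k, hk⟩ : Fin V) := by
    intro k
    induction k with
    | zero => intro _; exact SimpleGraph.Reachable.refl _
    | succ k ih =>
      intro hk
      refine (ih (by omega)).trans (SimpleGraph.Adj.reachable ?_)
      exact lineGraph_adj.2 (Or.inl rfl)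
  have : Nonempty (Fin (lineGraph V x).numV) := ⟨(⟨0, hV⟩ : Fin V)⟩
  refine SimpleGraph.Connected.mk fun u v => ?_
  exact (key u.1 u.2).symm.trans (key v.1 v.2)

/-- The ordinate is affine along an edge and increases by one, so it locates a point on the edge.
Planarity is read off from the ordinates alone. -/
theorem point_snd_of_mem_seg {V : ℕ} {x : ℕ → ℤ} {e : Fin V × Fin V}
    (he : e ∈ (lineGraph V x).edges) {z : Plane} (hz : z ∈ (lineGraph V x).seg e) :
    ((e.1 : ℕ) : ℝ) ≤ z 1 ∧ z 1 ≤ (e.1 : ℕ) + 1 ∧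
      (z 1 = (e.1 : ℕ) → z = (lineGraph V x).point e.1) ∧
      (z 1 = (e.1 : ℕ) + 1 → z = (lineGraph V x).point e.2) := by
  obtain ⟨a, b, ha, hb, hab, rfl⟩ := hz
  have h2 : (e.2 : ℕ) = e.1 + 1 := mem_lineGraph_edges.1 he
  have hy : (a • (lineGraph V x).point e.1 + b • (lineGraph V x).point e.2 : Plane) 1
      = (e.1 : ℕ) + b := by
    simp only [GeoGraph.point, lineGraph, toPlane]
    simp [h2]
    linear_combination (e.1 : ℝ) * hab
  rw [hy]
  refine ⟨by linarith, by linarith, fun h => ?_, fun h => ?_⟩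
  · have hb0 : b = 0 := by linarith
    have ha1 : a = 1 := by linarith
    simp [hb0, ha1]
  · have hb0 : b = 1 := by linarith
    have ha1 : a = 0 := by linarith
    simp [hb0, ha1]

theorem lineGraph_isPlanar (V : ℕ) (x : ℕ → ℤ) : (lineGraph V x).IsPlanar where
  pos_injective u v h := by
    have : ((u.1 : ℕ) : ℤ) = v.1 := congrArg Prod.snd h
    exact Fin.ext (by exact_mod_cast this)
  ne_of_mem e he h := by
    have : (e.2.1 : ℕ) = e.1.1 + 1 := mem_lineGraph_edges.1 he
    rw [h] at this; omega
  vertex_of_mem_seg e he w hw := by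
    obtain ⟨h1, h2, -, -⟩ := point_snd_of_mem_seg he hw
    have h2' : (e.2.1 : ℕ) = e.1.1 + 1 := mem_lineGraph_edges.1 he
    have hp : (lineGraph V x).point w 1 = (w.1 : ℕ) := by
      simp [GeoGraph.point, lineGraph, toPlane]
    rw [hp] at h1 h2
    have h1' : e.1.1 ≤ w.1 := by exact_mod_cast h1
    have h2'' : w.1 ≤ e.1.1 + 1 := by
      have : ((w.1 : ℕ) : ℝ) ≤ ((e.1.1 + 1 : ℕ) : ℝ) := by push_cast; exact h2
      exact_mod_cast this
    rcases Nat.lt_or_ge e.1.1 w.1 with h | h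
    · exact Or.inr (Fin.ext (by omega))
    · exact Or.inl (Fin.ext (by omega))
  noncrossing := by
    -- A common point of two edges has an ordinate at most that of the upper end of the earlier edge
    -- and at least that of the lower end of the later edge; so it is both of these ends.
    have key : ∀ e f : Fin V × Fin V, e ∈ (lineGraph V x).edges → f ∈ (lineGraph V x).edges →
        e.1 < f.1 → (lineGraph V x).seg e ∩ (lineGraph V x).seg f ⊆
          {(lineGraph V x).point e.1, (lineGraph V x).point e.2} ∩
          {(lineGraph V x).point f.1, (lineGraph V x).point f.2} := by
      rintro e f he hf hij z ⟨hi, hj⟩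
      obtain ⟨-, a2, -, a4⟩ := point_snd_of_mem_seg he hi
      obtain ⟨b1, -, b3, -⟩ := point_snd_of_mem_seg hf hj
      have hle : ((e.1 : ℕ) : ℝ) + 1 ≤ (f.1 : ℕ) := by
        have : (e.1 : ℕ) + 1 ≤ f.1 := hij
        exact_mod_cast this
      exact ⟨Or.inr (a4 (by linarith)), Or.inl (b3 (by linarith))⟩
    have : (List.ofFn fun e : Fin (V - 1) =>
        ((⟨e, by omega⟩, ⟨e + 1, by omega⟩) : Fin V × Fin V)).Pairwise fun e f =>
        (lineGraph V x).seg e ∩ (lineGraph V x).seg f ⊆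
          {(lineGraph V x).point e.1, (lineGraph V x).point e.2} ∩
          {(lineGraph V x).point f.1, (lineGraph V x).point f.2} :=
      List.pairwise_ofFn.2 fun i j hij => key _ _ (mem_lineGraph_edges.2 rfl) (mem_lineGraph_edges.2 rfl) hij
    exact this

end MapMatching

/-! ### Labels of the vertices of the graph and of the trajectory -/

namespace MapMatching

/-- Identifiers of the valleys of a block: down from `m + 1` to `0`, up to `m`, down to `-1`. -/
def pid (m w : ℕ) : ℤ :=
  if w ≤ m + 1 then (m : ℤ) + 1 - w else if w ≤ 2 * m + 1 then (w : ℤ) - m - 1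
  else 3 * (m : ℤ) + 1 - w

/-- A triangle wave with values from `m` down to `0` and back up to `m`. -/
def tri (m z : ℕ) : ℕ := if z % (2 * m) < m then m - z % (2 * m) else z % (2 * m) - m

/-- Identifiers of the valleys of the trajectory. -/
def qid (m B u : ℕ) : ℤ :=
  if u = 0 then (m : ℤ) + 1 else if u = (2 * B + 1) * m + 2 then -1 else (tri m (u - 1) : ℤ)

/-- Labels of the vertices of the graph. The bit `pa i c` is the coordinate `c` of vector `i`. -/
def plab (m : ℕ) (pa : ℕ → ℕ → Bool) (v : ℕ) : ℤ :=
  if v % 2 = 0 then -8 * pid m (v / 2 % (3 * m + 3)) - 20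
  else if m + 1 ≤ v / 2 % (3 * m + 3) ∧ v / 2 % (3 * m + 3) ≤ 2 * m ∧
    pa (v / 2 / (3 * m + 3)) (v / 2 % (3 * m + 3) - (m + 1)) = true then 2 else 4

/-- Labels of the vertices of the trajectory. -/
def qlab (m B : ℕ) (qb : ℕ → ℕ → Bool) (k : ℕ) : ℤ :=
  if k % 2 = 0 then -8 * qid m B (k / 2) - 19
  else if 1 ≤ k / 2 ∧ m ≤ (k / 2 - 1) % (2 * m) ∧
    qb ((k / 2 - 1) / (2 * m)) ((k / 2 - 1) % (2 * m) - m) = true then 5 else 3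

/-- The number of vertices of the graph. -/
def graphSize (m A : ℕ) : ℕ := A * (6 * m + 6)

/-- The number of vertices of the trajectory. -/
def trajSize (m B : ℕ) : ℕ := 2 * ((2 * B + 1) * m) + 5

theorem qid_ge (m B u : ℕ) : -1 ≤ qid m B u := by
  unfold qid; split_ifs <;> omega

theorem pid_ge {m w : ℕ} (h : w < 3 * m + 3) : -1 ≤ pid m w := by
  unfold pid; split_ifs <;> omega

theorem qlab_even (m B : ℕ) (qb : ℕ → ℕ → Bool) (u : ℕ) :
    qlab m B qb (2 * u) = -8 * qid m B u - 19 := by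
  simp [qlab]

theorem plab_even (m : ℕ) (pa : ℕ → ℕ → Bool) (w : ℕ) :
    plab m pa (2 * w) = -8 * pid m (w % (3 * m + 3)) - 20 := by
  simp [plab]

theorem plab_block_odd {m i w : ℕ} (pa : ℕ → ℕ → Bool) (hw : w < 3 * m + 3) :
    plab m pa (2 * (i * (3 * m + 3) + w) + 1) =
      if m + 1 ≤ w ∧ w ≤ 2 * m ∧ pa i (w - (m + 1)) = true then 2 else 4 := by
  have h1 : (2 * (i * (3 * m + 3) + w) + 1) / 2 = i * (3 * m + 3) + w := by omega
  have h2 : (i * (3 * m + 3) + w) % (3 * m + 3) = w := by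
    rw [Nat.mul_add_mod_self_right, Nat.mod_eq_of_lt hw]
  have h3 : (i * (3 * m + 3) + w) / (3 * m + 3) = i := by
    rw [Nat.add_comm, Nat.add_mul_div_right _ _ (by omega), Nat.div_eq_of_lt hw, Nat.zero_add]
  have h4 : ¬ (2 * (i * (3 * m + 3) + w) + 1) % 2 = 0 := by omega
  simp only [plab, h1, h2, h3, if_neg h4]

theorem plab_block_even {m i w : ℕ} (pa : ℕ → ℕ → Bool) (hw : w < 3 * m + 3) :
    plab m pa (2 * (i * (3 * m + 3) + w)) = -8 * pid m w - 20 := by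
  rw [plab_even, Nat.mul_add_mod_self_right, Nat.mod_eq_of_lt hw]

theorem qlab_odd (m B : ℕ) (qb : ℕ → ℕ → Bool) (z : ℕ) :
    qlab m B qb (2 * (z + 1) + 1) =
      if m ≤ z % (2 * m) ∧ qb (z / (2 * m)) (z % (2 * m) - m) = true then 5 else 3 := by
  have h1 : (2 * (z + 1) + 1) / 2 = z + 1 := by omega
  have h4 : ¬ (2 * (z + 1) + 1) % 2 = 0 := by omega
  simp only [qlab, h1, if_neg h4]
  simp

theorem succ_mod_div {d : ℕ} (hd : 0 < d) (z : ℕ) :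
    (z % d + 1 < d ∧ (z + 1) % d = z % d + 1 ∧ (z + 1) / d = z / d) ∨
      (z % d + 1 = d ∧ (z + 1) % d = 0 ∧ (z + 1) / d = z / d + 1) := by
  have hlt := Nat.mod_lt z hd
  have e := Nat.div_add_mod z d
  rcases Nat.lt_or_ge (z % d + 1) d with h | h
  · left
    refine ⟨h, ?_, ?_⟩
    · conv_lhs => rw [← e, Nat.add_assoc, Nat.mul_add_mod, Nat.mod_eq_of_lt h]
    · conv_lhs => rw [← e, Nat.add_assoc, Nat.mul_add_div hd, Nat.div_eq_of_lt h, Nat.add_zero]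
  · right
    have h' : z % d + 1 = d := by omega
    refine ⟨h', ?_, ?_⟩
    · conv_lhs => rw [← e, Nat.add_assoc, Nat.mul_add_mod, h', Nat.mod_self]
    · conv_lhs => rw [← e, Nat.add_assoc, Nat.mul_add_div hd, h', Nat.div_self hd]

section Sound

variable {m A B : ℕ} {pa qb : ℕ → ℕ → Bool} {v : ℕ → ℕ}

/-- The walk has to start at the left end and to finish at the right end of one block. If no pair
were orthogonal, it could leave the first leg only to climb the middle leg during an ascent of the
trajectory, and would be stopped there by a common bit one. So it would never get to the third leg,
where the last identifier can be reached. -/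
theorem exists_pair_of_walk (hm : 0 < m)
    (hv : ∀ k < trajSize m B, v k < graphSize m A)
    (hstep : ∀ k, k + 1 < trajSize m B → v (k + 1) = v k + 1 ∨ v k = v (k + 1) + 1)
    (hlab : ∀ k < trajSize m B, |plab m pa (v k) - qlab m B qb k| < 3) :
    ∃ i < A, ∃ j < B, ∀ c < m, ¬ (pa i c = true ∧ qb j c = true) := by
  set l := (2 * B + 1) * m with hl
  have hlen : trajSize m B = 2 * l + 5 := rfl
  -- Valleys of the trajectory have labels at most `-11`, peaks of the graph at least `2`.
  have heven : ∀ u ≤ l + 2, v (2 * u) % 2 = 0 := by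
    intro u hu
    have h := hlab (2 * u) (by omega)
    rw [qlab_even, abs_lt] at h
    have := qid_ge m B u
    by_contra hodd
    have : 2 ≤ plab m pa (v (2 * u)) := by
      unfold plab; rw [if_neg hodd]; split_ifs <;> norm_num
    omega
  obtain ⟨W, hW⟩ : ∃ W : ℕ → ℕ, ∀ u ≤ l + 2, v (2 * u) = 2 * W u :=
    ⟨fun u => v (2 * u) / 2, fun u hu => by have := heven u hu; dsimp only; omega⟩
  -- The difference of two valley labels is `-1` plus a multiple of eight, so an absolute value
  -- below `3` makes the identifiers equal.
  have hid : ∀ u ≤ l + 2, pid m (W u % (3 * m + 3)) = qid m B u := by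
    intro u hu
    have h := hlab (2 * u) (by omega)
    rw [qlab_even, hW u hu, plab_even, abs_lt] at h
    omega
  have hWstep : ∀ u, u + 1 ≤ l + 2 →
      (W (u + 1) = W u + 1 ∧ v (2 * u + 1) = 2 * W u + 1) ∨ W (u + 1) + 1 = W u ∨
        W (u + 1) = W u := by
    intro u hu
    have h1 := hstep (2 * u) (by omega)
    have h2 := hstep (2 * u + 1) (by omega)
    have h3 := hW u (by omega)
    have h4 := hW (u + 1) hu
    rw [show 2 * (u + 1) = 2 * u + 1 + 1 by ring] at h4
    omega
  have hmod : ∀ i w, w < 3 * m + 3 → (i * (3 * m + 3) + w) % (3 * m + 3) = w := by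
    intro i w hw
    rw [Nat.mul_add_mod_self_right, Nat.mod_eq_of_lt hw]
  -- the first valley
  set i := W 0 / (3 * m + 3) with hi
  -- The identifier `m + 1` occurs in a block only at its leftmost valley.
  have hW0 : W 0 = i * (3 * m + 3) := by
    have h := hid 0 (by omega)
    have hlt := Nat.mod_lt (W 0) (show 0 < 3 * m + 3 by omega)
    have e := Nat.div_add_mod' (W 0) (3 * m + 3)
    simp only [qid, if_true] at h
    have : W 0 % (3 * m + 3) = 0 := by
      unfold pid at h; split_ifs at h <;> omega
    rw [← hi, this] at e
    omega
  have hiA : i < A := by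
    have h := hv 0 (by omega)
    have h0 := hW 0 (by omega)
    rw [Nat.mul_zero] at h0
    rw [h0, hW0, graphSize] at h
    by_contra hge
    have : A * (3 * m + 3) ≤ i * (3 * m + 3) := Nat.mul_le_mul_right _ (not_lt.1 hge)
    have e : A * (6 * m + 6) = 2 * (A * (3 * m + 3)) := by ring
    omega
  have hq : ∀ z ≤ l, qid m B (z + 1) = tri m z := by
    intro z hz
    simp only [qid]
    rw [if_neg (by omega), if_neg (by omega)]; simp
  have hW1 : W 1 = i * (3 * m + 3) + 1 := by
    have h := hid 1 (by omega)
    rw [hq 0 (by omega)] at h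
    have ht : tri m 0 = m := by simp [tri, hm]
    rw [ht] at h
    rcases hWstep 0 (by omega) with ⟨h1, -⟩ | h1 | h1
    · rw [h1, hW0]
    -- The valley to the left, if there is one, closes the previous block and has identifier `-1`,
    -- while `m` is required.
    · exfalso
      rcases Nat.eq_zero_or_pos i with h0 | h0
      · rw [h0] at hW0; omega
      · obtain ⟨i', hi'⟩ : ∃ i', i = i' + 1 := ⟨i - 1, by omega⟩
        have : W 1 = i' * (3 * m + 3) + (3 * m + 2) := by
          rw [hi'] at hW0
          have : (i' + 1) * (3 * m + 3) = i' * (3 * m + 3) + (3 * m + 3) := by ring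
          simp only [Nat.zero_add] at h1
          omega
        rw [this, hmod _ _ (by omega)] at h
        unfold pid at h; split_ifs at h <;> omega
    · exfalso
      simp only [Nat.zero_add] at h1
      rw [h1, hW0, show i * (3 * m + 3) = i * (3 * m + 3) + 0 by rfl, hmod _ _ (by omega)] at h
      unfold pid at h; split_ifs at h <;> omega
  by_contra hno
  push Not at hno
  -- Either the walk is on the first leg, or the trajectory is in an ascent and the walk climbs the
  -- middle leg, all coordinates passed so far being free of common ones. The two alternatives
  -- overlap at the valley `w = m + 1`, where the legs meet.
  have inv : ∀ z ≤ l, ∃ w, W (z + 1) = i * (3 * m + 3) + w ∧ ((w + tri m z = m + 1) ∨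
      (m ≤ z % (2 * m) ∧ w = m + 1 + tri m z ∧
        ∀ c < z % (2 * m) - m, ¬ (pa i c = true ∧ qb (z / (2 * m)) c = true))) := by
    intro z
    induction z with
    | zero =>
      intro _
      exact ⟨1, hW1, Or.inl (by simp [tri, hm]; omega)⟩
    | succ z ih =>
      intro hz
      obtain ⟨w, hw, hinv⟩ := ih (by omega)
      have hid' := hid (z + 1 + 1) (by omega)
      rw [hq (z + 1) hz] at hid'
      have hst := hWstep (z + 1) (by omega)
      have hlt := Nat.mod_lt z (show 0 < 2 * m by omega)
      have hpk := hlab (2 * (z + 1) + 1) (by omega)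
      rw [qlab_odd] at hpk
      have hdm := Nat.div_add_mod z (2 * m)
      set r := z % (2 * m) with hr
      set s := z / (2 * m) with hs
      have hw1 : 1 ≤ w ∧ w ≤ 3 * m + 1 := by
        simp only [tri, ← hr] at hinv
        split_ifs at hinv <;> omega
      rcases hst with ⟨h1, h2⟩ | h1 | h1
      · -- a step to the right
        rw [hw] at h1 h2
        rw [h2, plab_block_odd pa (by omega), abs_lt] at hpk
        rw [h1, Nat.add_assoc, hmod _ _ (by omega)] at hid'
        refine ⟨w + 1, by rw [h1, Nat.add_assoc], ?_⟩
        rcases succ_mod_div (show 0 < 2 * m by omega) z with ⟨h3, h4, h5⟩ | ⟨h3, h4, h5⟩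
        · rw [h4, h5]
          simp only [tri, h4, ← hr, ← hs] at hinv hid' ⊢ h3
          rcases Nat.lt_or_ge r m with hrm | hrm
          · left
            rw [if_pos hrm] at hinv
            unfold pid at hid'
            split_ifs at hid' ⊢ <;> omega
          · right
            rw [if_neg (by omega)] at hinv
            rw [if_neg (by omega)] at hid' ⊢
            have hwr : w = m + 1 + (r - m) ∧
                ∀ c < r - m, ¬ (pa i c = true ∧ qb s c = true) := by
              rcases hinv with hinv | ⟨-, hinv, hc⟩
              · have : r = m := by
                  unfold pid at hid'
                  split_ifs at hid' <;> omega
                refine ⟨by omega, fun c hc => by omega⟩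
              · exact ⟨hinv, hc⟩
            refine ⟨by omega, by omega, fun c hc => ?_⟩
            -- The new coordinate `r - m` is read at the peak that has just been passed: two ones
            -- there would be `2` against `5`.
            rcases Nat.lt_or_ge c (r - m) with hlt' | hge
            · exact hwr.2 c hlt'
            · have hceq : c = r - m := by omega
              rintro ⟨hp, hq'⟩
              rw [hceq] at hp hq'
              rw [if_pos ⟨by omega, by omega, by
                rw [show w - (m + 1) = r - m by omega]; exact hp⟩, if_pos ⟨hrm, hq'⟩] at hpk
              norm_num at hpk
        -- The ascent ends with a step to the right. On the first leg the identifier would have gone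
        -- down; on the middle leg the last coordinate has now been checked, and the pair is
        -- orthogonal.
        · rw [h4, h5]
          simp only [tri, h4, ← hr, ← hs] at hinv hid' ⊢ h3
          rw [if_neg (by omega)] at hinv
          rw [if_pos (by omega)] at hid'
          exfalso
          rcases Nat.lt_or_ge w (m + 1) with hwm | hwm
          · have : w + 1 ≤ m + 1 := by omega
            rw [pid, if_pos this] at hid'
            omega
          · have hwr : w = m + 1 + (r - m) ∧
                ∀ c < r - m, ¬ (pa i c = true ∧ qb s c = true) := by
              rcases hinv with hinv | ⟨-, hinv, hc⟩
              · refine ⟨by omega, fun c hc => by omega⟩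
              · exact ⟨hinv, hc⟩
            -- The final, incomplete wave only descends, so an ascent belongs to one of the `B`
            -- vectors.
            have hsB : s < B := by
              by_contra hge
              have h6 : 2 * m * B ≤ 2 * m * s := Nat.mul_le_mul_left _ (not_lt.1 hge)
              have h7 : l = 2 * m * B + m := by rw [hl]; ring
              omega
            obtain ⟨c, hc, hp, hq'⟩ := hno i hiA s hsB
            rcases Nat.lt_or_ge c (r - m) with hlt' | hge
            · exact hwr.2 c hlt' ⟨hp, hq'⟩
            · have hceq : c = r - m := by omega
              rw [hceq] at hp hq'
              rw [if_pos ⟨by omega, by omega, by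
                rw [show w - (m + 1) = r - m by omega]; exact hp⟩,
                if_pos ⟨by omega, hq'⟩] at hpk
              norm_num at hpk
      · -- a step to the left
        have h1' : W (z + 1 + 1) = i * (3 * m + 3) + (w - 1) := by omega
        rw [h1', hmod _ _ (by omega)] at hid'
        refine ⟨w - 1, h1', Or.inl ?_⟩
        rcases succ_mod_div (show 0 < 2 * m by omega) z with ⟨h3, h4, h5⟩ | ⟨h3, h4, h5⟩
        all_goals
          simp only [tri, h4, ← hr] at hinv hid' ⊢ h3
          unfold pid at hid'
          split_ifs at hid' hinv ⊢ <;> omega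
      · exfalso
        rw [h1, hw, hmod _ _ (by omega)] at hid'
        rcases succ_mod_div (show 0 < 2 * m by omega) z with ⟨h3, h4, h5⟩ | ⟨h3, h4, h5⟩
        all_goals
          simp only [tri, h4, ← hr] at hinv hid' h3
          unfold pid at hid'
          split_ifs at hid' hinv <;> omega
  obtain ⟨w, hw, hinv⟩ := inv l le_rfl
  have hr : l % (2 * m) = m := by
    rw [hl, show (2 * B + 1) * m = 2 * m * B + m by ring, Nat.mul_add_mod,
      Nat.mod_eq_of_lt (by omega)]
  have hwm : w = m + 1 := by
    simp only [tri, hr] at hinv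
    simp at hinv
    omega
  have h := hid (l + 1 + 1) (by omega)
  have hqe : qid m B (l + 1 + 1) = -1 := by
    simp only [qid]; rw [if_neg (by omega), if_pos (by omega)]
  rw [hqe] at h
  rcases hWstep (l + 1) (by omega) with ⟨h1, -⟩ | h1 | h1
  · rw [h1, hw, Nat.add_assoc, hmod _ _ (by omega)] at h
    unfold pid at h; split_ifs at h <;> omega
  · have h1' : W (l + 1 + 1) = i * (3 * m + 3) + (w - 1) := by omega
    rw [h1', hmod _ _ (by omega)] at h
    unfold pid at h; split_ifs at h <;> omega
  · rw [h1, hw, hmod _ _ (by omega)] at h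
    unfold pid at h; split_ifs at h <;> omega

end Sound

/-- The valleys visited inside a block by the path that meets block `j` of the trajectory. -/
def walkValley (m B j u : ℕ) : ℕ :=
  if u = 0 then 0 else if u = (2 * B + 1) * m + 2 then 3 * m + 2
  else if (u - 1) / (2 * m) < j ∨ ((u - 1) / (2 * m) = j ∧ (u - 1) % (2 * m) ≤ m)
    then m + 1 - tri m (u - 1)
  else if (u - 1) / (2 * m) = j then m + 1 + tri m (u - 1) else 3 * m + 1 - tri m (u - 1)

theorem tri_le {m : ℕ} (hm : 0 < m) (z : ℕ) : tri m z ≤ m := by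
  have := Nat.mod_lt z (show 0 < 2 * m by omega)
  unfold tri; split_ifs <;> omega

theorem walkValley_lt {m : ℕ} (hm : 0 < m) (B j u : ℕ) : walkValley m B j u < 3 * m + 3 := by
  have := tri_le hm (u - 1)
  unfold walkValley; split_ifs <;> omega

theorem pid_walkValley {m B j u : ℕ} (hm : 0 < m) :
    pid m (walkValley m B j u) = qid m B u := by
  have ht := tri_le hm (u - 1)
  by_cases h0 : u = 0
  · simp [walkValley, qid, pid, h0]
  by_cases hlast : u = (2 * B + 1) * m + 2
  · simp only [walkValley, qid, if_neg h0, if_pos hlast, pid]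
    split_ifs <;> omega
  simp only [walkValley, qid, if_neg h0, if_neg hlast]
  split_ifs with h1 h2
  · unfold pid; split_ifs <;> omega
  · unfold pid; split_ifs <;> omega
  · unfold pid; split_ifs <;> omega

theorem walkValley_succ {m B j z : ℕ} (hz : z ≤ (2 * B + 1) * m) :
    walkValley m B j (z + 1) =
      if z / (2 * m) < j ∨ (z / (2 * m) = j ∧ z % (2 * m) ≤ m) then m + 1 - tri m z
      else if z / (2 * m) = j then m + 1 + tri m z else 3 * m + 1 - tri m z := by
  unfold walkValley
  rw [if_neg (by omega), if_neg (by omega)]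
  simp only [Nat.add_sub_cancel]

theorem walkValley_last {m B j : ℕ} :
    walkValley m B j ((2 * B + 1) * m + 1 + 1) = 3 * m + 2 := by
  unfold walkValley
  rw [if_neg (by omega), if_pos (by omega)]

theorem last_mod_div {m : ℕ} (hm : 0 < m) (B : ℕ) :
    (2 * B + 1) * m % (2 * m) = m ∧ (2 * B + 1) * m / (2 * m) = B := by
  rw [show (2 * B + 1) * m = 2 * m * B + m by ring]
  exact ⟨by rw [Nat.mul_add_mod, Nat.mod_eq_of_lt (by omega)],
    by rw [Nat.mul_add_div (by omega), Nat.div_eq_of_lt (by omega), Nat.add_zero]⟩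

theorem walkValley_end {m B j : ℕ} (hm : 0 < m) (hj : j < B) :
    walkValley m B j ((2 * B + 1) * m + 1) = 3 * m + 1 := by
  obtain ⟨hr, hs⟩ := last_mod_div hm B
  rw [walkValley_succ le_rfl, hr, hs, if_neg (by omega), if_neg (by omega), tri, hr,
    if_neg (by omega)]
  omega

/-- The three rules for the position agree where they meet: at identifier `0`, where the walk
changes from the first to the middle leg, and at identifier `m`, where it changes from the middle to
the third. -/
theorem walkValley_step {m B j u : ℕ} (hm : 0 < m) (hj : j < B) (hu : u < (2 * B + 1) * m + 2) :
    walkValley m B j (u + 1) = walkValley m B j u + 1 ∨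
      walkValley m B j u = walkValley m B j (u + 1) + 1 := by
  rcases Nat.eq_zero_or_pos u with h0 | h0
  · subst h0
    left
    rw [walkValley_succ (Nat.zero_le _)]
    have : j = 0 ∨ 0 < j := Nat.eq_zero_or_pos j
    simp [walkValley, tri, hm, this.symm, eq_comm]
  obtain ⟨z, rfl⟩ : ∃ z, u = z + 1 := ⟨u - 1, by omega⟩
  by_cases hz : z = (2 * B + 1) * m
  · left
    rw [hz, walkValley_last, walkValley_end hm hj]
  · rw [walkValley_succ (by omega), walkValley_succ (by omega)]
    simp only [tri]
    rcases succ_mod_div (show 0 < 2 * m by omega) z with ⟨h3, h4, h5⟩ | ⟨h3, h4, h5⟩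
    all_goals
      rw [h4, h5]
      generalize z % (2 * m) = r at *
      generalize z / (2 * m) = s at *
      rcases lt_trichotomy s j with hsj | hsj | hsj
      all_goals
        rcases Nat.lt_or_ge r m with hrm | hrm
        all_goals
          split_ifs <;> omega

/-- The path, inside a block, that meets block `j` of the trajectory. -/
def walkPos (m B j k : ℕ) : ℕ := walkValley m B j (k / 2) + walkValley m B j ((k + 1) / 2)

/-- The walk oscillates on the first leg during the waves before wave `j`, climbs the middle leg in
the ascent of wave `j`, and oscillates on the third leg afterwards. Outside the middle leg all peaks
are at `4`, which is compatible with both `3` and `5`; on the middle leg orthogonality excludes `2`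
against `5`. -/
theorem walk_close {m B i j : ℕ} {pa qb : ℕ → ℕ → Bool} (hm : 0 < m) (hj : j < B)
    (hc : ∀ c < m, ¬ (pa i c = true ∧ qb j c = true)) :
    ∀ k < trajSize m B, walkPos m B j k < 6 * m + 6 ∧
      (k + 1 < trajSize m B → walkPos m B j (k + 1) = walkPos m B j k + 1 ∨
        walkPos m B j k = walkPos m B j (k + 1) + 1) ∧
      |plab m pa (i * (6 * m + 6) + walkPos m B j k) - qlab m B qb k| ≤ 1 := by
  intro k hk
  set l := (2 * B + 1) * m with hl
  have hlen : trajSize m B = 2 * l + 5 := rfl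
  have hb : i * (6 * m + 6) = 2 * (i * (3 * m + 3)) := by ring
  refine ⟨?_, ?_, ?_⟩
  · have := walkValley_lt hm B j (k / 2)
    have := walkValley_lt hm B j ((k + 1) / 2)
    unfold walkPos; omega
  · intro hk'
    have := walkValley_step (u := k / 2) hm hj (by omega)
    have h1 : (k + 1 + 1) / 2 = k / 2 + 1 := by omega
    unfold walkPos
    rw [h1]
    omega
  · rcases Nat.even_or_odd' k with ⟨u, rfl | rfl⟩
    · have h1 : walkPos m B j (2 * u) = 2 * walkValley m B j u := by
        have h2 : 2 * u / 2 = u := by omega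
        have h3 : (2 * u + 1) / 2 = u := by omega
        unfold walkPos; rw [h2, h3]; ring
      rw [h1, hb, ← Nat.mul_add, plab_block_even pa (walkValley_lt hm B j u), qlab_even,
        pid_walkValley hm]
      rw [show -8 * qid m B u - 20 - (-8 * qid m B u - 19) = -1 by ring]
      norm_num
    · have hst := walkValley_step (u := u) hm hj (by omega)
      have h1 : walkPos m B j (2 * u + 1) = walkValley m B j u + walkValley m B j (u + 1) := by
        have h2 : (2 * u + 1) / 2 = u := by omega
        have h3 : (2 * u + 1 + 1) / 2 = u + 1 := by omega
        unfold walkPos; rw [h2, h3]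
      -- Whatever the direction of the step, the peak between two neighbouring valleys has the index
      -- that follows the left one.
      obtain ⟨w, hw, hwu⟩ : ∃ w, walkPos m B j (2 * u + 1) = 2 * w + 1 ∧
          w = min (walkValley m B j u) (walkValley m B j (u + 1)) := by
        refine ⟨_, ?_, rfl⟩
        rw [h1]
        rcases hst with h | h
        · rw [h, min_eq_left (by omega)]; omega
        · rw [h, min_eq_right (by omega)]; omega
      have hwlt : w < 3 * m + 3 := hwu ▸ (min_le_left _ _).trans_lt (walkValley_lt hm B j u)
      rw [hw, hb, ← Nat.add_assoc, ← Nat.mul_add, plab_block_odd pa hwlt]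
      rcases Nat.eq_zero_or_pos u with h0 | h0
      · subst h0
        have hw0 : w = 0 := by
          rw [hwu]; simp [walkValley]
        rw [if_neg (by omega)]
        simp [qlab]
      obtain ⟨z, rfl⟩ : ∃ z, u = z + 1 := ⟨u - 1, by omega⟩
      rw [qlab_odd]
      by_cases hq : m ≤ z % (2 * m) ∧ qb (z / (2 * m)) (z % (2 * m) - m) = true
      · rw [if_pos hq, if_neg, show (4 : ℤ) - 5 = -1 by norm_num]
        · norm_num
        rintro ⟨h2, h3, h4⟩
        have hlt := Nat.mod_lt z (show 0 < 2 * m by omega)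
        by_cases hz : z = l
        · rw [hz, hl, walkValley_last, walkValley_end hm hj] at hwu
          omega
        -- A peak of the middle leg is passed in an ascent of the trajectory only in wave `j`, and
        -- there the coordinates on both sides agree.
        have hwz : z / (2 * m) = j ∧ w = z % (2 * m) + 1 := by
          rw [walkValley_succ (by omega), walkValley_succ (by omega)] at hwu
          simp only [tri] at hwu
          have hrm := hq.1
          clear hc h4 hq hst h1 hw hb
          rcases succ_mod_div (show 0 < 2 * m by omega) z with ⟨h3, h4, h5⟩ | ⟨h3, h4, h5⟩
          all_goals
            rw [h4, h5] at hwu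
            generalize z % (2 * m) = r at *
            generalize z / (2 * m) = s at *
            rcases lt_trichotomy s j with hsj | hsj | hsj
            all_goals
              split_ifs at hwu <;> omega
        obtain ⟨hs, hwz⟩ := hwz
        refine hc (z % (2 * m) - m) (by omega) ⟨?_, ?_⟩
        · rw [show z % (2 * m) - m = w - (m + 1) by omega]; exact h4
        · rw [← hs]; exact hq.2
      · rw [if_neg hq]
        split_ifs <;> norm_num

end MapMatching

/-! ### The graph and the trajectory of two families of Boolean vectors -/

namespace MapMatching

/-- The scale of the drawing, large compared with the ordinates of the graph. -/
def scale (m A : ℕ) : ℕ := 100 * graphSize m A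

def gadgetGraph (m A : ℕ) (pa : ℕ → ℕ → Bool) : GeoGraph :=
  lineGraph (graphSize m A) fun v => (scale m A : ℤ) * plab m pa v

def gadgetTraj (m A B : ℕ) (qb : ℕ → ℕ → Bool) : List (ℤ × ℤ) :=
  (List.range (trajSize m B)).map fun k => ((scale m A : ℤ) * qlab m B qb k, 0)

theorem length_gadgetTraj (m A B : ℕ) (qb : ℕ → ℕ → Bool) :
    (gadgetTraj m A B qb).length = trajSize m B := by
  simp [gadgetTraj]

theorem getD_traj {m A B k : ℕ} (qb : ℕ → ℕ → Bool) (hk : k < trajSize m B) :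
    ((gadgetTraj m A B qb).map toPlane).getD k 0 =
      toPlane ((scale m A : ℤ) * qlab m B qb k, 0) := by
  rw [List.getD_eq_getElem _ _ (by simpa [gadgetTraj] using hk)]
  simp [gadgetTraj]

theorem getD_path {m A : ℕ} {pa : ℕ → ℕ → Bool} (π : List (Fin (gadgetGraph m A pa).numV)) {k : ℕ}
    (hk : k < π.length) :
    (List.map (gadgetGraph m A pa).point π).getD k 0 = toPlane ((scale m A : ℤ) * plab m pa (π[k] : ℕ), ((π[k] : ℕ) : ℤ)) := by
  rw [List.getD_eq_getElem _ _ (by rw [List.length_map]; exact hk), List.getElem_map]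
  rfl

/-- The ordinate is at most `S / 100`, and `1 + 10 ^ (-4)` is below the square of `1.0001`. -/
theorem dist_toPlane_le {S V : ℕ} (hS : S = 100 * V) {a b : ℤ} {v : ℕ} (hab : |a - b| ≤ 1)
    (hv : v < V) :
    dist (toPlane ((S : ℤ) * a, (v : ℤ))) (toPlane ((S : ℤ) * b, 0)) ≤ 1.0001 * (S : ℝ) := by
  have hV : (v : ℝ) ≤ V := by exact_mod_cast hv.le
  have hS' : (S : ℝ) = 100 * V := by rw [hS]; push_cast; ring
  have h1 : |(a : ℝ) - b| ≤ 1 := by exact_mod_cast hab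
  have h2 : ((a : ℝ) - b) ^ 2 ≤ 1 := by
    rw [← sq_abs]; nlinarith [abs_nonneg ((a : ℝ) - b)]
  have hv0 : (0 : ℝ) ≤ v := Nat.cast_nonneg v
  rw [EuclideanSpace.dist_eq, Fin.sum_univ_two, Real.sqrt_le_left (by positivity)]
  simp only [toPlane, Real.dist_eq, sq_abs]
  simp only [Matrix.cons_val_zero, Matrix.cons_val_one]
  push_cast
  have h3 : ((S : ℝ) * a - S * b) ^ 2 ≤ S ^ 2 := by
    have : ((S : ℝ) * a - S * b) ^ 2 = S ^ 2 * ((a : ℝ) - b) ^ 2 := by ring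
    rw [this]; nlinarith [sq_nonneg (S : ℝ)]
  have h4 : ((v : ℝ) - 0) ^ 2 ≤ (V : ℝ) ^ 2 := by
    rw [sub_zero]; exact pow_le_pow_left₀ hv0 hV 2
  have h5 : (V : ℝ) = S / 100 := by rw [hS']; ring
  rw [h5] at h4
  nlinarith [sq_nonneg (S : ℝ)]

theorem matchDist_bddBelow (P : GeoGraph) (Q : List (ℤ × ℤ)) :
    BddBelow {r : ℝ | ∃ π : List (Fin P.numV), π ≠ [] ∧ π.IsChain P.graph.Adj ∧
      r = frechetDist (π.map P.point) (Q.map toPlane)} :=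
  ⟨0, by rintro r ⟨π, -, -, rfl⟩; exact frechetDist_nonneg _ _⟩

theorem matchDist_gadget_le {m A B : ℕ} (hm : 0 < m) (pa qb : ℕ → ℕ → Bool)
    (h : ∃ i < A, ∃ j < B, ∀ c < m, ¬ (pa i c = true ∧ qb j c = true)) :
    (gadgetGraph m A pa).matchDist (gadgetTraj m A B qb) ≤ 1.0001 * (scale m A : ℝ) := by
  obtain ⟨i, hi, j, hj, hc⟩ := h
  have hw := walk_close (B := B) (qb := qb) (pa := pa) hm hj hc
  have hlt : ∀ k : Fin (trajSize m B), i * (6 * m + 6) + walkPos m B j k <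
      (gadgetGraph m A pa).numV := by
    intro k
    change _ < graphSize m A
    have h1 := (hw k k.2).1
    have h2 : (i + 1) * (6 * m + 6) ≤ A * (6 * m + 6) := Nat.mul_le_mul_right _ hi
    rw [graphSize]
    rw [Nat.add_mul] at h2
    omega
  set π : List (Fin (gadgetGraph m A pa).numV) := List.ofFn fun k : Fin (trajSize m B) =>
    ⟨i * (6 * m + 6) + walkPos m B j k, hlt k⟩ with hπ
  have hlen : π.length = trajSize m B := by simp [hπ]
  have hpos : 0 < trajSize m B := by unfold trajSize; omega
  refine le_trans (csInf_le (matchDist_bddBelow _ _) ⟨π, ?_, ?_, rfl⟩) ?_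
  · intro h0
    have := congrArg List.length h0
    rw [hlen, List.length_nil] at this
    omega
  · rw [List.isChain_iff_getElem]
    intro k hk
    rw [hlen] at hk
    refine lineGraph_adj.2 ?_
    have h1 := (hw k (by omega)).2.1 hk
    simp only [hπ, List.getElem_ofFn]
    omega
  · apply frechetDist_le
    · rw [List.length_map, hlen]; exact hpos
    · rw [List.length_map, List.length_map, length_gadgetTraj, hlen]
    · intro k
      rcases Nat.lt_or_ge k (trajSize m B) with hk | hk
      · rw [getD_traj qb hk]
        rw [getD_path π (hlen ▸ hk)]
        refine dist_toPlane_le rfl ?_ (π[k]'(hlen ▸ hk)).2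
        simp only [hπ, List.getElem_ofFn]
        exact (hw k hk).2.2
      · rw [List.getD_eq_default _ _ (by rw [List.length_map, hlen]; exact hk),
          List.getD_eq_default _ _ (by rw [List.length_map, length_gadgetTraj]; exact hk), dist_self]
        positivity

/-- A path closer than `3 * scale` would be synchronised with the trajectory, and its sequence of
vertices would be a walk to which `exists_pair_of_walk` applies. -/
theorem le_matchDist_gadget {m A B : ℕ} (hm : 0 < m) (hA : 0 < A) (pa qb : ℕ → ℕ → Bool)
    (h : ¬ ∃ i < A, ∃ j < B, ∀ c < m, ¬ (pa i c = true ∧ qb j c = true)) :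
    3 * (scale m A : ℝ) ≤ (gadgetGraph m A pa).matchDist (gadgetTraj m A B qb) := by
  have hV : 0 < graphSize m A := by unfold graphSize; positivity
  have hS : (0 : ℝ) < scale m A := by
    have : 0 < scale m A := by unfold scale; positivity
    exact_mod_cast this
  apply le_csInf
  · exact ⟨_, [(⟨0, hV⟩ : Fin (gadgetGraph m A pa).numV)], by simp, by simp, rfl⟩
  rintro r ⟨π, hne, hch, rfl⟩
  by_contra hlt
  push Not at hlt
  apply h
  have hxP : ∀ k (hk : k < π.length),
      ((List.map (gadgetGraph m A pa).point π).getD k 0) 0 =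
        (scale m A : ℝ) * plab m pa (π[k] : ℕ) := by
    intro k hk
    rw [getD_path π hk]
    simp [toPlane]
  have hxQ : ∀ k < trajSize m B, (((gadgetTraj m A B qb).map toPlane).getD k 0) 0 =
      (scale m A : ℝ) * qlab m B qb k := by
    intro k hk
    rw [getD_traj qb hk]
    simp [toPlane]
  have hstep : ∀ k (hk : k + 1 < π.length), (π[k + 1] : ℕ) = π[k] + 1 ∨
      (π[k] : ℕ) = π[k + 1] + 1 := by
    intro k hk
    have := List.isChain_iff_getElem.1 hch k hk
    exact lineGraph_adj.1 this
  have hpos : 0 < π.length := List.length_pos_of_ne_nil hne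
  -- Along a path in a path graph the parity of the vertices alternates. So a path is a zigzag,
  -- either in phase with the trajectory or in opposite phase, according to the parity of its first
  -- vertex.
  have hpar : ∀ k (hk : k < π.length), ((π[k] : ℕ) % 2 = 0 ↔ ((π[0] : ℕ) % 2 = 0 ↔ k % 2 = 0)) := by
    intro k
    induction k with
    | zero => intro _; simp
    | succ k ih =>
      intro hk
      have h1 := ih (by omega)
      have h2 := hstep k hk
      omega
  have hval : ∀ v, v % 2 = 0 → ((plab m pa v : ℤ) : ℝ) ≤ -11 := by
    intro v hv
    have : plab m pa v ≤ -11 := by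
      have := pid_ge (Nat.mod_lt (v / 2) (show 0 < 3 * m + 3 by omega))
      unfold plab; rw [if_pos hv]; omega
    exact_mod_cast this
  have hpk : ∀ v, ¬ v % 2 = 0 → (2 : ℝ) ≤ ((plab m pa v : ℤ) : ℝ) := by
    intro v hv
    have : 2 ≤ plab m pa v := by
      unfold plab; rw [if_neg hv]; split_ifs <;> norm_num
    exact_mod_cast this
  have hqv : ∀ k, k % 2 = 0 → ((qlab m B qb k : ℤ) : ℝ) ≤ -11 := by
    intro k hk
    have : qlab m B qb k ≤ -11 := by
      have := qid_ge m B (k / 2)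
      unfold qlab; rw [if_pos hk]; omega
    exact_mod_cast this
  have hqp : ∀ k, ¬ k % 2 = 0 → (2 : ℝ) ≤ ((qlab m B qb k : ℤ) : ℝ) := by
    intro k hk
    have : 2 ≤ qlab m B qb k := by
      unfold qlab; rw [if_neg hk]; split_ifs <;> norm_num
    exact_mod_cast this
  have hl1 : (List.map (gadgetGraph m A pa).point π).length = π.length := List.length_map _
  have hl2 : ((gadgetTraj m A B qb).map toPlane).length = trajSize m B := by
    rw [List.length_map, length_gadgetTraj]
  -- Valley labels are at most `-8 * (-1) - 19 = -11` and peak labels at least `2`, so there is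
  -- ample room for `-11 + 2 * 3 ≤ 2`.
  obtain ⟨hlen, hclose⟩ := close_of_frechetDist_lt (l := (scale m A : ℝ) * (-11))
    (h := (scale m A : ℝ) * 2) (d := 3 * (scale m A : ℝ))
    (hl1 ▸ hpos) (by rw [hl2]; unfold trajSize; omega) (by linarith) (by
      rw [hl1]
      by_cases h0 : (π[0] : ℕ) % 2 = 0
      · left
        intro k hk
        have h1 := hpar k hk
        simp only [h0, true_iff] at h1
        dsimp only
        rw [hxP k hk, Nat.even_iff]
        exact ⟨fun he => mul_le_mul_of_nonneg_left (hval _ (h1.2 he)) hS.le,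
          fun he => mul_le_mul_of_nonneg_left (hpk _ (fun hc => he (h1.1 hc))) hS.le⟩
      · right
        intro k hk he
        have h1 := hpar k hk
        rw [Nat.even_iff] at he
        rw [hxP k hk]
        exact mul_le_mul_of_nonneg_left (hpk _ (by tauto)) hS.le)
    (by
      rw [hl2]
      intro k hk
      dsimp only
      rw [hxQ k hk, Nat.even_iff]
      exact ⟨fun he => mul_le_mul_of_nonneg_left (hqv _ he) hS.le,
        fun he => mul_le_mul_of_nonneg_left (hqp _ he) hS.le⟩) hlt
  rw [hl1, hl2] at hlen
  rw [hl1] at hclose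
  refine exists_pair_of_walk (v := fun k => if hk : k < π.length then (π[k] : ℕ) else 0) hm ?_ ?_ ?_
  · intro k hk
    rw [dif_pos (hlen ▸ hk)]
    exact (π[k]'(hlen ▸ hk)).2
  · intro k hk
    have hk' : k + 1 < π.length := hlen ▸ hk
    rw [dif_pos hk', dif_pos (by omega : k < π.length)]
    exact hstep k hk'
  · intro k hk
    have hk' : k < π.length := hlen ▸ hk
    rw [dif_pos hk']
    have h1 := hclose k hk'
    rw [hxP k hk', hxQ k hk, ← mul_sub, abs_mul, abs_of_pos hS, mul_comm] at h1
    have h2 := lt_of_mul_lt_mul_right h1 hS.le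
    refine (Int.cast_lt (R := ℝ)).1 ?_
    push_cast
    exact h2

end MapMatching

/-! ### Lengths of integers and elementary properties of runs -/

namespace RAM

theorem len_pos (z : ℤ) : 1 ≤ len z := by simp [len]

theorem len_le_succ {z : ℤ} {k : ℕ} : len z ≤ k + 1 ↔ z.natAbs < 2 ^ k := by
  rw [len, Nat.succ_le_succ_iff, Nat.size_le]

theorem len_le_succ_of_abs {z : ℤ} {k : ℕ} (h₁ : -2 ^ k < z) (h₂ : z < 2 ^ k) :
    len z ≤ k + 1 := by
  rw [len_le_succ]
  have : (z.natAbs : ℤ) < ((2 ^ k : ℕ) : ℤ) := by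
    push_cast; rw [abs_lt]; exact ⟨h₁, h₂⟩
  exact_mod_cast this

theorem len_mono {x y : ℤ} (h : x.natAbs ≤ y.natAbs) : len x ≤ len y :=
  Nat.succ_le_succ (Nat.size_le_size h)

theorem natAbs_lt_of_len {z : ℤ} : z.natAbs < 2 ^ (len z - 1) := by
  have := (len_le_succ (z := z) (k := len z - 1)).1 (by have := len_pos z; omega)
  exact this

theorem len_add_le (x y : ℤ) : len (x + y) ≤ max (len x) (len y) + 1 := by
  have hx := natAbs_lt_of_len (z := x)
  have hy := natAbs_lt_of_len (z := y)
  have h1 := len_pos x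
  rw [len_le_succ]
  have hx' : x.natAbs < 2 ^ (max (len x) (len y) - 1) :=
    hx.trans_le (Nat.pow_le_pow_right (by norm_num) (by omega))
  have hy' : y.natAbs < 2 ^ (max (len x) (len y) - 1) :=
    hy.trans_le (Nat.pow_le_pow_right (by norm_num) (by omega))
  have h2 : 2 ^ max (len x) (len y) = 2 * 2 ^ (max (len x) (len y) - 1) := by
    rw [← pow_succ']; congr 1; omega
  have := Int.natAbs_add_le x y
  omega

theorem len_neg (x : ℤ) : len (-x) = len x := by simp [len]

theorem len_mul_lt (x y : ℤ) : len (x * y) + 1 ≤ len x + len y := by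
  have hx := natAbs_lt_of_len (z := x)
  have hy := natAbs_lt_of_len (z := y)
  have h1 := len_pos x
  have h2 := len_pos y
  have : len (x * y) ≤ (len x - 1 + (len y - 1)) + 1 := by
    rw [len_le_succ, Int.natAbs_mul, pow_add]
    exact Nat.mul_lt_mul'' hx hy
  omega

/-- The bound is the price of the instruction up to one, so a result never has a length that was not
paid for. It covers division and remainder by zero as well. -/
theorem len_eval_le (o : Op) (x y : ℤ) : len (o.eval x y) ≤ len x + len y := by
  have h1 := len_pos x
  have h2 := len_pos y
  cases o with
  | add => have := len_add_le x y; simp only [Op.eval]; omega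
  | sub =>
    have := len_add_le x (-y)
    rw [len_neg] at this
    simp only [Op.eval, sub_eq_add_neg]; omega
  | mul => have := len_mul_lt x y; simp only [Op.eval]; omega
  | div =>
    have : len (x / y) ≤ len x := len_mono (Int.natAbs_ediv_le_natAbs x y)
    simp only [Op.eval]; omega
  | mod =>
    simp only [Op.eval]
    by_cases hy : y = 0
    · subst hy; rw [Int.emod_zero]; omega
    · have : len (x % y) ≤ len y := by
        apply len_mono
        have h3 := Int.emod_nonneg x hy
        have h4 := Int.emod_lt_abs x hy
        rw [Int.abs_eq_natAbs] at h4
        omega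
      omega

/-- A register is either left alone by a run or its final content is paid for. -/
theorem Runs.reg_eq_or_len_le {c : Prog} {s s' : State} {t : ℕ} (h : Runs c s s' t) (r : ℕ) :
    s'.reg r = s.reg r ∨ len (s'.reg r) ≤ t := by
  induction h with
  | skip s => exact Or.inl rfl
  | const s r' z =>
    simp only [State.setReg]; split_ifs
    · exact Or.inr (by omega)
    · exact Or.inl rfl
  | arith s o r' x y =>
    simp only [State.setReg]; split_ifs
    · exact Or.inr (by have := len_eval_le o (s.reg x) (s.reg y); omega)
    · exact Or.inl rfl
  | load s r' a i =>
    simp only [State.setReg]; split_ifs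
    · exact Or.inr (by omega)
    · exact Or.inl rfl
  | store s a i r' => exact Or.inl rfl
  | seq _ _ ih₁ ih₂ =>
    rcases ih₂ with h | h
    · rw [h]; exact ih₁.imp id (fun h => by omega)
    · exact Or.inr (by omega)
  | ite_pos _ _ ih => exact ih.imp id (fun h => by omega)
  | ite_neg _ _ ih => exact ih.imp id (fun h => by omega)
  | loop_stop _ => exact Or.inl rfl
  | loop_step _ _ _ ih₁ ih₂ =>
    rcases ih₂ with h | h
    · rw [h]; exact ih₁.imp id (fun h => by omega)
    · exact Or.inr (by omega)

/-- Programs without loops. -/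
def Prog.LoopFree : Prog → Prop
  | .seq c d => c.LoopFree ∧ d.LoopFree
  | .ite _ c d => c.LoopFree ∧ d.LoopFree
  | .loop _ _ => False
  | _ => True

/-- Final state of a program without loops. -/
def Prog.exec : Prog → State → State
  | .skip, s => s
  | .const r z, s => s.setReg r z
  | .arith o r x y, s => s.setReg r (o.eval (s.reg x) (s.reg y))
  | .load r a i, s => s.setReg r (s.mem a (s.reg i))
  | .store a i r, s => s.setMem a (s.reg i) (s.reg r)
  | .seq c d, s => d.exec (c.exec s)
  | .ite r c d, s => if 0 < s.reg r then c.exec s else d.exec s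
  | .loop _ _, s => s

/-- Cost of a program without loops. -/
def Prog.cost : Prog → State → ℕ
  | .skip, _ => 1
  | .const _ z, _ => 1 + len z
  | .arith _ _ x y, s => 1 + len (s.reg x) + len (s.reg y)
  | .load _ a i, s => 1 + len (s.reg i) + len (s.mem a (s.reg i))
  | .store _ i r, s => 1 + len (s.reg i) + len (s.reg r)
  | .seq c d, s => c.cost s + d.cost (c.exec s)
  | .ite r c d, s => 1 + len (s.reg r) + if 0 < s.reg r then c.cost s else d.cost s
  | .loop _ _, _ => 0

theorem Prog.LoopFree.runs {c : Prog} (h : c.LoopFree) (s : State) :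
    Runs c s (c.exec s) (c.cost s) := by
  induction c generalizing s with
  | skip => exact .skip s
  | const r z => exact .const s r z
  | arith o r x y => exact .arith s o r x y
  | load r a i => exact .load s r a i
  | store a i r => exact .store s a i r
  | seq c d ihc ihd => exact .seq (ihc h.1 s) (ihd h.2 _)
  | ite r c d ihc ihd =>
    simp only [Prog.exec, Prog.cost]
    by_cases hr : 0 < s.reg r
    · rw [if_pos hr, if_pos hr]; exact .ite_pos hr (ihc h.1 s)
    · rw [if_neg hr, if_neg hr]; exact .ite_neg (not_lt.1 hr) (ihd h.2 s)
  | loop r c => exact h.elim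

theorem setReg_reg (s : State) (r r' : ℕ) (z : ℤ) :
    (s.setReg r z).reg r' = if r' = r then z else s.reg r' := rfl

theorem setReg_mem (s : State) (r : ℕ) (z : ℤ) : (s.setReg r z).mem = s.mem := rfl

theorem setMem_reg (s : State) (a : ℕ) (i z : ℤ) : (s.setMem a i z).reg = s.reg := rfl

theorem setMem_mem (s : State) (a a' : ℕ) (i j z : ℤ) :
    (s.setMem a i z).mem a' j = if a' = a ∧ j = i then z else s.mem a' j := rfl

end RAM

/-! ### Execution with a clock in a part of the memory

A program is executed on a copy of its state that is kept in the cells of the arrays whose index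
has a given remainder: the registers in array `1`, array `a` in array `a + 2`. Register `0` holds
the remaining time, register `1` the modulus, register `2` the remainder, and register `3` is set
to `1` when one of the simulated registers `0` and `1` is written. -/

namespace RAM

/-- Decrease the remaining time by about the length of register `6`. -/
def chargeInit : Prog :=
  .seq (.arith .mul 6 4 4) (.seq (.arith .mul 10 5 5) (.seq (.arith .add 6 6 10)
    (.seq (.const 8 2) (.seq (.const 9 1) (.seq (.const 11 1)
      (.seq (.arith .sub 10 6 8) (.arith .add 10 10 11)))))))

def chargeStep : Prog :=
  .seq (.arith .mul 8 8 8) (.seq (.arith .add 9 9 9)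
    (.seq (.arith .sub 10 6 8) (.arith .add 10 10 11)))

def chargeFin : Prog := .seq (.arith .sub 0 0 9) (.arith .sub 0 0 11)

def charge : Prog := .seq chargeInit (.seq (.loop 10 chargeStep) chargeFin)

/-- Load operands into registers `4` and `5`, pay for them, and continue if time is left. -/
def charged (pre k : Prog) : Prog :=
  .ite 0 (.seq pre (.seq charge (.ite 0 k .skip))) .skip

/-- Load the simulated register `x` into register `v`. -/
def getReg (v x : ℕ) : Prog :=
  .seq (.const 7 x) (.seq (.arith .mul 7 7 1) (.seq (.arith .add 7 7 2) (.load v 1 7)))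

/-- Store register `v` into the simulated register `x`. -/
def putReg (x v : ℕ) : Prog :=
  .seq (.const 7 x) (.seq (.arith .mul 7 7 1) (.seq (.arith .add 7 7 2) (.seq (.store 1 7 v)
    (if x ≤ 1 then .const 3 1 else .skip))))

/-- Turn the index in register `v` into an address in register `7`. -/
def address (v : ℕ) : Prog := .seq (.arith .mul 7 v 1) (.arith .add 7 7 2)

def guard (r : ℕ) : Prog :=
  .seq (.const 12 0) (charged (.seq (getReg 4 r) (.const 5 0)) (.arith .add 12 4 5))

/-- The program that simulates a given program. -/
def sim : Prog → Prog
  | .skip => .skip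
  | .const r z => charged (.seq (.const 4 z) (.const 5 0)) (putReg r 4)
  | .arith o r x y =>
      charged (.seq (getReg 4 x) (getReg 5 y)) (.seq (.arith o 4 4 5) (putReg r 4))
  | .load r a i =>
      charged (.seq (getReg 4 i) (.seq (address 4) (.load 5 (a + 2) 7))) (putReg r 5)
  | .store a i r =>
      charged (.seq (getReg 4 i) (getReg 5 r)) (.seq (address 4) (.store (a + 2) 7 5))
  | .seq c d => .seq (sim c) (sim d)
  | .ite r c d => charged (.seq (getReg 4 r) (.const 5 0)) (.ite 4 (sim c) (sim d))
  | .loop r c => .seq (guard r) (.loop 12 (.seq (sim c) (guard r)))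

/-- Only registers `4` to `11` differ. -/
def SameBut (h h' : State) : Prop :=
  h'.mem = h.mem ∧ ∀ r, r ≤ 3 ∨ 12 ≤ r → h'.reg r = h.reg r

/-- Only register `0` and registers `6` to `11` differ. -/
def SameCharge (h h' : State) : Prop :=
  h'.mem = h.mem ∧ ∀ r, (r ≠ 0 ∧ r ≤ 5) ∨ 12 ≤ r → h'.reg r = h.reg r

/-- Register `8` runs through `2 ^ (2 ^ i)` by squaring, register `9` through `2 ^ i`. The loop ends
when register `8` exceeds register `6`, so `2 ^ i` then approximates the length of register `6`
within a constant factor. The number of rounds is logarithmic in that length; `n` bounds the rounds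
that are left. -/
theorem chargeLoop_run (L : ℕ) (n : ℕ) : ∀ (i : ℕ) (h : State), len (h.reg 6) ≤ L →
    0 ≤ h.reg 6 → 2 ^ i ≤ 2 * L → h.reg 9 = 2 ^ i → h.reg 8 = 2 ^ (2 ^ i) → h.reg 11 = 1 →
    h.reg 10 = h.reg 6 - h.reg 8 + 1 → L < 2 ^ (i + n) → (i = 0 ∨ 2 ^ i ≤ 2 * len (h.reg 6) - 2) →
    ∃ h' t i', Runs (.loop 10 chargeStep) h h' t ∧ h'.mem = h.mem ∧ h'.reg 9 = 2 ^ i' ∧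
      h'.reg 11 = 1 ∧ (∀ r, r ≤ 5 ∨ 12 ≤ r → h'.reg r = h.reg r) ∧
      (i' = 0 ∨ 2 ^ i' ≤ 2 * len (h.reg 6) - 2) ∧ len (h.reg 6) ≤ 2 ^ i' + 1 ∧
      t ≤ (n + 1) * (60 * L) := by
  induction n with
  | zero =>
    intro i h hL h0 hi h9 h8 h11 h10 hn hi'
    have hL1 : 1 ≤ L := (len_pos _).trans hL
    have hlt : (h.reg 6).natAbs < 2 ^ (len (h.reg 6) - 1) := natAbs_lt_of_len
    have h1 : (h.reg 6).natAbs < 2 ^ (2 ^ i) :=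
      hlt.trans_le (Nat.pow_le_pow_right (by norm_num) (by simp at hn; omega))
    have h2 : h.reg 6 < h.reg 8 := by
      rw [h8]
      have : ((h.reg 6).natAbs : ℤ) < ((2 ^ 2 ^ i : ℕ) : ℤ) := by exact_mod_cast h1
      push_cast at this
      rwa [abs_of_nonneg h0] at this
    refine ⟨h, _, i, Runs.loop_stop (by rw [h10]; omega), rfl, h9, h11, fun _ _ => rfl, hi', ?_, ?_⟩
    · simp at hn; omega
    · have h3 : len (h.reg 8) ≤ 2 ^ i + 2 := by
        rw [len_le_succ, h8, Int.natAbs_pow]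
        exact Nat.pow_lt_pow_right (by norm_num) (by omega)
      have h4 := len_add_le (h.reg 6 - h.reg 8) 1
      have h5 := len_add_le (h.reg 6) (-h.reg 8)
      rw [len_neg, ← sub_eq_add_neg] at h5
      have h6 : len (1 : ℤ) = 2 := by decide
      rw [h10]
      omega
  | succ n ih =>
    intro i h hL h0 hi h9 h8 h11 h10 hn hi'
    have hL1 : 1 ≤ L := (len_pos _).trans hL
    have hl8 : len (h.reg 8) ≤ 2 ^ i + 2 := by
      rw [len_le_succ, h8, Int.natAbs_pow]
      exact Nat.pow_lt_pow_right (by norm_num) (by omega)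
    have hl1 : len (1 : ℤ) = 2 := by decide
    have hl10 : len (h.reg 10) ≤ 3 * L + 5 := by
      have h4 := len_add_le (h.reg 6 - h.reg 8) 1
      have h5 := len_add_le (h.reg 6) (-h.reg 8)
      rw [len_neg, ← sub_eq_add_neg] at h5
      rw [h10]
      omega
    rcases lt_or_ge (h.reg 6) (h.reg 8) with hc | hc
    · refine ⟨h, _, i, Runs.loop_stop (by rw [h10]; omega), rfl, h9, h11, fun _ _ => rfl, hi', ?_, ?_⟩
      · rw [len_le_succ]
        rw [h8] at hc
        zify
        rwa [abs_of_nonneg h0]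
      · nlinarith
    · have hpow : (h.reg 8) * h.reg 8 = 2 ^ (2 ^ (i + 1)) := by
        rw [h8, ← pow_add]; congr 1; ring
      have hsz : 2 ^ i + 2 ≤ len (h.reg 6) := by
        by_contra hlt
        have h1 : len (h.reg 6) ≤ 2 ^ i + 1 := by omega
        rw [len_le_succ] at h1
        zify at h1
        rw [abs_of_nonneg h0, ← h8] at h1
        omega
      obtain ⟨h', t, i', hrun, hm, h9', h11', hr, hi'', hlen, ht⟩ :=
        ih (i + 1) (chargeStep.exec h)
          (by simpa [chargeStep, Prog.exec, setReg_reg] using hL)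
          (by simpa [chargeStep, Prog.exec, setReg_reg] using h0)
          (by rw [pow_succ]; omega)
          (by simp [chargeStep, Prog.exec, setReg_reg, h9, Op.eval]; ring)
          (by simp [chargeStep, Prog.exec, setReg_reg, Op.eval, hpow])
          (by simp [chargeStep, Prog.exec, setReg_reg, h11])
          (by simp [chargeStep, Prog.exec, setReg_reg, h11, Op.eval])
          (by rw [show i + 1 + n = i + (n + 1) by ring]; exact hn)
          (by right; simp [chargeStep, Prog.exec, setReg_reg]; rw [pow_succ]; omega)
      have hlf : chargeStep.LoopFree := by simp [chargeStep, Prog.LoopFree]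
      have e6 : (chargeStep.exec h).reg 6 = h.reg 6 := by
        simp [chargeStep, Prog.exec, setReg_reg]
      rw [e6] at hi'' hlen
      refine ⟨h', _, i', .loop_step (by rw [h10]; omega) (hlf.runs h) hrun, ?_, h9', h11', ?_,
        hi'', hlen, ?_⟩
      · rw [hm]; simp [chargeStep, Prog.exec, setReg_mem]
      · intro r hr'
        rw [hr r hr']
        simp only [chargeStep, Prog.exec, setReg_reg]
        rw [if_neg (by omega), if_neg (by omega), if_neg (by omega), if_neg (by omega)]
      · have hl9 : len (h.reg 9) ≤ 2 ^ i + 1 := by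
          rw [len_le_succ, h9, Int.natAbs_pow]
          exact Nat.pow_lt_pow_right (by norm_num) Nat.lt_two_pow_self
        have hl88 := len_mul_lt (h.reg 8) (h.reg 8)
        have hsub := len_add_le (h.reg 6) (-(h.reg 8 * h.reg 8))
        rw [len_neg, ← sub_eq_add_neg] at hsub
        have hcost : chargeStep.cost h ≤ 40 * L := by
          simp only [chargeStep, Prog.cost, Prog.exec, setReg_reg, Op.eval, h11]
          simp only [Nat.reduceEqDiff, if_false, if_true, hl1]
          omega
        have : (n + 1 + 1) * (60 * L) = (n + 1) * (60 * L) + 60 * L := by ring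
        omega

/-- The sum of squares `x * x + y * y` combines both operands and both signs in one nonnegative
number at least as long as either of them. The amount taken off is `2 ^ i + 1`. It is at least both
lengths, so the simulated step is paid for, and at most four times their sum, which is why simulated
time is counted fourfold below. -/
theorem charge_run {h : State} {L b n : ℕ} (hL : len (h.reg 4) + len (h.reg 5) ≤ L)
    (hn : 2 * L < 2 ^ n) (hb : len (h.reg 0) ≤ b) :
    ∃ h' t amt, Runs charge h h' t ∧ SameCharge h h' ∧ h'.reg 0 = h.reg 0 - (amt : ℕ) ∧
      len (h.reg 4) ≤ amt ∧ len (h.reg 5) ≤ amt ∧ 1 ≤ amt ∧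
      amt ≤ 4 * (len (h.reg 4) + len (h.reg 5)) ∧ t ≤ (n + 2) * (300 * L) + 4 * b := by
  set x := h.reg 4 with hx
  set y := h.reg 5 with hy
  have px := len_pos x
  have py := len_pos y
  have hlf : chargeInit.LoopFree := by simp [chargeInit, Prog.LoopFree]
  have hlf' : chargeFin.LoopFree := by simp [chargeFin, Prog.LoopFree]
  have e6 : (chargeInit.exec h).reg 6 = x * x + y * y := by
    simp [chargeInit, Prog.exec, setReg_reg, Op.eval, hx, hy]
  have hnn : 0 ≤ x * x + y * y := add_nonneg (mul_self_nonneg x) (mul_self_nonneg y)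
  have hxx := len_mul_lt x x
  have hyy := len_mul_lt y y
  have hw := len_add_le (x * x) (y * y)
  have hl1 : len (1 : ℤ) = 2 := by decide
  have hl2 : len (2 : ℤ) = 3 := by decide
  obtain ⟨h₁, t₁, i, hrun, hm, h9, h11, hr, hi, hlen, ht⟩ :=
    chargeLoop_run (2 * L) n 0 (chargeInit.exec h) (by rw [e6]; omega)
      (by rw [e6]; exact hnn) (by simp; omega)
      (by simp [chargeInit, Prog.exec, setReg_reg]) (by simp [chargeInit, Prog.exec, setReg_reg])
      (by simp [chargeInit, Prog.exec, setReg_reg])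
      (by simp [chargeInit, Prog.exec, setReg_reg, Op.eval]) (by simpa using hn) (Or.inl rfl)
  rw [e6] at hi hlen
  have hxw : len x ≤ len (x * x + y * y) := by
    apply len_mono; zify; rw [abs_of_nonneg hnn]
    rcases abs_cases x with ⟨h1, h2⟩ | ⟨h1, h2⟩ <;> nlinarith
  have hyw : len y ≤ len (x * x + y * y) := by
    apply len_mono; zify; rw [abs_of_nonneg hnn]
    rcases abs_cases y with ⟨h1, h2⟩ | ⟨h1, h2⟩ <;> nlinarith
  have hw1 := len_pos (x * x + y * y)
  have hi2 : 2 ^ i ≤ 4 * L ∧ 2 ^ i + 1 ≤ 4 * (len x + len y) := by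
    rcases hi with rfl | hi
    · simp; omega
    · omega
  have h0 : h₁.reg 0 = h.reg 0 := by
    rw [hr 0 (by omega)]; simp [chargeInit, Prog.exec, setReg_reg]
  refine ⟨chargeFin.exec h₁, _, 2 ^ i + 1, .seq (hlf.runs h) (.seq hrun (hlf'.runs h₁)), ⟨?_, ?_⟩,
    ?_, by omega, by omega, by omega, hi2.2, ?_⟩
  · simp only [chargeFin, Prog.exec, setReg_mem, hm, chargeInit]
  · intro r hr'
    simp only [chargeFin, Prog.exec, setReg_reg]
    rw [if_neg (by omega), if_neg (by omega), hr r (by omega)]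
    simp only [chargeInit, Prog.exec, setReg_reg]
    rw [if_neg (by omega), if_neg (by omega), if_neg (by omega), if_neg (by omega),
      if_neg (by omega), if_neg (by omega), if_neg (by omega), if_neg (by omega)]
  · simp [chargeFin, Prog.exec, setReg_reg, Op.eval, h9, h11, h0]; ring
  · have c1 : chargeInit.cost h ≤ 60 * L := by
      have hs := len_add_le (x * x + y * y) (-2)
      rw [len_neg, ← sub_eq_add_neg] at hs
      simp only [chargeInit, Prog.cost, Prog.exec, setReg_reg, Op.eval, ← hx, ← hy]
      simp only [Nat.reduceEqDiff, if_false, if_true, hl1, hl2]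
      omega
    have c2 : chargeFin.cost h₁ ≤ 40 * L + 4 * b := by
      have h9l : len ((2 : ℤ) ^ i) ≤ 4 * L + 1 := by
        rw [len_le_succ, Int.natAbs_pow]
        exact Nat.pow_lt_pow_right (by norm_num) (Nat.lt_two_pow_self.trans_le hi2.1)
      have hs := len_add_le (h.reg 0) (-(2 : ℤ) ^ i)
      rw [len_neg, ← sub_eq_add_neg] at hs
      simp only [chargeFin, Prog.cost, Prog.exec, setReg_reg, Op.eval, h9, h0]
      simp only [OfNat.ofNat_ne_zero, if_false, if_true, h11, hl1]
      omega
    have e1 : (n + 2) * (300 * L) = 300 * (n * L) + 600 * L := by ring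
    have e2 : (n + 1) * (60 * (2 * L)) = 120 * (n * L) + 120 * L := by ring
    omega

end RAM

namespace RAM

/-- Lengths of the simulated cells plus the remaining time are bounded by `B`. -/
structure SimInv (Z B ℓ : ℕ) (h : State) : Prop where
  nonneg : 0 ≤ h.reg 2
  lt : h.reg 2 < h.reg 1
  len_one : len (h.reg 1) ≤ ℓ + 1
  len_two : len (h.reg 2) ≤ ℓ + 1
  len_zero : len (h.reg 0) ≤ ℓ + 1
  const_le : Z + (h.reg 0).toNat ≤ B
  cell_le : ∀ (a : ℕ) (i : ℤ),
    len (h.mem (a + 1) (i * h.reg 1 + h.reg 2)) + (h.reg 0).toNat ≤ B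
  pow : 20 * B < 2 ^ ℓ

/-- What a simulated program may change. -/
structure Frame (h h' : State) : Prop where
  reg : ∀ r, r = 1 ∨ r = 2 ∨ 13 ≤ r → h'.reg r = h.reg r
  dirty : h'.reg 3 = h.reg 3 ∨ h'.reg 3 = 1
  clock : h'.reg 0 ≤ h.reg 0
  mem_zero : h'.mem 0 = h.mem 0
  mem : ∀ a i, i % h.reg 1 ≠ h.reg 2 → h'.mem a i = h.mem a i

/-- The state `h` holds a copy of the state `s`. -/
def Rel (h s : State) : Prop :=
  (∀ r : ℕ, h.mem 1 (r * h.reg 1 + h.reg 2) = s.reg r) ∧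
    ∀ (a : ℕ) (i : ℤ), h.mem (a + 2) (i * h.reg 1 + h.reg 2) = s.mem a i

/-- The flag in register `3` tells whether registers `0` and `1` of the copy are unchanged. -/
def Flag (h h' s s' : State) (t : ℕ) : Prop :=
  (h'.reg 3 = 1 ∧ (len (s'.reg 0) ≤ t ∨ len (s'.reg 1) ≤ t)) ∨
    (h'.reg 3 = h.reg 3 ∧ s'.reg 0 = s.reg 0 ∧ s'.reg 1 = s.reg 1)

/-- The potential that pays for simulated steps. -/
def pot (B : ℕ) (h : State) : ℕ := if 0 < h.reg 0 then (h.reg 0).toNat + B else 0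

/-- Effect of a simulated program. -/
structure SimOut (c : Prog) (K Z B ℓ : ℕ) (h h' : State) (t : ℕ) : Prop where
  inv : SimInv Z B ℓ h'
  frame : Frame h h'
  pot_le : pot B h' ≤ pot B h
  time : t + K * (ℓ + 1) * pot B h' ≤ K * (ℓ + 1) * (pot B h + 1)
  faithful : ∀ s s' t, Rel h s → Runs c s s' t → 4 * (t : ℤ) < h.reg 0 →
    Rel h' s' ∧ h.reg 0 ≤ h'.reg 0 + 4 * t ∧ Flag h h' s s' t

theorem Frame.refl (h : State) : Frame h h :=
  ⟨fun _ _ => rfl, Or.inl rfl, le_rfl, rfl, fun _ _ _ => rfl⟩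

theorem Frame.trans {h h' h'' : State} (f : Frame h h') (g : Frame h' h'') : Frame h h'' where
  reg r hr := (g.reg r hr).trans (f.reg r hr)
  dirty := by
    rcases g.dirty with h1 | h1
    · rw [h1]; exact f.dirty
    · exact Or.inr h1
  clock := g.clock.trans f.clock
  mem_zero := g.mem_zero.trans f.mem_zero
  mem a i hi := by
    rw [g.mem a i (by rw [f.reg 1 (by simp), f.reg 2 (by simp)]; exact hi), f.mem a i hi]

theorem pot_mono {B : ℕ} {h h' : State} (hle : h'.reg 0 ≤ h.reg 0) : pot B h' ≤ pot B h := by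
  unfold pot; split_ifs <;> omega

theorem Flag.trans {h h' h'' s s' s'' : State} {t t' : ℕ} (f : Flag h h' s s' t)
    (g : Flag h' h'' s' s'' t') : Flag h h'' s s'' (t + t') := by
  rcases g with ⟨h1, h2⟩ | ⟨h1, h2, h3⟩
  · exact Or.inl ⟨h1, h2.imp (fun h => by omega) (fun h => by omega)⟩
  · rcases f with ⟨h4, h5⟩ | ⟨h4, h5, h6⟩
    · exact Or.inl ⟨h1.trans h4, by rw [h2, h3]; exact h5.imp (fun h => by omega) (fun h => by omega)⟩
    · exact Or.inr ⟨h1.trans h4, h2.trans h5, h3.trans h6⟩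

theorem Flag.mono {h h' s s' : State} {t t' : ℕ} (f : Flag h h' s s' t) (ht : t ≤ t') :
    Flag h h' s s' t' :=
  f.imp (fun h => ⟨h.1, h.2.imp (fun h => h.trans ht) (fun h => h.trans ht)⟩) id

/-- Because the potential does not increase, an estimate with a small factor implies the one with a
larger factor; constants of different programs can thus be unified. -/
theorem time_mono {K K' q p p' t : ℕ} (hK : K ≤ K') (hp : p' ≤ p)
    (h : t + K * q * p' ≤ K * q * (p + 1)) : t + K' * q * p' ≤ K' * q * (p + 1) := by
  obtain ⟨d, rfl⟩ := Nat.exists_eq_add_of_le hK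
  have : d * q * p' ≤ d * q * (p + 1) := Nat.mul_le_mul_left _ (by omega)
  have e1 : (K + d) * q * p' = K * q * p' + d * q * p' := by ring
  have e2 : (K + d) * q * (p + 1) = K * q * (p + 1) + d * q * (p + 1) := by ring
  omega

theorem SimOut.mono {c : Prog} {K K' Z B ℓ : ℕ} {h h' : State} {t : ℕ} (hK : K ≤ K')
    (o : SimOut c K Z B ℓ h h' t) : SimOut c K' Z B ℓ h h' t :=
  ⟨o.inv, o.frame, o.pot_le, time_mono hK o.pot_le o.time, o.faithful⟩

/-- Without remaining time a simulated program does nothing. The term `+ 1` in the time bound pays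
for noticing this. -/
theorem SimInv.refl_of_stopped {c : Prog} {K Z B ℓ : ℕ} {h : State} {t : ℕ} (hi : SimInv Z B ℓ h)
    (h0 : h.reg 0 ≤ 0) (ht : t ≤ K * (ℓ + 1)) : SimOut c K Z B ℓ h h t where
  inv := hi
  frame := Frame.refl h
  pot_le := le_rfl
  time := by
    have : K * (ℓ + 1) * (pot B h + 1) = K * (ℓ + 1) * pot B h + K * (ℓ + 1) := by ring
    omega
  faithful s s' t _ _ h4 := by omega

section Pieces

variable {Z B ℓ : ℕ} {h : State}

theorem getReg_loopFree (v x : ℕ) : (getReg v x).LoopFree := by simp [getReg, Prog.LoopFree]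

theorem putReg_loopFree (x v : ℕ) : (putReg x v).LoopFree := by
  unfold putReg; split_ifs <;> simp [Prog.LoopFree]

theorem address_loopFree (v : ℕ) : (address v).LoopFree := by simp [address, Prog.LoopFree]

theorem exec_getReg (h : State) (v x : ℕ) :
    (∀ r, r ≠ v → r ≠ 7 → ((getReg v x).exec h).reg r = h.reg r) ∧
      ((getReg v x).exec h).mem = h.mem ∧
      ((getReg v x).exec h).reg v = h.mem 1 (x * h.reg 1 + h.reg 2) := by
  refine ⟨fun r h1 h2 => ?_, ?_, ?_⟩
  · simp [getReg, Prog.exec, setReg_reg, h1, h2]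
  · simp [getReg, Prog.exec, setReg_mem]
  · simp [getReg, Prog.exec, setReg_reg, setReg_mem, Op.eval]

theorem cost_getReg (h1 : len (h.reg 1) ≤ ℓ + 1) (h2 : len (h.reg 2) ≤ ℓ + 1) (v x : ℕ) :
    (getReg v x).cost h ≤
      (4 * len x + 10) * (ℓ + 1) + len (h.mem 1 (x * h.reg 1 + h.reg 2)) := by
  have a1 := len_mul_lt x (h.reg 1)
  have a2 := len_add_le (x * h.reg 1) (h.reg 2)
  have p1 := len_pos x
  simp only [getReg, Prog.cost, Prog.exec, setReg_reg, setReg_mem, Op.eval]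
  simp only [Nat.reduceEqDiff, OfNat.one_ne_ofNat, if_false, if_true]
  have e : (4 * len (x : ℤ) + 10) * (ℓ + 1) =
    4 * (len (x : ℤ) * ℓ) + 4 * len (x : ℤ) + 10 * ℓ + 10 := by ring
  have : ℓ ≤ len (x : ℤ) * ℓ := Nat.le_mul_of_pos_left _ p1
  omega

theorem exec_putReg (h : State) {v : ℕ} (hv : v < 7) (x : ℕ) :
    (∀ r, r ≠ 3 → r ≠ 7 → ((putReg x v).exec h).reg r = h.reg r) ∧
      ((putReg x v).exec h).mem = (h.setMem 1 (x * h.reg 1 + h.reg 2) (h.reg v)).mem ∧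
      ((putReg x v).exec h).reg 3 = if x ≤ 1 then 1 else h.reg 3 := by
  have hv' : v ≠ 7 := by omega
  unfold putReg
  split_ifs with hx
  · refine ⟨fun r h1 h2 => ?_, ?_, ?_⟩
    · simp [Prog.exec, setReg_reg, setMem_reg, h1, h2]
    · simp [Prog.exec, setReg_reg, setReg_mem, State.setMem, Op.eval, hv']
    · simp [Prog.exec, setReg_reg]
  · refine ⟨fun r h1 h2 => ?_, ?_, ?_⟩
    · simp [Prog.exec, setReg_reg, setMem_reg, h2]
    · simp [Prog.exec, setReg_reg, setReg_mem, State.setMem, Op.eval, hv']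
    · simp [Prog.exec, setReg_reg, setMem_reg]

theorem cost_putReg (h1 : len (h.reg 1) ≤ ℓ + 1) (h2 : len (h.reg 2) ≤ ℓ + 1) {v : ℕ}
    (hv : v < 7) (x : ℕ) :
    (putReg x v).cost h ≤ (4 * len x + 20) * (ℓ + 1) + len (h.reg v) := by
  have hv' : v ≠ 7 := by omega
  have a1 := len_mul_lt x (h.reg 1)
  have a2 := len_add_le (x * h.reg 1) (h.reg 2)
  have p1 := len_pos x
  have hl1 : len (1 : ℤ) = 2 := by decide
  have e : (4 * len (x : ℤ) + 20) * (ℓ + 1) =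
    4 * (len (x : ℤ) * ℓ) + 4 * len (x : ℤ) + 20 * ℓ + 20 := by ring
  have : ℓ ≤ len (x : ℤ) * ℓ := Nat.le_mul_of_pos_left _ p1
  unfold putReg
  split_ifs <;>
  · simp only [Prog.cost, Prog.exec, setReg_reg, Op.eval]
    simp only [Nat.reduceEqDiff, OfNat.one_ne_ofNat, if_false, if_true, hv', hl1]
    omega

theorem exec_address (h : State) {v : ℕ} :
    (∀ r, r ≠ 7 → ((address v).exec h).reg r = h.reg r) ∧
      ((address v).exec h).mem = h.mem ∧
      ((address v).exec h).reg 7 = h.reg v * h.reg 1 + h.reg 2 := by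
  refine ⟨fun r h1 => ?_, ?_, ?_⟩
  · simp [address, Prog.exec, setReg_reg, h1]
  · simp [address, Prog.exec, setReg_mem]
  · simp [address, Prog.exec, setReg_reg, Op.eval]

theorem cost_address (h1 : len (h.reg 1) ≤ ℓ + 1) (h2 : len (h.reg 2) ≤ ℓ + 1) {v : ℕ} :
    (address v).cost h ≤ 5 * (ℓ + 1) + 2 * len (h.reg v) ∧
      len (h.reg v * h.reg 1 + h.reg 2) ≤ 2 * (ℓ + 1) + len (h.reg v) := by
  have a1 := len_mul_lt (h.reg v) (h.reg 1)
  have a2 := len_add_le (h.reg v * h.reg 1) (h.reg 2)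
  have p1 := len_pos (h.reg v)
  constructor
  · simp only [address, Prog.cost, Prog.exec, setReg_reg, Op.eval]
    simp only [Nat.reduceEqDiff, if_false, if_true]
    omega
  · omega

end Pieces

/-- Loading and paying for the operands. -/
theorem charged_spec {Z B ℓ Kp : ℕ} {h h₁ : State} {pre : Prog} {tp : ℕ} (hi : SimInv Z B ℓ h)
    (h0 : 0 < h.reg 0) (hpre : Runs pre h h₁ tp) (hs : SameBut h h₁)
    (hx : len (h₁.reg 4) + (h.reg 0).toNat ≤ B) (hy : len (h₁.reg 5) + (h.reg 0).toNat ≤ B)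
    (htp : tp ≤ Kp * (ℓ + 1) * (len (h₁.reg 4) + len (h₁.reg 5))) (Kk : ℕ) :
    ∃ (h₂ : State) (amt T : ℕ), SimInv Z B ℓ h₂ ∧ Frame h h₂ ∧ h₂.mem = h.mem ∧
      h₂.reg 3 = h.reg 3 ∧ h₂.reg 12 = h.reg 12 ∧ h₂.reg 4 = h₁.reg 4 ∧ h₂.reg 5 = h₁.reg 5 ∧
      h₂.reg 0 = h.reg 0 - (amt : ℕ) ∧ len (h₁.reg 4) ≤ amt ∧ len (h₁.reg 5) ≤ amt ∧ 1 ≤ amt ∧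
      amt ≤ 4 * (len (h₁.reg 4) + len (h₁.reg 5)) ∧
      T + Kk * (ℓ + 1) * (len (h₁.reg 4) + len (h₁.reg 5)) +
        (2 * Kp + 2 * Kk + 2000) * (ℓ + 1) * pot B h₂ ≤
          (2 * Kp + 2 * Kk + 2000) * (ℓ + 1) * pot B h ∧
      (h₂.reg 0 ≤ 0 → ∀ k, Runs (charged pre k) h h₂ T) ∧
      (0 < h₂.reg 0 → ∀ k h₃ t₃, Runs k h₂ h₃ t₃ →
        ∃ T' ≤ T, Runs (charged pre k) h h₃ (T' + t₃)) := by
  have e0 : h₁.reg 0 = h.reg 0 := hs.2 0 (by simp)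
  have p4 := len_pos (h₁.reg 4)
  have p5 := len_pos (h₁.reg 5)
  obtain ⟨h₂, tc, amt, hrun, hsame, hamt, hx', hy', h1, hle, htc⟩ :=
    -- The operands have length at most `B` each, so `20 * B < 2 ^ ℓ` bounds the rounds of the
    -- charging loop by `ℓ`.
    charge_run (h := h₁) (n := ℓ) (b := ℓ + 1) le_rfl
      (by have := hi.pow; omega) (by rw [e0]; exact hi.len_zero)
  rw [e0] at hamt
  have hreg : ∀ r, r = 1 ∨ r = 2 ∨ r = 3 ∨ 12 ≤ r → h₂.reg r = h.reg r := by
    intro r hr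
    rw [hsame.2 r (by omega), hs.2 r (by omega)]
  have hmem : h₂.mem = h.mem := hsame.1.trans hs.1
  have hinv : SimInv Z B ℓ h₂ := by
    refine ⟨?_, ?_, ?_, ?_, ?_, ?_, ?_, hi.pow⟩
    · rw [hreg 2 (by simp)]; exact hi.nonneg
    · rw [hreg 2 (by simp), hreg 1 (by simp)]; exact hi.lt
    · rw [hreg 1 (by simp)]; exact hi.len_one
    · rw [hreg 2 (by simp)]; exact hi.len_two
    · have := hi.pow
      have hp : (20 * (B : ℤ)) < 2 ^ ℓ := by exact_mod_cast this
      apply len_le_succ_of_abs <;> omega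
    · have := hi.const_le; omega
    · intro a i
      rw [hmem, hreg 1 (by simp), hreg 2 (by simp)]
      have := hi.cell_le a i; omega
  have hframe : Frame h h₂ :=
    ⟨fun r hr => hreg r (by omega), Or.inl (hreg 3 (by simp)), by omega, by rw [hmem],
      fun a i _ => by rw [hmem]⟩
  refine ⟨h₂, amt, (1 + len (h.reg 0)) + (tp + (tc + (1 + len (h₂.reg 0) + 1))), hinv, hframe,
    hmem, hreg 3 (by simp), hreg 12 (by simp), hsame.2 4 (by simp), hsame.2 5 (by simp), hamt, hx', hy', h1, hle,
    ?_, ?_, ?_⟩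
  · have l0 := hi.len_zero
    have l2 := hinv.len_zero
    generalize hL : len (h₁.reg 4) + len (h₁.reg 5) = L at *
    -- If time is left, the potential falls by `amt`; if the clock runs out, it falls by more than
    -- `B`. The extra `B` in the potential pays for operands that are longer than the remaining
    -- time.
    have hdrop : pot B h₂ + min amt B ≤ pot B h := by
      unfold pot; rw [if_pos h0]; split_ifs <;> omega
    have hLm : L ≤ 2 * min amt B := by omega
    have hT : (1 + len (h.reg 0)) + (tp + (tc + (1 + len (h₂.reg 0) + 1))) ≤
        (Kp + 1000) * (ℓ + 1) * L := by
      have hL2 : 2 ≤ L := by omega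
      have e1 : (ℓ + 2) * (300 * L) = 300 * (ℓ * L) + 600 * L := by ring
      have e2 : (Kp + 1000) * (ℓ + 1) * L =
        Kp * (ℓ + 1) * L + 1000 * (ℓ * L) + 1000 * L := by ring
      have : ℓ * 2 ≤ ℓ * L := Nat.mul_le_mul_left _ hL2
      omega
    have e3 : (2 * Kp + 2 * Kk + 2000) * (ℓ + 1) * (pot B h₂ + min amt B) ≤
        (2 * Kp + 2 * Kk + 2000) * (ℓ + 1) * pot B h := Nat.mul_le_mul_left _ hdrop
    have e4 : (2 * Kp + 2 * Kk + 2000) * (ℓ + 1) * (pot B h₂ + min amt B) =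
        (2 * Kp + 2 * Kk + 2000) * (ℓ + 1) * pot B h₂ +
          ((Kp + 1000) * (ℓ + 1) * (2 * min amt B) + Kk * (ℓ + 1) * (2 * min amt B)) := by ring
    have e5 : (Kp + 1000) * (ℓ + 1) * L ≤ (Kp + 1000) * (ℓ + 1) * (2 * min amt B) :=
      Nat.mul_le_mul_left _ hLm
    have e6 : Kk * (ℓ + 1) * L ≤ Kk * (ℓ + 1) * (2 * min amt B) := Nat.mul_le_mul_left _ hLm
    omega
  · intro h2 k
    exact .ite_pos h0 (.seq hpre (.seq hrun (.ite_neg h2 (.skip h₂))))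
  · intro h2 k h₃ t₃ hk
    refine ⟨(1 + len (h.reg 0)) + (tp + (tc + (1 + len (h₂.reg 0)))), by omega, ?_⟩
    have := Runs.ite_pos (d := Prog.skip) h0
      (.seq hpre (.seq hrun (Runs.ite_pos (d := Prog.skip) h2 hk)))
    rw [show ∀ a b c d e : ℕ, a + (b + (c + d)) + e = a + (b + (c + (d + e))) by intros; ring]
    exact this

theorem charged_stopped {h : State} {ℓ : ℕ} (h0 : h.reg 0 ≤ 0) (hl : len (h.reg 0) ≤ ℓ + 1)
    (pre k : Prog) : ∃ t ≤ 3 * (ℓ + 1), Runs (charged pre k) h h t :=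
  ⟨_, by omega, .ite_neg h0 (.skip h)⟩

theorem address_emod {i C c : ℤ} (h0 : 0 ≤ c) (h1 : c < C) : (i * C + c) % C = c := by
  rw [add_comm, Int.add_mul_emod_self_right, Int.emod_eq_of_lt h0 h1]

theorem address_inj {i j C c : ℤ} (h0 : 0 ≤ c) (h1 : c < C) : i * C + c = j * C + c ↔ i = j := by
  constructor
  · intro h
    exact mul_right_cancel₀ (by omega : C ≠ 0) (add_right_cancel h)
  · rintro rfl; rfl

/-- Only cells in the residue class `reg 2` modulo `reg 1` are touched, and never array `0`, which
holds the formula. This separates the candidates from each other and from the input. -/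
theorem write_spec {Z B ℓ a : ℕ} {i val : ℤ} {h h' : State} (hi : SimInv Z B ℓ h)
    (hmem : h'.mem = (h.setMem (a + 1) (i * h.reg 1 + h.reg 2) val).mem)
    (hreg : ∀ r, r ≤ 2 ∨ 13 ≤ r → h'.reg r = h.reg r) (hd : h'.reg 3 = h.reg 3 ∨ h'.reg 3 = 1)
    (hval : len val + (h.reg 0).toNat ≤ B) : SimInv Z B ℓ h' ∧ Frame h h' := by
  have r0 := hreg 0 (by simp)
  have r1 := hreg 1 (by simp)
  have r2 := hreg 2 (by simp)
  refine ⟨⟨?_, ?_, ?_, ?_, ?_, ?_, ?_, hi.pow⟩, ⟨fun r hr => hreg r (by omega), hd, r0.le, ?_, ?_⟩⟩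
  · rw [r2]; exact hi.nonneg
  · rw [r2, r1]; exact hi.lt
  · rw [r1]; exact hi.len_one
  · rw [r2]; exact hi.len_two
  · rw [r0]; exact hi.len_zero
  · rw [r0]; exact hi.const_le
  · intro a' i'
    rw [hmem, r0, r1, r2, setMem_mem]
    split_ifs
    · exact hval
    · exact hi.cell_le a' i'
  · funext j
    rw [hmem, setMem_mem, if_neg (by omega)]
  · intro a' j hj
    rw [hmem, setMem_mem, if_neg]
    rintro ⟨-, rfl⟩
    exact hj (address_emod hi.nonneg hi.lt)

/-- Simulated registers live in array `1` and simulated arrays in the arrays from `2` on, so a write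
to a register disturbs no simulated array. -/
theorem rel_setReg {h h' s : State} {x : ℕ} {v : ℤ} (h0 : 0 ≤ h.reg 2) (h1 : h.reg 2 < h.reg 1)
    (hr : Rel h s) (hmem : h'.mem = (h.setMem 1 (x * h.reg 1 + h.reg 2) v).mem)
    (r1 : h'.reg 1 = h.reg 1) (r2 : h'.reg 2 = h.reg 2) : Rel h' (s.setReg x v) := by
  refine ⟨fun r => ?_, fun a i => ?_⟩
  · rw [hmem, r1, r2, setMem_mem, setReg_reg]
    have : ((r : ℤ) * h.reg 1 + h.reg 2 = x * h.reg 1 + h.reg 2) ↔ r = x := by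
      rw [address_inj h0 h1]; exact_mod_cast Iff.rfl
    simp only [this, true_and]
    split_ifs
    · rfl
    · exact hr.1 r
  · rw [hmem, r1, r2, setMem_mem, if_neg (by omega)]
    exact hr.2 a i

theorem rel_setMem {h h' s : State} {a : ℕ} {i v : ℤ} (h0 : 0 ≤ h.reg 2) (h1 : h.reg 2 < h.reg 1)
    (hr : Rel h s) (hmem : h'.mem = (h.setMem (a + 2) (i * h.reg 1 + h.reg 2) v).mem)
    (r1 : h'.reg 1 = h.reg 1) (r2 : h'.reg 2 = h.reg 2) : Rel h' (s.setMem a i v) := by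
  refine ⟨fun r => ?_, fun a' i' => ?_⟩
  · rw [hmem, r1, r2, setMem_mem, if_neg (by omega)]
    exact hr.1 r
  · rw [hmem, r1, r2, setMem_mem, setMem_mem]
    simp only [Nat.add_right_cancel_iff, address_inj h0 h1]
    split_ifs
    · rfl
    · exact hr.2 a' i'

/-- A simulated instruction that writes one cell. -/
theorem leaf_spec {c pre k : Prog} {Z B ℓ Kp Kk : ℕ} {h : State} (hi : SimInv Z B ℓ h)
    (hpre : 0 < h.reg 0 → ∃ h₁ tp, Runs pre h h₁ tp ∧ SameBut h h₁ ∧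
      len (h₁.reg 4) + (h.reg 0).toNat ≤ B ∧ len (h₁.reg 5) + (h.reg 0).toNat ≤ B ∧
      tp ≤ Kp * (ℓ + 1) * (len (h₁.reg 4) + len (h₁.reg 5)) ∧
      ∀ h₂ : State, SimInv Z B ℓ h₂ → h₂.mem = h.mem → h₂.reg 1 = h.reg 1 → h₂.reg 2 = h.reg 2 →
        h₂.reg 4 = h₁.reg 4 → h₂.reg 5 = h₁.reg 5 →
        k.LoopFree ∧ k.cost h₂ ≤ Kk * (ℓ + 1) * (len (h₁.reg 4) + len (h₁.reg 5)) ∧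
        (∀ r, r ≤ 2 ∨ 13 ≤ r → (k.exec h₂).reg r = h₂.reg r) ∧
        ((k.exec h₂).reg 3 = h₂.reg 3 ∨ (k.exec h₂).reg 3 = 1) ∧
        (∃ (a : ℕ) (i val : ℤ), len val ≤ len (h₁.reg 4) + len (h₁.reg 5) ∧
          (k.exec h₂).mem = (h₂.setMem (a + 1) (i * h₂.reg 1 + h₂.reg 2) val).mem) ∧
        ∀ s s' t, Rel h₂ s → Runs c s s' t → len (h₁.reg 4) + len (h₁.reg 5) ≤ t ∧
          Rel (k.exec h₂) s' ∧ Flag h₂ (k.exec h₂) s s' t) :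
    ∃ h' t, Runs (charged pre k) h h' t ∧
      SimOut c (2 * Kp + 2 * Kk + 2000) Z B ℓ h h' t := by
  rcases le_or_gt (h.reg 0) 0 with h0 | h0
  · obtain ⟨t, ht, hr⟩ := charged_stopped h0 hi.len_zero pre k
    exact ⟨h, t, hr, hi.refl_of_stopped h0
      (ht.trans (Nat.mul_le_mul_right _ (by omega)))⟩
  obtain ⟨h₁, tp, hrun, hs, hx, hy, htp, hk⟩ := hpre h0
  obtain ⟨h₂, amt, T, hi₂, hf₂, hm₂, hd₂, -, h4, h5, hamt, hx', hy', h1, hle, hT, hrun0, hrun1⟩ :=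
    charged_spec hi h0 hrun hs hx hy htp Kk
  have p4 := len_pos (h₁.reg 4)
  have p5 := len_pos (h₁.reg 5)
  have hrel : ∀ s, Rel h s → Rel h₂ s := by
    intro s hr
    refine ⟨fun r => ?_, fun a i => ?_⟩
    · rw [hm₂, hf₂.reg 1 (by simp), hf₂.reg 2 (by simp)]; exact hr.1 r
    · rw [hm₂, hf₂.reg 1 (by simp), hf₂.reg 2 (by simp)]; exact hr.2 a i
  obtain ⟨hlf, hcost, hreg, hd, ⟨a, i, val, hval, hmem⟩, hfaith⟩ :=
    hk h₂ hi₂ hm₂ (hf₂.reg 1 (by simp)) (hf₂.reg 2 (by simp)) h4 h5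
  rcases le_or_gt (h₂.reg 0) 0 with h2 | h2
  · refine ⟨h₂, T, hrun0 h2 k, hi₂, hf₂, pot_mono hf₂.clock, ?_, ?_⟩
    · have : (2 * Kp + 2 * Kk + 2000) * (ℓ + 1) * (pot B h + 1) =
        (2 * Kp + 2 * Kk + 2000) * (ℓ + 1) * pot B h + (2 * Kp + 2 * Kk + 2000) * (ℓ + 1) := by ring
      omega
    · intro s s' t hr hrs ht
      have := (hfaith s s' t (hrel s hr) hrs).1
      omega
  · obtain ⟨T', hT', hr⟩ := hrun1 h2 k _ _ (hlf.runs h₂)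
    -- The new value is no longer than both operands together: one of them already fitted beside the
    -- old clock, and the other one is at most the amount by which the clock has been lowered.
    obtain ⟨hi₃, hf₃⟩ := write_spec hi₂ hmem hreg hd (by omega)
    have hp : pot B (k.exec h₂) = pot B h₂ := by unfold pot; rw [hreg 0 (by simp)]
    refine ⟨_, _, hr, hi₃, hf₂.trans hf₃, pot_mono (hf₂.trans hf₃).clock, ?_, ?_⟩
    · rw [hp]
      have : (2 * Kp + 2 * Kk + 2000) * (ℓ + 1) * (pot B h + 1) =
        (2 * Kp + 2 * Kk + 2000) * (ℓ + 1) * pot B h + (2 * Kp + 2 * Kk + 2000) * (ℓ + 1) := by ring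
      omega
    · intro s s' t hr hrs ht
      obtain ⟨g1, g2, g3⟩ := hfaith s s' t (hrel s hr) hrs
      refine ⟨g2, ?_, ?_⟩
      · rw [hreg 0 (by simp)]; omega
      · unfold Flag at g3 ⊢; rwa [hd₂] at g3

end RAM

/-! ### Simulation of instructions without branching and of sequences -/

namespace RAM

theorem SimInv.congr {Z B ℓ : ℕ} {h h' : State} (hi : SimInv Z B ℓ h) (hm : h'.mem = h.mem)
    (hr : ∀ r, r ≤ 2 → h'.reg r = h.reg r) : SimInv Z B ℓ h' := by
  have r0 := hr 0 (by simp)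
  have r1 := hr 1 (by simp)
  have r2 := hr 2 (by simp)
  refine ⟨?_, ?_, ?_, ?_, ?_, ?_, ?_, hi.pow⟩
  · rw [r2]; exact hi.nonneg
  · rw [r1, r2]; exact hi.lt
  · rw [r1]; exact hi.len_one
  · rw [r2]; exact hi.len_two
  · rw [r0]; exact hi.len_zero
  · rw [r0]; exact hi.const_le
  · rw [hm, r0, r1, r2]; exact hi.cell_le

theorem Rel.congr {h h' s : State} (hr : Rel h s) (hm : h'.mem = h.mem)
    (r1 : h'.reg 1 = h.reg 1) (r2 : h'.reg 2 = h.reg 2) : Rel h' s := by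
  unfold Rel; rw [hm, r1, r2]; exact hr

theorem pre_const (h : State) (z : ℤ) :
    ∃ h₁ tp, Runs (.seq (.const 4 z) (.const 5 0)) h h₁ tp ∧ SameBut h h₁ ∧ h₁.reg 4 = z ∧
      h₁.reg 5 = 0 ∧ tp = len z + 3 := by
  refine ⟨_, _, .seq (.const _ _ _) (.const _ _ _), ⟨rfl, fun r hr => ?_⟩, ?_, ?_, ?_⟩
  · rw [setReg_reg, setReg_reg, if_neg (by omega), if_neg (by omega)]
  · simp [setReg_reg]
  · simp [setReg_reg]
  · have : len (0 : ℤ) = 1 := by decide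
    omega

theorem pre_one {ℓ : ℕ} {h : State} (h1 : len (h.reg 1) ≤ ℓ + 1) (h2 : len (h.reg 2) ≤ ℓ + 1)
    (x : ℕ) : ∃ h₁ tp, Runs (.seq (getReg 4 x) (.const 5 0)) h h₁ tp ∧ SameBut h h₁ ∧
      h₁.reg 4 = h.mem 1 (x * h.reg 1 + h.reg 2) ∧ h₁.reg 5 = 0 ∧
      tp ≤ (4 * len x + 20) * (ℓ + 1) * (len (h₁.reg 4) + len (h₁.reg 5)) := by
  obtain ⟨a1, a2, a3⟩ := exec_getReg h 4 x
  have e4 : ((Prog.const 5 0).exec ((getReg 4 x).exec h)).reg 4 =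
      h.mem 1 (x * h.reg 1 + h.reg 2) := by simp [Prog.exec, setReg_reg, a3]
  have e5 : ((Prog.const 5 0).exec ((getReg 4 x).exec h)).reg 5 = 0 := by
    simp [Prog.exec, setReg_reg]
  refine ⟨_, _, .seq ((getReg_loopFree 4 x).runs h) (.const _ _ _), ⟨?_, fun r hr => ?_⟩,
    e4, e5, ?_⟩
  · rw [setReg_mem, a2]
  · rw [setReg_reg, if_neg (by omega), a1 r (by omega) (by omega)]
  · have hc := cost_getReg h1 h2 4 x
    have h0 : len (0 : ℤ) = 1 := by decide
    simp only [Prog.exec] at e4 e5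
    rw [e4, e5, h0]
    set v := len (h.mem 1 (x * h.reg 1 + h.reg 2)) with hv
    have : (4 * len (x : ℤ) + 10) * (ℓ + 1) ≤ (4 * len (x : ℤ) + 10) * (ℓ + 1) * (v + 1) :=
      Nat.le_mul_of_pos_right _ (by omega)
    have e : (4 * len (x : ℤ) + 20) * (ℓ + 1) * (v + 1) =
      (4 * len (x : ℤ) + 10) * (ℓ + 1) * (v + 1) + 10 * (ℓ * v) + 10 * ℓ + 10 * v + 10 := by ring
    omega

theorem pre_two {ℓ : ℕ} {h : State} (h1 : len (h.reg 1) ≤ ℓ + 1) (h2 : len (h.reg 2) ≤ ℓ + 1)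
    (x y : ℕ) : ∃ h₁ tp, Runs (.seq (getReg 4 x) (getReg 5 y)) h h₁ tp ∧ SameBut h h₁ ∧
      h₁.reg 4 = h.mem 1 (x * h.reg 1 + h.reg 2) ∧ h₁.reg 5 = h.mem 1 (y * h.reg 1 + h.reg 2) ∧
      tp ≤ (4 * len x + 4 * len y + 30) * (ℓ + 1) * (len (h₁.reg 4) + len (h₁.reg 5)) := by
  obtain ⟨a1, a2, a3⟩ := exec_getReg h 4 x
  obtain ⟨b1, b2, b3⟩ := exec_getReg ((getReg 4 x).exec h) 5 y
  have r1 := a1 1 (by simp) (by simp)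
  have r2 := a1 2 (by simp) (by simp)
  rw [a2, r1, r2] at b3
  have e4 := (b1 4 (by simp) (by simp)).trans a3
  refine ⟨_, _, .seq ((getReg_loopFree 4 x).runs h) ((getReg_loopFree 5 y).runs _),
    ⟨b2.trans a2, fun r hr => ?_⟩, e4, b3, ?_⟩
  · rw [b1 r (by omega) (by omega), a1 r (by omega) (by omega)]
  · have hc := cost_getReg h1 h2 4 x
    have hc' := cost_getReg (h := (getReg 4 x).exec h) (r1 ▸ h1) (r2 ▸ h2) 5 y
    rw [a2, r1, r2] at hc'
    rw [e4, b3]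
    set v := len (h.mem 1 (x * h.reg 1 + h.reg 2)) with hv
    set w := len (h.mem 1 (y * h.reg 1 + h.reg 2)) with hw
    have pv : 1 ≤ v := len_pos _
    have : (4 * len (x : ℤ) + 4 * len (y : ℤ) + 20) * (ℓ + 1) ≤
      (4 * len (x : ℤ) + 4 * len (y : ℤ) + 20) * (ℓ + 1) * (v + w) :=
      Nat.le_mul_of_pos_right _ (by omega)
    have e : (4 * len (x : ℤ) + 4 * len (y : ℤ) + 30) * (ℓ + 1) * (v + w) =
      (4 * len (x : ℤ) + 4 * len (y : ℤ) + 20) * (ℓ + 1) * (v + w) +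
        10 * (ℓ * v) + 10 * (ℓ * w) + 10 * v + 10 * w := by ring
    have e' : (4 * len (x : ℤ) + 4 * len (y : ℤ) + 20) * (ℓ + 1) =
      (4 * len (x : ℤ) + 10) * (ℓ + 1) + (4 * len (y : ℤ) + 10) * (ℓ + 1) := by ring
    omega

/-- A write to register `0` or `1` sets the flag, and the written value is paid for; for any other
register the flag and both contents stay as they are. -/
theorem flag_setReg {h h' s : State} {x t : ℕ} {z : ℤ}
    (h3 : h'.reg 3 = if x ≤ 1 then 1 else h.reg 3) (ht : len z ≤ t) :
    Flag h h' s (s.setReg x z) t := by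
  unfold Flag
  simp only [setReg_reg]
  by_cases hx : x ≤ 1
  · rw [if_pos hx] at h3
    left
    refine ⟨h3, ?_⟩
    rcases Nat.eq_zero_or_pos x with rfl | hx0
    · left; simpa using ht
    · right; rw [if_pos (by omega)]; exact ht
  · rw [if_neg hx] at h3
    right
    exact ⟨h3, by rw [if_neg (by omega)], by rw [if_neg (by omega)]⟩

/-- The result of the simulation of a program: there is a run with the properties of `SimOut`. -/
def Simulates (c : Prog) : Prop :=
  ∃ K, ∀ Z B ℓ h, K ≤ Z → SimInv Z B ℓ h → ∃ h' t, Runs (sim c) h h' t ∧ SimOut c K Z B ℓ h h' t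

theorem simulates_const (r : ℕ) (z : ℤ) : Simulates (.const r z) := by
  -- The length of the literal `z` enters the constant. So `K ≤ Z` makes it fit into the space that
  -- `const_le` reserves beside the clock.
  refine ⟨2 * 3 + 2 * (4 * len r + 30) + 2000 + len z, fun Z B ℓ h hZ hi => ?_⟩
  have hc := hi.const_le
  have := leaf_spec (c := .const r z) (pre := .seq (.const 4 z) (.const 5 0)) (k := putReg r 4)
    (Kp := 3) (Kk := 4 * len r + 30) hi fun h0 => by
      obtain ⟨h₁, tp, hr, hs, h4, h5, htp⟩ := pre_const h z
      have l0 : len (0 : ℤ) = 1 := by decide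
      have pz := len_pos z
      refine ⟨h₁, tp, hr, hs, by rw [h4]; omega, by rw [h5]; omega, ?_, ?_⟩
      · rw [htp, h4, h5, l0]
        have : 3 * (ℓ + 1) * (len z + 1) = 3 * (ℓ * len z) + 3 * ℓ + 3 * len z + 3 := by ring
        omega
      · intro h₂ hi₂ hm₂ r1 r2 g4 g5
        obtain ⟨a1, a2, a3⟩ := exec_putReg h₂ (v := 4) (by simp) r
        have hcost := cost_putReg hi₂.len_one hi₂.len_two (v := 4) (by simp) r
        rw [g4, h4] at a2 hcost
        rw [h4, h5, l0]
        refine ⟨putReg_loopFree r 4, ?_, fun r' hr' => a1 r' (by omega) (by omega), ?_,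
          ⟨0, r, z, by omega, a2⟩, ?_⟩
        · have h1 : (4 * len (r : ℤ) + 20) * (ℓ + 1) ≤ (4 * len (r : ℤ) + 20) * (ℓ + 1) * (len z + 1) :=
            Nat.le_mul_of_pos_right _ (by omega)
          have : (4 * len (r : ℤ) + 30) * (ℓ + 1) * (len z + 1) =
            (4 * len (r : ℤ) + 20) * (ℓ + 1) * (len z + 1) + 10 * (ℓ * len z) + 10 * ℓ +
              10 * len z + 10 := by ring
          omega
        · rw [a3]; split_ifs <;> simp
        · intro s s' t hr hrun
          cases hrun
          exact ⟨by omega, rel_setReg hi₂.nonneg hi₂.lt hr a2 (a1 1 (by simp) (by simp))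
            (a1 2 (by simp) (by simp)), flag_setReg a3 (by omega)⟩
  obtain ⟨h', t, hr, ho⟩ := this
  exact ⟨h', t, hr, ho.mono (by omega)⟩

theorem simulates_arith (o : Op) (r x y : ℕ) : Simulates (.arith o r x y) := by
  refine ⟨2 * (4 * len x + 4 * len y + 30) + 2 * (4 * len r + 30) + 2000,
    fun Z B ℓ h hZ hi => ?_⟩
  refine leaf_spec hi fun h0 => ?_
  obtain ⟨h₁, tp, hr, hs, h4, h5, htp⟩ := pre_two hi.len_one hi.len_two x y
  refine ⟨h₁, tp, hr, hs, ?_, ?_, htp, ?_⟩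
  · rw [h4]; exact hi.cell_le 0 x
  · rw [h5]; exact hi.cell_le 0 y
  · intro h₂ hi₂ hm₂ r1 r2 g4 g5
    set g := (Prog.arith o 4 4 5).exec h₂ with hg
    have greg : ∀ r, r ≠ 4 → g.reg r = h₂.reg r := by
      intro r hr; simp [hg, Prog.exec, setReg_reg, hr]
    have g4' : g.reg 4 = o.eval (h₂.reg 4) (h₂.reg 5) := by simp [hg, Prog.exec, setReg_reg]
    have gm : g.mem = h₂.mem := rfl
    obtain ⟨a1, a2, a3⟩ := exec_putReg g (v := 4) (by simp) r
    have hcost := cost_putReg (h := g) (greg 1 (by simp) ▸ hi₂.len_one)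
      (greg 2 (by simp) ▸ hi₂.len_two) (v := 4) (by simp) r
    have hl := len_eval_le o (h₂.reg 4) (h₂.reg 5)
    have p4 := len_pos (h₂.reg 4)
    rw [greg 1 (by simp), greg 2 (by simp)] at a2
    rw [greg 3 (by simp)] at a3
    refine ⟨⟨trivial, putReg_loopFree r 4⟩, ?_, ?_, ?_, ⟨0, r, g.reg 4, ?_, ?_⟩, ?_⟩
    · simp only [Prog.cost]
      rw [← hg, ← g4, ← g5]
      rw [g4'] at hcost
      generalize hL : len (h₂.reg 4) + len (h₂.reg 5) = L at *
      have h1 : (4 * len (r : ℤ) + 20) * (ℓ + 1) ≤ (4 * len (r : ℤ) + 20) * (ℓ + 1) * L :=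
        Nat.le_mul_of_pos_right _ (by omega)
      have : (4 * len (r : ℤ) + 30) * (ℓ + 1) * L =
        (4 * len (r : ℤ) + 20) * (ℓ + 1) * L + 10 * (ℓ * L) + 10 * L := by ring
      omega
    · intro r' hr'
      exact (a1 r' (by omega) (by omega)).trans (greg r' (by omega))
    · change ((putReg r 4).exec g).reg 3 = _ ∨ ((putReg r 4).exec g).reg 3 = _
      rw [a3]; split_ifs <;> simp
    · rw [g4', ← g4, ← g5]; exact hl
    · exact a2
    · intro s s' t hrel hrun
      cases hrun
      have e4 : h₂.reg 4 = s.reg x := by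
        rw [g4, h4, ← hrel.1 x, hm₂, r1, r2]
      have e5 : h₂.reg 5 = s.reg y := by
        rw [g5, h5, ← hrel.1 y, hm₂, r1, r2]
      rw [e4, e5] at g4' hl
      rw [← g4, ← g5, e4, e5]
      rw [g4'] at a2
      exact ⟨by omega, rel_setReg hi₂.nonneg hi₂.lt hrel a2
        ((a1 1 (by simp) (by simp)).trans (greg 1 (by simp)))
        ((a1 2 (by simp) (by simp)).trans (greg 2 (by simp))), flag_setReg a3 (by omega)⟩

theorem simulates_load (r a i : ℕ) : Simulates (.load r a i) := by
  refine ⟨2 * (4 * len i + 40) + 2 * (4 * len r + 30) + 2000, fun Z B ℓ h hZ hi => ?_⟩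
  refine leaf_spec hi fun h0 => ?_
  obtain ⟨a1, a2, a3⟩ := exec_getReg h 4 i
  set g := (getReg 4 i).exec h with hg
  obtain ⟨b1, b2, b3⟩ := exec_address g (v := 4)
  set g' := (address 4).exec g with hg'
  have gr : ∀ r, r ≠ 4 → r ≠ 7 → g'.reg r = h.reg r := fun r h1 h2 =>
    (b1 r h2).trans (a1 r h1 h2)
  have gm : g'.mem = h.mem := b2.trans a2
  have g4 : g'.reg 4 = h.mem 1 (i * h.reg 1 + h.reg 2) := (b1 4 (by simp)).trans a3
  have g7 : g'.reg 7 = h.mem 1 (i * h.reg 1 + h.reg 2) * h.reg 1 + h.reg 2 := by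
    rw [b3, a3, a1 1 (by simp) (by simp), a1 2 (by simp) (by simp)]
  have hr : Runs (.seq (getReg 4 i) (.seq (address 4) (.load 5 (a + 2) 7))) h _ _ :=
    .seq ((getReg_loopFree 4 i).runs h) (.seq ((address_loopFree 4).runs _) (.load _ _ _ _))
  rw [← hg, ← hg'] at hr
  set h₁ := g'.setReg 5 (g'.mem (a + 2) (g'.reg 7)) with hh₁
  have h4 : h₁.reg 4 = h.mem 1 (i * h.reg 1 + h.reg 2) := by
    rw [hh₁, setReg_reg, if_neg (by simp), g4]
  have h5 : h₁.reg 5 = h.mem (a + 2) (h₁.reg 4 * h.reg 1 + h.reg 2) := by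
    rw [h4, hh₁, setReg_reg, if_pos rfl, g7, gm]
  refine ⟨h₁, _, hr, ⟨by rw [hh₁, setReg_mem, gm], fun r hr => ?_⟩, ?_, ?_, ?_, ?_⟩
  · rw [hh₁, setReg_reg, if_neg (by omega), gr r (by omega) (by omega)]
  · rw [h4]; exact hi.cell_le 0 i
  · rw [h5]; exact hi.cell_le (a + 1) _
  · have c1 := cost_getReg hi.len_one hi.len_two 4 i
    have c2 := cost_address (h := g) (ℓ := ℓ) (v := 4) (by rw [a1 1 (by simp) (by simp)]; exact hi.len_one)
      (by rw [a1 2 (by simp) (by simp)]; exact hi.len_two)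
    rw [← b3, ← b1 4 (by simp), g4] at c2
    have e5 : g'.mem (a + 2) (g'.reg 7) = h₁.reg 5 := by
      rw [hh₁, setReg_reg, if_pos rfl]
    rw [e5, h4]
    have p4 := len_pos (h.mem 1 (i * h.reg 1 + h.reg 2))
    have p5 := len_pos (h₁.reg 5)
    set v := len (h.mem 1 (i * h.reg 1 + h.reg 2)) with hv
    set w := len (h₁.reg 5) with hw
    have e : (4 * len (i : ℤ) + 40) * (ℓ + 1) * (v + w) =
      (4 * len (i : ℤ) + 20) * (ℓ + 1) * (v + w) + 20 * (ℓ * v) + 20 * (ℓ * w) + 20 * v + 20 * w := by ring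
    have h1 : (4 * len (i : ℤ) + 20) * (ℓ + 1) ≤ (4 * len (i : ℤ) + 20) * (ℓ + 1) * (v + w) :=
      Nat.le_mul_of_pos_right _ (by omega)
    have e2 : (4 * len (i : ℤ) + 20) * (ℓ + 1) = (4 * len (i : ℤ) + 10) * (ℓ + 1) + 10 * ℓ + 10 := by ring
    have h2 := c2.2
    have h3 := c2.1
    omega
  · intro h₂ hi₂ hm₂ r1 r2 g4 g5
    obtain ⟨a1, a2, a3⟩ := exec_putReg h₂ (v := 5) (by simp) r
    have hcost := cost_putReg hi₂.len_one hi₂.len_two (v := 5) (by simp) r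
    have p4 := len_pos (h₁.reg 4)
    rw [g5] at a2 hcost
    refine ⟨putReg_loopFree r 5, ?_, fun r' hr' => a1 r' (by omega) (by omega), ?_,
      ⟨0, r, h₁.reg 5, by omega, a2⟩, ?_⟩
    · generalize hL : len (h₁.reg 4) + len (h₁.reg 5) = L at *
      have h1 : (4 * len (r : ℤ) + 20) * (ℓ + 1) ≤ (4 * len (r : ℤ) + 20) * (ℓ + 1) * L :=
        Nat.le_mul_of_pos_right _ (by omega)
      have : (4 * len (r : ℤ) + 30) * (ℓ + 1) * L =
        (4 * len (r : ℤ) + 20) * (ℓ + 1) * L + 10 * (ℓ * L) + 10 * L := by ring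
      omega
    · rw [a3]; split_ifs <;> simp
    · intro s s' t hr hrun
      cases hrun
      have e4 : h₁.reg 4 = s.reg i := by
        rw [h4, ← hr.1 i, hm₂, r1, r2]
      have e5 : h₁.reg 5 = s.mem a (s.reg i) := by
        rw [h5, e4, ← hr.2 a, hm₂, r1, r2]
      rw [e5] at a2
      rw [e5, e4]
      exact ⟨by omega, rel_setReg hi₂.nonneg hi₂.lt hr a2 (a1 1 (by simp) (by simp))
        (a1 2 (by simp) (by simp)), flag_setReg a3 (by omega)⟩

theorem simulates_store (a i r : ℕ) : Simulates (.store a i r) := by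
  refine ⟨2 * (4 * len i + 4 * len r + 30) + 2 * 30 + 2000, fun Z B ℓ h hZ hi => ?_⟩
  refine leaf_spec (Kk := 30) hi fun h0 => ?_
  obtain ⟨h₁, tp, hr, hs, h4, h5, htp⟩ := pre_two hi.len_one hi.len_two i r
  refine ⟨h₁, tp, hr, hs, ?_, ?_, htp, ?_⟩
  · rw [h4]; exact hi.cell_le 0 i
  · rw [h5]; exact hi.cell_le 0 r
  · intro h₂ hi₂ hm₂ r1 r2 g4 g5
    obtain ⟨b1, b2, b3⟩ := exec_address h₂ (v := 4)
    have c2 := cost_address (h := h₂) (ℓ := ℓ) (v := 4) hi₂.len_one hi₂.len_two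
    set g := (address 4).exec h₂ with hg
    have p4 := len_pos (h₁.reg 4)
    have p5 := len_pos (h₁.reg 5)
    have b5 : g.reg 5 = h₁.reg 5 := (b1 5 (by simp)).trans g5
    rw [g4] at b3 c2
    have hmem : ((Prog.store (a + 2) 7 5).exec g).mem =
        (h₂.setMem (a + 1 + 1) (h₁.reg 4 * h₂.reg 1 + h₂.reg 2) (h₁.reg 5)).mem := by
      simp only [Prog.exec, State.setMem, b2, b3, b5]
    refine ⟨⟨address_loopFree 4, trivial⟩, ?_, ?_, Or.inl (b1 3 (by simp)),
      ⟨a + 1, h₁.reg 4, h₁.reg 5, by omega, hmem⟩, ?_⟩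
    · simp only [Prog.cost]
      rw [← hg, b3, b5]
      have h2 := c2.2
      have h3 := c2.1
      set v := len (h₁.reg 4) with hv
      set w := len (h₁.reg 5) with hw
      have : 30 * (ℓ + 1) * (v + w) = 30 * (ℓ * v) + 30 * (ℓ * w) + 30 * v + 30 * w := by ring
      have : ℓ ≤ ℓ * v := Nat.le_mul_of_pos_right _ p4
      omega
    · intro r' hr'
      exact b1 r' (by omega)
    · intro s s' t hrel hrun
      cases hrun
      have e4 : h₁.reg 4 = s.reg i := by
        rw [h4, ← hrel.1 i, hm₂, r1, r2]
      have e5 : h₁.reg 5 = s.reg r := by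
        rw [h5, ← hrel.1 r, hm₂, r1, r2]
      rw [e4, e5] at hmem
      rw [e4, e5]
      refine ⟨by omega, rel_setMem hi₂.nonneg hi₂.lt hrel hmem (b1 1 (by simp)) (b1 2 (by simp)),
        Or.inr ⟨b1 3 (by simp), rfl, rfl⟩⟩

theorem simulates_skip : Simulates .skip := by
  refine ⟨1, fun Z B ℓ h hZ hi => ⟨h, 1, .skip h, hi, Frame.refl h, le_rfl, ?_, ?_⟩⟩
  · have : 1 * (ℓ + 1) * (pot B h + 1) = 1 * (ℓ + 1) * pot B h + ℓ + 1 := by ring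
    omega
  · intro s s' t hr hrun _
    cases hrun
    exact ⟨hr, by omega, Or.inr ⟨rfl, rfl, rfl⟩⟩

/-- The potentials telescope. Each part contributes its own term `+ 1`, so the constants are added.
-/
theorem simulates_seq {c d : Prog} (hc : Simulates c) (hd : Simulates d) :
    Simulates (.seq c d) := by
  obtain ⟨K₁, h₁⟩ := hc
  obtain ⟨K₂, h₂⟩ := hd
  refine ⟨K₁ + K₂, fun Z B ℓ h hZ hi => ?_⟩
  obtain ⟨g, t, hr, o⟩ := h₁ Z B ℓ h (by omega) hi
  obtain ⟨g', t', hr', o'⟩ := h₂ Z B ℓ g (by omega) o.inv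
  refine ⟨g', t + t', .seq hr hr', o'.inv, o.frame.trans o'.frame, o'.pot_le.trans o.pot_le, ?_, ?_⟩
  · have a1 := o.time
    have a2 := o'.time
    have a3 := o.pot_le
    have a4 := o'.pot_le
    obtain ⟨x, hx⟩ := Nat.exists_eq_add_of_le a3
    obtain ⟨y, hy⟩ := Nat.exists_eq_add_of_le a4
    rw [hx] at a1 ⊢
    rw [hy] at a1 a2 ⊢
    nlinarith [Nat.zero_le (K₂ * (ℓ + 1) * x), Nat.zero_le (K₁ * (ℓ + 1) * y)]
  · intro s s' u hrel hrun hu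
    cases hrun with
    | seq r1 r2 =>
      push_cast at hu
      obtain ⟨b1, b2, b3⟩ := o.faithful _ _ _ hrel r1 (by omega)
      obtain ⟨c1, c2, c3⟩ := o'.faithful _ _ _ b1 r2 (by omega)
      exact ⟨c1, by push_cast; omega, b3.trans c3⟩

end RAM

/-! ### Simulation of conditionals and loops, and the comparison with the threshold -/

namespace RAM

theorem mul_mul_succ (K q p : ℕ) : K * (q + 1) * (p + 1) = K * (q + 1) * p + K * (q + 1) :=
  Nat.mul_succ _ _

theorem Rel.of_frame {h h' s : State} (hr : Rel h s) (hm : h'.mem = h.mem) (f : Frame h h') :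
    Rel h' s :=
  hr.congr hm (f.reg 1 (by simp)) (f.reg 2 (by simp))

theorem simulates_ite {c d : Prog} (r : ℕ) (hc : Simulates c) (hd : Simulates d) :
    Simulates (.ite r c d) := by
  obtain ⟨K₁, h₁⟩ := hc
  obtain ⟨K₂, h₂⟩ := hd
  refine ⟨2 * (4 * len r + 20) + 2 * 2 + 2000 + K₁ + K₂, fun Z B ℓ h hZ hi => ?_⟩
  rcases le_or_gt (h.reg 0) 0 with h0 | h0
  · obtain ⟨t, ht, hr⟩ := charged_stopped h0 hi.len_zero
      (.seq (getReg 4 r) (.const 5 0)) (.ite 4 (sim c) (sim d))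
    exact ⟨h, t, hr, hi.refl_of_stopped h0
      (ht.trans (Nat.mul_le_mul_right _ (by omega)))⟩
  obtain ⟨g, tp, hrun, hs, h4, h5, htp⟩ := pre_one hi.len_one hi.len_two r
  have l0 : len (0 : ℤ) = 1 := by decide
  have hc := hi.cell_le 0 r
  obtain ⟨g₂, amt, T, hi₂, hf₂, hm₂, hd₂, -, g4, g5, hamt, hx', hy', h1, hle, hT, hrun0, hrun1⟩ :=
    charged_spec hi h0 hrun hs (by rw [h4]; exact hc)
      (by rw [h5]; have := len_pos (h.mem (0 + 1) (r * h.reg 1 + h.reg 2)); omega) htp 2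
  have e4 : ∀ s, Rel h s → g.reg 4 = s.reg r := fun s hr => by rw [h4, ← hr.1 r]
  rw [h5, l0] at hle hT
  have p4 := len_pos (g.reg 4)
  -- Charging for the test leaves a reserve of two units per length, out of which the branching
  -- itself is paid.
  have hfix : ∀ K, 2 * (4 * len (r : ℤ) + 20) + 2 * 2 + 2000 ≤ K →
      T + 2 * (ℓ + 1) * (len (g.reg 4) + 1) + K * (ℓ + 1) * pot B g₂ ≤ K * (ℓ + 1) * pot B h := by
    intro K hK
    obtain ⟨D, rfl⟩ := Nat.exists_eq_add_of_le hK
    have := Nat.mul_le_mul_left (D * (ℓ + 1)) (pot_mono (B := B) hf₂.clock)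
    have e : ∀ q, (2 * (4 * len (r : ℤ) + 20) + 2 * 2 + 2000 + D) * (ℓ + 1) * q =
      (2 * (4 * len (r : ℤ) + 20) + 2 * 2 + 2000) * (ℓ + 1) * q + D * (ℓ + 1) * q := by
      intro q; ring
    rw [e, e]
    omega
  rcases le_or_gt (g₂.reg 0) 0 with h2 | h2
  · refine ⟨g₂, T, hrun0 h2 _, hi₂, hf₂, pot_mono hf₂.clock, ?_, ?_⟩
    · have := hfix (2 * (4 * len (r : ℤ) + 20) + 2 * 2 + 2000 + K₁ + K₂) (by omega)
      rw [mul_mul_succ]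
      omega
    · intro s s' t hr hrs ht
      rw [e4 s hr] at hle
      cases hrs <;> push_cast at ht <;> omega
  · obtain ⟨K, e, hKe, hK⟩ : ∃ K e, K ≤ K₁ + K₂ ∧ e = (if 0 < g.reg 4 then c else d) ∧
        ∃ h' t, Runs (sim e) g₂ h' t ∧ SimOut e K Z B ℓ g₂ h' t := by
      by_cases hp : 0 < g.reg 4
      · exact ⟨K₁, c, by omega, by rw [if_pos hp], h₁ Z B ℓ g₂ (by omega) hi₂⟩
      · exact ⟨K₂, d, by omega, by rw [if_neg hp], h₂ Z B ℓ g₂ (by omega) hi₂⟩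
    obtain ⟨he, h', t, hr, ho⟩ := hK
    have hri : Runs (.ite 4 (sim c) (sim d)) g₂ h' (1 + len (g₂.reg 4) + t) := by
      by_cases hp : 0 < g.reg 4
      · rw [if_pos hp] at he; subst he
        exact .ite_pos (by rw [g4]; exact hp) hr
      · rw [if_neg hp] at he; subst he
        exact .ite_neg (by rw [g4]; exact not_lt.1 hp) hr
    obtain ⟨T', hT', hr'⟩ := hrun1 h2 _ _ _ hri
    refine ⟨_, _, hr', ho.inv, hf₂.trans ho.frame, ho.pot_le.trans (pot_mono hf₂.clock), ?_, ?_⟩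
    · have a1 := hfix (2 * (4 * len (r : ℤ) + 20) + 2 * 2 + 2000 + K₁ + K₂) (by omega)
      have a2 := time_mono (q := ℓ + 1)
        (show K ≤ 2 * (4 * len (r : ℤ) + 20) + 2 * 2 + 2000 + K₁ + K₂ by omega) ho.pot_le ho.time
      rw [mul_mul_succ] at a2
      rw [mul_mul_succ]
      rw [g4]
      have : 2 * (ℓ + 1) * (len (g.reg 4) + 1) =
        2 * (ℓ * len (g.reg 4)) + 2 * ℓ + 2 * len (g.reg 4) + 2 := by ring
      omega
    · intro s s' t hrel hrs ht
      have hrel₂ := hrel.of_frame hm₂ hf₂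
      rw [e4 s hrel] at hle
      have key : ∀ u, Runs e s s' u → t = 1 + len (s.reg r) + u →
          Rel h' s' ∧ h.reg 0 ≤ h'.reg 0 + 4 * t ∧ Flag h h' s s' t := by
        intro u hu htu
        subst htu
        push_cast at ht
        obtain ⟨b1, b2, b3⟩ := ho.faithful _ _ _ hrel₂ hu (by omega)
        refine ⟨b1, by push_cast; omega, ?_⟩
        have := b3.mono (t' := 1 + len (s.reg r) + u) (by omega)
        unfold Flag at this ⊢
        rwa [hd₂] at this
      cases hrs with
      | ite_pos hp hu =>
        rw [← e4 s hrel] at hp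
        rw [if_pos hp] at he; subst he
        exact key _ hu rfl
      | ite_neg hp hu =>
        rw [← e4 s hrel] at hp
        rw [if_neg (not_lt.2 hp)] at he; subst he
        exact key _ hu rfl

/-- A charged computation with registers `4` to `12` only. -/
theorem probe_spec {pre k : Prog} {Z B ℓ Kp Kk ex : ℕ} {h h₁ : State} {tp : ℕ}
    (hi : SimInv Z B ℓ h) (h0 : 0 < h.reg 0) (hpre : Runs pre h h₁ tp) (hs : SameBut h h₁)
    (hx : len (h₁.reg 4) + (h.reg 0).toNat ≤ B) (hy : len (h₁.reg 5) + (h.reg 0).toNat ≤ B)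
    (htp : tp ≤ Kp * (ℓ + 1) * (len (h₁.reg 4) + len (h₁.reg 5)))
    (hk : k.LoopFree) (hkm : ∀ g, (k.exec g).mem = g.mem)
    (hkr : ∀ g r, r ≤ 3 ∨ 13 ≤ r → (k.exec g).reg r = g.reg r)
    (hkc : ∀ g : State, g.reg 4 = h₁.reg 4 → g.reg 5 = h₁.reg 5 → (∀ r, 13 ≤ r → g.reg r = h.reg r) →
      k.cost g + ex ≤ Kk * (ℓ + 1) * (len (h₁.reg 4) + len (h₁.reg 5))) :
    ∃ h' t amt, Runs (charged pre k) h h' t ∧ SimInv Z B ℓ h' ∧ Frame h h' ∧ h'.mem = h.mem ∧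
      h'.reg 3 = h.reg 3 ∧ h'.reg 0 = h.reg 0 - (amt : ℕ) ∧
      1 ≤ amt ∧ amt ≤ 4 * (len (h₁.reg 4) + len (h₁.reg 5)) ∧
      t + ex + (2 * Kp + 2 * Kk + 2000) * (ℓ + 1) * pot B h' ≤
          (2 * Kp + 2 * Kk + 2000) * (ℓ + 1) * pot B h ∧ pot B h' < pot B h ∧
      (h'.reg 0 ≤ 0 ∧ h'.reg 12 = h.reg 12 ∨ 0 < h'.reg 0 ∧ ∃ g : State, g.reg 4 = h₁.reg 4 ∧
        g.reg 5 = h₁.reg 5 ∧ (∀ r, 13 ≤ r → g.reg r = h.reg r) ∧ h' = k.exec g) := by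
  obtain ⟨h₂, amt, T, hi₂, hf₂, hm₂, hd₂, hr12, h4, h5, hamt, hx', hy', h1, hle, hT, hrun0, hrun1⟩ :=
    charged_spec hi h0 hpre hs hx hy htp Kk
  have hpot : pot B h₂ < pot B h := by
    have := hi.const_le
    unfold pot; rw [if_pos h0]; split_ifs <;> omega
  have hc := hkc h₂ h4 h5 (fun r hr => hf₂.reg r (by omega))
  rcases le_or_gt (h₂.reg 0) 0 with h2 | h2
  · exact ⟨h₂, T, amt, hrun0 h2 k, hi₂, hf₂, hm₂, hd₂, hamt, h1, hle, by omega, hpot,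
      Or.inl ⟨h2, hr12⟩⟩
  · obtain ⟨T', hT', hr'⟩ := hrun1 h2 _ _ _ (hk.runs h₂)
    have r0 := hkr h₂ 0 (by simp)
    have hp : pot B (k.exec h₂) = pot B h₂ := by unfold pot; rw [r0]
    refine ⟨_, _, amt, hr', hi₂.congr (hkm h₂) (fun r hr => hkr h₂ r (by omega)), hf₂.trans
      ⟨fun r hr => hkr h₂ r (by omega), Or.inl (hkr h₂ 3 (by simp)), r0.le, by rw [hkm],
        fun a i _ => by rw [hkm]⟩, (hkm h₂).trans hm₂, (hkr h₂ 3 (by simp)).trans hd₂,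
      by rw [r0, hamt], h1, hle, ?_, by rw [hp]; exact hpot,
      Or.inr ⟨by rw [r0]; exact h2, h₂, h4, h5, fun r hr => hf₂.reg r (by omega), rfl⟩⟩
    rw [hp]
    omega

/-- The simulated test of a loop. -/
theorem guard_spec (r : ℕ) : ∃ K, ∀ Z B ℓ h, K ≤ Z → SimInv Z B ℓ h → ∃ h' t,
    Runs (guard r) h h' t ∧ SimInv Z B ℓ h' ∧ Frame h h' ∧ pot B h' ≤ pot B h ∧
      t + 1 + len (h'.reg 12) + K * (ℓ + 1) * pot B h' ≤ K * (ℓ + 1) * (pot B h + 1) ∧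
      (0 < h'.reg 12 → pot B h' < pot B h) ∧
      ∀ s, Rel h s → 4 * (1 + len (s.reg r) : ℤ) < h.reg 0 → Rel h' s ∧
        h.reg 0 ≤ h'.reg 0 + 4 * (1 + len (s.reg r)) ∧ h'.reg 3 = h.reg 3 ∧
        h'.reg 12 = s.reg r := by
  refine ⟨2 * (4 * len r + 20) + 2 * 10 + 2000, fun Z B ℓ h hZ hi => ?_⟩
  have l0 : len (0 : ℤ) = 1 := by decide
  set h₀ := h.setReg 12 0 with hh₀
  have hreg₀ : ∀ r, r ≠ 12 → h₀.reg r = h.reg r := by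
    intro r hr; rw [hh₀, setReg_reg, if_neg hr]
  have h12 : h₀.reg 12 = 0 := by rw [hh₀, setReg_reg, if_pos rfl]
  have hi₀ : SimInv Z B ℓ h₀ := hi.congr rfl (fun r hr => hreg₀ r (by omega))
  have hf₀ : Frame h h₀ := ⟨fun r hr => hreg₀ r (by omega), Or.inl (hreg₀ 3 (by simp)),
    (hreg₀ 0 (by simp)).le, rfl, fun _ _ _ => rfl⟩
  have hrun₀ : Runs (.const 12 0) h h₀ (1 + len 0) := .const _ _ _
  have hp₀ : pot B h₀ = pot B h := by unfold pot; rw [hreg₀ 0 (by simp)]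
  rcases le_or_gt (h₀.reg 0) 0 with h0 | h0
  · obtain ⟨t, ht, hr⟩ := charged_stopped h0 hi₀.len_zero
      (.seq (getReg 4 r) (.const 5 0)) (.arith .add 12 4 5)
    refine ⟨h₀, _, .seq hrun₀ hr, hi₀, hf₀, hp₀.le, ?_, fun hc => by omega, ?_⟩
    · rw [hp₀, h12, l0, mul_mul_succ]
      have : 2000 * (ℓ + 1) ≤ (2 * (4 * len (r : ℤ) + 20) + 2 * 10 + 2000) * (ℓ + 1) :=
        Nat.mul_le_mul_right _ (by omega)
      omega
    · intro s _ hlt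
      rw [hreg₀ 0 (by simp)] at h0
      omega
  obtain ⟨g, tp, hrun, hs, h4, h5, htp⟩ := pre_one hi₀.len_one hi₀.len_two r
  have hc := hi₀.cell_le 0 r
  have p4 := len_pos (g.reg 4)
  obtain ⟨h', t, amt, hrn, hi', hf', hm', hd', hamt, h1, hle, hT, hpl, hres⟩ :=
    probe_spec (k := .arith .add 12 4 5) (Kk := 10) (ex := 5 + len (g.reg 4)) hi₀ h0 hrun hs
      (by rw [h4]; exact hc)
      (by rw [h5]; have := len_pos (h₀.mem (0 + 1) (r * h₀.reg 1 + h₀.reg 2)); omega) htp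
      trivial (fun g => rfl)
      (fun g r hr => by simp only [Prog.exec, setReg_reg]; rw [if_neg (by omega)])
      (fun g' e4 e5 _ => by
        simp only [Prog.cost]; rw [e4, e5, h5, l0]
        have : 10 * (ℓ + 1) * (len (g.reg 4) + 1) =
          10 * (ℓ * len (g.reg 4)) + 10 * ℓ + 10 * len (g.reg 4) + 10 := by ring
        omega)
  have hlen : len (h'.reg 12) ≤ len (g.reg 4) := by
    rcases hres with ⟨-, h2⟩ | ⟨-, g', e4, e5, -, rfl⟩
    · rw [h2, h12, l0]; exact p4
    · simp [Prog.exec, setReg_reg, e4, e5, h5, Op.eval]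
  rw [h5, l0] at hle
  refine ⟨h', _, .seq hrun₀ hrn, hi', hf₀.trans hf', hp₀ ▸ hpl.le, ?_, fun _ => hp₀ ▸ hpl, ?_⟩
  · rw [hp₀] at hT
    rw [mul_mul_succ]
    omega
  · intro s hrel hlt
    have hrel₀ : Rel h₀ s := hrel.of_frame rfl hf₀
    have e4 : g.reg 4 = s.reg r := by rw [h4, ← hrel₀.1 r]
    rw [e4] at hle
    rw [hreg₀ 0 (by simp)] at hamt
    refine ⟨hrel₀.of_frame hm' hf', by omega, hd'.trans (hreg₀ 3 (by simp)), ?_⟩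
    rcases hres with ⟨h2, -⟩ | ⟨-, g', f4, f5, -, rfl⟩
    · omega
    · simp [Prog.exec, setReg_reg, f4, f5, h5, Op.eval, e4]

/-- Induction on the potential: a test that comes out positive has been charged for, so the
potential has dropped strictly before the body runs. This makes the simulation halt even if the
simulated loop does not. The drop by one also absorbs the terms `+ 1` of the test and of the body in
each round, which is the reason for counting `K₁` twice. -/
theorem simulates_loop {c : Prog} (r : ℕ) (hc : Simulates c) : Simulates (.loop r c) := by
  obtain ⟨K₁, h₁⟩ := guard_spec r
  obtain ⟨K₂, h₂⟩ := hc
  refine ⟨2 * K₁ + K₂, fun Z B ℓ h hZ => ?_⟩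
  induction hn : pot B h using Nat.strong_induction_on generalizing h with
  | _ n ih =>
  intro hi
  obtain ⟨g, tg, hg, hig, hfg, hpg, htg, hdec, hfaith⟩ := h₁ Z B ℓ h (by omega) hi
  have hmul := Nat.mul_le_mul_left ((K₁ + K₂) * (ℓ + 1)) (Nat.succ_le_succ hpg)
  have e : ∀ q, (2 * K₁ + K₂) * (ℓ + 1) * q = K₁ * (ℓ + 1) * q + K₁ * (ℓ + 1) * q +
      K₂ * (ℓ + 1) * q := by intro q; ring
  rcases le_or_gt (g.reg 12) 0 with h0 | h0
  · refine ⟨g, _, .seq hg (Runs.loop_stop h0), hig, hfg, hpg, ?_, ?_⟩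
    · have e1 : ∀ q, (K₁ + K₂) * (ℓ + 1) * q = K₁ * (ℓ + 1) * q + K₂ * (ℓ + 1) * q := by
        intro q; ring
      rw [e1, e1, Nat.succ_eq_add_one, Nat.succ_eq_add_one] at hmul
      rw [e, e]
      simp only [mul_mul_succ] at hmul htg ⊢
      omega
    · intro s s' t hrel hrun hlt
      cases hrun with
      | loop_stop hr =>
        push_cast at hlt
        obtain ⟨b1, b2, b3, b4⟩ := hfaith s hrel (by omega)
        exact ⟨b1, by push_cast; omega, Or.inr ⟨b3, rfl, rfl⟩⟩
      | loop_step hr hr1 hr2 =>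
        push_cast at hlt
        obtain ⟨b1, b2, b3, b4⟩ := hfaith s hrel (by omega)
        omega
  · have hlt := hdec h0
    obtain ⟨g₁, t₁, hr₁, o₁⟩ := h₂ Z B ℓ g (by omega) hig
    have hp₁ := o₁.pot_le
    obtain ⟨g₂, t₂, hr₂, o₂⟩ := ih (pot B g₁) (by omega) g₁ rfl o₁.inv
    have hp₂ := o₂.pot_le
    -- The simulated loop starts with a test and every round of it ends with one. Splitting off the
    -- first test of the remaining run supplies the last test of the current round.
    cases hr₂ with
    | @seq _ _ _ u _ ta tb hra hrb =>
    refine ⟨g₂, _, .seq hg (.loop_step h0 (.seq hr₁ hra) hrb), o₂.inv,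
      hfg.trans (o₁.frame.trans o₂.frame), by omega, ?_, ?_⟩
    · have a1 := o₁.time
      have a2 := o₂.time
      have b1 := Nat.mul_le_mul_left (K₁ * (ℓ + 1)) (show pot B g₁ + 1 ≤ pot B g + 1 by omega)
      have b2 := Nat.mul_le_mul_left (K₁ * (ℓ + 1)) (show pot B g + 1 ≤ pot B h by omega)
      have b3 := Nat.mul_le_mul_left (K₂ * (ℓ + 1)) (show pot B g + 1 ≤ pot B h by omega)
      simp only [e] at a2 ⊢
      simp only [mul_mul_succ] at htg a1 a2 b1 b2 b3 ⊢
      omega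
    · intro s s' t hrel hrun hlt
      cases hrun with
      | loop_stop hr =>
        push_cast at hlt
        obtain ⟨b1, b2, b3, b4⟩ := hfaith s hrel (by omega)
        omega
      | loop_step hr hr1 hr2 =>
        push_cast at hlt
        obtain ⟨b1, b2, b3, b4⟩ := hfaith s hrel (by omega)
        obtain ⟨c1, c2, c3⟩ := o₁.faithful _ _ _ b1 hr1 (by omega)
        obtain ⟨d1, d2, d3⟩ := o₂.faithful _ _ _ c1 hr2 (by omega)
        refine ⟨d1, by push_cast; omega, ?_⟩
        have := c3.trans d3
        replace this := this.mono (t' := 1 + len (s.reg r) + (_ + _)) (Nat.le_add_left _ _)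
        rw [← Nat.add_assoc] at this
        unfold Flag at this ⊢
        rw [b3] at this
        exact this

/-- Every program is simulated. -/
theorem simulates (c : Prog) : Simulates c := by
  induction c with
  | skip => exact simulates_skip
  | const r z => exact simulates_const r z
  | arith o r x y => exact simulates_arith o r x y
  | load r a i => exact simulates_load r a i
  | store a i r => exact simulates_store a i r
  | seq c d hc hd => exact simulates_seq hc hd
  | ite r c d hc hd => exact simulates_ite r hc hd
  | loop r c hc => exact simulates_loop r hc

/-- Compare the fraction of the simulated registers `0` and `1` with register `13`. -/
def compare : Prog :=
  .seq (.const 12 0) (charged (.seq (getReg 4 0) (getReg 5 1))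
    (.seq (.arith .mul 5 5 13) (.seq (.arith .sub 12 5 4)
      (.ite 12 (.const 12 1) (.const 12 0)))))

theorem exec_seq (c d : Prog) (s : State) : (Prog.seq c d).exec s = d.exec (c.exec s) := rfl

theorem exec_arith (o : Op) (r x y : ℕ) (s : State) :
    (Prog.arith o r x y).exec s = s.setReg r (o.eval (s.reg x) (s.reg y)) := rfl

theorem exec_ite_const (r : ℕ) (a b : ℤ) (s : State) :
    (Prog.ite r (.const r a) (.const r b)).exec s = s.setReg r (if 0 < s.reg r then a else b) := by
  simp only [Prog.exec]; split_ifs <;> rfl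

/-- Multiplying the threshold with the denominator avoids a division. The price depends on the two
simulated registers, which the faithful part therefore mentions with their lengths. -/
theorem compare_spec : ∃ K, ∀ Z B ℓ h, K ≤ Z → SimInv Z B ℓ h → len (h.reg 13) ≤ ℓ + 1 → ∃ h' t,
    Runs compare h h' t ∧ SimInv Z B ℓ h' ∧ Frame h h' ∧ pot B h' ≤ pot B h ∧
      t + K * (ℓ + 1) * pot B h' ≤ K * (ℓ + 1) * (pot B h + 1) ∧
      (h'.reg 12 = 0 ∨ h'.reg 12 = 1) ∧ h'.reg 3 = h.reg 3 ∧
      ∀ s, Rel h s → 4 * (len (s.reg 0) + len (s.reg 1) : ℤ) < h.reg 0 → Rel h' s ∧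
        h.reg 0 ≤ h'.reg 0 + 4 * (len (s.reg 0) + len (s.reg 1)) ∧
        (h'.reg 12 = 1 ↔ s.reg 0 < s.reg 1 * h.reg 13) := by
  refine ⟨2 * (4 * len (0 : ℕ) + 4 * len (1 : ℕ) + 30) + 2 * 30 + 2000, fun Z B ℓ h hZ hi h13 => ?_⟩
  have l0 : len (0 : ℤ) = 1 := by decide
  have l1 : len (1 : ℤ) = 2 := by decide
  set h₀ := h.setReg 12 0 with hh₀
  have hreg₀ : ∀ r, r ≠ 12 → h₀.reg r = h.reg r := by
    intro r hr; rw [hh₀, setReg_reg, if_neg hr]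
  have h12 : h₀.reg 12 = 0 := by rw [hh₀, setReg_reg, if_pos rfl]
  have hi₀ : SimInv Z B ℓ h₀ := hi.congr rfl (fun r hr => hreg₀ r (by omega))
  have hf₀ : Frame h h₀ := ⟨fun r hr => hreg₀ r (by omega), Or.inl (hreg₀ 3 (by simp)),
    (hreg₀ 0 (by simp)).le, rfl, fun _ _ _ => rfl⟩
  have hrun₀ : Runs (.const 12 0) h h₀ (1 + len 0) := .const _ _ _
  have hp₀ : pot B h₀ = pot B h := by unfold pot; rw [hreg₀ 0 (by simp)]
  rcases le_or_gt (h₀.reg 0) 0 with h0 | h0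
  · obtain ⟨t, ht, hr⟩ := charged_stopped h0 hi₀.len_zero
      (.seq (getReg 4 0) (getReg 5 1)) (.seq (.arith .mul 5 5 13) (.seq (.arith .sub 12 5 4)
      (.ite 12 (.const 12 1) (.const 12 0))))
    refine ⟨h₀, _, .seq hrun₀ hr, hi₀, hf₀, hp₀.le, ?_, Or.inl h12, hreg₀ 3 (by simp), ?_⟩
    · rw [hp₀, l0, mul_mul_succ]
      have : 2000 * (ℓ + 1) ≤
          (2 * (4 * len (0 : ℕ) + 4 * len (1 : ℕ) + 30) + 2 * 30 + 2000) * (ℓ + 1) :=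
        Nat.mul_le_mul_right _ (by omega)
      omega
    · intro s _ hlt
      rw [hreg₀ 0 (by simp)] at h0
      omega
  obtain ⟨g, tp, hrun, hs, h4, h5, htp⟩ := pre_two hi₀.len_one hi₀.len_two 0 1
  have p4 := len_pos (g.reg 4)
  have p5 := len_pos (g.reg 5)
  obtain ⟨h', t, amt, hrn, hi', hf', hm', hd', hamt, h1, hle, hT, hpl, hres⟩ :=
    probe_spec (k := .seq (.arith .mul 5 5 13) (.seq (.arith .sub 12 5 4)
      (.ite 12 (.const 12 1) (.const 12 0)))) (Kk := 30) (ex := 5) hi₀ h0 hrun hs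
      (by rw [h4]; exact hi₀.cell_le 0 _) (by rw [h5]; exact hi₀.cell_le 0 _) htp
      ⟨trivial, trivial, trivial, trivial⟩
      (fun g => by simp only [exec_seq, exec_arith, exec_ite_const, setReg_mem])
      (fun g r hr => by
        simp only [exec_seq, exec_arith, exec_ite_const]
        rw [setReg_reg, if_neg (by omega), setReg_reg, if_neg (by omega), setReg_reg,
          if_neg (by omega)])
      (fun g' e4 e5 e13 => by
        have a1 := len_mul_lt (g.reg 5) (h.reg 13)
        have a2 := len_add_le (g.reg 5 * h.reg 13) (-g.reg 4)
        rw [len_neg, ← sub_eq_add_neg] at a2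
        have ee : 30 * (ℓ + 1) * (len (g.reg 4) + len (g.reg 5)) =
          30 * (ℓ * len (g.reg 4)) + 30 * (ℓ * len (g.reg 5)) + 30 * len (g.reg 4) +
            30 * len (g.reg 5) := by ring
        have : ℓ ≤ ℓ * len (g.reg 4) := Nat.le_mul_of_pos_right _ p4
        simp only [Prog.cost, Prog.exec, setReg_reg]
        simp only [Nat.reduceEqDiff, if_false, if_true, e4, e5, e13 13 le_rfl,
          hreg₀ 13 (by simp), Op.eval, l0, l1]
        split_ifs <;> omega)
  have hval : ∀ g' : State, g'.reg 4 = g.reg 4 → g'.reg 5 = g.reg 5 → g'.reg 13 = h₀.reg 13 →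
      ((Prog.seq (.arith .mul 5 5 13) (.seq (.arith .sub 12 5 4)
        (.ite 12 (.const 12 1) (.const 12 0)))).exec g').reg 12 =
      if g.reg 4 < g.reg 5 * h.reg 13 then 1 else 0 := by
    intro g' e4 e5 e13
    rw [hreg₀ 13 (by simp)] at e13
    simp only [exec_seq, exec_arith, exec_ite_const, setReg_reg]
    simp only [Nat.reduceEqDiff, if_false, if_true, e4, e5, e13, Op.eval, sub_pos]
  refine ⟨h', _, .seq hrun₀ hrn, hi', hf₀.trans hf', hp₀ ▸ hpl.le, ?_, ?_,
    hd'.trans (hreg₀ 3 (by simp)), ?_⟩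
  · rw [hp₀] at hT
    rw [mul_mul_succ]
    omega
  · rcases hres with ⟨-, h2⟩ | ⟨-, g', e4, e5, e13, rfl⟩
    · exact Or.inl (h2.trans h12)
    · rw [hval g' e4 e5 (e13 13 le_rfl)]; split_ifs <;> simp
  · intro s hrel hlt
    have hrel₀ : Rel h₀ s := hrel.of_frame rfl hf₀
    have e4 : g.reg 4 = s.reg 0 := by rw [h4, ← hrel₀.1 0]
    have e5 : g.reg 5 = s.reg 1 := by rw [h5, ← hrel₀.1 1]
    rw [e4, e5] at hle
    rw [hreg₀ 0 (by simp)] at hamt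
    refine ⟨hrel₀.of_frame hm' hf', by omega, ?_⟩
    rcases hres with ⟨h2, -⟩ | ⟨-, g', f4, f5, f13, rfl⟩
    · omega
    · rw [hval g' f4 f5 (f13 13 le_rfl), e4, e5]; split_ifs with hh <;> simp [hh]

end RAM

/-! ### Functions computed in polynomial time by programs that read array `0` -/

namespace RAM

/-- `q` is bounded by a power of `n`. -/
def Poly {W : Type} (n q : W → ℕ) : Prop := ∃ Z : ℕ, ∀ w, q w ≤ n w ^ Z

/-- Situations in which a function is to be computed: the parameter, the contents of array `0`,
and the values that are given in registers. -/
structure Ctx (W : Type) where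
  n : W → ℕ
  two_le : ∀ w, 2 ≤ n w
  cells : W → ℤ → ℤ
  env : W → List ℤ

namespace Ctx

variable {W : Type} {Γ : Ctx W}

theorem poly_of_le {q q' : W → ℕ} (h : Poly Γ.n q') (hle : ∀ w, q w ≤ q' w) : Poly Γ.n q :=
  h.imp fun _ hZ w => (hle w).trans (hZ w)

/-- Since the parameter is at least two, `c ≤ 2 ^ c ≤ n ^ c`. So pure powers `n ^ Z` suffice and no
coefficient is needed. -/
theorem poly_const (Γ : Ctx W) (c : ℕ) : Poly Γ.n fun _ => c :=
  ⟨c, fun w => Nat.lt_two_pow_self.le.trans (Nat.pow_le_pow_left (Γ.two_le w) c)⟩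

theorem poly_n (Γ : Ctx W) : Poly Γ.n Γ.n := ⟨1, fun w => by simp⟩

theorem poly_mul {q q' : W → ℕ} (h : Poly Γ.n q) (h' : Poly Γ.n q') :
    Poly Γ.n fun w => q w * q' w := by
  obtain ⟨Z, hZ⟩ := h
  obtain ⟨Z', hZ'⟩ := h'
  exact ⟨Z + Z', fun w => by rw [pow_add]; exact Nat.mul_le_mul (hZ w) (hZ' w)⟩

theorem poly_add {q q' : W → ℕ} (h : Poly Γ.n q) (h' : Poly Γ.n q') :
    Poly Γ.n fun w => q w + q' w := by
  obtain ⟨Z, hZ⟩ := h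
  obtain ⟨Z', hZ'⟩ := h'
  refine ⟨Z + Z' + 1, fun w => ?_⟩
  have h2 := Γ.two_le w
  have h1 : q w ≤ Γ.n w ^ (Z + Z') :=
    (hZ w).trans (Nat.pow_le_pow_right (by omega) (by omega))
  have h1' : q' w ≤ Γ.n w ^ (Z + Z') :=
    (hZ' w).trans (Nat.pow_le_pow_right (by omega) (by omega))
  rw [pow_succ]
  nlinarith

theorem poly_pow {q : W → ℕ} (h : Poly Γ.n q) (k : ℕ) : Poly Γ.n fun w => q w ^ k := by
  obtain ⟨Z, hZ⟩ := h
  exact ⟨Z * k, fun w => by rw [pow_mul]; exact Nat.pow_le_pow_left (hZ w) k⟩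

/-- The function `f` is computed in polynomial time: some program computes it from registers
`regs` into register `d` and uses only registers from `d` on. -/
structure Comp (Γ : Ctx W) (f : W → ℤ) : Prop where
  poly : Poly Γ.n fun w => len (f w)
  exists_prog : ∀ (regs : List ℕ) (d : ℕ), (∀ r ∈ regs, r < d) → ∃ (p : Prog) (T : W → ℕ),
    Poly Γ.n T ∧ ∀ w s, regs.map s.reg = Γ.env w → s.mem 0 = Γ.cells w → ∃ s' t,
      Runs p s s' t ∧ t ≤ T w ∧ s'.mem = s.mem ∧ (∀ r < d, s'.reg r = s.reg r) ∧ s'.reg d = f w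

theorem Comp.congr {f g : W → ℤ} (hf : Γ.Comp f) (h : ∀ w, g w = f w) : Γ.Comp g := by
  rwa [funext h]

theorem comp_const (Γ : Ctx W) (z : ℤ) : Γ.Comp fun _ => z where
  poly := Γ.poly_const _
  exists_prog regs d hd := ⟨.const d z, fun _ => 1 + len z, Γ.poly_const _, fun w s _ _ =>
    ⟨_, _, .const s d z, le_rfl, rfl, fun r hr => by rw [setReg_reg, if_neg (by omega)],
      by rw [setReg_reg, if_pos rfl]⟩⟩

theorem Comp.op {f g : W → ℤ} (o : Op) (hf : Γ.Comp f) (hg : Γ.Comp g) :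
    Γ.Comp fun w => o.eval (f w) (g w) where
  poly := poly_of_le (poly_add hf.poly hg.poly) fun w => len_eval_le o _ _
  exists_prog regs d hd := by
    obtain ⟨p, T, hT, hp⟩ := hf.exists_prog regs d hd
    obtain ⟨p', T', hT', hp'⟩ := hg.exists_prog regs (d + 1) fun r hr => by have := hd r hr; omega
    refine ⟨.seq p (.seq p' (.arith o d d (d + 1))), _,
      poly_add hT (poly_add hT' (poly_add (Γ.poly_const 1) (poly_add hf.poly hg.poly))),
      fun w s he hm => ?_⟩
    obtain ⟨s₁, t₁, hr₁, ht₁, hm₁, hk₁, hv₁⟩ := hp w s he hm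
    obtain ⟨s₂, t₂, hr₂, ht₂, hm₂, hk₂, hv₂⟩ := hp' w s₁
      (by rw [← he]; exact List.map_congr_left fun r hr => hk₁ r (hd r hr)) (by rw [hm₁, hm])
    have e1 : s₂.reg d = f w := by rw [hk₂ d (by omega), hv₁]
    refine ⟨_, _, .seq hr₁ (.seq hr₂ (.arith s₂ o d d (d + 1))), ?_, ?_, fun r hr => ?_, ?_⟩
    · rw [e1, hv₂]; omega
    · rw [setReg_mem, hm₂, hm₁]
    · rw [setReg_reg, if_neg (by omega), hk₂ r (by omega), hk₁ r hr]
    · rw [setReg_reg, if_pos rfl, e1, hv₂]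

theorem Comp.add {f g : W → ℤ} (hf : Γ.Comp f) (hg : Γ.Comp g) : Γ.Comp fun w => f w + g w :=
  hf.op .add hg

theorem Comp.sub {f g : W → ℤ} (hf : Γ.Comp f) (hg : Γ.Comp g) : Γ.Comp fun w => f w - g w :=
  hf.op .sub hg

theorem Comp.mul {f g : W → ℤ} (hf : Γ.Comp f) (hg : Γ.Comp g) : Γ.Comp fun w => f w * g w :=
  hf.op .mul hg

theorem Comp.div {f g : W → ℤ} (hf : Γ.Comp f) (hg : Γ.Comp g) : Γ.Comp fun w => f w / g w :=
  hf.op .div hg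

theorem Comp.mod {f g : W → ℤ} (hf : Γ.Comp f) (hg : Γ.Comp g) : Γ.Comp fun w => f w % g w :=
  hf.op .mod hg

/-- Reading array `0`. -/
theorem Comp.read {f : W → ℤ} (hf : Γ.Comp f)
    (hl : Poly Γ.n fun w => len (Γ.cells w (f w))) : Γ.Comp fun w => Γ.cells w (f w) where
  poly := hl
  exists_prog regs d hd := by
    obtain ⟨p, T, hT, hp⟩ := hf.exists_prog regs d hd
    refine ⟨.seq p (.load d 0 d), _,
      poly_add hT (poly_add (Γ.poly_const 1) (poly_add hf.poly hl)), fun w s he hm => ?_⟩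
    obtain ⟨s₁, t₁, hr₁, ht₁, hm₁, hk₁, hv₁⟩ := hp w s he hm
    refine ⟨_, _, .seq hr₁ (.load s₁ d 0 d), ?_, ?_, fun r hr => ?_, ?_⟩
    · rw [hv₁, hm₁, hm]; omega
    · rw [setReg_mem, hm₁]
    · rw [setReg_reg, if_neg (by omega), hk₁ r hr]
    · rw [setReg_reg, if_pos rfl, hv₁, hm₁, hm]

theorem Comp.ite_pos {c f g : W → ℤ} (hc : Γ.Comp c) (hf : Γ.Comp f) (hg : Γ.Comp g) :
    Γ.Comp fun w => if 0 < c w then f w else g w where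
  poly := poly_of_le (poly_add hf.poly hg.poly) fun w => by split_ifs <;> omega
  exists_prog regs d hd := by
    obtain ⟨p₀, T₀, hT₀, hp₀⟩ := hc.exists_prog regs d hd
    obtain ⟨p, T, hT, hp⟩ := hf.exists_prog regs d hd
    obtain ⟨p', T', hT', hp'⟩ := hg.exists_prog regs d hd
    refine ⟨.seq p₀ (.ite d p p'), _, poly_add hT₀ (poly_add (Γ.poly_const 1)
      (poly_add hc.poly (poly_add hT hT'))), fun w s he hm => ?_⟩
    obtain ⟨s₁, t₁, hr₁, ht₁, hm₁, hk₁, hv₁⟩ := hp₀ w s he hm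
    have he₁ : regs.map s₁.reg = Γ.env w := by
      rw [← he]; exact List.map_congr_left fun r hr => hk₁ r (hd r hr)
    by_cases h0 : 0 < c w
    · obtain ⟨s₂, t₂, hr₂, ht₂, hm₂, hk₂, hv₂⟩ := hp w s₁ he₁ (by rw [hm₁, hm])
      refine ⟨s₂, _, .seq hr₁ (.ite_pos (by rw [hv₁]; exact h0) hr₂), ?_, ?_, fun r hr => ?_, ?_⟩
      · rw [hv₁]; omega
      · rw [hm₂, hm₁]
      · rw [hk₂ r hr, hk₁ r hr]
      · rw [hv₂, if_pos h0]
    · obtain ⟨s₂, t₂, hr₂, ht₂, hm₂, hk₂, hv₂⟩ := hp' w s₁ he₁ (by rw [hm₁, hm])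
      refine ⟨s₂, _, .seq hr₁ (.ite_neg (by rw [hv₁]; omega) hr₂), ?_, ?_, fun r hr => ?_, ?_⟩
      · rw [hv₁]; omega
      · rw [hm₂, hm₁]
      · rw [hk₂ r hr, hk₁ r hr]
      · rw [hv₂, if_neg h0]

/-- A given value. -/
theorem comp_env (i : ℕ) {f : W → ℤ} (hi : ∀ w, (Γ.env w)[i]? = some (f w))
    (hl : Poly Γ.n fun w => len (f w)) : Γ.Comp f where
  poly := hl
  exists_prog regs d hd := by
    by_cases hlt : i < regs.length
    · refine ⟨.seq (.const d 0) (.arith .add d regs[i] d), _,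
        poly_add (Γ.poly_const 10) hl, fun w s he hm => ?_⟩
      have hv : s.reg regs[i] = f w := by
        have := hi w
        rw [← he, List.getElem?_map, List.getElem?_eq_getElem hlt] at this
        simpa using this
      have hne : regs[i] < d := hd _ (List.getElem_mem hlt)
      have l0 : len (0 : ℤ) = 1 := by decide
      refine ⟨_, _, .seq (.const s d 0) (.arith _ .add d regs[i] d), ?_, rfl, fun r hr => ?_, ?_⟩
      · rw [setReg_reg, setReg_reg, if_pos rfl, if_neg (by omega), hv, l0]; omega
      · rw [setReg_reg, if_neg (by omega), setReg_reg, if_neg (by omega)]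
      · simp [setReg_reg, hne.ne, Op.eval, hv]
    -- With fewer registers than `i` no state matches the environment, so any program will do.
    · refine ⟨.skip, _, Γ.poly_const 0, fun w s he hm => ?_⟩
      have := hi w
      rw [← he, List.getElem?_eq_none (by simpa using hlt)] at this
      cases this

/-- Additional values in the registers. -/
theorem Comp.weaken {W' : Type} {Δ : Ctx W'} {f : W → ℤ} (hf : Γ.Comp f) (σ : W' → W) (k : ℕ)
    (hn : ∀ w, Δ.n w = Γ.n (σ w)) (hc : ∀ w, Δ.cells w = Γ.cells (σ w))
    (he : ∀ w, (Δ.env w).drop k = Γ.env (σ w)) : Δ.Comp fun w => f (σ w) where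
  poly := hf.poly.imp fun Z hZ w => by rw [hn]; exact hZ _
  exists_prog regs d hd := by
    obtain ⟨p, T, hT, hp⟩ := hf.exists_prog (regs.drop k) d fun r hr => hd r (List.mem_of_mem_drop hr)
    refine ⟨p, fun w => T (σ w), hT.imp fun Z hZ w => by rw [hn]; exact hZ _, fun w s hs hm => ?_⟩
    exact hp (σ w) s (by rw [← he, ← hs, List.map_drop]) (by rw [hm, hc])

/-- The situations inside an iteration that computes `a w (cnt w)`. -/
def iter (Γ : Ctx W) (a : W → ℕ → ℤ) (cnt : W → ℕ) : Ctx (Σ w, Fin (cnt w)) where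
  n w := Γ.n w.1
  two_le w := Γ.two_le w.1
  cells w := Γ.cells w.1
  env w := a w.1 w.2 :: ((w.2 : ℕ) : ℤ) :: Γ.env w.1

variable {a : W → ℕ → ℤ} {cnt : W → ℕ}

theorem Comp.inside {f : W → ℤ} (hf : Γ.Comp f) : (Γ.iter a cnt).Comp fun w => f w.1 :=
  hf.weaken Sigma.fst 2 (fun _ => rfl) (fun _ => rfl) (fun _ => rfl)

theorem poly_inside {q : W → ℕ} (hq : Poly Γ.n q) : Poly (Γ.iter a cnt).n fun w => q w.1 :=
  hq.imp fun _ hZ w => hZ w.1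

theorem len_natCast_le (m : ℕ) : len (m : ℤ) ≤ m + 1 := by
  rw [len_le_succ, Int.natAbs_natCast]; exact Nat.lt_two_pow_self

theorem comp_index (hcnt : Poly Γ.n cnt) : (Γ.iter a cnt).Comp fun w => ((w.2 : ℕ) : ℤ) :=
  comp_env 1 (fun _ => rfl) (poly_of_le (poly_add (poly_inside hcnt) (poly_const _ 1)) fun w => by
    have := len_natCast_le w.2
    have := w.2.2
    omega)

theorem comp_acc (ha : ∃ Z, ∀ w, ∀ i ≤ cnt w, len (a w i) ≤ Γ.n w ^ Z) :
    (Γ.iter a cnt).Comp fun w => a w.1 w.2 := by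
  obtain ⟨Z, hZ⟩ := ha
  exact comp_env 0 (fun _ => rfl) ⟨Z, fun w => hZ w.1 _ w.2.2.le⟩

/-- Iteration is compiled to a loop that keeps the accumulator in register `d`, then the number of
rounds, the index, the number of rounds left and the constant one; the step works from register `d +
5` on. All accumulators, not only the last, must have polynomial length, since an iterated
polynomial step could otherwise double the length each time. -/
theorem Comp.fold (hc : Γ.Comp fun w => (cnt w : ℤ)) (hcnt : Poly Γ.n cnt)
    (h0 : Γ.Comp fun w => a w 0) (ha : ∃ Z, ∀ w, ∀ i ≤ cnt w, len (a w i) ≤ Γ.n w ^ Z)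
    (hs : (Γ.iter a cnt).Comp fun w => a w.1 (w.2 + 1)) : Γ.Comp fun w => a w (cnt w) where
  poly := ha.imp fun Z hZ w => hZ w _ le_rfl
  exists_prog regs d hd := by
    obtain ⟨p₀, T₀, hT₀, hp₀⟩ := h0.exists_prog regs d hd
    obtain ⟨p₁, T₁, hT₁, hp₁⟩ := hc.exists_prog regs (d + 1) fun r hr => by have := hd r hr; omega
    obtain ⟨p₂, T₂, ⟨Z₂, hZ₂⟩, hp₂⟩ := hs.exists_prog (d :: (d + 2) :: regs) (d + 5) (by
      intro r hr
      simp only [List.mem_cons] at hr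
      rcases hr with rfl | rfl | hr
      · omega
      · omega
      · have := hd r hr; omega)
    obtain ⟨Za, hZa⟩ := ha
    set body : Prog := .seq p₂ (.seq (.const (d + 6) 0) (.seq (.arith .add d (d + 5) (d + 6))
      (.seq (.arith .add (d + 2) (d + 2) (d + 4)) (.arith .sub (d + 3) (d + 1) (d + 2))))) with hbody
    have l0 : len (0 : ℤ) = 1 := by decide
    have l1 : len (1 : ℤ) = 2 := by decide
    have key : ∀ w m i s, i + m = cnt w → regs.map s.reg = Γ.env w → s.mem 0 = Γ.cells w →
        s.reg d = a w i → s.reg (d + 1) = (cnt w : ℤ) → s.reg (d + 2) = (i : ℤ) → s.reg (d + 3) = (m : ℤ) →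
        s.reg (d + 4) = 1 → ∃ s' t, Runs (.loop (d + 3) body) s s' t ∧
          t ≤ (m + 1) * (Γ.n w ^ Z₂ + Γ.n w ^ Za + 6 * cnt w + 30) ∧ s'.mem = s.mem ∧
          (∀ r < d, s'.reg r = s.reg r) ∧ s'.reg d = a w (cnt w) := by
      intro w m
      induction m with
      | zero =>
        intro i s him he hm h0 h1 h2 h3 h4
        refine ⟨s, _, Runs.loop_stop (by rw [h3]; simp), ?_, rfl, fun _ _ => rfl, ?_⟩
        · rw [h3]; simp [l0]
        · rw [h0, ← him, Nat.add_zero]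
      | succ m ih =>
        intro i s him he hm h0 h1 h2 h3 h4
        obtain ⟨s₁, t₁, hr₁, ht₁, hm₁, hk₁, hv₁⟩ := hp₂ ⟨w, i, by omega⟩ s
          (by simp only [List.map_cons, iter, he, h0, h2]) hm
        have hZ := hZ₂ ⟨w, i, by omega⟩
        simp only [iter] at hZ hv₁
        set tail : Prog := (.seq (.const (d + 6) 0) (.seq (.arith .add d (d + 5) (d + 6))
          (.seq (.arith .add (d + 2) (d + 2) (d + 4)) (.arith .sub (d + 3) (d + 1) (d + 2)))))
          with htail
        have hlf : tail.LoopFree := by simp [htail, Prog.LoopFree]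
        have k1 := hk₁ (d + 1) (by omega)
        have k2 := hk₁ (d + 2) (by omega)
        have k4 := hk₁ (d + 4) (by omega)
        have v0 : (tail.exec s₁).reg d = a w (i + 1) := by
          simp [htail, Prog.exec, setReg_reg, Op.eval, hv₁]
        have v1 : (tail.exec s₁).reg (d + 1) = cnt w := by
          simp [htail, Prog.exec, setReg_reg, k1, h1]
        have v2 : (tail.exec s₁).reg (d + 2) = (i + 1 : ℕ) := by
          simp [htail, Prog.exec, setReg_reg, Op.eval, k2, h2, k4, h4]
        have v3 : (tail.exec s₁).reg (d + 3) = m := by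
          simp [htail, Prog.exec, setReg_reg, Op.eval, k2, h2, k4, h4, k1, h1]; omega
        have v4 : (tail.exec s₁).reg (d + 4) = 1 := by
          simp [htail, Prog.exec, setReg_reg, k4, h4]
        have vr : ∀ r < d, (tail.exec s₁).reg r = s.reg r := by
          intro r hr
          simp only [htail, Prog.exec, setReg_reg]
          rw [if_neg (by omega), if_neg (by omega), if_neg (by omega), if_neg (by omega),
            hk₁ r (by omega)]
        have hm₂ : (tail.exec s₁).mem = s.mem := by
          simp only [htail, Prog.exec, setReg_mem, hm₁]
        have hcost : tail.cost s₁ ≤ Γ.n w ^ Za + 4 * cnt w + 20 := by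
          have b1 := len_natCast_le (cnt w)
          have b2 := len_natCast_le i
          have b3 := len_natCast_le (i + 1)
          push_cast at b3
          have b4 := hZa w (i + 1) (by omega)
          simp [htail, Prog.cost, Prog.exec, setReg_reg, Op.eval, k2, h2, k4, h4, k1, h1, hv₁, l0, l1]
          omega
        obtain ⟨s', t, hr, ht, hm', hk', hv'⟩ := ih (i + 1) (tail.exec s₁) (by omega)
          (by rw [← he]; exact List.map_congr_left fun r hr => vr r (hd r hr)) (by rw [hm₂, hm])
          v0 v1 v2 v3 v4
        refine ⟨s', _, .loop_step (by rw [h3]; positivity) (.seq hr₁ (hlf.runs s₁)) hr, ?_,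
          hm'.trans hm₂, fun r hr => by rw [hk' r hr, vr r hr], hv'⟩
        rw [h3]
        have b5 := len_natCast_le (m + 1)
        have e : (m + 1 + 1) * (Γ.n w ^ Z₂ + Γ.n w ^ Za + 6 * cnt w + 30) =
          (m + 1) * (Γ.n w ^ Z₂ + Γ.n w ^ Za + 6 * cnt w + 30) +
          (Γ.n w ^ Z₂ + Γ.n w ^ Za + 6 * cnt w + 30) := by ring
        have ht₁' := ht₁.trans hZ
        omega
    refine ⟨.seq p₀ (.seq p₁ (.seq (.const (d + 2) 0) (.seq (.const (d + 4) 1)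
      (.seq (.arith .sub (d + 3) (d + 1) (d + 2)) (.loop (d + 3) body))))), _,
      poly_add hT₀ (poly_add hT₁ (poly_add (poly_add hc.poly (Γ.poly_const 10))
        (poly_mul (poly_add hcnt (Γ.poly_const 1)) (poly_add (poly_add (poly_add
          (poly_pow Γ.poly_n Z₂) (poly_pow Γ.poly_n Za)) (poly_mul (Γ.poly_const 6) hcnt))
          (Γ.poly_const 30))))), fun w s he hm => ?_⟩
    obtain ⟨s₁, t₁, hr₁, ht₁, hm₁, hk₁, hv₁⟩ := hp₀ w s he hm
    obtain ⟨s₂, t₂, hr₂, ht₂, hm₂, hk₂, hv₂⟩ := hp₁ w s₁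
      (by rw [← he]; exact List.map_congr_left fun r hr => hk₁ r (hd r hr)) (by rw [hm₁, hm])
    set s₃ := ((s₂.setReg (d + 2) 0).setReg (d + 4) 1).setReg (d + 3)
      (Op.sub.eval (((s₂.setReg (d + 2) 0).setReg (d + 4) 1).reg (d + 1))
        (((s₂.setReg (d + 2) 0).setReg (d + 4) 1).reg (d + 2))) with hs₃
    have vr : ∀ r < d, s₃.reg r = s.reg r := by
      intro r hr
      rw [hs₃, setReg_reg, if_neg (by omega), setReg_reg, if_neg (by omega), setReg_reg,
        if_neg (by omega), hk₂ r (by omega), hk₁ r hr]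
    obtain ⟨s', t, hr, ht, hm', hk', hv'⟩ := key w (cnt w) 0 s₃ (by omega)
      (by rw [← he]; exact List.map_congr_left fun r hr => vr r (hd r hr))
      (by simp only [hs₃, setReg_mem, hm₂, hm₁, hm])
      (by simp [hs₃, setReg_reg, hk₂ d, hv₁]) (by simp [hs₃, setReg_reg, hv₂])
      (by simp [hs₃, setReg_reg]) (by simp [hs₃, setReg_reg, Op.eval, hv₂])
      (by simp [hs₃, setReg_reg])
    refine ⟨s', _, .seq hr₁ (.seq hr₂ (.seq (.const _ _ _) (.seq (.const _ _ _)
      (.seq (.arith _ .sub (d + 3) (d + 1) (d + 2)) hr)))), ?_, ?_,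
      fun r hr => by rw [hk' r hr, vr r hr], hv'⟩
    · simp only [setReg_reg]
      simp only [Nat.add_left_cancel_iff, Nat.reduceEqDiff, OfNat.one_ne_ofNat, if_false, if_true, hv₂, l0, l1]
      omega
    · rw [hm', hs₃]; simp only [setReg_mem, hm₂, hm₁]

/-! #### Decisions and natural numbers -/

/-- The predicate `p` is decided in polynomial time. -/
def Dec (Γ : Ctx W) (p : W → Prop) : Prop := ∃ f, Γ.Comp f ∧ ∀ w, 0 < f w ↔ p w

theorem Comp.ite {p : W → Prop} [∀ w, Decidable (p w)] {f g : W → ℤ} (hp : Γ.Dec p)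
    (hf : Γ.Comp f) (hg : Γ.Comp g) : Γ.Comp fun w => if p w then f w else g w := by
  obtain ⟨c, hc, h⟩ := hp
  exact (hc.ite_pos hf hg).congr fun w => by simp only [h]

theorem Dec.congr {p q : W → Prop} (hp : Γ.Dec p) (h : ∀ w, q w ↔ p w) : Γ.Dec q :=
  hp.imp fun _ hc => ⟨hc.1, fun w => (hc.2 w).trans (h w).symm⟩

theorem Comp.lt {f g : W → ℤ} (hf : Γ.Comp f) (hg : Γ.Comp g) : Γ.Dec fun w => f w < g w :=
  ⟨_, hg.sub hf, fun _ => sub_pos⟩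

theorem Dec.not {p : W → Prop} (hp : Γ.Dec p) : Γ.Dec fun w => ¬ p w := by
  obtain ⟨c, hc, h⟩ := hp
  exact ⟨_, (Γ.comp_const 1).sub hc, fun w => by
    have := h w
    beta_reduce; rw [← this]; omega⟩

theorem Dec.and {p q : W → Prop} (hp : Γ.Dec p) (hq : Γ.Dec q) : Γ.Dec fun w => p w ∧ q w := by
  obtain ⟨c, hc, h⟩ := hp
  obtain ⟨c', hc', h'⟩ := hq
  refine ⟨_, hc.ite_pos hc' (Γ.comp_const 0), fun w => ?_⟩
  have h1 := h w
  have h2 := h' w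
  beta_reduce
  rw [← h1, ← h2]
  split_ifs with h3 <;> simp [h3]

theorem Comp.le {f g : W → ℤ} (hf : Γ.Comp f) (hg : Γ.Comp g) : Γ.Dec fun w => f w ≤ g w :=
  (hg.lt hf).not.congr fun _ => not_lt.symm

theorem Comp.eq {f g : W → ℤ} (hf : Γ.Comp f) (hg : Γ.Comp g) : Γ.Dec fun w => f w = g w :=
  ((hf.le hg).and (hg.le hf)).congr fun _ => le_antisymm_iff

theorem Dec.or {p q : W → Prop} (hp : Γ.Dec p) (hq : Γ.Dec q) : Γ.Dec fun w => p w ∨ q w :=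
  (hp.not.and hq.not).not.congr fun _ => or_iff_not_and_not

/-- A function with natural values is computed in polynomial time. -/
abbrev NComp (Γ : Ctx W) (f : W → ℕ) : Prop := Γ.Comp fun w => (f w : ℤ)

theorem ncomp_const (Γ : Ctx W) (k : ℕ) : Γ.NComp fun _ => k := Γ.comp_const k

namespace NComp

variable {f g : W → ℕ}

theorem add (hf : Γ.NComp f) (hg : Γ.NComp g) : Γ.NComp fun w => f w + g w :=
  (Comp.add hf hg).congr fun _ => by push_cast; rfl

theorem mul (hf : Γ.NComp f) (hg : Γ.NComp g) : Γ.NComp fun w => f w * g w :=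
  (Comp.mul hf hg).congr fun _ => by push_cast; rfl

theorem div (hf : Γ.NComp f) (hg : Γ.NComp g) : Γ.NComp fun w => f w / g w :=
  (Comp.div hf hg).congr fun _ => by push_cast; rfl

theorem mod (hf : Γ.NComp f) (hg : Γ.NComp g) : Γ.NComp fun w => f w % g w :=
  (Comp.mod hf hg).congr fun _ => by push_cast; rfl

theorem lt (hf : Γ.NComp f) (hg : Γ.NComp g) : Γ.Dec fun w => f w < g w :=
  (Comp.lt hf hg).congr fun _ => by norm_cast

theorem le (hf : Γ.NComp f) (hg : Γ.NComp g) : Γ.Dec fun w => f w ≤ g w :=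
  (Comp.le hf hg).congr fun _ => by norm_cast

theorem eq (hf : Γ.NComp f) (hg : Γ.NComp g) : Γ.Dec fun w => f w = g w :=
  (Comp.eq hf hg).congr fun _ => by norm_cast

theorem ite {p : W → Prop} [∀ w, Decidable (p w)] (hp : Γ.Dec p) (hf : Γ.NComp f)
    (hg : Γ.NComp g) : Γ.NComp fun w => if p w then f w else g w :=
  (Comp.ite hp hf hg).congr fun _ => by push_cast; rfl

theorem sub (hf : Γ.NComp f) (hg : Γ.NComp g) : Γ.NComp fun w => f w - g w :=
  (Comp.ite (hg.le hf) (Comp.sub hf hg) (Γ.comp_const 0)).congr fun _ => by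
    beta_reduce; split_ifs <;> omega

theorem min (hf : Γ.NComp f) (hg : Γ.NComp g) : Γ.NComp fun w => min (f w) (g w) :=
  (ite (hf.le hg) hf hg).congr fun _ => by beta_reduce; rw [Nat.min_def]

theorem succ (hf : Γ.NComp f) : Γ.NComp fun w => f w + 1 := hf.add (Γ.ncomp_const 1)

/-- Repeated multiplication takes `g w` rounds, hence the requirement that the exponent itself, not
just its length, be polynomially bounded. This is the case for the powers of two in the reduction,
whose exponents are linear or quadratic in the size. -/
theorem pow (hf : Γ.NComp f) (hg : Γ.NComp g) (hp : Poly Γ.n g) :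
    Γ.NComp fun w => f w ^ g w := by
  have hacc : ∃ Z, ∀ w, ∀ i ≤ g w, len (((f w ^ i : ℕ)) : ℤ) ≤ Γ.n w ^ Z := by
    obtain ⟨Z, hZ⟩ := poly_add (Γ.poly_const 2) (poly_mul hp hf.poly)
    refine ⟨Z, fun w i hi => le_trans ?_ (hZ w)⟩
    have : ∀ i, len (((f w ^ i : ℕ)) : ℤ) ≤ 2 + i * len (f w : ℤ) := by
      intro i
      induction i with
      | zero => simp; decide
      | succ i ih =>
        have := len_mul_lt ((f w ^ i : ℕ) : ℤ) (f w)
        rw [pow_succ]; push_cast at this ih ⊢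
        have e : (i + 1) * len (f w : ℤ) = i * len (f w : ℤ) + len (f w : ℤ) := by ring
        omega
    exact (this i).trans (Nat.add_le_add_left (Nat.mul_le_mul_right _ hi) 2)
  exact Comp.fold (a := fun w i => ((f w ^ i : ℕ) : ℤ)) hg hp
    ((Γ.comp_const 1).congr fun w => by simp) hacc
    ((Comp.mul (comp_acc hacc) hf.inside).congr fun w => by push_cast; ring)

end NComp

end Ctx

end RAM

/-! ### Bounds for coordinates and distances -/

namespace MapMatching

theorem abs_plab_le (m : ℕ) (pa : ℕ → ℕ → Bool) (v : ℕ) : |plab m pa v| ≤ 8 * m + 40 := by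
  have h := Nat.mod_lt (v / 2) (show 0 < 3 * m + 3 by omega)
  unfold plab pid
  rw [abs_le]
  split_ifs <;> constructor <;> omega

theorem abs_qlab_le {m : ℕ} (hm : 0 < m) (B : ℕ) (qb : ℕ → ℕ → Bool) (k : ℕ) :
    |qlab m B qb k| ≤ 8 * m + 40 := by
  have h := tri_le hm (k / 2 - 1)
  unfold qlab qid
  rw [abs_le]
  split_ifs <;> constructor <;> omega

/-- All reparametrisations start at `0`, so the first vertices are always matched. -/
theorem le_frechetDist {a b : List Plane} (ha : 0 < a.length) (hb : 0 < b.length) :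
    dist (a.getD 0 0) (b.getD 0 0) ≤ frechetDist a b := by
  apply le_csInf
  · exact ⟨_, _, _, isReparam_linear ha, isReparam_linear hb, rfl⟩
  rintro r ⟨f, g, hf, hg, rfl⟩
  have hbdd : BddAbove ((fun μ => dist (polyCurve a (f μ)) (polyCurve b (g μ))) ''
      Set.Icc 0 1) := by
    obtain ⟨R, hR⟩ := polyCurve_bounded a
    obtain ⟨R', hR'⟩ := polyCurve_bounded b
    refine ⟨R + R', ?_⟩
    rintro x ⟨μ, -, rfl⟩
    exact (dist_le_norm_add_norm _ _).trans (add_le_add (hR _) (hR' _))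
  have h0 : ∀ {n : ℕ} {f : ℝ → ℝ}, IsReparam n f → 0 < n → f 0 = 0 := by
    intro n f hf hn
    obtain ⟨μ, hμ, h⟩ := hf.exists_eq hn
    have h1 := hf.2.1 (Set.left_mem_Icc.2 zero_le_one) hμ hμ.1
    have h2 := (hf.mem (Set.left_mem_Icc.2 zero_le_one)).1
    simp only [Nat.cast_zero] at h
    linarith
  have hp : ∀ a : List Plane, polyCurve a 0 = a.getD 0 0 := by
    intro a; simp [polyCurve]
  have := le_csSup hbdd ⟨0, Set.left_mem_Icc.2 zero_le_one, rfl⟩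
  simpa only [h0 hf ha, h0 hg hb, hp] using this

theorem abs_sub_le_dist (a b : ℤ × ℤ) : |(a.1 : ℝ) - b.1| ≤ dist (toPlane a) (toPlane b) := by
  rw [EuclideanSpace.dist_eq, Fin.sum_univ_two]
  refine Real.le_sqrt_of_sq_le ?_
  simp only [toPlane, Real.dist_eq, sq_abs, Matrix.cons_val_zero, Matrix.cons_val_one]
  nlinarith [sq_nonneg ((a.2 : ℝ) - b.2)]

theorem dist_le_abs_add (a b : ℤ × ℤ) :
    dist (toPlane a) (toPlane b) ≤ |(a.1 : ℝ) - b.1| + |(a.2 : ℝ) - b.2| := by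
  rw [EuclideanSpace.dist_eq, Fin.sum_univ_two, Real.sqrt_le_left (by positivity)]
  simp only [toPlane, Real.dist_eq, Matrix.cons_val_zero, Matrix.cons_val_one]
  nlinarith [abs_nonneg ((a.1 : ℝ) - b.1), abs_nonneg ((a.2 : ℝ) - b.2)]

/-- All labels of the graph are even and all labels of the trajectory are odd, so the first vertices
are at least one unit apart. Together with `matchDist_le_scale` this confines the quotient in an
answer to an explicit range. -/
theorem scale_le_matchDist {m A B : ℕ} (hA : 0 < A) (pa qb : ℕ → ℕ → Bool) :
    (scale m A : ℝ) ≤ (gadgetGraph m A pa).matchDist (gadgetTraj m A B qb) := by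
  have hV : 0 < graphSize m A := by unfold graphSize; positivity
  have hq : 0 < trajSize m B := by unfold trajSize; omega
  apply le_csInf
  · exact ⟨_, [(⟨0, hV⟩ : Fin (gadgetGraph m A pa).numV)], by simp, by simp, rfl⟩
  rintro r ⟨π, hne, -, rfl⟩
  have hpos : 0 < π.length := List.length_pos_of_ne_nil hne
  refine le_trans ?_ (le_frechetDist (by simpa using hpos)
    (by rw [List.length_map, length_gadgetTraj]; exact hq))
  rw [getD_path π hpos, getD_traj qb hq]
  refine le_trans ?_ (abs_sub_le_dist _ _)
  have h1 : (1 : ℤ) ≤ |plab m pa (π[0] : ℕ) - qlab m B qb 0| := by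
    have : plab m pa (π[0] : ℕ) - qlab m B qb 0 ≠ 0 := by
      unfold plab qlab; split_ifs <;> omega
    exact Int.one_le_abs this
  have h2 : (1 : ℝ) ≤ |(plab m pa (π[0] : ℕ) : ℝ) - qlab m B qb 0| := by exact_mod_cast h1
  push_cast
  rw [← mul_sub, abs_mul, Nat.abs_cast]
  exact le_mul_of_one_le_right (Nat.cast_nonneg _) h2

/-- A path that goes back and forth along the first edge has as many vertices as the trajectory, and
all labels are at most `8 * m + 40` in absolute value. -/
theorem matchDist_le_scale {m A B : ℕ} (hm : 0 < m) (hA : 0 < A) (pa qb : ℕ → ℕ → Bool) :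
    (gadgetGraph m A pa).matchDist (gadgetTraj m A B qb) ≤ (scale m A : ℝ) * (16 * m + 81) := by
  have hV : 2 ≤ graphSize m A := by
    have : 1 * (6 * m + 6) ≤ A * (6 * m + 6) := Nat.mul_le_mul_right _ hA
    unfold graphSize; omega
  have hq : 0 < trajSize m B := by unfold trajSize; omega
  have hlt : ∀ k : Fin (trajSize m B), (k : ℕ) % 2 < (gadgetGraph m A pa).numV := fun k =>
    (Nat.mod_lt _ (by norm_num)).trans_le hV
  set π : List (Fin (gadgetGraph m A pa).numV) := List.ofFn fun k : Fin (trajSize m B) =>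
    ⟨(k : ℕ) % 2, hlt k⟩ with hπ
  have hlen : π.length = trajSize m B := by simp [hπ]
  refine le_trans (csInf_le (matchDist_bddBelow _ _) ⟨π, ?_, ?_, rfl⟩) ?_
  · intro h0
    have := congrArg List.length h0
    rw [hlen, List.length_nil] at this
    omega
  · rw [List.isChain_iff_getElem]
    intro k hk
    refine lineGraph_adj.2 ?_
    simp only [hπ, List.getElem_ofFn]
    omega
  · apply frechetDist_le
    · rw [List.length_map, hlen]; exact hq
    · rw [List.length_map, List.length_map, length_gadgetTraj, hlen]
    · intro k
      rcases Nat.lt_or_ge k (trajSize m B) with hk | hk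
      · rw [getD_traj qb hk, getD_path π (hlen ▸ hk)]
        refine (dist_le_abs_add _ _).trans ?_
        have h1 := abs_plab_le m pa (π[k]'(hlen ▸ hk) : ℕ)
        have h2 := abs_qlab_le hm B qb k
        have h3 : |plab m pa (π[k]'(hlen ▸ hk) : ℕ) - qlab m B qb k| ≤ 16 * m + 80 :=
          (abs_sub _ _).trans (by omega)
        have h4 : |(plab m pa (π[k]'(hlen ▸ hk) : ℕ) : ℝ) - qlab m B qb k| ≤ 16 * m + 80 := by
          exact_mod_cast h3
        have h5 : ((π[k]'(hlen ▸ hk) : ℕ) : ℝ) ≤ scale m A := by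
          have := (π[k]'(hlen ▸ hk)).2
          have h6 : (gadgetGraph m A pa).numV = graphSize m A := rfl
          exact_mod_cast (show ((π[k]'(hlen ▸ hk) : ℕ)) ≤ scale m A by unfold scale; omega)
        have h0 : (0 : ℝ) ≤ scale m A := Nat.cast_nonneg _
        push_cast
        rw [← mul_sub, abs_mul, Nat.abs_cast, sub_zero, Nat.abs_cast]
        nlinarith
      · rw [List.getD_eq_default _ _ (by rw [List.length_map, hlen]; exact hk),
          List.getD_eq_default _ _ (by rw [List.length_map, length_gadgetTraj]; exact hk), dist_self]
        positivity

end MapMatching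

/-! ### Evaluating formulas -/

namespace SAT

/-- The contents of an array that holds a list. -/
def cellsOf (l : List ℤ) (j : ℤ) : ℤ := if 0 ≤ j ∧ j < (l.length : ℤ) then l.getD j.toNat 0 else 0

/-- Position of clause `c` in the array `z`. -/
def ptr (z : ℤ → ℤ) : ℕ → ℤ
  | 0 => 2
  | c + 1 => ptr z c + 1 + z (ptr z c)

/-- The literal `l` concerns a variable in `[lo, hi)` and is satisfied by the bits of `x`, the
lowest bit being the value of variable `lo`. -/
def LitTrue (l : ℤ) (x lo hi : ℕ) : Prop :=
  lo + 1 ≤ l.natAbs ∧ l.natAbs ≤ hi ∧ (x.testBit (l.natAbs - 1 - lo) = true ↔ 0 < l)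

/-- No literal of clause `c` is satisfied. -/
def Free (z : ℤ → ℤ) (c x lo hi : ℕ) : Prop :=
  ∀ e < (z (ptr z c)).toNat, ¬ LitTrue (z (ptr z c + 1 + (e : ℤ))) x lo hi

theorem cellsOf_append (p s : List ℤ) (j : ℕ) :
    cellsOf (p ++ s) (p.length + j) = cellsOf s j := by
  have h : (0 ≤ (p.length + j : ℤ) ∧ (p.length + j : ℤ) < ((p ++ s).length : ℤ)) ↔
      (0 ≤ (j : ℤ) ∧ (j : ℤ) < (s.length : ℤ)) := by
    rw [List.length_append]; omega
  simp only [cellsOf, h]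
  split_ifs
  · have : ((p.length : ℤ) + (j : ℤ)).toNat = p.length + j := by omega
    rw [this, List.getD_append_right _ _ _ _ (by omega)]
    simp
  · rfl

theorem cellsOf_natCast (l : List ℤ) (j : ℕ) : cellsOf l j = l.getD j 0 := by
  unfold cellsOf
  split_ifs with h
  · simp
  · rw [List.getD_eq_default _ _ (by omega)]

variable {N : ℕ}

theorem cellsOf_encode_natAbs_le (φ : CNF N) {k : ℕ} (hk : ∀ cl ∈ φ, cl.length ≤ k) (j : ℤ) :
    (cellsOf (encode φ) j).natAbs ≤ N + φ.length + k := by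
  have key : ∀ v ∈ encode φ, v.natAbs ≤ N + φ.length + k := by
    intro v hv
    simp only [encode, List.mem_cons, List.mem_flatMap] at hv
    rcases hv with rfl | rfl | ⟨cl, hcl, rfl | hv⟩
    · omega
    · omega
    · have := hk cl hcl; omega
    · obtain ⟨l, -, rfl⟩ := List.mem_map.1 hv
      have := l.1.2
      unfold encodeLiteral
      split_ifs <;> omega
  unfold cellsOf
  split_ifs with h
  · have hlt : j.toNat < (encode φ).length := by omega
    rw [List.getD_eq_getElem _ _ hlt]
    exact key _ (List.getElem_mem hlt)
  · simp

/-- Induction along the clauses: the entry at the position of a clause is its length, which is what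
`ptr` uses to skip it. -/
theorem exists_prefix (φ : CNF N) {c : ℕ} (hc : c ≤ φ.length) : ∃ p : List ℤ,
    encode φ = p ++ (φ.drop c).flatMap (fun cl => (cl.length : ℤ) :: cl.map encodeLiteral) ∧
      ptr (cellsOf (encode φ)) c = p.length := by
  induction c with
  | zero => exact ⟨[(N : ℤ), (φ.length : ℤ)], by simp [encode], by simp [ptr]⟩
  | succ c ih =>
    obtain ⟨p, hp, hl⟩ := ih (by omega)
    rw [List.drop_eq_getElem_cons (by omega : c < φ.length), List.flatMap_cons] at hp
    refine ⟨p ++ ((φ[c].length : ℤ) :: φ[c].map encodeLiteral), by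
      rw [hp, List.append_assoc], ?_⟩
    have : cellsOf (encode φ) p.length = φ[c].length := by
      have := cellsOf_append p (((φ[c].length : ℤ) :: φ[c].map encodeLiteral) ++
        (φ.drop (c + 1)).flatMap (fun cl => (cl.length : ℤ) :: cl.map encodeLiteral)) 0
      rw [← hp, cellsOf_natCast] at this
      simpa only [Nat.cast_zero, add_zero, List.cons_append, List.getD_cons_zero] using this
    rw [ptr, hl, this]
    simp
    ring

theorem cellsOf_ptr (φ : CNF N) {c : ℕ} (hc : c < φ.length) :
    cellsOf (encode φ) (ptr (cellsOf (encode φ)) c) = φ[c].length ∧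
      ∀ e (he : e < φ[c].length), cellsOf (encode φ) (ptr (cellsOf (encode φ)) c + 1 + (e : ℤ)) =
        encodeLiteral φ[c][e] := by
  obtain ⟨p, hp, hl⟩ := exists_prefix φ hc.le
  rw [List.drop_eq_getElem_cons hc, List.flatMap_cons] at hp
  have key := fun j : ℕ => cellsOf_append p (((φ[c].length : ℤ) :: φ[c].map encodeLiteral) ++
        (φ.drop (c + 1)).flatMap (fun cl => (cl.length : ℤ) :: cl.map encodeLiteral)) j
  rw [← hp] at key
  rw [hl]
  refine ⟨?_, fun e he => ?_⟩
  · have := key 0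
    rw [cellsOf_natCast] at this
    simpa using this
  · have := key (e + 1)
    rw [cellsOf_natCast] at this
    push_cast at this
    rw [show (p.length : ℤ) + 1 + (e : ℤ) = p.length + (e + 1) by ring, this]
    rw [List.getD_append _ _ _ _ (by simp; omega)]
    simp [he]

theorem litTrue_encodeLiteral (l : Literal N) (x lo hi : ℕ) :
    LitTrue (encodeLiteral l) x lo hi ↔
      lo ≤ l.1 ∧ (l.1 : ℕ) < hi ∧ x.testBit (l.1 - lo) = l.2 := by
  have h1 : (encodeLiteral l).natAbs = l.1 + 1 := by
    unfold encodeLiteral; split_ifs <;> omega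
  have h2 : 0 < encodeLiteral l ↔ l.2 = true := by
    unfold encodeLiteral; split_ifs with h
    · simp only [h, iff_true]; omega
    · simp [h]
  unfold LitTrue
  rw [h1, h2, Nat.add_sub_cancel, Nat.add_le_add_iff_right, Nat.succ_le_iff]
  refine and_congr Iff.rfl (and_congr Iff.rfl ?_)
  cases x.testBit (l.1 - lo) <;> cases l.2 <;> simp

theorem free_encode (φ : CNF N) {c : ℕ} (hc : c < φ.length) (x : ℕ) :
    Free (cellsOf (encode φ)) c x 0 N ↔ ¬ ∃ l ∈ φ[c], x.testBit l.1 = l.2 := by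
  obtain ⟨h1, h2⟩ := cellsOf_ptr φ hc
  unfold Free
  rw [h1]
  push Not
  constructor
  · intro h l hl he
    obtain ⟨e, he', rfl⟩ := List.getElem_of_mem hl
    refine h e (by simpa using he') ?_
    rw [h2 e he', litTrue_encodeLiteral]
    exact ⟨Nat.zero_le _, (φ[c][e]).1.2, he⟩
  · intro h e he
    have he' : e < φ[c].length := by simpa using he
    rw [h2 e he', litTrue_encodeLiteral]
    rintro ⟨-, -, h3⟩
    exact h _ (List.getElem_mem he') h3

theorem satisfiable_of_bits (φ : CNF N) (x : ℕ)
    (h : ∀ c < φ.length, ¬ Free (cellsOf (encode φ)) c x 0 N) : Satisfiable φ := by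
  refine ⟨fun v => x.testBit v, fun cl hcl => ?_⟩
  obtain ⟨c, hc, rfl⟩ := List.getElem_of_mem hcl
  have := h c hc
  rw [free_encode φ hc, not_not] at this
  exact this

theorem Satisfiable.exists_bits {φ : CNF N} (h : Satisfiable φ) :
    ∃ x < 2 ^ N, ∀ c < φ.length, ¬ Free (cellsOf (encode φ)) c x 0 N := by
  obtain ⟨a, ha⟩ := h
  refine ⟨Nat.ofBits a, Nat.ofBits_lt_two_pow a, fun c hc => ?_⟩
  rw [free_encode φ hc, not_not]
  obtain ⟨l, hl, h⟩ := ha _ (List.getElem_mem hc)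
  exact ⟨l, hl, by rw [Nat.testBit_ofBits_lt _ _ l.1.2]; exact h⟩

/-- The low and the high part of an assignment occupy separate bits of one number, so a literal is
satisfied by the whole iff it is satisfied by the part that contains its variable. Surplus bits of
`i` do not matter, because only variables below `a` are looked at; this admits more blocks than low
assignments. -/
theorem litTrue_add (l : ℤ) (i y : ℕ) {a N : ℕ} (ha : a ≤ N) :
    LitTrue l (i % 2 ^ a + 2 ^ a * y) 0 N ↔ LitTrue l i 0 a ∨ LitTrue l y a N := by
  unfold LitTrue
  rw [add_comm (i % 2 ^ a), Nat.testBit_two_pow_mul_add _ (Nat.mod_lt _ (by positivity)),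
    Nat.sub_zero, Nat.testBit_mod_two_pow]
  by_cases h : l.natAbs - 1 < a
  · simp only [h, if_true, decide_true, Bool.true_and]
    constructor
    · rintro ⟨h1, h2, h3⟩; exact Or.inl ⟨h1, by omega, h3⟩
    · rintro (⟨h1, h2, h3⟩ | ⟨h1, h2, h3⟩)
      · exact ⟨h1, by omega, h3⟩
      · omega
  · simp only [h, if_false]
    constructor
    · rintro ⟨h1, h2, h3⟩; exact Or.inr ⟨by omega, h2, h3⟩
    · rintro (⟨h1, h2, h3⟩ | ⟨h1, h2, h3⟩)
      · omega
      · exact ⟨by omega, h2, h3⟩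

theorem free_add (z : ℤ → ℤ) (c i y : ℕ) {a N : ℕ} (ha : a ≤ N) :
    Free z c (i % 2 ^ a + 2 ^ a * y) 0 N ↔ Free z c i 0 a ∧ Free z c y a N := by
  unfold Free
  simp only [litTrue_add _ _ _ ha, not_or]
  exact ⟨fun h => ⟨fun e he => (h e he).1, fun e he => (h e he).2⟩,
    fun h e he => ⟨h.1 e he, h.2 e he⟩⟩

end SAT

/-! ### Deciding in polynomial time whether a partial assignment satisfies a clause -/

namespace RAM

namespace Ctx

variable {W : Type} {Γ : Ctx W}

theorem Comp.toNat {f : W → ℤ} (hf : Γ.Comp f) : Γ.NComp fun w => (f w).toNat :=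
  (hf.ite_pos hf (Γ.comp_const 0)).congr fun w => by beta_reduce; split_ifs <;> omega

theorem Comp.natAbs {f : W → ℤ} (hf : Γ.Comp f) : Γ.NComp fun w => (f w).natAbs :=
  (hf.ite_pos hf ((Γ.comp_const 0).sub hf)).congr fun w => by beta_reduce; split_ifs <;> omega

theorem Dec.iff {p q : W → Prop} (hp : Γ.Dec p) (hq : Γ.Dec q) : Γ.Dec fun w => p w ↔ q w :=
  ((hp.and hq).or (hp.not.and hq.not)).congr fun _ => by tauto

-- The accumulator is the indicator of the conjunction over all smaller indices.
open Classical in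
theorem dec_ball {cnt : W → ℕ} (hc : Γ.NComp cnt) (hp : Poly Γ.n cnt) {p : W → ℕ → Prop}
    (h : ∀ a, (Γ.iter a cnt).Dec fun w => p w.1 w.2) : Γ.Dec fun w => ∀ i < cnt w, p w i := by
  set a : W → ℕ → ℤ := fun w i => if ∀ j < i, p w j then 1 else 0 with ha
  have hacc : ∃ Z, ∀ w, ∀ i ≤ cnt w, len (a w i) ≤ Γ.n w ^ Z := by
    refine (Γ.poly_const 2).imp fun Z hZ w i _ => le_trans ?_ (hZ w)
    simp only [ha]; split_ifs <;> decide
  refine ⟨_, Comp.fold (a := a) hc hp ((Γ.comp_const 1).congr fun w => by simp [ha]) hacc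
    ((Comp.ite (h a) (comp_acc hacc) (comp_const _ 0)).congr fun w => ?_), fun w => ?_⟩
  · simp only [ha, Nat.lt_succ_iff_lt_or_eq, or_imp, forall_and, forall_eq]
    split_ifs <;> tauto
  · simp only [ha]; split_ifs with h1 <;> simpa using h1

theorem NComp.testBit {x i : W → ℕ} (hx : Γ.NComp x) (hi : Γ.NComp i) (hp : Poly Γ.n i) :
    Γ.Dec fun w => (x w).testBit (i w) = true :=
  (((hx.div ((Γ.ncomp_const 2).pow hi hp)).mod (Γ.ncomp_const 2)).eq (Γ.ncomp_const 1)).congr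
    fun w => by rw [Nat.testBit_eq_decide_div_mod_eq]; simp

/-- All cells of array `0` are small. -/
def Small (Γ : Ctx W) : Prop := ∀ w i, (Γ.cells w i).natAbs ≤ Γ.n w

theorem Small.inside (hz : Γ.Small) {a : W → ℕ → ℤ} {cnt : W → ℕ} : (Γ.iter a cnt).Small :=
  fun w i => hz w.1 i

theorem len_le_natAbs (v : ℤ) : len v ≤ v.natAbs + 1 := by
  rw [len_le_succ]; exact Nat.lt_two_pow_self

theorem Small.poly (hz : Γ.Small) (f : W → ℤ) : Poly Γ.n fun w => (Γ.cells w (f w)).natAbs :=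
  poly_of_le Γ.poly_n fun w => hz w _

theorem Small.read (hz : Γ.Small) {f : W → ℤ} (hf : Γ.Comp f) : Γ.Comp fun w => Γ.cells w (f w) :=
  hf.read (poly_of_le (poly_add (hz.poly f) (Γ.poly_const 1)) fun _ => len_le_natAbs _)

/-- Each clause moves the position by at most `n + 1`, so the pointer stays polynomial. -/
theorem Small.comp_ptr (hz : Γ.Small) {c : W → ℕ} (hc : Γ.NComp c) (hp : Poly Γ.n c) :
    Γ.Comp fun w => SAT.ptr (Γ.cells w) (c w) := by
  have hacc : ∃ Z, ∀ w, ∀ i ≤ c w, len (SAT.ptr (Γ.cells w) i) ≤ Γ.n w ^ Z := by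
    obtain ⟨Z, hZ⟩ := poly_add (Γ.poly_const 3) (poly_mul hp (poly_add Γ.poly_n (Γ.poly_const 1)))
    refine ⟨Z, fun w i hi => le_trans ?_ (hZ w)⟩
    have : ∀ i, (SAT.ptr (Γ.cells w) i).natAbs ≤ 2 + i * (Γ.n w + 1) := by
      intro i
      induction i with
      | zero => simp [SAT.ptr]
      | succ i ih =>
        have := hz w (SAT.ptr (Γ.cells w) i)
        rw [SAT.ptr, Nat.succ_mul]
        omega
    have h1 := this i
    have h2 := len_le_natAbs (SAT.ptr (Γ.cells w) i)
    have h3 : i * (Γ.n w + 1) ≤ c w * (Γ.n w + 1) := Nat.mul_le_mul_right _ hi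
    change _ ≤ 3 + c w * (Γ.n w + 1)
    omega
  exact Comp.fold (a := fun w i => SAT.ptr (Γ.cells w) i) hc hp
    ((Γ.comp_const 2).congr fun _ => rfl) hacc
    (((comp_acc hacc).add (comp_const _ 1)).add (hz.inside.read (comp_acc hacc)))

theorem dec_litTrue {l : W → ℤ} {x lo hi : W → ℕ} (hl : Γ.Comp l)
    (hlp : Poly Γ.n fun w => (l w).natAbs) (hx : Γ.NComp x) (hlo : Γ.NComp lo) (hhi : Γ.NComp hi) :
    Γ.Dec fun w => SAT.LitTrue (l w) (x w) (lo w) (hi w) :=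
  (hlo.succ.le hl.natAbs).and ((hl.natAbs.le hhi).and ((hx.testBit ((hl.natAbs.sub
    (Γ.ncomp_const 1)).sub hlo) (poly_of_le hlp fun w => by omega)).iff
    (Comp.lt (Γ.comp_const 0) hl)))

theorem Small.dec_free (hz : Γ.Small) {c x lo hi : W → ℕ} (hc : Γ.NComp c) (hp : Poly Γ.n c)
    (hx : Γ.NComp x) (hlo : Γ.NComp lo) (hhi : Γ.NComp hi) :
    Γ.Dec fun w => SAT.Free (Γ.cells w) (c w) (x w) (lo w) (hi w) := by
  have h1 := hz.comp_ptr hc hp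
  have hcnt : Poly Γ.n fun w => (Γ.cells w (SAT.ptr (Γ.cells w) (c w))).toNat :=
    poly_of_le (hz.poly fun w => SAT.ptr (Γ.cells w) (c w)) fun w => by omega
  refine dec_ball (hz.read h1).toNat hcnt fun a => Dec.not ?_
  exact dec_litTrue (hz.inside.read ((h1.inside.add (comp_const _ 1)).add
    (comp_index hcnt))) (hz.inside.poly _) hx.inside hlo.inside hhi.inside

end Ctx

end RAM

/-! ### Computing the encodings of the graph and of the trajectories -/

namespace MapMatching

theorem length_flatMap_pair {α : Type*} (f g : α → ℤ) (l : List α) :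
    (l.flatMap fun z => [f z, g z]).length = 2 * l.length := by
  induction l with
  | nil => rfl
  | cons a l ih => rw [List.flatMap_cons, List.length_append, ih, List.length_cons]; simp; ring

theorem getD_flatMap_pair {α : Type*} (f g : α → ℤ) (l : List α) (u : ℕ) :
    (l.flatMap fun z => [f z, g z]).getD u 0 =
      if u % 2 = 0 then (l.map f).getD (u / 2) 0 else (l.map g).getD (u / 2) 0 := by
  induction l generalizing u with
  | nil => simp
  | cons a l ih =>
    match u with
    | 0 => simp
    | 1 => simp
    | u + 2 =>
      have h := ih u
      have e : (u + 2) / 2 = u / 2 + 1 := by omega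
      rw [Nat.add_mod_right, e, List.map_cons, List.map_cons, List.getD_cons_succ,
        List.getD_cons_succ, ← h]
      simp

/-- Entries of the encoding of the graph. -/
def graphEntry (m A : ℕ) (pa : ℕ → ℕ → Bool) (t : ℕ) : ℤ :=
  if t = 0 then graphSize m A else if t = 1 then ((graphSize m A - 1 : ℕ) : ℤ)
  else if t - 2 < 2 * graphSize m A then
    if (t - 2) % 2 = 0 then (scale m A : ℤ) * plab m pa ((t - 2) / 2) else (((t - 2) / 2 : ℕ) : ℤ)
  else if (t - 2 - 2 * graphSize m A) % 2 = 0 then (((t - 2 - 2 * graphSize m A) / 2 : ℕ) : ℤ)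
  else (((t - 2 - 2 * graphSize m A) / 2 + 1 : ℕ) : ℤ)

/-- Length of the encoding of the graph. -/
def graphLen (m A : ℕ) : ℕ := 2 + 2 * graphSize m A + 2 * (graphSize m A - 1)

/-- Entries of the encoding of the trajectory. -/
def trajEntry (m A B : ℕ) (qb : ℕ → ℕ → Bool) (t : ℕ) : ℤ :=
  if t = 0 then trajSize m B
  else if (t - 1) % 2 = 0 then (scale m A : ℤ) * qlab m B qb ((t - 1) / 2) else 0

def trajLen (m B : ℕ) : ℕ := 1 + 2 * trajSize m B

theorem length_encode_gadgetGraph (m A : ℕ) (pa : ℕ → ℕ → Bool) :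
    (gadgetGraph m A pa).encode.length = graphLen m A := by
  unfold GeoGraph.encode graphLen
  rw [List.length_cons, List.length_cons, List.length_append, length_flatMap_pair,
    length_flatMap_pair]
  simp [gadgetGraph, lineGraph]
  ring

theorem getD_encode_gadgetGraph {m A t : ℕ} (pa : ℕ → ℕ → Bool) (ht : t < graphLen m A) :
    (gadgetGraph m A pa).encode.getD t 0 = graphEntry m A pa t := by
  have hlen : ((gadgetGraph m A pa).edges).length = graphSize m A - 1 := by
    simp [gadgetGraph, lineGraph]
  unfold graphLen at ht
  match t, ht with
  | 0, _ => simp [GeoGraph.encode, graphEntry, gadgetGraph, lineGraph]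
  | 1, _ => simp [GeoGraph.encode, graphEntry, gadgetGraph, lineGraph]
  | u + 2, ht =>
    unfold graphEntry GeoGraph.encode
    rw [List.getD_cons_succ, List.getD_cons_succ, if_neg (by omega), if_neg (by omega),
      Nat.add_sub_cancel]
    have hl : ((List.ofFn (gadgetGraph m A pa).pos).flatMap (fun z => [z.1, z.2])).length =
        2 * graphSize m A := by
      rw [length_flatMap_pair]; simp [gadgetGraph, lineGraph]
    split_ifs with h1 h2 h2
    · rw [List.getD_append _ _ _ _ (by omega), getD_flatMap_pair, if_pos h2,
        List.getD_eq_getElem _ _ (by simp [gadgetGraph, lineGraph]; omega)]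
      simp [gadgetGraph, lineGraph]
    · rw [List.getD_append _ _ _ _ (by omega), getD_flatMap_pair, if_neg h2,
        List.getD_eq_getElem _ _ (by simp [gadgetGraph, lineGraph]; omega)]
      simp [gadgetGraph, lineGraph]
    · rw [List.getD_append_right _ _ _ _ (by omega), hl, getD_flatMap_pair, if_pos h2,
        List.getD_eq_getElem _ _ (by rw [List.length_map, hlen]; omega)]
      simp [gadgetGraph, lineGraph]
    · rw [List.getD_append_right _ _ _ _ (by omega), hl, getD_flatMap_pair, if_neg h2,
        List.getD_eq_getElem _ _ (by rw [List.length_map, hlen]; omega)]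
      simp [gadgetGraph, lineGraph]

theorem length_encodeTraj (m A B : ℕ) (qb : ℕ → ℕ → Bool) :
    (encodeTraj (gadgetTraj m A B qb)).length = trajLen m B := by
  rw [encodeTraj, List.length_cons, length_flatMap_pair, length_gadgetTraj, trajLen]
  ring

theorem getD_encodeTraj {m A B t : ℕ} (qb : ℕ → ℕ → Bool) (ht : t < trajLen m B) :
    (encodeTraj (gadgetTraj m A B qb)).getD t 0 = trajEntry m A B qb t := by
  unfold trajLen at ht
  match t, ht with
  | 0, _ => simp [encodeTraj, trajEntry, gadgetTraj]
  | u + 1, ht =>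
    unfold trajEntry encodeTraj
    rw [List.getD_cons_succ, if_neg (by omega), Nat.add_sub_cancel, getD_flatMap_pair]
    split_ifs with h2
    · rw [List.getD_eq_getElem _ _ (by simp [gadgetTraj]; omega)]
      simp [gadgetTraj]
    · rw [List.getD_eq_getElem _ _ (by simp [gadgetTraj]; omega)]
      simp [gadgetTraj]

end MapMatching

/-! ### Labels and encodings as polynomial-time functions -/

namespace RAM

namespace Ctx

open MapMatching

variable {W : Type} {Γ : Ctx W} {m A B v t : W → ℕ} {pa qb : W → ℕ → ℕ → Bool}

theorem comp_pid (hm : Γ.NComp m) (hv : Γ.NComp v) : Γ.Comp fun w => pid (m w) (v w) :=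
  Comp.ite (hv.le hm.succ) (Comp.sub (Comp.add hm (Γ.comp_const 1)) hv)
    (Comp.ite (hv.le ((Γ.ncomp_const 2).mul hm).succ)
      (Comp.sub (Comp.sub hv hm) (Γ.comp_const 1))
      (Comp.sub (Comp.add (Comp.mul (Γ.comp_const 3) hm) (Γ.comp_const 1)) hv))

theorem ncomp_tri (hm : Γ.NComp m) (hv : Γ.NComp v) : Γ.NComp fun w => tri (m w) (v w) :=
  have h := hv.mod ((Γ.ncomp_const 2).mul hm)
  NComp.ite (h.lt hm) (hm.sub h) (h.sub hm)

theorem comp_qid (hm : Γ.NComp m) (hB : Γ.NComp B) (hv : Γ.NComp v) :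
    Γ.Comp fun w => qid (m w) (B w) (v w) :=
  Comp.ite (hv.eq (Γ.ncomp_const 0)) (Comp.add hm (Γ.comp_const 1))
    (Comp.ite (hv.eq (((((Γ.ncomp_const 2).mul hB).succ).mul hm).add (Γ.ncomp_const 2)))
      (Γ.comp_const (-1)) (ncomp_tri hm (hv.sub (Γ.ncomp_const 1))))

theorem comp_plab (hm : Γ.NComp m) (hv : Γ.NComp v)
    (hpa : Γ.Dec fun w => pa w (v w / 2 / (3 * m w + 3)) (v w / 2 % (3 * m w + 3) - (m w + 1)) = true) :
    Γ.Comp fun w => plab (m w) (pa w) (v w) :=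
  have h2 := Γ.ncomp_const 2
  have h := (hv.div h2).mod (((Γ.ncomp_const 3).mul hm).add (Γ.ncomp_const 3))
  Comp.ite ((hv.mod h2).eq (Γ.ncomp_const 0))
    ((((Γ.comp_const (-8)).mul (comp_pid hm h)).sub (Γ.comp_const 20)))
    (Comp.ite ((hm.succ.le h).and ((h.le (h2.mul hm)).and hpa)) (Γ.comp_const 2) (Γ.comp_const 4))

theorem comp_qlab (hm : Γ.NComp m) (hB : Γ.NComp B) (hv : Γ.NComp v)
    (hqb : Γ.Dec fun w => qb w ((v w / 2 - 1) / (2 * m w)) ((v w / 2 - 1) % (2 * m w) - m w) = true) :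
    Γ.Comp fun w => qlab (m w) (B w) (qb w) (v w) :=
  have h2 := Γ.ncomp_const 2
  have h := hv.div h2
  Comp.ite ((hv.mod h2).eq (Γ.ncomp_const 0))
    ((((Γ.comp_const (-8)).mul (comp_qid hm hB h)).sub (Γ.comp_const 19)))
    (Comp.ite (((Γ.ncomp_const 1).le h).and
      ((hm.le ((h.sub (Γ.ncomp_const 1)).mod (h2.mul hm))).and hqb))
      (Γ.comp_const 5) (Γ.comp_const 3))

theorem ncomp_graphSize (hm : Γ.NComp m) (hA : Γ.NComp A) :
    Γ.NComp fun w => graphSize (m w) (A w) :=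
  hA.mul (((Γ.ncomp_const 6).mul hm).add (Γ.ncomp_const 6))

theorem ncomp_scale (hm : Γ.NComp m) (hA : Γ.NComp A) : Γ.NComp fun w => scale (m w) (A w) :=
  (Γ.ncomp_const 100).mul (ncomp_graphSize hm hA)

theorem ncomp_trajSize (hm : Γ.NComp m) (hB : Γ.NComp B) :
    Γ.NComp fun w => trajSize (m w) (B w) :=
  ((Γ.ncomp_const 2).mul ((((Γ.ncomp_const 2).mul hB).succ).mul hm)).add (Γ.ncomp_const 5)

theorem ncomp_graphLen (hm : Γ.NComp m) (hA : Γ.NComp A) :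
    Γ.NComp fun w => graphLen (m w) (A w) :=
  have h := ncomp_graphSize hm hA
  ((Γ.ncomp_const 2).add ((Γ.ncomp_const 2).mul h)).add
    ((Γ.ncomp_const 2).mul (h.sub (Γ.ncomp_const 1)))

theorem ncomp_trajLen (hm : Γ.NComp m) (hB : Γ.NComp B) :
    Γ.NComp fun w => trajLen (m w) (B w) :=
  (Γ.ncomp_const 1).add ((Γ.ncomp_const 2).mul (ncomp_trajSize hm hB))

theorem comp_graphEntry (hm : Γ.NComp m) (hA : Γ.NComp A) (ht : Γ.NComp t)
    (hpa : ∀ v : W → ℕ, Γ.NComp v → Γ.Dec fun w =>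
      pa w (v w / 2 / (3 * m w + 3)) (v w / 2 % (3 * m w + 3) - (m w + 1)) = true) :
    Γ.Comp fun w => graphEntry (m w) (A w) (pa w) (t w) :=
  have h2 := Γ.ncomp_const 2
  have hV := ncomp_graphSize hm hA
  have hu := ht.sub h2
  have hu' := hu.sub (h2.mul hV)
  Comp.ite (ht.eq (Γ.ncomp_const 0)) hV (Comp.ite (ht.eq (Γ.ncomp_const 1))
    (hV.sub (Γ.ncomp_const 1)) (Comp.ite (hu.lt (h2.mul hV))
      (Comp.ite ((hu.mod h2).eq (Γ.ncomp_const 0))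
        (Comp.mul (ncomp_scale hm hA) (comp_plab hm (hu.div h2) (hpa _ (hu.div h2)))) (hu.div h2))
      (Comp.ite ((hu'.mod h2).eq (Γ.ncomp_const 0)) (hu'.div h2) (hu'.div h2).succ)))

theorem comp_trajEntry (hm : Γ.NComp m) (hA : Γ.NComp A) (hB : Γ.NComp B) (ht : Γ.NComp t)
    (hqb : ∀ v : W → ℕ, Γ.NComp v → Γ.Dec fun w =>
      qb w ((v w / 2 - 1) / (2 * m w)) ((v w / 2 - 1) % (2 * m w) - m w) = true) :
    Γ.Comp fun w => trajEntry (m w) (A w) (B w) (qb w) (t w) :=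
  have h2 := Γ.ncomp_const 2
  have hu := ht.sub (Γ.ncomp_const 1)
  Comp.ite (ht.eq (Γ.ncomp_const 0)) (ncomp_trajSize hm hB)
    (Comp.ite ((hu.mod h2).eq (Γ.ncomp_const 0))
      (Comp.mul (ncomp_scale hm hA) (comp_qlab hm hB (hu.div h2) (hqb _ (hu.div h2))))
      (Γ.comp_const 0))

end Ctx

end RAM

/-! ### The numbers and bits that occur in the reduction -/

namespace RAM

/-- Parameters of the reduction: the fraction `1 / D` of the variables is encoded in the graph,
`D₂` is the inverse of the saved exponent, `E`, `G` and `b` are exponents of the number of blocks,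
of the largest trajectories and of the time that a candidate is given, `R` is the resolution of the
candidate sizes, and `K` is added to the size of a formula. -/
structure Par where
  D : ℕ
  D₂ : ℕ
  E : ℕ
  G : ℕ
  R : ℕ
  K : ℕ
  b : ℕ

namespace Par

variable (P : Par) (N M c : ℕ)

def size : ℕ := N + M + P.K

def low : ℕ := N / P.D

/-- Number of blocks of the graph. -/
def blocks : ℕ := 2 ^ P.low N * P.size N M ^ P.E

/-- Number of blocks of a trajectory. -/
def batch : ℕ := min ((P.R + c % P.R) * 2 ^ (c / P.R)) (P.blocks N M ^ P.G)

def queries : ℕ := 2 ^ (N - P.low N) / P.batch N M c + 1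

def budget : ℕ := P.size N M ^ P.b * 2 ^ (N - P.low N / P.D₂)

/-- Number of assignments that are tried for a query. -/
def trials : ℕ := P.batch N M c * 2 ^ P.low N

end Par

open Classical in
/-- Clause `c` is not satisfied by the low variables. -/
noncomputable def lowBits (z : ℤ → ℤ) (M lo i c : ℕ) : Bool := decide (c < M ∧ SAT.Free z c i 0 lo)

open Classical in
/-- Clause `c` is not satisfied by the high variables. -/
noncomputable def highBits (z : ℤ → ℤ) (M lo N off i c : ℕ) : Bool :=
  decide (c < M ∧ SAT.Free z c (off + i) lo N)

/-- A formula with clauses of size at most `k` and three numbers. -/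
structure Sit (P : Par) (k e : ℕ) where
  N : ℕ
  φ : SAT.CNF N
  le : ∀ cl ∈ φ, cl.length ≤ k
  c : ℕ
  j : ℕ
  t : ℕ
  c_le : c ≤ P.size N φ.length ^ 2
  j_le : len j ≤ P.size N φ.length ^ e
  t_le : len t ≤ P.size N φ.length ^ e

/-- The context given by a formula and three numbers. -/
def sitCtx (P : Par) (k e : ℕ) (hK : k + 2 ≤ P.K) : Ctx (Sit P k e) where
  n w := P.size w.N w.φ.length
  two_le w := by unfold Par.size; omega
  cells w := SAT.cellsOf (SAT.encode w.φ)
  env w := [(w.c : ℤ), (w.j : ℤ), (w.t : ℤ)]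

namespace Sit

open Ctx MapMatching

variable {P : Par} {k e : ℕ} {hK : k + 2 ≤ P.K}

local notation "Γ₀" => sitCtx P k e hK

theorem small : (Γ₀).Small := fun w i =>
  (SAT.cellsOf_encode_natAbs_le w.φ w.le i).trans (by simp only [sitCtx, Par.size]; omega)

theorem ncomp_c : (Γ₀).NComp fun w => w.c :=
  comp_env 0 (fun _ => rfl) (poly_of_le (poly_add (poly_pow (Γ₀).poly_n 2) ((Γ₀).poly_const 1))
    fun w => (len_natCast_le w.c).trans (Nat.succ_le_succ w.c_le))

theorem ncomp_j : (Γ₀).NComp fun w => w.j := comp_env 1 (fun _ => rfl) ⟨e, fun w => w.j_le⟩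

theorem ncomp_t : (Γ₀).NComp fun w => w.t := comp_env 2 (fun _ => rfl) ⟨e, fun w => w.t_le⟩

theorem ncomp_N : (Γ₀).NComp fun w => w.N :=
  (small.read ((Γ₀).comp_const 0)).congr fun w => by
    have h : SAT.cellsOf (SAT.encode w.φ) ((0 : ℕ) : ℤ) = w.N := by
      rw [SAT.cellsOf_natCast]; rfl
    exact h.symm

theorem ncomp_M : (Γ₀).NComp fun w => w.φ.length :=
  (small.read ((Γ₀).comp_const 1)).congr fun w => by
    have h : SAT.cellsOf (SAT.encode w.φ) ((1 : ℕ) : ℤ) = w.φ.length := by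
      rw [SAT.cellsOf_natCast]; rfl
    exact h.symm

theorem ncomp_size : (Γ₀).NComp fun w => P.size w.N w.φ.length :=
  (ncomp_N.add ncomp_M).add ((Γ₀).ncomp_const P.K)

theorem ncomp_low : (Γ₀).NComp fun w => P.low w.N := ncomp_N.div ((Γ₀).ncomp_const P.D)

theorem poly_of_le_N {q : Sit P k e → ℕ} (h : ∀ w, q w ≤ w.N) : Poly (Γ₀).n q :=
  poly_of_le (Γ₀).poly_n fun w => (h w).trans (by simp only [sitCtx, Par.size]; omega)

theorem poly_low : Poly (Γ₀).n fun w => P.low w.N := poly_of_le_N fun _ => Nat.div_le_self _ _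

theorem ncomp_blocks : (Γ₀).NComp fun w => P.blocks w.N w.φ.length :=
  (((Γ₀).ncomp_const 2).pow ncomp_low poly_low).mul
    (ncomp_size.pow ((Γ₀).ncomp_const P.E) ((Γ₀).poly_const _))

theorem ncomp_batch : (Γ₀).NComp fun w => P.batch w.N w.φ.length w.c :=
  have hR := (Γ₀).ncomp_const P.R
  NComp.min ((hR.add (ncomp_c.mod hR)).mul (((Γ₀).ncomp_const 2).pow (ncomp_c.div hR)
    (poly_of_le (poly_pow (Γ₀).poly_n 2) fun w => (Nat.div_le_self _ _).trans w.c_le)))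
    (ncomp_blocks.pow ((Γ₀).ncomp_const P.G) ((Γ₀).poly_const _))

theorem ncomp_queries : (Γ₀).NComp fun w => P.queries w.N w.φ.length w.c :=
  ((((Γ₀).ncomp_const 2).pow (ncomp_N.sub ncomp_low) (poly_of_le_N fun _ => Nat.sub_le _ _)).div
    ncomp_batch).succ

theorem ncomp_budget : (Γ₀).NComp fun w => P.budget w.N w.φ.length :=
  (ncomp_size.pow ((Γ₀).ncomp_const P.b) ((Γ₀).poly_const _)).mul
    (((Γ₀).ncomp_const 2).pow (ncomp_N.sub (ncomp_low.div ((Γ₀).ncomp_const P.D₂)))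
      (poly_of_le_N fun _ => Nat.sub_le _ _))

theorem ncomp_trials : (Γ₀).NComp fun w => P.trials w.N w.φ.length w.c :=
  ncomp_batch.mul (((Γ₀).ncomp_const 2).pow ncomp_low poly_low)

theorem ncomp_dim : (Γ₀).NComp fun w => w.φ.length + 1 := ncomp_M.succ

/-- Entries are computed one at a time from the formula. The graph is exponentially large, but each
of its bits only asks whether one clause is free under one low assignment. -/
theorem comp_graph : (Γ₀).Comp fun w => graphEntry (w.φ.length + 1) (P.blocks w.N w.φ.length)
    (lowBits (SAT.cellsOf (SAT.encode w.φ)) w.φ.length (P.low w.N)) w.t := by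
  refine comp_graphEntry ncomp_dim ncomp_blocks ncomp_t fun v hv => ?_
  have h2 := (Γ₀).ncomp_const 2
  have hd := (((Γ₀).ncomp_const 3).mul (ncomp_dim (P := P) (e := e) (hK := hK))).add ((Γ₀).ncomp_const 3)
  have hc := ((hv.div h2).mod hd).sub (ncomp_dim.succ)
  refine ((hc.lt ncomp_M).and (small.dec_free hc ?_ ((hv.div h2).div hd) ((Γ₀).ncomp_const 0)
    ncomp_low)).congr fun w => ?_
  · refine poly_of_le (poly_mul ((Γ₀).poly_const 6) (Γ₀).poly_n) fun w => ?_
    have := Nat.mod_lt (v w / 2) (show 0 < 3 * (w.φ.length + 1) + 3 by omega)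
    simp only [sitCtx, Par.size]
    omega
  · simp only [lowBits, decide_eq_true_eq]
    rfl

theorem comp_traj : (Γ₀).Comp fun w => trajEntry (w.φ.length + 1) (P.blocks w.N w.φ.length)
    (P.batch w.N w.φ.length w.c) (highBits (SAT.cellsOf (SAT.encode w.φ)) w.φ.length (P.low w.N) w.N
      (w.j * P.batch w.N w.φ.length w.c)) w.t := by
  refine comp_trajEntry ncomp_dim ncomp_blocks ncomp_batch ncomp_t fun v hv => ?_
  have h2 := (Γ₀).ncomp_const 2
  have hd := h2.mul (ncomp_dim (P := P) (e := e) (hK := hK))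
  have hu := (hv.div h2).sub ((Γ₀).ncomp_const 1)
  have hc := (hu.mod hd).sub ncomp_dim
  refine ((hc.lt ncomp_M).and (small.dec_free hc ?_ ((ncomp_j.mul ncomp_batch).add (hu.div hd))
    ncomp_low ncomp_N)).congr fun w => ?_
  · refine poly_of_le (poly_mul ((Γ₀).poly_const 6) (Γ₀).poly_n) fun w => ?_
    have := Nat.mod_lt (v w / 2 - 1) (show 0 < 2 * (w.φ.length + 1) by omega)
    simp only [sitCtx, Par.size]
    omega
  · simp only [highBits, decide_eq_true_eq]
    rfl

theorem ncomp_threshold : (Γ₀).NComp fun w =>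
    3 * scale (w.φ.length + 1) (P.blocks w.N w.φ.length) :=
  ((Γ₀).ncomp_const 3).mul (ncomp_scale ncomp_dim ncomp_blocks)

theorem dec_check : (Γ₀).Dec fun w => ∀ c < w.φ.length,
    ¬ SAT.Free (SAT.cellsOf (SAT.encode w.φ)) c
      (w.j * P.trials w.N w.φ.length w.c + w.t) 0 w.N := by
  have hM : Poly (Γ₀).n fun w => w.φ.length :=
    poly_of_le (Γ₀).poly_n fun w => by simp only [sitCtx, Par.size]; omega
  refine dec_ball ncomp_M hM fun a => Dec.not ?_
  exact small.inside.dec_free (comp_index hM) (poly_of_le (poly_inside hM) fun w => w.2.2.le)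
    ((ncomp_j.mul ncomp_trials).add ncomp_t).inside (comp_const _ 0) ncomp_N.inside

theorem ncomp_modulus : (Γ₀).NComp fun w => P.size w.N w.φ.length ^ 2 :=
  ncomp_size.pow ((Γ₀).ncomp_const 2) ((Γ₀).poly_const _)

theorem ncomp_address : (Γ₀).NComp fun w => w.t * P.size w.N w.φ.length ^ 2 + w.c :=
  (ncomp_t.mul ncomp_modulus).add ncomp_c

end Sit

end RAM

/-! ### Counting loops and assignments -/

namespace RAM

/-- For the values of register `i` from `0` to the content of register `q`, which is set by
`cntp`. -/
def forProg (i q f : ℕ) (cntp body : Prog) : Prog :=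
  .seq (.const i 0) (.seq cntp (.seq (.arith .sub f q i) (.loop f (.seq body
    (.seq (.const 31 1) (.seq (.arith .add i i 31) (.arith .sub f q i)))))))

/-- The invariant carries a supply `F` of time from which each round pays for itself and `12 * L`
for the loop control; the bound on the running time then needs no separate induction. The closure
condition `hcl` allows the loop control to change its own registers. -/
theorem loop_rule {i q f cnt L : ℕ} {body : Prog} (hiq : i ≠ q) (hif : i ≠ f) (hqf : q ≠ f)
    (hi : i ≠ 31) (hq : q ≠ 31) (hL : len (cnt : ℤ) ≤ L) {Inv : ℕ → ℕ → State → Prop}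
    (hcl : ∀ k F s s', Inv k F s → s'.mem = s.mem →
      (∀ r, r ≠ i → r ≠ f → r ≠ 31 → s'.reg r = s.reg r) → Inv k F s')
    (hstep : ∀ k F s, k < cnt → Inv k F s → s.reg i = (k : ℤ) → s.reg q = (cnt : ℤ) →
      ∃ s' t F', Runs body s s' t ∧ t + F' + 12 * L ≤ F ∧ s'.reg i = (k : ℤ) ∧
        s'.reg q = (cnt : ℤ) ∧ Inv (k + 1) F' s') (m : ℕ) :
    ∀ k F s, k + m = cnt → Inv k F s → s.reg i = (k : ℤ) → s.reg q = (cnt : ℤ) →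
      s.reg f = (m : ℤ) → ∃ s' t F', Runs (.loop f (.seq body (.seq (.const 31 1)
        (.seq (.arith .add i i 31) (.arith .sub f q i))))) s s' t ∧ t + F' ≤ F + 2 * L ∧
        Inv cnt F' s' ∧ s'.reg i = (cnt : ℤ) ∧ s'.reg q = (cnt : ℤ) := by
  have l0 : len (0 : ℤ) = 1 := by decide
  have l1 : len (1 : ℤ) = 2 := by decide
  have hL1 := (len_pos _).trans hL
  have hle : ∀ x : ℕ, x ≤ cnt → len (x : ℤ) ≤ L := fun x hx =>
    (len_mono (by simpa using hx)).trans hL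
  induction m with
  | zero =>
    intro k F s hk hI h1 h2 h3
    rw [Nat.add_zero] at hk
    subst hk
    refine ⟨s, _, F, Runs.loop_stop (by rw [h3]; simp), ?_, hI, h1, h2⟩
    rw [h3]; simp [l0]; omega
  | succ m ih =>
    intro k F s hk hI h1 h2 h3
    obtain ⟨s₁, t₁, F₁, hr₁, ht₁, g1, g2, hI₁⟩ := hstep k F s (by omega) hI h1 h2
    set tail : Prog := .seq (.const 31 1) (.seq (.arith .add i i 31) (.arith .sub f q i)) with htail
    have hlf : tail.LoopFree := by simp [htail, Prog.LoopFree]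
    have hm : (tail.exec s₁).mem = s₁.mem := rfl
    have hr : ∀ r, r ≠ i → r ≠ f → r ≠ 31 → (tail.exec s₁).reg r = s₁.reg r := by
      intro r a b c
      simp only [htail, Prog.exec, setReg_reg, if_neg a, if_neg b, if_neg c]
    have vi : (tail.exec s₁).reg i = ((k + 1 : ℕ) : ℤ) := by
      simp [htail, Prog.exec, setReg_reg, hif, hi, Op.eval, g1]
    have vf : (tail.exec s₁).reg f = (m : ℤ) := by
      simp [htail, Prog.exec, setReg_reg, hi, hq, hiq.symm, Op.eval, g1, g2]
      omega
    have vq : (tail.exec s₁).reg q = (cnt : ℤ) := by rw [hr q hiq.symm hqf hq, g2]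
    obtain ⟨s', t, F', hr', ht', hI', v1, v2⟩ := ih (k + 1) F₁ (tail.exec s₁) (by omega)
      (hcl _ _ _ _ hI₁ hm hr) vi vq vf
    refine ⟨s', _, F', .loop_step (by rw [h3]; positivity) (.seq hr₁ (hlf.runs s₁)) hr', ?_,
      hI', v1, v2⟩
    have hcost : tail.cost s₁ ≤ 10 * L := by
      have a1 := hle k (by omega)
      have a2 := hle (k + 1) (by omega)
      push_cast at a2
      simp [htail, Prog.cost, Prog.exec, setReg_reg, hi, hq, hiq.symm, Op.eval, g1, g2, l1]
      omega
    have a3 := hle (m + 1) (by omega)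
    rw [h3]
    omega

theorem for_rule {i q f cnt L T : ℕ} {cntp body : Prog} (hiq : i ≠ q) (hif : i ≠ f) (hqf : q ≠ f)
    (hi : i ≠ 31) (hq : q ≠ 31) (hL : len (cnt : ℤ) ≤ L) {Inv : ℕ → ℕ → State → Prop}
    (hcl : ∀ k F s s', Inv k F s → s'.mem = s.mem →
      (∀ r, r ≠ i → r ≠ f → r ≠ 31 → s'.reg r = s.reg r) → Inv k F s')
    (hstep : ∀ k F s, k < cnt → Inv k F s → s.reg i = (k : ℤ) → s.reg q = (cnt : ℤ) →
      ∃ s' t F', Runs body s s' t ∧ t + F' + 12 * L ≤ F ∧ s'.reg i = (k : ℤ) ∧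
        s'.reg q = (cnt : ℤ) ∧ Inv (k + 1) F' s') {F : ℕ} {s s₁ : State} {t₁ : ℕ}
    (hcnt : Runs cntp (s.setReg i 0) s₁ t₁) (ht₁ : t₁ ≤ T) (h0 : Inv 0 F s₁)
    (hi0 : s₁.reg i = 0) (hq0 : s₁.reg q = (cnt : ℤ)) :
    ∃ s' t F', Runs (forProg i q f cntp body) s s' t ∧ t + F' ≤ F + T + 8 * L ∧
        Inv cnt F' s' ∧ s'.reg i = (cnt : ℤ) := by
  have l0 : len (0 : ℤ) = 1 := by decide
  have hL1 := (len_pos _).trans hL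
  obtain ⟨s', t, F', hr, ht, hI, hv, -⟩ := loop_rule hiq hif hqf hi hq hL hcl hstep cnt 0 F
    (s₁.setReg f (Op.sub.eval (s₁.reg q) (s₁.reg i))) (by omega)
    (hcl _ _ _ _ h0 rfl fun r _ h _ => by rw [setReg_reg, if_neg h])
    (by rw [setReg_reg, if_neg hif, hi0]; rfl) (by rw [setReg_reg, if_neg hqf, hq0])
    (by rw [setReg_reg, if_pos rfl, hq0, hi0]; simp [Op.eval])
  refine ⟨s', _, F', .seq (.const s i 0) (.seq hcnt (.seq (.arith s₁ .sub f q i) hr)), ?_, hI, hv⟩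
  rw [hq0, hi0, l0]
  omega

section Kit

variable {P : Par} {k e : ℕ}

/-- The state `s` holds the formula and the numbers of the situation `w`. -/
structure At (w : Sit P k e) (s : State) : Prop where
  mem : s.mem 0 = SAT.cellsOf (SAT.encode w.φ)
  c : s.reg 14 = (w.c : ℤ)
  j : s.reg 15 = (w.j : ℤ)
  t : s.reg 16 = (w.t : ℤ)

/-- The program `p` assigns the value of `f` to register `r` in time `n ^ Z`, and otherwise changes
registers from `50` on only. -/
def Assigns (p : Prog) (r : ℕ) (f : Sit P k e → ℤ) (Z : ℕ) : Prop :=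
  ∀ w, len (f w) ≤ P.size w.N w.φ.length ^ Z ∧ ∀ s, At w s → ∃ s' t, Runs p s s' t ∧
    t ≤ P.size w.N w.φ.length ^ Z ∧ s'.mem = s.mem ∧ s'.reg r = f w ∧ ∀ r' < 50, r' ≠ r → s'.reg r' = s.reg r'

theorem Assigns.mono {p : Prog} {r Z Z' : ℕ} {f : Sit P k e → ℤ} (h : Assigns p r f Z) (hZ : Z ≤ Z')
    (hK : k + 2 ≤ P.K) : Assigns p r f Z' := by
  intro w
  have hle := Nat.pow_le_pow_right (show 0 < P.size w.N w.φ.length by unfold Par.size; omega) hZ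
  refine ⟨(h w).1.trans hle, fun s hw => ?_⟩
  obtain ⟨s', t, h1, h2, h3⟩ := (h w).2 s hw
  exact ⟨s', t, h1, h2.trans hle, h3⟩

/-- The program works on registers from `50` on and finally moves its result to `r` by adding zero.
So the programs of the reduction can be composed freely below `50`. -/
theorem Ctx.Comp.exists_assigns {hK : k + 2 ≤ P.K} {f : Sit P k e → ℤ}
    (hf : (sitCtx P k e hK).Comp f) (r : ℕ) (_ : r < 50) : ∃ p Z, Assigns p r f Z := by
  obtain ⟨p, T, hT, hp⟩ := hf.exists_prog [14, 15, 16] 50 (by simp)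
  have l0 : len (0 : ℤ) = 1 := by decide
  obtain ⟨Z, hZ⟩ := Ctx.poly_add hT (Ctx.poly_add ((sitCtx P k e hK).poly_const 10) hf.poly)
  refine ⟨.seq p (.seq (.const 51 0) (.arith .add r 50 51)), Z, fun w => ⟨?_, fun s hw => ?_⟩⟩
  · refine le_trans ?_ (hZ w)
    change len (f w) ≤ T w + (10 + len (f w))
    omega
  obtain ⟨s₁, t₁, hr₁, ht₁, hm₁, hk₁, hv₁⟩ := hp w s
    (by simp [sitCtx, hw.c, hw.j, hw.t]) hw.mem
  refine ⟨_, _, .seq hr₁ (.seq (.const _ _ _) (.arith _ .add r 50 51)), ?_, hm₁, ?_, ?_⟩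
  · refine le_trans ?_ (hZ w)
    simp only [setReg_reg]
    simp only [Nat.reduceEqDiff, if_false, if_true, hv₁, l0]
    omega
  · simp [setReg_reg, hv₁, Op.eval]
  · intro r' h1 h2
    rw [setReg_reg, if_neg h2, setReg_reg, if_neg (by omega), hk₁ r' h1]

open MapMatching in
/-- Programs for the numbers that the reduction needs. -/
structure Kit (P : Par) (k e : ℕ) where
  Z : ℕ
  modulus : Prog
  modulus_spec : Assigns (P := P) (k := k) (e := e) modulus 1
    (fun w => ((P.size w.N w.φ.length ^ 2 : ℕ) : ℤ)) Z
  residue : Prog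
  residue_spec : Assigns (P := P) (k := k) (e := e) residue 2 (fun w => (w.c : ℤ)) Z
  clock : Prog
  clock_spec : Assigns (P := P) (k := k) (e := e) clock 0
    (fun w => (P.budget w.N w.φ.length : ℤ)) Z
  threshold : Prog
  threshold_spec : Assigns (P := P) (k := k) (e := e) threshold 13
    (fun w => ((3 * scale (w.φ.length + 1) (P.blocks w.N w.φ.length) : ℕ) : ℤ)) Z
  graphCnt : Prog
  graphCnt_spec : Assigns (P := P) (k := k) (e := e) graphCnt 26
    (fun w => (graphLen (w.φ.length + 1) (P.blocks w.N w.φ.length) : ℤ)) Z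
  trajCnt : Prog
  trajCnt_spec : Assigns (P := P) (k := k) (e := e) trajCnt 26
    (fun w => (trajLen (w.φ.length + 1) (P.batch w.N w.φ.length w.c) : ℤ)) Z
  trialCnt : Prog
  trialCnt_spec : Assigns (P := P) (k := k) (e := e) trialCnt 26
    (fun w => (P.trials w.N w.φ.length w.c : ℤ)) Z
  queryCnt : Prog
  queryCnt_spec : Assigns (P := P) (k := k) (e := e) queryCnt 25
    (fun w => (P.queries w.N w.φ.length w.c : ℤ)) Z
  candCnt : Prog
  candCnt_spec : Assigns (P := P) (k := k) (e := e) candCnt 24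
    (fun w => ((P.size w.N w.φ.length ^ 2 : ℕ) : ℤ)) Z
  graphVal : Prog
  graphVal_spec : Assigns (P := P) (k := k) (e := e) graphVal 20
    (fun w => graphEntry (w.φ.length + 1) (P.blocks w.N w.φ.length)
      (lowBits (SAT.cellsOf (SAT.encode w.φ)) w.φ.length (P.low w.N)) w.t) Z
  trajVal : Prog
  trajVal_spec : Assigns (P := P) (k := k) (e := e) trajVal 20
    (fun w => trajEntry (w.φ.length + 1) (P.blocks w.N w.φ.length)
      (P.batch w.N w.φ.length w.c) (highBits (SAT.cellsOf (SAT.encode w.φ)) w.φ.length (P.low w.N)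
        w.N (w.j * P.batch w.N w.φ.length w.c)) w.t) Z
  addr : Prog
  addr_spec : Assigns (P := P) (k := k) (e := e) addr 21
    (fun w => ((w.t * P.size w.N w.φ.length ^ 2 + w.c : ℕ) : ℤ)) Z
  test : Sit P k e → ℤ
  test_pos : ∀ w, 0 < test w ↔ ∀ c < w.φ.length, ¬ SAT.Free (SAT.cellsOf (SAT.encode w.φ)) c
      (w.j * P.trials w.N w.φ.length w.c + w.t) 0 w.N
  check : Prog
  check_spec : Assigns (P := P) (k := k) (e := e) check 20 test Z

theorem exists_kit (P : Par) (k e : ℕ) (hK : k + 2 ≤ P.K) : Nonempty (Kit P k e) := by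
  obtain ⟨test, htest, hpos⟩ := Sit.dec_check (P := P) (k := k) (e := e) (hK := hK)
  obtain ⟨p1, Z1, h1⟩ := (Sit.ncomp_modulus (hK := hK)).exists_assigns 1 (by simp)
  obtain ⟨p2, Z2, h2⟩ := (Sit.ncomp_c (hK := hK)).exists_assigns 2 (by simp)
  obtain ⟨p3, Z3, h3⟩ := (Sit.ncomp_budget (hK := hK)).exists_assigns 0 (by simp)
  obtain ⟨p4, Z4, h4⟩ := (Sit.ncomp_threshold (hK := hK)).exists_assigns 13 (by simp)
  obtain ⟨p5, Z5, h5⟩ := (Ctx.ncomp_graphLen (Sit.ncomp_dim (hK := hK))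
    Sit.ncomp_blocks).exists_assigns 26 (by simp)
  obtain ⟨p6, Z6, h6⟩ := (Ctx.ncomp_trajLen (Sit.ncomp_dim (hK := hK))
    Sit.ncomp_batch).exists_assigns 26 (by simp)
  obtain ⟨p7, Z7, h7⟩ := (Sit.ncomp_trials (hK := hK)).exists_assigns 26 (by simp)
  obtain ⟨p8, Z8, h8⟩ := (Sit.ncomp_queries (hK := hK)).exists_assigns 25 (by simp)
  obtain ⟨p9, Z9, h9⟩ := (Sit.ncomp_modulus (hK := hK)).exists_assigns 24 (by simp)
  obtain ⟨p10, Z10, h10⟩ := (Sit.comp_graph (hK := hK)).exists_assigns 20 (by simp)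
  obtain ⟨p11, Z11, h11⟩ := (Sit.comp_traj (hK := hK)).exists_assigns 20 (by simp)
  obtain ⟨p12, Z12, h12⟩ := (Sit.ncomp_address (hK := hK)).exists_assigns 21 (by simp)
  obtain ⟨p13, Z13, h13⟩ := htest.exists_assigns 20 (by simp)
  exact ⟨{
    Z := Z1 + Z2 + Z3 + Z4 + Z5 + Z6 + Z7 + Z8 + Z9 + Z10 + Z11 + Z12 + Z13
    modulus := p1, modulus_spec := h1.mono (by omega) hK
    residue := p2, residue_spec := h2.mono (by omega) hK
    clock := p3, clock_spec := h3.mono (by omega) hK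
    threshold := p4, threshold_spec := h4.mono (by omega) hK
    graphCnt := p5, graphCnt_spec := h5.mono (by omega) hK
    trajCnt := p6, trajCnt_spec := h6.mono (by omega) hK
    trialCnt := p7, trialCnt_spec := h7.mono (by omega) hK
    queryCnt := p8, queryCnt_spec := h8.mono (by omega) hK
    candCnt := p9, candCnt_spec := h9.mono (by omega) hK
    graphVal := p10, graphVal_spec := h10.mono (by omega) hK
    trajVal := p11, trajVal_spec := h11.mono (by omega) hK
    addr := p12, addr_spec := h12.mono (by omega) hK
    test := test, test_pos := hpos
    check := p13, check_spec := h13.mono (by omega) hK }⟩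

end Kit

end RAM

/-! ### Writing encodings into the simulated memory -/

namespace RAM

/-- Write the values computed by `val` into array `a`. -/
def writeProg (a : ℕ) (cntp val addr : Prog) : Prog :=
  forProg 16 26 29 cntp (.seq val (.seq addr (.store a 21 20)))

/-- The cells `0, …, cnt - 1` of array `a` in the part of the memory with remainder `c` modulo `C`
get the values `v`. -/
structure Written (a : ℕ) (C c : ℤ) (cnt : ℕ) (v : ℕ → ℤ) (h h' : State) : Prop where
  new : ∀ t < cnt, h'.mem a (t * C + c) = v t
  old : ∀ a' i, (a' ≠ a ∨ ∀ t < cnt, i ≠ t * C + c) → h'.mem a' i = h.mem a' i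

theorem Written.zero (a : ℕ) (C c : ℤ) (v : ℕ → ℤ) {h h' : State} (hm : h'.mem = h.mem) :
    Written a C c 0 v h h' :=
  ⟨fun t ht => by omega, fun a' i _ => by rw [hm]⟩

theorem Written.succ {a : ℕ} {C c : ℤ} {k : ℕ} {v : ℕ → ℤ} {h h' h'' : State}
    (hw : Written a C c k v h h') (hC : 0 < C)
    (hm : h''.mem = (h'.setMem a (k * C + c) (v k)).mem) : Written a C c (k + 1) v h h'' := by
  have hinj : ∀ t : ℕ, (t : ℤ) * C + c = k * C + c ↔ t = k := by
    intro t
    constructor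
    · intro h
      have := mul_right_cancel₀ hC.ne' (add_right_cancel h)
      exact_mod_cast this
    · rintro rfl; rfl
  refine ⟨fun t ht => ?_, fun a' i hi => ?_⟩
  · rw [hm, setMem_mem]
    simp only [hinj, true_and]
    split_ifs with h1
    · rw [h1]
    · exact hw.new t (by omega)
  · rw [hm, setMem_mem, if_neg, hw.old a' i (hi.imp id fun h t ht => h t (by omega))]
    rintro ⟨rfl, rfl⟩
    rcases hi with hi | hi
    · exact hi rfl
    · exact hi k (by omega) rfl

/-- The input of a simulated program is written from outside without charging the clock; its entries
only have to fit beside the clock. -/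
theorem SimInv.written {Z B ℓ a cnt : ℕ} {C c : ℤ} {v : ℕ → ℤ} {h h' : State}
    (hi : SimInv Z B ℓ h) (hw : Written a C c cnt v h h') (hC : h.reg 1 = C) (hc : h.reg 2 = c)
    (hr : ∀ r, r ≤ 2 → h'.reg r = h.reg r) (hv : ∀ t < cnt, len (v t) + (h.reg 0).toNat ≤ B) :
    SimInv Z B ℓ h' := by
  subst hC hc
  have r0 := hr 0 (by simp)
  have r1 := hr 1 (by simp)
  have r2 := hr 2 (by simp)
  refine ⟨?_, ?_, ?_, ?_, ?_, ?_, fun a' i => ?_, hi.pow⟩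
  · rw [r2]; exact hi.nonneg
  · rw [r1, r2]; exact hi.lt
  · rw [r1]; exact hi.len_one
  · rw [r2]; exact hi.len_two
  · rw [r0]; exact hi.len_zero
  · rw [r0]; exact hi.const_le
  · rw [r0, r1, r2]
    by_cases hcell : a' + 1 = a ∧ ∃ t < cnt, i * h.reg 1 + h.reg 2 = t * h.reg 1 + h.reg 2
    · obtain ⟨rfl, t, ht, he⟩ := hcell
      rw [he, hw.new t ht]
      exact hv t ht
    · rw [hw.old]
      · exact hi.cell_le a' i
      · by_contra hcon
        push Not at hcon
        exact hcell ⟨hcon.1, hcon.2⟩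

/-- Cell `t` of a simulated array sits at address `t * C + c`, so writing the entries there has the
effect of `State.write` on the copy. -/
theorem Rel.written {a : ℕ} {C c : ℤ} {v : ℕ → ℤ} {l : List ℤ} {h h' s : State}
    (hrel : Rel h s) (hw : Written (a + 2) C c l.length v h h') (hC : h.reg 1 = C)
    (hc : h.reg 2 = c) (h0 : 0 ≤ c) (hlt : c < C) (r1 : h'.reg 1 = h.reg 1)
    (r2 : h'.reg 2 = h.reg 2) (hv : ∀ t < l.length, v t = l.getD t 0) :
    Rel h' (s.write a l) := by
  subst hC hc
  refine ⟨fun r => ?_, fun a' i => ?_⟩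
  · rw [r1, r2, hw.old _ _ (Or.inl (by omega))]
    exact hrel.1 r
  · rw [r1, r2]
    simp only [State.write]
    split_ifs with hcell
    · obtain ⟨rfl, hi0, hil⟩ := hcell
      obtain ⟨t, rfl⟩ := Int.eq_ofNat_of_zero_le hi0
      have ht : t < l.length := by exact_mod_cast hil
      rw [hw.new t ht, hv t ht]
      rfl
    · rw [hw.old]
      · exact hrel.2 a' i
      · by_contra hcon
        push Not at hcon
        obtain ⟨ha, t, ht, he⟩ := hcon
        rw [address_inj h0 hlt] at he
        exact hcell ⟨by omega, by omega, by omega⟩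

theorem Frame.written {a : ℕ} {C c : ℤ} {cnt : ℕ} {v : ℕ → ℤ} {h h' : State}
    (hw : Written (a + 1) C c cnt v h h') (h0 : 0 ≤ c) (hlt : c < C) :
    h'.mem 0 = h.mem 0 ∧ ∀ a' i, i % C ≠ c → h'.mem a' i = h.mem a' i := by
  refine ⟨funext fun i => hw.old 0 i (Or.inl (by omega)), fun a' i hi => hw.old a' i (Or.inr ?_)⟩
  rintro t - rfl
  exact hi (address_emod h0 hlt)

variable {P : Par} {k e : ℕ}

theorem write_run {Z a N c j cnt : ℕ} {φ : SAT.CNF N} {hφ : ∀ cl ∈ φ, cl.length ≤ k}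
    (hc : c ≤ P.size N φ.length ^ 2) (hj : len j ≤ P.size N φ.length ^ e)
    (hcnt : len cnt ≤ P.size N φ.length ^ e) (hn : 2 ≤ P.size N φ.length)
    {cntp val addr : Prog} {cntF vF : Sit P k e → ℤ} (hcp : Assigns cntp 26 cntF Z)
    (hvp : Assigns val 20 vF Z) (hap : Assigns (P := P) (k := k) (e := e) addr 21
      (fun w => ((w.t * P.size w.N w.φ.length ^ 2 + w.c : ℕ) : ℤ)) Z)
    (hcF : ∀ t ht, cntF ⟨N, φ, hφ, c, j, t, hc, hj, ht⟩ = cnt)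
    {v : ℕ → ℤ} (hvF : ∀ t ht, vF ⟨N, φ, hφ, c, j, t, hc, hj, ht⟩ = v t)
    {s : State} (hm : s.mem 0 = SAT.cellsOf (SAT.encode φ)) (h14 : s.reg 14 = c)
    (h15 : s.reg 15 = j) :
    ∃ s' t, Runs (writeProg (a + 1) cntp val addr) s s' t ∧
      t ≤ (cnt + 1) * (6 * P.size N φ.length ^ Z + 12 * P.size N φ.length ^ e) ∧
      Written (a + 1) ((P.size N φ.length ^ 2 : ℕ) : ℤ) c cnt v s s' ∧
      ∀ r < 50, r ∉ [16, 20, 21, 26, 29, 31] → s'.reg r = s.reg r := by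
  set n := P.size N φ.length with hndef
  have hC : (0 : ℤ) < ((n ^ 2 : ℕ) : ℤ) := by positivity
  have hZ1 : 1 ≤ n ^ Z := Nat.one_le_pow _ _ (by omega)
  have hlenc : ∀ t ≤ cnt, len (t : ℤ) ≤ n ^ e := fun t ht =>
    (len_mono (by simpa using ht)).trans hcnt
  set X := 6 * n ^ Z + 12 * n ^ e with hX
  have h0len : len ((0 : ℕ) : ℤ) ≤ n ^ e := hlenc 0 (Nat.zero_le _)
  obtain ⟨s₁, t₁, hr₁, ht₁, hm₁, hv₁, hk₁⟩ :=
    (hcp ⟨N, φ, hφ, c, j, 0, hc, hj, h0len⟩).2 (s.setReg 16 0)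
      ⟨hm, h14, h15, rfl⟩
  rw [hcF] at hv₁
  -- The supply after `m` entries is `X` for each of the remaining ones; `X` covers computing the
  -- entry, computing its address, storing and loop control.
  obtain ⟨s', t, F', hr, ht, ⟨hF, hw, hreg⟩, -⟩ := for_rule (i := 16) (q := 26) (f := 29)
    (L := n ^ e) (T := n ^ Z) (cnt := cnt) (F := cnt * X) (s := s) (cntp := cntp)
    (body := .seq val (.seq addr (.store (a + 1) 21 20)))
    (Inv := fun m F s' => F = (cnt - m) * X ∧ Written (a + 1) ((n ^ 2 : ℕ) : ℤ) c m v s s' ∧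
      ∀ r < 50, r ∉ [16, 20, 21, 26, 29, 31] → s'.reg r = s.reg r)
    (by simp) (by simp) (by simp) (by simp) (by simp) hcnt
    (by
      rintro m F s₁ s₂ ⟨h1, h2, h3⟩ hm' hr'
      refine ⟨h1, ⟨fun t ht => by rw [hm']; exact h2.new t ht,
        fun a' i hi => by rw [hm']; exact h2.old a' i hi⟩, fun r hr hne => ?_⟩
      simp only [List.mem_cons, List.not_mem_nil, or_false, not_or] at hne
      rw [hr' r hne.1 hne.2.2.2.2.1 hne.2.2.2.2.2]
      exact h3 r hr (by simp; tauto))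
    (by
      rintro m F s₁ hmlt ⟨h1, h2, h3⟩ hs16 hs26
      have hms : s₁.mem 0 = SAT.cellsOf (SAT.encode φ) := by
        rw [← hm]; funext i; exact h2.old 0 i (Or.inl (by omega))
      have htm := hlenc m hmlt.le
      obtain ⟨hlv, hval⟩ := hvp ⟨N, φ, hφ, c, j, m, hc, hj, htm⟩
      obtain ⟨hla, haddr⟩ := hap ⟨N, φ, hφ, c, j, m, hc, hj, htm⟩
      rw [hvF] at hlv
      obtain ⟨s₂, t₂, hr₂, ht₂, hm₂, hv₂, hk₂⟩ := hval s₁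
        ⟨hms, by rw [h3 14 (by simp) (by simp), h14], by rw [h3 15 (by simp) (by simp), h15], hs16⟩
      rw [hvF] at hv₂
      obtain ⟨s₃, t₃, hr₃, ht₃, hm₃, hv₃, hk₃⟩ := haddr s₂
        ⟨by rw [hm₂, hms], by rw [hk₂ 14 (by simp) (by simp), h3 14 (by simp) (by simp), h14],
          by rw [hk₂ 15 (by simp) (by simp), h3 15 (by simp) (by simp), h15],
          by rw [hk₂ 16 (by simp) (by simp), hs16]⟩
      have h20 : s₃.reg 20 = v m := by rw [hk₃ 20 (by simp) (by simp), hv₂]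
      refine ⟨_, _, (cnt - (m + 1)) * X, .seq hr₂ (.seq hr₃ (.store s₃ (a + 1) 21 20)), ?_, ?_, ?_,
        rfl, h2.succ hC ?_, fun r hr hne => ?_⟩
      · have e1 : (cnt - m) * X = (cnt - (m + 1)) * X + X := by
          rw [show cnt - m = cnt - (m + 1) + 1 by omega, Nat.succ_mul]
        rw [h1, e1, h20, hv₃]
        dsimp only at hla hlv ht₂ ht₃ ⊢
        rw [← hndef] at hla hlv ht₂ ht₃ ⊢
        omega
      · rw [setMem_reg, hk₃ 16 (by simp) (by simp), hk₂ 16 (by simp) (by simp), hs16]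
      · rw [setMem_reg, hk₃ 26 (by simp) (by simp), hk₂ 26 (by simp) (by simp), hs26]
      · rw [h20, hv₃]
        simp only [State.setMem, hm₃, hm₂]
        push_cast
        rfl
      · simp only [List.mem_cons, List.not_mem_nil, or_false, not_or] at hne
        rw [setMem_reg, hk₃ r hr hne.2.2.1, hk₂ r hr hne.2.1, h3 r hr (by simp; tauto)])
    hr₁ ht₁ ⟨by simp, Written.zero _ _ _ _ hm₁, fun r hr hne => by
      simp only [List.mem_cons, List.not_mem_nil, or_false, not_or] at hne
      rw [hk₁ r hr hne.2.2.2.1, setReg_reg, if_neg hne.1]⟩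
    (by rw [hk₁ 16 (by simp) (by simp), setReg_reg, if_pos rfl]) hv₁
  refine ⟨s', t, hr, ?_, hw, hreg⟩
  have : (cnt + 1) * X = cnt * X + X := Nat.succ_mul _ _
  omega

end RAM

/-! ### Running the data structure on the trajectories of a candidate -/

namespace RAM

open MapMatching

/-- Registers `1`, `2` and `13` to `49` with the exception of those in `X` are kept, and so are
array `0` and the cells that do not belong to the simulated memory. -/
structure Keeps (X : List ℕ) (h h' : State) : Prop where
  reg : ∀ r, r = 1 ∨ r = 2 ∨ 13 ≤ r ∧ r < 50 → r ∉ X → h'.reg r = h.reg r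
  mem_zero : h'.mem 0 = h.mem 0
  mem : ∀ a i, i % h.reg 1 ≠ h.reg 2 → h'.mem a i = h.mem a i

/-- Registers `1` and `2` must not be in the list of exceptions, since they determine which residue
class is protected. -/
theorem Keeps.trans {X Y Z : List ℕ} {h h' h'' : State} (f : Keeps X h h') (g : Keeps Y h' h'')
    (hX : X ⊆ Z) (hY : Y ⊆ Z) (h1 : 1 ∉ Z) (h2 : 2 ∉ Z) : Keeps Z h h'' where
  reg r hr hn := (g.reg r hr fun hy => hn (hY hy)).trans (f.reg r hr fun hx => hn (hX hx))
  mem_zero := g.mem_zero.trans f.mem_zero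
  mem a i hi := by
    rw [g.mem a i, f.mem a i hi]
    rwa [f.reg 1 (by simp) fun h => h1 (hX h), f.reg 2 (by simp) fun h => h2 (hX h)]

theorem Frame.keeps {h h' : State} (f : Frame h h') : Keeps [] h h' :=
  ⟨fun r hr _ => f.reg r (by omega), f.mem_zero, f.mem⟩

theorem Keeps.of_mem {X : List ℕ} {h h' : State} (hm : h'.mem = h.mem)
    (hr : ∀ r, r < 50 → r ∉ X → h'.reg r = h.reg r) : Keeps X h h' :=
  ⟨fun r hr' hn => hr r (by omega) hn, by rw [hm], fun a i _ => by rw [hm]⟩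

theorem Keeps.refl (h : State) : Keeps [] h h := .of_mem rfl fun _ _ _ => rfl

theorem Keeps.mono {X Y : List ℕ} {h h' : State} (f : Keeps X h h') (hX : X ⊆ Y) : Keeps Y h h' :=
  ⟨fun r hr hn => f.reg r hr fun hx => hn (hX hx), f.mem_zero, f.mem⟩

/-- A common constant for the simulations of `prep` and `query` and for comparisons. -/
structure SimConst (prep query : Prog) (K : ℕ) : Prop where
  prep : ∀ Z B ℓ h, K ≤ Z → SimInv Z B ℓ h →
    ∃ h' t, Runs (sim prep) h h' t ∧ SimOut prep K Z B ℓ h h' t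
  query : ∀ Z B ℓ h, K ≤ Z → SimInv Z B ℓ h →
    ∃ h' t, Runs (sim query) h h' t ∧ SimOut query K Z B ℓ h h' t
  compare : ∀ Z B ℓ h, K ≤ Z → SimInv Z B ℓ h → len (h.reg 13) ≤ ℓ + 1 → ∃ h' t,
    Runs compare h h' t ∧ SimInv Z B ℓ h' ∧ Frame h h' ∧ pot B h' ≤ pot B h ∧
      t + K * (ℓ + 1) * pot B h' ≤ K * (ℓ + 1) * (pot B h + 1) ∧
      (h'.reg 12 = 0 ∨ h'.reg 12 = 1) ∧ h'.reg 3 = h.reg 3 ∧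
      ∀ s, Rel h s → 4 * (len (s.reg 0) + len (s.reg 1) : ℤ) < h.reg 0 → Rel h' s ∧
        h.reg 0 ≤ h'.reg 0 + 4 * (len (s.reg 0) + len (s.reg 1)) ∧
        (h'.reg 12 = 1 ↔ s.reg 0 < s.reg 1 * h.reg 13)

theorem exists_simConst (prep query : Prog) : ∃ K, SimConst prep query K := by
  obtain ⟨K₁, h₁⟩ := simulates prep
  obtain ⟨K₂, h₂⟩ := simulates query
  obtain ⟨K₃, h₃⟩ := compare_spec
  refine ⟨K₁ + K₂ + K₃, ⟨fun Z B ℓ h hZ hi => ?_, fun Z B ℓ h hZ hi => ?_,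
    fun Z B ℓ h hZ hi hl => ?_⟩⟩
  · obtain ⟨h', t, hr, ho⟩ := h₁ Z B ℓ h (by omega) hi
    exact ⟨h', t, hr, ho.mono (by omega)⟩
  · obtain ⟨h', t, hr, ho⟩ := h₂ Z B ℓ h (by omega) hi
    exact ⟨h', t, hr, ho.mono (by omega)⟩
  · obtain ⟨h', t, hr, a1, a2, a3, a4, a5⟩ := h₃ Z B ℓ h (by omega) hi hl
    exact ⟨h', t, hr, a1, a2, a3, time_mono (by omega) a3 a4, a5⟩

/-- Set register `17` to the result of the comparison, and register `3` to `0`. -/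
def recordProg : Prog :=
  .seq compare (.seq (.const 20 0) (.seq (.arith .add 17 12 20) (.const 3 0)))

/-- Register `17` remembers the result of the comparison beyond the next query, and clearing
register `3` makes the flag refer to that query alone. -/
theorem record_run {prep query : Prog} {K Z B ℓ : ℕ} {h : State} (hK : SimConst prep query K)
    (hZ : K ≤ Z) (hi : SimInv Z B ℓ h) (hl : len (h.reg 13) ≤ ℓ + 1) : ∃ h' t,
    Runs recordProg h h' t ∧ SimInv Z B ℓ h' ∧ Keeps [17, 20] h h' ∧ pot B h' ≤ pot B h ∧
      t + K * (ℓ + 1) * pot B h' ≤ K * (ℓ + 1) * (pot B h + 1) + 20 ∧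
      (h'.reg 17 = 0 ∨ h'.reg 17 = 1) ∧ h'.reg 3 = 0 ∧
      ∀ s, Rel h s → 4 * (len (s.reg 0) + len (s.reg 1) : ℤ) < h.reg 0 → Rel h' s ∧
        h.reg 0 ≤ h'.reg 0 + 4 * (len (s.reg 0) + len (s.reg 1)) ∧
        (h'.reg 17 = 1 ↔ s.reg 0 < s.reg 1 * h.reg 13) := by
  obtain ⟨h₁, t₁, hr₁, hi₁, hf₁, hp₁, ht₁, h12, h3, hs₁⟩ := hK.compare Z B ℓ h hZ hi hl
  set tail : Prog := .seq (.const 20 0) (.seq (.arith .add 17 12 20) (.const 3 0)) with htail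
  have hlf : tail.LoopFree := by simp [htail, Prog.LoopFree]
  have hm : (tail.exec h₁).mem = h₁.mem := rfl
  have hreg : ∀ r, r ≠ 3 → r ≠ 17 → r ≠ 20 → (tail.exec h₁).reg r = h₁.reg r := by
    intro r a b c
    simp only [htail, Prog.exec, setReg_reg, if_neg a, if_neg b, if_neg c]
  have e17 : (tail.exec h₁).reg 17 = h₁.reg 12 := by
    simp [htail, Prog.exec, setReg_reg, Op.eval]
  have e3 : (tail.exec h₁).reg 3 = 0 := by simp [htail, Prog.exec, setReg_reg]
  have hp : pot B (tail.exec h₁) = pot B h₁ := by unfold pot; rw [hreg 0 (by simp) (by simp) (by simp)]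
  have hcost : tail.cost h₁ ≤ 20 := by
    have l0 : len (0 : ℤ) = 1 := by decide
    have l1 : len (1 : ℤ) = 2 := by decide
    have : len (h₁.reg 12) ≤ 2 := by rcases h12 with h | h <;> rw [h] <;> omega
    simp [htail, Prog.cost, Prog.exec, setReg_reg, l0]
    omega
  have hf : Frame h h₁ := hf₁
  have hk : Keeps [17, 20] h (tail.exec h₁) := by
    refine ⟨fun r hr hn => ?_, by rw [hm]; exact hf.mem_zero,
      fun a i hi => by rw [hm]; exact hf.mem a i hi⟩
    simp only [List.mem_cons, List.not_mem_nil, or_false, not_or] at hn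
    rw [hreg r (by omega) hn.1 hn.2]
    exact hf.keeps.reg r hr (by simp)
  refine ⟨_, _, .seq hr₁ (hlf.runs h₁), hi₁.congr hm fun r hr =>
    hreg r (by omega) (by omega) (by omega), hk,
    by rw [hp]; exact hp₁, by rw [hp]; omega, by rw [e17]; exact h12, e3, fun s hr hlt => ?_⟩
  · obtain ⟨b1, b2, b3⟩ := hs₁ s hr hlt
    refine ⟨b1.congr hm (hreg 1 (by simp) (by simp) (by simp)) (hreg 2 (by simp) (by simp) (by simp)), ?_, ?_⟩
    · rw [hreg 0 (by simp) (by simp) (by simp)]; exact b2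
    · rw [e17]; exact b3

section Candidate

variable {P : Par} {k e N : ℕ}

/-- The graph of a formula. -/
noncomputable def graphOf (P : Par) (φ : SAT.CNF N) : GeoGraph :=
  gadgetGraph (φ.length + 1) (P.blocks N φ.length)
    (lowBits (SAT.cellsOf (SAT.encode φ)) φ.length (P.low N))

/-- Trajectory `j` of candidate `c`. -/
noncomputable def trajOf (P : Par) (φ : SAT.CNF N) (c j : ℕ) : List (ℤ × ℤ) :=
  gadgetTraj (φ.length + 1) (P.blocks N φ.length) (P.batch N φ.length c)
    (highBits (SAT.cellsOf (SAT.encode φ)) φ.length (P.low N) N (j * P.batch N φ.length c))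

/-- One of the assignments that belong to query `j` satisfies the formula. -/
def Yes (P : Par) (φ : SAT.CNF N) (c j : ℕ) : Prop :=
  ∃ u < P.trials N φ.length c, ∀ i < φ.length,
    ¬ SAT.Free (SAT.cellsOf (SAT.encode φ)) i (j * P.trials N φ.length c + u) 0 N

/-- Three times the scale of the drawing. -/
def thr (P : Par) (φ : SAT.CNF N) : ℕ := 3 * scale (φ.length + 1) (P.blocks N φ.length)

/-- The data structure answers the queries of candidate `c` within the budget. -/
def Good (P : Par) (φ : SAT.CNF N) (c : ℕ) (prep query : Prog) : Prop :=
  ∃ (s₀ : State) (t₀ : ℕ) (S : Set State) (τ μ : ℕ),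
    Runs prep (State.zero.write 0 (graphOf P φ).encode) s₀ t₀ ∧ s₀ ∈ S ∧
    (∀ s ∈ S, ∀ j < P.queries N φ.length c, ∃ s' ∈ S, ∃ t ≤ τ,
      Runs query (s.write 1 (encodeTraj (trajOf P φ c j))) s' t ∧
      (s'.reg 0 < s'.reg 1 * (thr P φ : ℤ) ↔ Yes P φ c j) ∧
      ∀ u, len (s'.reg 0) ≤ u ∨ len (s'.reg 1) ≤ u →
        len (s'.reg 0) + len (s'.reg 1) ≤ 2 * u + μ) ∧
    4 * t₀ + 4 * (2 * t₀ + 2) + P.queries N φ.length c * (4 * τ + 4 * (2 * τ + μ)) <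
      P.budget N φ.length

/-- Lengths of the numbers that occur for candidate `c`. -/
structure Lens (P : Par) (N M c e Z Zs ℓ : ℕ) : Prop where
  c_lt : c < P.size N M ^ 2
  graph : len (graphLen (M + 1) (P.blocks N M)) ≤ P.size N M ^ e
  traj : len (trajLen (M + 1) (P.batch N M c)) ≤ P.size N M ^ e
  queries : len (P.queries N M c) ≤ P.size N M ^ e
  trials : len (P.trials N M c) ≤ P.size N M ^ e
  modulus : len ((P.size N M ^ 2 : ℕ) : ℤ) ≤ ℓ + 1
  thr : len ((3 * scale (M + 1) (P.blocks N M) : ℕ) : ℤ) ≤ ℓ + 1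
  budget : len (P.budget N M) ≤ ℓ + 1
  pow : 20 * (P.budget N M + P.size N M ^ Z + Zs) < 2 ^ ℓ

/-- Answer the query that is given by trajectory `j`. -/
def queryProg (kit : Kit P k e) (query : Prog) : Prog :=
  .seq (writeProg 3 kit.trajCnt kit.trajVal kit.addr) (.seq (sim query)
    (.seq (.ite 3 recordProg .skip)
      (.ite 17 (.seq (.const 20 1) (.arith .add 18 15 20)) .skip)))

/-- Set register `19` to `1` if an assignment that belongs to the query in register `18` satisfies
the formula. -/
def verifyProg (kit : Kit P k e) : Prog :=
  .ite 18 (.seq (.const 20 1) (.seq (.arith .sub 15 18 20)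
    (forProg 16 26 29 kit.trialCnt (.seq kit.check (.ite 20 (.const 19 1) .skip))))) .skip

/-- Register `19` is set only after an assignment has passed the test on the formula itself. This
conclusion is independent of how the data structure behaved, so wrong candidates do no harm. -/
theorem verify_run (kit : Kit P k e) {φ : SAT.CNF N} (hφ : ∀ cl ∈ φ, cl.length ≤ k) {c f Zs ℓ : ℕ}
    (hL : Lens P N φ.length c e kit.Z Zs ℓ) (hn : 2 ≤ P.size N φ.length) {s : State}
    (hm : s.mem 0 = SAT.cellsOf (SAT.encode φ)) (h14 : s.reg 14 = c) (h18 : s.reg 18 = (f : ℤ))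
    (hf : f ≤ P.queries N φ.length c) :
    ∃ s' t, Runs (verifyProg kit) s s' t ∧ s'.mem = s.mem ∧
      (∀ r, r < 50 → r ∉ [15, 16, 19, 20, 26, 29, 31] → s'.reg r = s.reg r) ∧
      t ≤ (P.trials N φ.length c + 1) *
        (10 * P.size N φ.length ^ kit.Z + 40 * P.size N φ.length ^ e + 40) ∧
      (s'.reg 19 = s.reg 19 ∨ s'.reg 19 = 1 ∧ SAT.Satisfiable φ) ∧
      (0 < f → Yes P φ c (f - 1) → s'.reg 19 = 1) := by
  set n := P.size N φ.length with hndef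
  have hZ1 : 1 ≤ n ^ kit.Z := Nat.one_le_pow _ _ (by omega)
  have l0 : len (0 : ℤ) = 1 := by decide
  have l1 : len (1 : ℤ) = 2 := by decide
  have hlq : ∀ t ≤ P.queries N φ.length c, len (t : ℤ) ≤ n ^ e := fun t ht =>
    (len_mono (by simpa using ht)).trans hL.queries
  have hlt : ∀ t ≤ P.trials N φ.length c, len (t : ℤ) ≤ n ^ e := fun t ht =>
    (len_mono (by simpa using ht)).trans hL.trials
  set X := 10 * n ^ kit.Z + 40 * n ^ e + 40 with hX
  have hXX : X ≤ (P.trials N φ.length c + 1) * X := Nat.le_mul_of_pos_left _ (by omega)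
  have hlf := hlq f hf
  rcases Nat.eq_zero_or_pos f with rfl | hf0
  · refine ⟨s, _, .ite_neg (by rw [h18]; simp) (.skip s), rfl, fun _ _ _ => rfl, ?_, Or.inl rfl,
      fun h => by omega⟩
    rw [h18]
    omega
  set s₁ := (s.setReg 20 1).setReg 15 (Op.sub.eval ((s.setReg 20 1).reg 18) ((s.setReg 20 1).reg 20))
    with hs₁
  have hreg₁ : ∀ r, r ≠ 15 → r ≠ 20 → s₁.reg r = s.reg r := by
    intro r h1 h2; rw [hs₁, setReg_reg, if_neg h1, setReg_reg, if_neg h2]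
  -- Register `18` holds the index of the query plus one, zero meaning that no query was answered
  -- with yes.
  have h15 : s₁.reg 15 = ((f - 1 : ℕ) : ℤ) := by
    simp [hs₁, setReg_reg, Op.eval, h18]; omega
  have hj := hlq (f - 1) (by omega)
  have hc := hL.c_lt.le
  obtain ⟨s₂, t₂, hr₂, ht₂, hm₂, hv₂, hk₂⟩ :=
    (kit.trialCnt_spec ⟨N, φ, hφ, c, f - 1, 0, hc, hj, hlt 0 (Nat.zero_le _)⟩).2 (s₁.setReg 16 0)
      ⟨hm, by rw [setReg_reg, if_neg (by simp), hreg₁ 14 (by simp) (by simp), h14],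
        by rw [setReg_reg, if_neg (by simp), h15], by rw [setReg_reg, if_pos rfl]; rfl⟩
  obtain ⟨s', t, F', hr, ht, ⟨hF, hm', hreg, hsat, hyes⟩, -⟩ := for_rule (i := 16) (q := 26) (f := 29)
    (L := n ^ e) (T := n ^ kit.Z) (cnt := P.trials N φ.length c) (F := P.trials N φ.length c * X)
    (s := s₁) (cntp := kit.trialCnt) (body := .seq kit.check (.ite 20 (.const 19 1) .skip))
    (Inv := fun m F s' => F = (P.trials N φ.length c - m) * X ∧ s'.mem = s.mem ∧
      (∀ r < 50, r ∉ [16, 19, 20, 26, 29, 31] → s'.reg r = s₁.reg r) ∧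
      (s'.reg 19 = s.reg 19 ∨ s'.reg 19 = 1 ∧ SAT.Satisfiable φ) ∧
      ((∃ u < m, ∀ i < φ.length, ¬ SAT.Free (SAT.cellsOf (SAT.encode φ)) i
        ((f - 1) * P.trials N φ.length c + u) 0 N) → s'.reg 19 = 1))
    (by simp) (by simp) (by simp) (by simp) (by simp) hL.trials
    (by
      rintro m F s₁ s₂ ⟨h1, h2, h3, h4, h5⟩ hm' hr'
      have h19 := hr' 19 (by simp) (by simp) (by simp)
      refine ⟨h1, hm'.trans h2, fun r hr hne => ?_, by rw [h19]; exact h4, by rw [h19]; exact h5⟩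
      simp only [List.mem_cons, List.not_mem_nil, or_false, not_or] at hne
      rw [hr' r hne.1 hne.2.2.2.2.1 hne.2.2.2.2.2]
      exact h3 r hr (by simp; tauto))
    (by
      rintro m F s₃ hmlt ⟨h1, h2, h3, h4, h5⟩ hs16 hs26
      obtain ⟨hlv, hval⟩ := kit.check_spec ⟨N, φ, hφ, c, f - 1, m, hc, hj, hlt m hmlt.le⟩
      have hpos := kit.test_pos ⟨N, φ, hφ, c, f - 1, m, hc, hj, hlt m hmlt.le⟩
      obtain ⟨s₄, t₄, hr₄, ht₄, hm₄, hv₄, hk₄⟩ := hval s₃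
        ⟨by rw [h2, hm], by rw [h3 14 (by simp) (by simp), hreg₁ 14 (by simp) (by simp), h14],
          by rw [h3 15 (by simp) (by simp), h15], hs16⟩
      have e1 : (P.trials N φ.length c - m) * X = (P.trials N φ.length c - (m + 1)) * X + X := by
        rw [show P.trials N φ.length c - m = P.trials N φ.length c - (m + 1) + 1 by omega,
          Nat.succ_mul]
      dsimp only at hlv ht₄ hpos
      rw [← hndef] at hlv ht₄
      have h19 := hk₄ 19 (by simp) (by simp)
      by_cases htest : 0 < kit.test ⟨N, φ, hφ, c, f - 1, m, hc, hj, hlt m hmlt.le⟩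
      · have hall := hpos.1 htest
        refine ⟨_, _, (P.trials N φ.length c - (m + 1)) * X, .seq hr₄ (.ite_pos (by rw [hv₄]; exact htest)
          (.const s₄ 19 1)), ?_, ?_, ?_, rfl, by rw [setReg_mem, hm₄, h2], fun r hr hne => ?_, ?_, ?_⟩
        · rw [h1, e1, hv₄, l1]; omega
        · rw [setReg_reg, if_neg (by simp), hk₄ 16 (by simp) (by simp), hs16]
        · rw [setReg_reg, if_neg (by simp), hk₄ 26 (by simp) (by simp), hs26]
        · simp only [List.mem_cons, List.not_mem_nil, or_false, not_or] at hne
          rw [setReg_reg, if_neg hne.2.1, hk₄ r hr hne.2.2.1, h3 r hr (by simp; tauto)]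
        · exact Or.inr ⟨by rw [setReg_reg, if_pos rfl], SAT.satisfiable_of_bits φ _ hall⟩
        · intro _; rw [setReg_reg, if_pos rfl]
      · refine ⟨_, _, (P.trials N φ.length c - (m + 1)) * X, .seq hr₄ (.ite_neg (by rw [hv₄]; omega)
          (.skip s₄)), ?_, ?_, ?_, rfl, by rw [hm₄, h2], fun r hr hne => ?_, ?_, ?_⟩
        · rw [h1, e1, hv₄]; omega
        · rw [hk₄ 16 (by simp) (by simp), hs16]
        · rw [hk₄ 26 (by simp) (by simp), hs26]
        · simp only [List.mem_cons, List.not_mem_nil, or_false, not_or] at hne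
          rw [hk₄ r hr hne.2.2.1, h3 r hr (by simp; tauto)]
        · rw [h19]; exact h4
        · rintro ⟨u, hu, hall⟩
          rw [h19]
          rcases Nat.lt_succ_iff_lt_or_eq.1 hu with hu | rfl
          · exact h5 ⟨u, hu, hall⟩
          · exact absurd (hpos.2 hall) htest)
    hr₂ ht₂ ⟨by simp, by rw [hm₂]; rfl, fun r hr hne => by
        simp only [List.mem_cons, List.not_mem_nil, or_false, not_or] at hne
        rw [hk₂ r hr hne.2.2.2.1, setReg_reg, if_neg hne.1],
      Or.inl (by rw [hk₂ 19 (by simp) (by simp), setReg_reg, if_neg (by simp),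
        hreg₁ 19 (by simp) (by simp)]), by rintro ⟨u, hu, -⟩; omega⟩
    (by rw [hk₂ 16 (by simp) (by simp), setReg_reg, if_pos rfl]) hv₂
  refine ⟨s', _, .ite_pos (by rw [h18]; exact_mod_cast hf0) (.seq (.const _ _ _)
    (.seq (.arith _ .sub 15 18 20) hr)), hm', fun r hr hne => ?_, ?_, hsat, fun _ hy => hyes hy⟩
  · simp only [List.mem_cons, List.not_mem_nil, or_false, not_or] at hne
    rw [hreg r hr (by simp; tauto), hreg₁ r hne.1 (by tauto)]
  · have e2 : (P.trials N φ.length c + 1) * X = P.trials N φ.length c * X + X := Nat.succ_mul _ _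
    simp only [setReg_reg]
    simp only [Nat.reduceEqDiff, if_false, if_true, h18, l1]
    omega

end Candidate

end RAM

/-! ### The loop over the queries of a candidate -/

namespace RAM

open MapMatching

variable {P : Par} {k e N : ℕ}

/-- The states in `S` answer the queries of candidate `c` in time `τ`, and the lengths of the two
numbers in an answer differ by at most `μ`. -/
structure Serves (P : Par) (φ : SAT.CNF N) (c : ℕ) (query : Prog) (S : Set State)
    (τ μ base : ℕ) : Prop where
  run : ∀ s ∈ S, ∀ j < P.queries N φ.length c, ∃ s' ∈ S, ∃ t ≤ τ,
    Runs query (s.write 1 (encodeTraj (trajOf P φ c j))) s' t ∧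
      (s'.reg 0 < s'.reg 1 * (thr P φ : ℤ) ↔ Yes P φ c j) ∧
      ∀ u, len (s'.reg 0) ≤ u ∨ len (s'.reg 1) ≤ u →
        len (s'.reg 0) + len (s'.reg 1) ≤ 2 * u + μ
  budget : base + P.queries N φ.length c * (4 * τ + 4 * (2 * τ + μ)) < P.budget N φ.length

/-- The state between two queries of candidate `c`. -/
structure Busy (P : Par) (φ : SAT.CNF N) (c W B ℓ : ℕ) (j : ℕ) (h : State) : Prop where
  inv : SimInv W B ℓ h
  cells : h.mem 0 = SAT.cellsOf (SAT.encode φ)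
  r1 : h.reg 1 = ((P.size N φ.length ^ 2 : ℕ) : ℤ)
  r2 : h.reg 2 = c
  r3 : h.reg 3 = 0
  r13 : h.reg 13 = (thr P φ : ℤ)
  r14 : h.reg 14 = c
  r17 : h.reg 17 = 0 ∨ h.reg 17 = 1
  r18 : ∃ f ≤ j, h.reg 18 = (f : ℤ)

/-- After `j` queries, the data structure and the record of its answers are correct. -/
def Tracks (P : Par) (φ : SAT.CNF N) (c : ℕ) (S : Set State) (τ μ base : ℕ) (j : ℕ)
    (h : State) : Prop :=
  (∃ s ∈ S, Rel h s ∧ (h.reg 17 = 1 ↔ s.reg 0 < s.reg 1 * (thr P φ : ℤ))) ∧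
    (P.budget N φ.length : ℤ) ≤ h.reg 0 + base + j * (4 * τ + 4 * (2 * τ + μ)) ∧
    ((∃ j' < j, Yes P φ c j') → 0 < h.reg 18) ∧ ∀ f : ℕ, h.reg 18 = f → 0 < f → Yes P φ c (f - 1)

theorem Busy.keeps {φ : SAT.CNF N} {c W B ℓ j : ℕ} {h h' : State} {X : List ℕ}
    (hb : Busy P φ c W B ℓ j h) (hi : SimInv W B ℓ h') (hk : Keeps X h h') (r3 : h'.reg 3 = 0)
    (r17 : h'.reg 17 = 0 ∨ h'.reg 17 = 1) (h1 : 1 ∉ X) (h2 : 2 ∉ X) (h13 : 13 ∉ X) (h14 : 14 ∉ X)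
    (h18 : ∃ f ≤ j + 1, h'.reg 18 = (f : ℤ)) : Busy P φ c W B ℓ (j + 1) h' where
  inv := hi
  cells := hk.mem_zero.trans hb.cells
  r1 := (hk.reg 1 (by simp) h1).trans hb.r1
  r2 := (hk.reg 2 (by simp) h2).trans hb.r2
  r3 := r3
  r13 := (hk.reg 13 (by simp) h13).trans hb.r13
  r14 := (hk.reg 14 (by simp) h14).trans hb.r14
  r17 := r17
  r18 := h18

/-- Record the answer to query `j`, which is found in the copy of the data structure. -/
def answerProg : Prog :=
  .seq (.ite 3 recordProg .skip)
    (.ite 17 (.seq (.const 20 1) (.arith .add 18 15 20)) .skip)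

/-- If the flag is not set, the two registers have not been written, and the recorded comparison
still describes them. Comparing afresh might be too expensive, as nothing in this query has paid for
their lengths. -/
theorem record_ite_run {prep query : Prog} {K Z B ℓ : ℕ} {h : State} (hK : SimConst prep query K)
    (hZ : K ≤ Z) (hi : SimInv Z B ℓ h) (hl : len (h.reg 13) ≤ ℓ + 1)
    (h17 : h.reg 17 = 0 ∨ h.reg 17 = 1) (h3 : h.reg 3 = 0 ∨ h.reg 3 = 1) : ∃ h' t,
    Runs (.ite 3 recordProg .skip) h h' t ∧ SimInv Z B ℓ h' ∧ Keeps [17, 20] h h' ∧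
      pot B h' ≤ pot B h ∧
      t + K * (ℓ + 1) * pot B h' ≤ K * (ℓ + 1) * (pot B h + 1) + 25 ∧
      (h'.reg 17 = 0 ∨ h'.reg 17 = 1) ∧ h'.reg 3 = 0 ∧
      ∀ s u, Rel h s → (h.reg 3 = 0 → (h.reg 17 = 1 ↔ s.reg 0 < s.reg 1 * h.reg 13)) →
        (h.reg 3 = 1 → len (s.reg 0) + len (s.reg 1) ≤ u) → 4 * (u : ℤ) < h.reg 0 → Rel h' s ∧
        h.reg 0 ≤ h'.reg 0 + 4 * u ∧ (h'.reg 17 = 1 ↔ s.reg 0 < s.reg 1 * h.reg 13) := by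
  have l0 : len (0 : ℤ) = 1 := by decide
  have l1 : len (1 : ℤ) = 2 := by decide
  rcases h3 with h3 | h3
  · refine ⟨h, _, .ite_neg (by rw [h3]) (.skip h), hi, (Keeps.refl h).mono (by simp), le_rfl,
      ?_, h17, h3, fun s u hr hs _ _ => ⟨hr, by omega, hs h3⟩⟩
    rw [h3, l0, mul_mul_succ]; omega
  · obtain ⟨h', t, hr, a1, a2, a3, a4, a5, a6, a7⟩ := record_run hK hZ hi hl
    refine ⟨h', _, .ite_pos (by rw [h3]; simp) hr, a1, a2, a3, by rw [h3, l1]; omega, a5, a6,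
      fun s u hs _ hu hlt => ?_⟩
    have hu' := hu h3
    obtain ⟨b1, b2, b3⟩ := a7 s hs (by omega)
    exact ⟨b1, by omega, b3⟩

theorem answer_run {prep query : Prog} {K Z B ℓ j L : ℕ} {h : State} (hK : SimConst prep query K)
    (hZ : K ≤ Z) (hi : SimInv Z B ℓ h) (hl : len (h.reg 13) ≤ ℓ + 1)
    (h17 : h.reg 17 = 0 ∨ h.reg 17 = 1) (h3 : h.reg 3 = 0 ∨ h.reg 3 = 1) (h15 : h.reg 15 = (j : ℤ))
    (hL : len (j : ℤ) ≤ L) : ∃ h' t,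
    Runs answerProg h h' t ∧ SimInv Z B ℓ h' ∧ Keeps [17, 18, 20] h h' ∧
      pot B h' ≤ pot B h ∧
      t + K * (ℓ + 1) * pot B h' ≤ K * (ℓ + 1) * (pot B h + 1) + 40 + L ∧
      (h'.reg 17 = 0 ∨ h'.reg 17 = 1) ∧ h'.reg 3 = 0 ∧
      (h'.reg 18 = if h'.reg 17 = 1 then ((j + 1 : ℕ) : ℤ) else h.reg 18) ∧
      ∀ s u, Rel h s → (h.reg 3 = 0 → (h.reg 17 = 1 ↔ s.reg 0 < s.reg 1 * h.reg 13)) →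
        (h.reg 3 = 1 → len (s.reg 0) + len (s.reg 1) ≤ u) → 4 * (u : ℤ) < h.reg 0 → Rel h' s ∧
        h.reg 0 ≤ h'.reg 0 + 4 * u ∧ (h'.reg 17 = 1 ↔ s.reg 0 < s.reg 1 * h.reg 13) := by
  have l0 : len (0 : ℤ) = 1 := by decide
  have l1 : len (1 : ℤ) = 2 := by decide
  obtain ⟨h₁, t₁, hr, a1, a2, a3, a4, a5, a6, a7⟩ := record_ite_run hK hZ hi hl h17 h3
  have e15 : h₁.reg 15 = j := (a2.reg 15 (by simp) (by simp)).trans h15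
  have e18 : h₁.reg 18 = h.reg 18 := a2.reg 18 (by simp) (by simp)
  rcases a5 with h0 | h1
  · refine ⟨h₁, _, .seq hr (.ite_neg (by rw [h0]) (.skip _)), a1, a2.mono (by simp), a3, ?_,
      Or.inl h0, a6, by rw [if_neg (by rw [h0]; simp), e18], a7⟩
    rw [h0, l0]; omega
  · set h₂ := (h₁.setReg 20 1).setReg 18 (Op.add.eval ((h₁.setReg 20 1).reg 15)
      ((h₁.setReg 20 1).reg 20)) with hh₂
    have hreg : ∀ r, r ≠ 18 → r ≠ 20 → h₂.reg r = h₁.reg r := by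
      intro r g1 g2; rw [hh₂, setReg_reg, if_neg g1, setReg_reg, if_neg g2]
    have hm : h₂.mem = h₁.mem := rfl
    have hp : pot B h₂ = pot B h₁ := by unfold pot; rw [hreg 0 (by simp) (by simp)]
    have e17 : h₂.reg 17 = 1 := (hreg 17 (by simp) (by simp)).trans h1
    refine ⟨h₂, _, .seq hr (.ite_pos (by rw [h1]; simp) (.seq (.const _ _ _)
      (.arith _ .add 18 15 20))), a1.congr hm fun r hr => hreg r (by omega) (by omega),
      ⟨fun r hr hn => ?_, by rw [hm]; exact a2.mem_zero, fun a i hi => by rw [hm]; exact a2.mem a i hi⟩,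
      by rw [hp]; exact a3, ?_, Or.inr e17, (hreg 3 (by simp) (by simp)).trans a6, ?_,
      fun s u b1 b2 b3 b4 => ?_⟩
    · simp only [List.mem_cons, List.not_mem_nil, or_false, not_or] at hn
      rw [hreg r hn.2.1 hn.2.2]
      exact a2.reg r hr (by simp; tauto)
    · rw [hp, h1]
      simp only [setReg_reg]
      simp only [Nat.reduceEqDiff, if_false, if_true, e15, l1]
      omega
    · rw [if_pos e17]
      simp [hh₂, setReg_reg, Op.eval, e15]
    · obtain ⟨c1, c2, c3⟩ := a7 s u b1 b2 b3 b4
      exact ⟨c1.congr hm (hreg 1 (by simp) (by simp)) (hreg 2 (by simp) (by simp)),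
        by rw [hreg 0 (by simp) (by simp)]; exact c2, by rw [hreg 17 (by simp) (by simp)]; exact c3⟩

theorem Rel.written_of_getD {a : ℕ} {C c : ℤ} {v : ℕ → ℤ} {l : List ℤ} {h h' s : State} {cnt : ℕ}
    (hrel : Rel h s) (hcnt : l.length = cnt) (hw : Written (a + 2) C c cnt v h h')
    (hC : h.reg 1 = C) (hc : h.reg 2 = c) (h0 : 0 ≤ c) (hlt : c < C) (r1 : h'.reg 1 = h.reg 1)
    (r2 : h'.reg 2 = h.reg 2) (hv : ∀ t < cnt, v t = l.getD t 0) : Rel h' (s.write a l) := by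
  subst hcnt
  exact hrel.written hw hC hc h0 hlt r1 r2 hv

theorem Written.keeps {a : ℕ} {C c : ℤ} {cnt : ℕ} {v : ℕ → ℤ} {h h' : State} {X : List ℕ}
    (hw : Written (a + 1) C c cnt v h h') (hC : h.reg 1 = C) (hc : h.reg 2 = c) (h0 : 0 ≤ c)
    (hlt : c < C) (hr : ∀ r < 50, r ∉ X → h'.reg r = h.reg r) : Keeps X h h' := by
  obtain ⟨h1, h2⟩ := Frame.written hw h0 hlt
  exact ⟨fun r hr' hn => hr r (by omega) hn, h1, fun a' i hi => h2 a' i (by rwa [hC, hc] at hi)⟩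

/-- Number of steps that are added to the simulation for one query. -/
def queryCost (P : Par) (N M c e Z Ks ℓ : ℕ) : ℕ :=
  2 * (Ks * (ℓ + 1)) + (trajLen (M + 1) (P.batch N M c) + 1) *
    (6 * P.size N M ^ Z + 12 * P.size N M ^ e) + 40 + 13 * P.size N M ^ e

/-- Time, memory and format are controlled for every data structure; correctness is only claimed
under `Serves` and `Tracks`. The budget in `Serves` ensures that the clock of a suitable candidate
never runs out, so that the simulation is faithful throughout. -/
theorem query_step (kit : Kit P k e) {φ : SAT.CNF N} (hφ : ∀ cl ∈ φ, cl.length ≤ k)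
    {c Ks ℓ j : ℕ} (hL : Lens P N φ.length c e kit.Z Ks ℓ) (hn : 2 ≤ P.size N φ.length)
    {prep query : Prog} (hK : SimConst prep query Ks) {h : State} {B : ℕ}
    (hb : Busy P φ c (P.size N φ.length ^ kit.Z + Ks) B ℓ j h)
    (h15 : h.reg 15 = (j : ℤ)) (hj : j < P.queries N φ.length c) : ∃ h' t,
    Runs (queryProg kit query) h h' t ∧ Keeps [16, 17, 18, 20, 21, 26, 29, 31] h h' ∧
      Busy P φ c (P.size N φ.length ^ kit.Z + Ks) B ℓ (j + 1) h' ∧ pot B h' ≤ pot B h ∧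
      t + Ks * (ℓ + 1) * pot B h' + 12 * P.size N φ.length ^ e ≤
        queryCost P N φ.length c e kit.Z Ks ℓ + Ks * (ℓ + 1) * pot B h ∧
      ∀ S τ μ base, Serves P φ c query S τ μ base → Tracks P φ c S τ μ base j h →
        Tracks P φ c S τ μ base (j + 1) h' := by
  have hlj : len (j : ℤ) ≤ P.size N φ.length ^ e :=
    (len_mono (by simpa using hj.le)).trans hL.queries
  have hcC : (c : ℤ) < ((P.size N φ.length ^ 2 : ℕ) : ℤ) := by exact_mod_cast hL.c_lt
  have hc0 : (0 : ℤ) ≤ c := by positivity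
  obtain ⟨h₁, t₁, hr₁, ht₁, hw, hreg₁⟩ := write_run (P := P) (k := k) (e := e) (Z := kit.Z) (a := 2)
    (N := N) (c := c) (j := j) (cnt := trajLen (φ.length + 1) (P.batch N φ.length c)) (φ := φ)
    (hφ := hφ) hL.c_lt.le hlj hL.traj hn kit.trajCnt_spec kit.trajVal_spec kit.addr_spec
    (fun _ _ => rfl) (v := trajEntry (φ.length + 1) (P.blocks N φ.length)
      (P.batch N φ.length c) (highBits (SAT.cellsOf (SAT.encode φ)) φ.length (P.low N)
        N (j * P.batch N φ.length c))) (fun _ _ => rfl) hb.cells hb.r14 h15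
  have hk₁ : Keeps [16, 20, 21, 26, 29, 31] h h₁ := hw.keeps hb.r1 hb.r2 hc0 hcC hreg₁
  have hp₁ : pot B h₁ = pot B h := by unfold pot; rw [hreg₁ 0 (by simp) (by simp)]
  have hi₁ : SimInv (P.size N φ.length ^ kit.Z + Ks) B ℓ h₁ :=
    hb.inv.written hw hb.r1 hb.r2 (fun r hr => hreg₁ r (by omega) (by simp; omega)) fun t ht => by
      have h1 := (kit.trajVal_spec ⟨N, φ, hφ, c, j, t, hL.c_lt.le, hlj,
        (len_mono (by simpa using ht.le)).trans hL.traj⟩).1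
      have h2 := hb.inv.const_le
      dsimp only at h1
      omega
  obtain ⟨h₂, t₂, hr₂, ho⟩ := hK.query _ B ℓ h₁ (Nat.le_add_left _ _) hi₁
  have hk₂ := ho.frame.keeps
  have h3₁ : h₁.reg 3 = 0 := (hreg₁ 3 (by simp) (by simp)).trans hb.r3
  have hk₁₂ : Keeps [16, 20, 21, 26, 29, 31] h h₂ :=
    hk₁.trans hk₂ (by simp) (by simp) (by simp) (by simp)
  have e13 : h₂.reg 13 = thr P φ := (hk₁₂.reg 13 (by simp) (by simp)).trans hb.r13
  have e17₁ : h₁.reg 17 = h.reg 17 := hk₁.reg 17 (by simp) (by simp)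
  have e17 : h₂.reg 17 = h.reg 17 := hk₁₂.reg 17 (by simp) (by simp)
  have e18 : h₂.reg 18 = h.reg 18 := hk₁₂.reg 18 (by simp) (by simp)
  obtain ⟨h₃, t₃, hr₃, a1, a2, a3, a4, a5, a6, a7, a8⟩ := answer_run (j := j)
    (L := P.size N φ.length ^ e) hK (Nat.le_add_left _ _)
    ho.inv (by rw [e13]; exact hL.thr) (by rw [e17]; exact hb.r17)
    (by rcases ho.frame.dirty with g | g
        · exact Or.inl (g.trans h3₁)
        · exact Or.inr g)
    ((hk₁₂.reg 15 (by simp) (by simp)).trans h15) hlj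
  have hk : Keeps [16, 17, 18, 20, 21, 26, 29, 31] h h₃ :=
    hk₁₂.trans a2 (by simp) (by simp) (by simp) (by simp)
  refine ⟨h₃, _, .seq hr₁ (.seq hr₂ hr₃), hk,
    hb.keeps a1 hk a6 a5 (by simp) (by simp) (by simp) (by simp) ?_, ?_, ?_, ?_⟩
  · obtain ⟨f, hf, hf'⟩ := hb.r18
    rw [a7]
    split_ifs
    · exact ⟨j + 1, le_rfl, rfl⟩
    · exact ⟨f, by omega, e18.trans hf'⟩
  · exact a3.trans (ho.pot_le.trans hp₁.le)
  · have ht₂ := ho.time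
    rw [mul_mul_succ] at a4 ht₂
    rw [hp₁] at ht₂
    unfold queryCost
    omega
  · rintro S τ μ base hS ⟨⟨s, hsS, hrel, h17⟩, hbud, hfound, hyes⟩
    obtain ⟨s', hs'S, t, ht, hrun, hiff, hlen⟩ := hS.run s hsS j hj
    have hrel₁ : Rel h₁ (s.write 1 (encodeTraj (trajOf P φ c j))) :=
      hrel.written_of_getD (length_encodeTraj _ _ _ _) hw hb.r1 hb.r2 hc0 hcC
        (hreg₁ 1 (by simp) (by simp)) (hreg₁ 2 (by simp) (by simp))
        fun t ht => (getD_encodeTraj _ ht).symm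
    have e0 : h₁.reg 0 = h.reg 0 := hreg₁ 0 (by simp) (by simp)
    have hB := hS.budget
    have hmul : (j + 1) * (4 * τ + 4 * (2 * τ + μ)) ≤
      P.queries N φ.length c * (4 * τ + 4 * (2 * τ + μ)) := Nat.mul_le_mul_right _ hj
    rw [Nat.succ_mul] at hmul
    have hsp : ((j * (4 * τ + 4 * (2 * τ + μ)) : ℕ) : ℤ) = (j : ℤ) * (4 * τ + 4 * (2 * τ + μ)) := by
      push_cast; ring
    have hsp' : (((j + 1 : ℕ) : ℤ)) * (4 * τ + 4 * (2 * τ + μ)) =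
        (j : ℤ) * (4 * τ + 4 * (2 * τ + μ)) + (4 * τ + 4 * (2 * τ + μ)) := by push_cast; ring
    obtain ⟨b1, b2, b3⟩ := ho.faithful _ _ _ hrel₁ hrun (by omega)
    -- If the flag is set, one of the two registers was paid for within time `τ`, and the condition
    -- on the lengths in an answer bounds the other one.
    have hflag : (h₂.reg 3 = 0 → (h₂.reg 17 = 1 ↔ s'.reg 0 < s'.reg 1 * h₂.reg 13)) ∧
        (h₂.reg 3 = 1 → len (s'.reg 0) + len (s'.reg 1) ≤ 2 * τ + μ) := by
      rw [e13, e17]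
      rcases b3 with ⟨g1, g2⟩ | ⟨g1, g2, g3⟩
      · refine ⟨fun g => by omega, fun _ => (hlen t g2).trans (by omega)⟩
      · refine ⟨fun _ => ?_, fun g => by omega⟩
        rw [g2, g3]; exact h17
    obtain ⟨d1, d2, d3⟩ := a8 s' (2 * τ + μ) b1 hflag.1 hflag.2 (by push_cast; omega)
    rw [e13] at d3
    refine ⟨⟨s', hs'S, d1, d3⟩, by rw [hsp']; push_cast at d2; omega, ?_, ?_⟩
    · rintro ⟨j', hj', hy⟩
      rw [a7]
      split_ifs with hc
      · positivity
      · rw [e18]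
        refine hfound ⟨j', ?_, hy⟩
        refine lt_of_le_of_ne (Nat.lt_succ_iff.1 hj') ?_
        rintro rfl
        exact hc (d3.2 (hiff.2 hy))
    · intro f hf hf0
      rw [a7] at hf
      split_ifs at hf with hc
      · have : f = j + 1 := by exact_mod_cast hf.symm
        rw [this]
        exact hiff.1 (d3.1 hc)
      · exact hyes f (e18.symm.trans hf) hf0

end RAM

/-! ### All queries of one candidate -/

namespace RAM

open MapMatching

variable {P : Par} {k e N : ℕ}

theorem Busy.congr {φ : SAT.CNF N} {c W B ℓ j : ℕ} {h h' : State} (hb : Busy P φ c W B ℓ j h)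
    (hm : h'.mem = h.mem) (hr : ∀ r, r ≤ 3 ∨ r = 13 ∨ r = 14 ∨ r = 17 ∨ r = 18 →
      h'.reg r = h.reg r) : Busy P φ c W B ℓ j h' where
  inv := hb.inv.congr hm fun r h => hr r (by omega)
  cells := by rw [hm]; exact hb.cells
  r1 := (hr 1 (by simp)).trans hb.r1
  r2 := (hr 2 (by simp)).trans hb.r2
  r3 := (hr 3 (by simp)).trans hb.r3
  r13 := (hr 13 (by simp)).trans hb.r13
  r14 := (hr 14 (by simp)).trans hb.r14
  r17 := by rw [hr 17 (by simp)]; exact hb.r17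
  r18 := by rw [hr 18 (by simp)]; exact hb.r18

theorem Tracks.congr {φ : SAT.CNF N} {c τ μ base j : ℕ} {S : Set State} {h h' : State}
    (ht : Tracks P φ c S τ μ base j h) (hm : h'.mem = h.mem)
    (hr : ∀ r, r ≤ 2 ∨ r = 17 ∨ r = 18 → h'.reg r = h.reg r) :
    Tracks P φ c S τ μ base j h' := by
  obtain ⟨⟨s, hs, hrel, h17⟩, h2, h3, h4⟩ := ht
  unfold Tracks
  rw [hr 17 (by simp), hr 18 (by simp), hr 0 (by simp)]
  exact ⟨⟨s, hs, hrel.congr hm (hr 1 (by simp)) (hr 2 (by simp)), h17⟩, h2, h3, h4⟩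

theorem pot_congr {h h' : State} (B : ℕ) (hr : h'.reg 0 = h.reg 0) : pot B h' = pot B h := by
  unfold pot; rw [hr]

/-- Answer all queries of a candidate. -/
def queriesProg (kit : Kit P k e) (query : Prog) : Prog :=
  forProg 15 25 28 (.seq (.const 16 0) kit.queryCnt) (queryProg kit query)

/-- The supply of time contains the potential of the simulation. Hence all queries share a single
budget, although a query may take any part of it. -/
theorem queries_run (kit : Kit P k e) {φ : SAT.CNF N} (hφ : ∀ cl ∈ φ, cl.length ≤ k)
    {c Ks ℓ : ℕ} (hL : Lens P N φ.length c e kit.Z Ks ℓ) (hn : 2 ≤ P.size N φ.length)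
    {prep query : Prog} (hK : SimConst prep query Ks) {h : State} {B : ℕ}
    (hb : Busy P φ c (P.size N φ.length ^ kit.Z + Ks) B ℓ 0 h) : ∃ h' t,
    Runs (queriesProg kit query) h h' t ∧
      Keeps [15, 16, 17, 18, 20, 21, 25, 26, 28, 29, 31] h h' ∧
      Busy P φ c (P.size N φ.length ^ kit.Z + Ks) B ℓ (P.queries N φ.length c) h' ∧
      t ≤ P.queries N φ.length c * queryCost P N φ.length c e kit.Z Ks ℓ +
        Ks * (ℓ + 1) * pot B h + P.size N φ.length ^ kit.Z + 8 * P.size N φ.length ^ e + 2 ∧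
      ∀ S τ μ base, Serves P φ c query S τ μ base → Tracks P φ c S τ μ base 0 h →
        Tracks P φ c S τ μ base (P.queries N φ.length c) h' := by
  have l0 : len (0 : ℤ) = 1 := by decide
  have h0len : len ((0 : ℕ) : ℤ) ≤ P.size N φ.length ^ e :=
    (len_mono (by simp)).trans hL.queries
  obtain ⟨h₁, t₁, hr₁, ht₁, hm₁, hv₁, hk₁⟩ :=
    (kit.queryCnt_spec ⟨N, φ, hφ, c, 0, 0, hL.c_lt.le, h0len, h0len⟩).2
      ((h.setReg 15 0).setReg 16 0) ⟨hb.cells, hb.r14, rfl, rfl⟩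
  dsimp only at ht₁ hv₁
  have hreg₁ : ∀ r < 50, r ≠ 15 → r ≠ 16 → r ≠ 25 → h₁.reg r = h.reg r := by
    intro r h1 h2 h3 h4
    rw [hk₁ r h1 h4, setReg_reg, if_neg h3, setReg_reg, if_neg h2]
  have hmem₁ : h₁.mem = h.mem := hm₁
  have hkeep : Keeps [15, 16, 25] h h₁ := .of_mem hmem₁ fun r h1 hn => by
    simp only [List.mem_cons, List.not_mem_nil, or_false, not_or] at hn
    exact hreg₁ r h1 hn.1 hn.2.1 hn.2.2
  set X := queryCost P N φ.length c e kit.Z Ks ℓ with hX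
  set nq := P.queries N φ.length c with hnq
  obtain ⟨h', t, F', hr, ht, ⟨hF, hk, hb', htr⟩, -⟩ := for_rule (i := 15) (q := 25) (f := 28)
    (L := P.size N φ.length ^ e) (T := P.size N φ.length ^ kit.Z + 2) (cnt := nq)
    (cntp := .seq (.const 16 0) kit.queryCnt) (body := queryProg kit query)
    (Inv := fun m F h' => F = (nq - m) * X + Ks * (ℓ + 1) * pot B h' ∧
      Keeps [15, 16, 17, 18, 20, 21, 25, 26, 28, 29, 31] h h' ∧
      Busy P φ c (P.size N φ.length ^ kit.Z + Ks) B ℓ m h' ∧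
      ∀ S τ μ base, Serves P φ c query S τ μ base → Tracks P φ c S τ μ base 0 h →
        Tracks P φ c S τ μ base m h')
    (by simp) (by simp) (by simp) (by simp) (by simp) hL.queries
    (by
      rintro m F s s' ⟨h1, h2, h3, h4⟩ hm' hr'
      refine ⟨by rw [h1, pot_congr B (hr' 0 (by simp) (by simp) (by simp))],
        h2.trans (Y := [15, 28, 31]) (.of_mem hm' fun r _ hn => ?_) (by simp) (by simp) (by simp)
          (by simp), h3.congr hm' fun r hr => hr' r (by omega) (by omega) (by omega),
        fun S τ μ base a b => (h4 S τ μ base a b).congr hm' fun r hr =>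
          hr' r (by omega) (by omega) (by omega)⟩
      simp only [List.mem_cons, List.not_mem_nil, or_false, not_or] at hn
      exact hr' r hn.1 hn.2.1 hn.2.2)
    (by
      rintro m F s hm ⟨h1, h2, h3, h4⟩ hs15 hs25
      obtain ⟨s', t, g1, g2, g3, g4, g5, g6⟩ := query_step kit hφ hL hn hK h3 hs15 hm
      refine ⟨s', t, (nq - (m + 1)) * X + Ks * (ℓ + 1) * pot B s', g1, ?_,
        (g2.reg 15 (by simp) (by simp)).trans hs15, (g2.reg 25 (by simp) (by simp)).trans hs25, rfl,
        h2.trans g2 (by simp) (by simp) (by simp) (by simp), g3,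
        fun S τ μ base a b => g6 S τ μ base a (h4 S τ μ base a b)⟩
      have e1 : (nq - m) * X = (nq - (m + 1)) * X + X := by
        rw [show nq - m = nq - (m + 1) + 1 by omega, Nat.succ_mul]
      rw [h1, e1]
      omega)
    (s := h) (.seq (.const _ 16 0) hr₁) (by rw [l0]; omega)
    ⟨by rw [Nat.sub_zero], hkeep.mono (by simp), hb.congr hmem₁ fun r hr =>
        hreg₁ r (by omega) (by omega) (by omega) (by omega), fun S τ μ base _ b => b.congr hmem₁
        fun r hr => hreg₁ r (by omega) (by omega) (by omega) (by omega)⟩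
    (by rw [hk₁ 15 (by simp) (by simp)]; rfl) hv₁
  refine ⟨h', t, hr, hk, hb', ?_, htr⟩
  rw [pot_congr B (hreg₁ 0 (by simp) (by simp) (by simp) (by simp))] at ht
  omega

end RAM

/-! ### Trying one candidate -/

namespace RAM

open MapMatching

variable {P : Par} {k e N : ℕ}

/-- Initialize the registers for a candidate. -/
def setupProg (kit : Kit P k e) : Prog :=
  .seq (.seq (.const 15 0) (.const 16 0)) (.seq kit.modulus (.seq kit.residue (.seq kit.clock
    (.seq kit.threshold (.seq (.const 17 0) (.seq (.const 18 0) (.const 3 0)))))))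

theorem setup_run (kit : Kit P k e) {φ : SAT.CNF N} (hφ : ∀ cl ∈ φ, cl.length ≤ k)
    {c Ks ℓ : ℕ} (hL : Lens P N φ.length c e kit.Z Ks ℓ) {h : State}
    (hm : h.mem 0 = SAT.cellsOf (SAT.encode φ)) (h14 : h.reg 14 = c) : ∃ h' t,
    Runs (setupProg kit) h h' t ∧ h'.mem = h.mem ∧
      (∀ r < 50, r ∉ [0, 1, 2, 3, 13, 15, 16, 17, 18] → h'.reg r = h.reg r) ∧
      t ≤ 4 * P.size N φ.length ^ kit.Z + 10 ∧
      h'.reg 0 = P.budget N φ.length ∧ h'.reg 1 = ((P.size N φ.length ^ 2 : ℕ) : ℤ) ∧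
      h'.reg 2 = c ∧ h'.reg 3 = 0 ∧ h'.reg 13 = (thr P φ : ℤ) ∧ h'.reg 15 = 0 ∧
      h'.reg 17 = 0 ∧ h'.reg 18 = 0 := by
  have l0 : len (0 : ℤ) = 1 := by decide
  have h0len : len ((0 : ℕ) : ℤ) ≤ P.size N φ.length ^ e :=
    (len_mono (by simp)).trans hL.queries
  set w : Sit P k e := ⟨N, φ, hφ, c, 0, 0, hL.c_lt.le, h0len, h0len⟩ with hw
  have hat : ∀ s s' : State, s'.mem = s.mem → s'.reg 14 = s.reg 14 → s'.reg 15 = s.reg 15 →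
      s'.reg 16 = s.reg 16 → At w s → At w s' := by
    intro s s' e1 e2 e3 e4 hs
    exact ⟨by rw [e1]; exact hs.mem, by rw [e2]; exact hs.c, by rw [e3]; exact hs.j,
      by rw [e4]; exact hs.t⟩
  have a₀ : At w ((h.setReg 15 0).setReg 16 0) := ⟨hm, h14, rfl, rfl⟩
  obtain ⟨h₁, t₁, r₁, b₁, m₁, v₁, k₁⟩ := (kit.modulus_spec w).2 _ a₀
  have a₁ := hat _ _ m₁ (k₁ 14 (by simp) (by simp)) (k₁ 15 (by simp) (by simp))
    (k₁ 16 (by simp) (by simp)) a₀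
  obtain ⟨h₂, t₂, r₂, b₂, m₂, v₂, k₂⟩ := (kit.residue_spec w).2 _ a₁
  have a₂ := hat _ _ m₂ (k₂ 14 (by simp) (by simp)) (k₂ 15 (by simp) (by simp))
    (k₂ 16 (by simp) (by simp)) a₁
  obtain ⟨h₃, t₃, r₃, b₃, m₃, v₃, k₃⟩ := (kit.clock_spec w).2 _ a₂
  have a₃ := hat _ _ m₃ (k₃ 14 (by simp) (by simp)) (k₃ 15 (by simp) (by simp))
    (k₃ 16 (by simp) (by simp)) a₂
  obtain ⟨h₄, t₄, r₄, b₄, m₄, v₄, k₄⟩ := (kit.threshold_spec w).2 _ a₃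
  set h₅ := ((h₄.setReg 17 0).setReg 18 0).setReg 3 0 with hh₅
  have k₅ : ∀ r, r ≠ 3 → r ≠ 17 → r ≠ 18 → h₅.reg r = h₄.reg r := by
    intro r g1 g2 g3
    rw [hh₅, setReg_reg, if_neg g1, setReg_reg, if_neg g3, setReg_reg, if_neg g2]
  refine ⟨h₅, _, .seq (.seq (.const _ _ _) (.const _ _ _)) (.seq r₁ (.seq r₂ (.seq r₃ (.seq r₄
    (.seq (.const _ _ _) (.seq (.const _ _ _) (.const _ _ _))))))), ?_, fun r hr hn => ?_, ?_, ?_,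
    ?_, ?_, rfl, ?_, ?_, rfl, rfl⟩
  · change h₄.mem = _; rw [m₄, m₃, m₂, m₁]; rfl
  · simp only [List.mem_cons, List.not_mem_nil, or_false, not_or] at hn
    obtain ⟨n0, n1, n2, n3, n13, n15, n16, n17, n18⟩ := hn
    rw [k₅ r n3 n17 n18, k₄ r hr n13, k₃ r hr n0, k₂ r hr n2, k₁ r hr n1, setReg_reg, if_neg n16,
      setReg_reg, if_neg n15]
  · rw [l0]
    have b₁' : t₁ ≤ P.size N φ.length ^ kit.Z := b₁
    have b₂' : t₂ ≤ P.size N φ.length ^ kit.Z := b₂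
    have b₃' : t₃ ≤ P.size N φ.length ^ kit.Z := b₃
    have b₄' : t₄ ≤ P.size N φ.length ^ kit.Z := b₄
    omega
  · rw [k₅ 0 (by simp) (by simp) (by simp), k₄ 0 (by simp) (by simp), v₃]
  · rw [k₅ 1 (by simp) (by simp) (by simp), k₄ 1 (by simp) (by simp), k₃ 1 (by simp) (by simp),
      k₂ 1 (by simp) (by simp), v₁]
  · rw [k₅ 2 (by simp) (by simp) (by simp), k₄ 2 (by simp) (by simp), k₃ 2 (by simp) (by simp), v₂]
  · rw [k₅ 13 (by simp) (by simp) (by simp), v₄]; rfl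
  · rw [k₅ 15 (by simp) (by simp) (by simp), k₄ 15 (by simp) (by simp), k₃ 15 (by simp) (by simp),
      k₂ 15 (by simp) (by simp), k₁ 15 (by simp) (by simp)]
    rfl

/-- Construct the data structure and record the initial contents of its registers. -/
def buildProg (kit : Kit P k e) (prep : Prog) : Prog :=
  .seq (setupProg kit) (.seq (writeProg 2 kit.graphCnt kit.graphVal kit.addr)
    (.seq (sim prep) recordProg))

/-- The residue class of the candidate is still zero, so it represents the state `State.zero`, in
which the preprocessing has to start. -/
theorem build_run (kit : Kit P k e) {φ : SAT.CNF N} (hφ : ∀ cl ∈ φ, cl.length ≤ k)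
    {c Ks ℓ : ℕ} (hL : Lens P N φ.length c e kit.Z Ks ℓ) (hn : 2 ≤ P.size N φ.length)
    {prep query : Prog} (hK : SimConst prep query Ks) {h : State}
    (hm : h.mem 0 = SAT.cellsOf (SAT.encode φ)) (h14 : h.reg 14 = c)
    (hz : ∀ a i, i % ((P.size N φ.length ^ 2 : ℕ) : ℤ) = c → h.mem (a + 1) i = 0) : ∃ h' t,
    Runs (buildProg kit prep) h h' t ∧ h'.reg 19 = h.reg 19 ∧ h'.reg 24 = h.reg 24 ∧
      (∀ a i, i % ((P.size N φ.length ^ 2 : ℕ) : ℤ) ≠ c → h'.mem a i = h.mem a i) ∧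
      Busy P φ c (P.size N φ.length ^ kit.Z + Ks)
        (P.budget N φ.length + (P.size N φ.length ^ kit.Z + Ks)) ℓ 0 h' ∧
      t + Ks * (ℓ + 1) * pot (P.budget N φ.length + (P.size N φ.length ^ kit.Z + Ks)) h' ≤
        4 * P.size N φ.length ^ kit.Z + 30 +
          (graphLen (φ.length + 1) (P.blocks N φ.length) + 1) *
            (6 * P.size N φ.length ^ kit.Z + 12 * P.size N φ.length ^ e) +
          Ks * (ℓ + 1) * (2 * P.budget N φ.length + (P.size N φ.length ^ kit.Z + Ks) + 2) ∧
      (Good P φ c prep query → ∃ S τ μ base, Serves P φ c query S τ μ base ∧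
        Tracks P φ c S τ μ base 0 h') := by
  have l0 : len (0 : ℤ) = 1 := by decide
  have h0len : len ((0 : ℕ) : ℤ) ≤ P.size N φ.length ^ e :=
    (len_mono (by simp)).trans hL.queries
  have hcC : (c : ℤ) < ((P.size N φ.length ^ 2 : ℕ) : ℤ) := by exact_mod_cast hL.c_lt
  have hc0 : (0 : ℤ) ≤ c := by positivity
  have hZ1 : 1 ≤ P.size N φ.length ^ kit.Z := Nat.one_le_pow _ _ (by omega)
  obtain ⟨h₁, t₁, hr₁, m₁, k₁, ht₁, v0, v1, v2, v3, v13, v15, v17, v18⟩ :=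
    setup_run kit hφ hL hm h14
  set W := P.size N φ.length ^ kit.Z + Ks with hW
  set B := P.budget N φ.length + W with hB
  have v14 : h₁.reg 14 = c := (k₁ 14 (by simp) (by simp)).trans h14
  have hz₁ : ∀ a (i : ℤ), h₁.mem (a + 1) (i * h₁.reg 1 + h₁.reg 2) = 0 := by
    intro a i
    rw [m₁, v1, v2]
    exact hz a _ (address_emod hc0 hcC)
  have hi₁ : SimInv W B ℓ h₁ := by
    refine ⟨by rw [v2]; exact hc0, by rw [v1, v2]; exact hcC, by rw [v1]; exact hL.modulus, ?_,
      by rw [v0]; exact hL.budget, by rw [v0, Int.toNat_natCast]; omega, fun a i => ?_, ?_⟩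
    · rw [v2]
      refine (len_mono ?_).trans hL.modulus
      have := hL.c_lt
      simpa using this.le
    · rw [hz₁, l0, v0, Int.toNat_natCast]; omega
    · have := hL.pow
      rw [hB, hW, ← add_assoc]; exact this
  have hrel₁ : Rel h₁ State.zero := ⟨fun r => hz₁ 0 r, fun a i => hz₁ (a + 1) i⟩
  obtain ⟨h₂, t₂, hr₂, ht₂, hw, hreg₂⟩ := write_run (P := P) (k := k) (e := e) (Z := kit.Z) (a := 1)
    (N := N) (c := c) (j := 0) (cnt := graphLen (φ.length + 1) (P.blocks N φ.length)) (φ := φ)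
    (hφ := hφ) hL.c_lt.le h0len hL.graph hn kit.graphCnt_spec kit.graphVal_spec kit.addr_spec
    (fun _ _ => rfl) (v := graphEntry (φ.length + 1) (P.blocks N φ.length)
      (lowBits (SAT.cellsOf (SAT.encode φ)) φ.length (P.low N))) (fun _ _ => rfl)
    (by rw [m₁]; exact hm) v14 v15
  have hk₂ : Keeps [16, 20, 21, 26, 29, 31] h₁ h₂ := hw.keeps v1 v2 hc0 hcC hreg₂
  have hp₂ : pot B h₂ = pot B h₁ := pot_congr B (hreg₂ 0 (by simp) (by simp))
  have hi₂ : SimInv W B ℓ h₂ :=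
    hi₁.written hw v1 v2 (fun r hr => hreg₂ r (by omega) (by simp; omega)) fun t ht => by
      have h1 := (kit.graphVal_spec ⟨N, φ, hφ, c, 0, t, hL.c_lt.le, h0len,
        (len_mono (by simpa using ht.le)).trans hL.graph⟩).1
      dsimp only at h1
      rw [v0, Int.toNat_natCast]
      omega
  obtain ⟨h₃, t₃, hr₃, ho⟩ := hK.prep W B ℓ h₂ (Nat.le_add_left _ _) hi₂
  have hk₃ := ho.frame.keeps
  have hk₁₃ : Keeps [16, 20, 21, 26, 29, 31] h₁ h₃ :=
    hk₂.trans hk₃ (by simp) (by simp) (by simp) (by simp)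
  have e13 : h₃.reg 13 = thr P φ := (hk₁₃.reg 13 (by simp) (by simp)).trans v13
  obtain ⟨h₄, t₄, hr₄, a1, a2, a3, a4, a5, a6, a7⟩ := record_run hK (Nat.le_add_left _ _)
    ho.inv (by rw [e13]; exact hL.thr)
  have hk : Keeps [16, 17, 20, 21, 26, 29, 31] h₁ h₄ :=
    hk₁₃.trans a2 (by simp) (by simp) (by simp) (by simp)
  have v18' : h₄.reg 18 = 0 := (hk.reg 18 (by simp) (by simp)).trans v18
  refine ⟨h₄, _, .seq hr₁ (.seq hr₂ (.seq hr₃ hr₄)),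
    (hk.reg 19 (by simp) (by simp)).trans (k₁ 19 (by simp) (by simp)),
    (hk.reg 24 (by simp) (by simp)).trans (k₁ 24 (by simp) (by simp)), fun a i hi => ?_,
    ⟨a1, ?_, (hk.reg 1 (by simp) (by simp)).trans v1, (hk.reg 2 (by simp) (by simp)).trans v2, a6,
      (hk.reg 13 (by simp) (by simp)).trans v13, (hk.reg 14 (by simp) (by simp)).trans v14, a5,
      ⟨0, le_rfl, v18'⟩⟩, ?_, ?_⟩
  · rw [hk.mem a i (by rwa [v1, v2]), m₁]
  · rw [hk.mem_zero, m₁, hm]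
  · have g := ho.time
    -- The clock starts at the budget, and the potential adds `B`, which is the budget plus `W`.
    have hpot : pot B h₁ ≤ 2 * P.budget N φ.length + W := by
      unfold pot
      split_ifs
      · rw [v0, Int.toNat_natCast]; omega
      · omega
    have h5 : Ks * (ℓ + 1) * (pot B h₁ + 2) ≤
        Ks * (ℓ + 1) * (2 * P.budget N φ.length + W + 2) := Nat.mul_le_mul_left _ (by omega)
    rw [show pot B h₁ + 2 = pot B h₁ + 1 + 1 from rfl, mul_mul_succ, mul_mul_succ] at h5
    rw [mul_mul_succ] at a4 g
    rw [hp₂] at g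
    omega
  · rintro ⟨s₀, t₀, S, τ, μ, hrun, hs₀, hS, hbud⟩
    have hSv : Serves P φ c query S τ μ (4 * t₀ + 4 * (2 * t₀ + 2)) := ⟨hS, hbud⟩
    refine ⟨S, τ, μ, _, hSv, ?_⟩
    have hrel₂ : Rel h₂ (State.zero.write 0 (graphOf P φ).encode) :=
      hrel₁.written_of_getD (length_encode_gadgetGraph _ _ _) hw v1 v2 hc0 hcC
        (hreg₂ 1 (by simp) (by simp)) (hreg₂ 2 (by simp) (by simp))
        fun t ht => (getD_encode_gadgetGraph _ ht).symm
    have e0 : h₂.reg 0 = P.budget N φ.length := (hreg₂ 0 (by simp) (by simp)).trans v0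
    obtain ⟨b1, b2, -⟩ := ho.faithful _ _ _ hrel₂ hrun (by omega)
    -- All registers are zero before the preprocessing, so afterwards their lengths are bounded by
    -- its time; here the first comparison is affordable without a condition on the quotient.
    have hlen : ∀ r, len (s₀.reg r) ≤ t₀ + 1 := by
      intro r
      rcases hrun.reg_eq_or_len_le r with g | g
      · rw [g]; change len 0 ≤ _; rw [l0]; omega
      · omega
    have hl0 := hlen 0
    have hl1 := hlen 1
    obtain ⟨d1, d2, d3⟩ := a7 s₀ b1 (by omega)
    rw [e13] at d3
    refine ⟨⟨s₀, hs₀, d1, d3⟩, by push_cast; omega, by rintro ⟨j', hj', -⟩; omega,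
      fun f hf hf0 => ?_⟩
    rw [v18'] at hf
    have : f = 0 := by exact_mod_cast hf.symm
    omega

/-- Search for a satisfying assignment with candidate `c`. -/
def candProg (kit : Kit P k e) (prep query : Prog) : Prog :=
  .seq (buildProg kit prep) (.seq (queriesProg kit query) (verifyProg kit))

/-- The time for candidate `c`. -/
def candCost (P : Par) (N M c e Z Ks ℓ : ℕ) : ℕ :=
  5 * P.size N M ^ Z + 8 * P.size N M ^ e + 40 +
    (graphLen (M + 1) (P.blocks N M) + 1) * (6 * P.size N M ^ Z + 12 * P.size N M ^ e) +
    Ks * (ℓ + 1) * (2 * P.budget N M + (P.size N M ^ Z + Ks) + 2) +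
    P.queries N M c * queryCost P N M c e Z Ks ℓ +
    (P.trials N M c + 1) * (10 * P.size N M ^ Z + 40 * P.size N M ^ e + 40)

theorem cand_run (kit : Kit P k e) {φ : SAT.CNF N} (hφ : ∀ cl ∈ φ, cl.length ≤ k)
    {c Ks ℓ : ℕ} (hL : Lens P N φ.length c e kit.Z Ks ℓ) (hn : 2 ≤ P.size N φ.length)
    {prep query : Prog} (hK : SimConst prep query Ks) {h : State}
    (hm : h.mem 0 = SAT.cellsOf (SAT.encode φ)) (h14 : h.reg 14 = c)
    (hz : ∀ a i, i % ((P.size N φ.length ^ 2 : ℕ) : ℤ) = c → h.mem (a + 1) i = 0) : ∃ h' t,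
    Runs (candProg kit prep query) h h' t ∧ h'.reg 14 = c ∧ h'.reg 24 = h.reg 24 ∧
      h'.mem 0 = SAT.cellsOf (SAT.encode φ) ∧
      (∀ a i, i % ((P.size N φ.length ^ 2 : ℕ) : ℤ) ≠ c → h'.mem a i = h.mem a i) ∧
      t ≤ candCost P N φ.length c e kit.Z Ks ℓ ∧
      (h'.reg 19 = h.reg 19 ∨ h'.reg 19 = 1 ∧ SAT.Satisfiable φ) ∧
      (Good P φ c prep query → (∃ j < P.queries N φ.length c, Yes P φ c j) → h'.reg 19 = 1) := by
  obtain ⟨h₁, t₁, r₁, e19, e24, hmem₁, hb₁, ht₁, hg₁⟩ := build_run kit hφ hL hn hK hm h14 hz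
  obtain ⟨h₂, t₂, r₂, hk₂, hb₂, ht₂, htr₂⟩ := queries_run kit hφ hL hn hK hb₁
  obtain ⟨f, hf, h18⟩ := hb₂.r18
  obtain ⟨h₃, t₃, r₃, m₃, k₃, ht₃, hs₃, hy₃⟩ := verify_run kit hφ hL hn hb₂.cells hb₂.r14 h18 hf
  have e19₂ : h₂.reg 19 = h.reg 19 := (hk₂.reg 19 (by simp) (by simp)).trans e19
  refine ⟨h₃, _, .seq r₁ (.seq r₂ r₃), (k₃ 14 (by simp) (by simp)).trans hb₂.r14,
    (k₃ 24 (by simp) (by simp)).trans ((hk₂.reg 24 (by simp) (by simp)).trans e24),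
    by rw [m₃]; exact hb₂.cells, fun a i hi => ?_, ?_, by rw [← e19₂]; exact hs₃, ?_⟩
  · rw [m₃, hk₂.mem a i (by rwa [hb₁.r1, hb₁.r2]), hmem₁ a i hi]
  · unfold candCost
    omega
  · rintro hg ⟨j, hj, hy⟩
    obtain ⟨S, τ, μ, base, hS, ht⟩ := hg₁ hg
    obtain ⟨-, -, h3, h4⟩ := htr₂ S τ μ base hS ht
    have hpos := h3 ⟨j, hj, hy⟩
    have hf0 : 0 < f := by rw [h18] at hpos; exact_mod_cast hpos
    exact hy₃ hf0 (h4 f h18 hf0)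

end RAM

/-! ### The search program -/

namespace RAM

open MapMatching

variable {P : Par} {k e N : ℕ}

/-- Try all candidates. -/
def searchProg (kit : Kit P k e) (prep query : Prog) : Prog :=
  .seq (forProg 14 24 27 kit.candCnt (candProg kit prep query))
    (.seq (.const 20 0) (.arith .add 0 19 20))

/-- Soundness comes from the final test of assignments and completeness from the single candidate
`c₀`. After `m` candidates the residue classes from `m` on are untouched, so each candidate starts
with clean memory. -/
theorem search_run (kit : Kit P k e) {φ : SAT.CNF N} (hφ : ∀ cl ∈ φ, cl.length ≤ k)
    {c₀ Ks ℓ T : ℕ} (hn : 2 ≤ P.size N φ.length)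
    (hL : ∀ c < P.size N φ.length ^ 2, Lens P N φ.length c e kit.Z Ks ℓ)
    (hlen : len ((P.size N φ.length ^ 2 : ℕ) : ℤ) ≤ P.size N φ.length ^ e)
    (hT : ∀ c < P.size N φ.length ^ 2, candCost P N φ.length c e kit.Z Ks ℓ ≤ T)
    {prep query : Prog} (hK : SimConst prep query Ks) (hc₀ : c₀ < P.size N φ.length ^ 2)
    (hgood : Good P φ c₀ prep query)
    (hyes : SAT.Satisfiable φ → ∃ j < P.queries N φ.length c₀, Yes P φ c₀ j) : ∃ s t,
    Runs (searchProg kit prep query) (State.zero.write 0 (SAT.encode φ)) s t ∧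
      t ≤ P.size N φ.length ^ 2 * (T + 12 * P.size N φ.length ^ e) +
        P.size N φ.length ^ kit.Z + 8 * P.size N φ.length ^ e + 10 ∧
      (s.reg 0 = 1 ↔ SAT.Satisfiable φ) := by
  have l0 : len (0 : ℤ) = 1 := by decide
  have l1 : len (1 : ℤ) = 2 := by decide
  have h0len : len ((0 : ℕ) : ℤ) ≤ P.size N φ.length ^ e :=
    (len_mono (by simp)).trans hlen
  set L := P.size N φ.length ^ e with hLdef
  set C := P.size N φ.length ^ 2 with hC
  have hCpos : 0 < C := by omega
  set s₀ := State.zero.write 0 (SAT.encode φ) with hs₀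
  have hm₀ : s₀.mem 0 = SAT.cellsOf (SAT.encode φ) := by
    funext i
    simp [hs₀, State.write, SAT.cellsOf, State.zero]
  have hz₀ : ∀ a i, s₀.mem (a + 1) i = 0 := by
    intro a i
    simp [hs₀, State.write, State.zero]
  obtain ⟨h₁, t₁, r₁, b₁, m₁, v₁, k₁⟩ := (kit.candCnt_spec
    ⟨N, φ, hφ, 0, 0, 0, Nat.zero_le _, h0len, h0len⟩).2 (s₀.setReg 14 0) ⟨hm₀, rfl, rfl, rfl⟩
  dsimp only at b₁ v₁
  obtain ⟨s', t, F', hr, ht, ⟨-, hm', -, h19, h19'⟩, -⟩ := for_rule (i := 14) (q := 24) (f := 27)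
    (L := L) (T := P.size N φ.length ^ kit.Z) (cnt := C) (F := C * (T + 12 * L)) (s := s₀)
    (cntp := kit.candCnt) (body := candProg kit prep query)
    (Inv := fun m F s => F = (C - m) * (T + 12 * L) ∧ s.mem 0 = SAT.cellsOf (SAT.encode φ) ∧
      (∀ (a : ℕ) (i : ℤ), (m : ℤ) ≤ i % (C : ℤ) → s.mem (a + 1) i = 0) ∧
      (s.reg 19 = 0 ∨ s.reg 19 = 1 ∧ SAT.Satisfiable φ) ∧
      (c₀ < m → SAT.Satisfiable φ → s.reg 19 = 1))
    (by simp) (by simp) (by simp) (by simp) (by simp) hlen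
    (by
      rintro m F s₁ s₂ ⟨h1, h2, h3, h4, h5⟩ hm' hr'
      have h19 := hr' 19 (by simp) (by simp) (by simp)
      exact ⟨h1, by rw [hm']; exact h2, by rw [hm']; exact h3, by rw [h19]; exact h4,
        by rw [h19]; exact h5⟩)
    (by
      rintro m F s hm ⟨h1, h2, h3, h4, h5⟩ hs14 hs24
      obtain ⟨s', t, g1, g2, g3, g4, g5, g6, g7, g8⟩ := cand_run kit hφ (hL m hm) hn hK h2 hs14
        fun a i hi => h3 a i hi.ge
      refine ⟨s', t, (C - (m + 1)) * (T + 12 * L), g1, ?_, g2, g3.trans hs24, rfl, g4,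
        fun a i hi => ?_, ?_, fun hlt hsat => ?_⟩
      · have e1 : (C - m) * (T + 12 * L) = (C - (m + 1)) * (T + 12 * L) + (T + 12 * L) := by
          rw [show C - m = C - (m + 1) + 1 by omega, Nat.succ_mul]
        have := hT m hm
        rw [h1, e1]
        omega
      · push_cast at hi
        rw [g5 (a + 1) i (by linarith : (m : ℤ) < i % (C : ℤ)).ne', h3 a i (by linarith)]
      · rcases g7 with g | g
        · rw [g]; exact h4
        · exact Or.inr g
      · rcases Nat.lt_succ_iff_lt_or_eq.1 hlt with hlt | rfl
        · rcases g7 with g | g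
          · rw [g]; exact h5 hlt hsat
          · exact g.1
        · exact g8 hgood (hyes hsat))
    r₁ b₁ ⟨by simp, by rw [m₁]; exact hm₀, fun a i _ => by rw [m₁]; exact hz₀ a i,
      Or.inl (by rw [k₁ 19 (by simp) (by simp)]; rfl), fun h => by omega⟩
    (by rw [k₁ 14 (by simp) (by simp)]; rfl) v₁
  refine ⟨_, _, .seq hr (.seq (.const _ _ _) (.arith _ .add 0 19 20)), ?_, ?_⟩
  · simp only [setReg_reg]
    simp only [Nat.reduceEqDiff, if_false, if_true, l0]
    have : len (s'.reg 19) ≤ 2 := by rcases h19 with h | h <;> [rw [h]; rw [h.1]] <;> omega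
    omega
  · have e0 : (((s'.setReg 20 0).setReg 0 (Op.add.eval ((s'.setReg 20 0).reg 19)
        ((s'.setReg 20 0).reg 20)))).reg 0 = s'.reg 19 := by
      simp [setReg_reg, Op.eval]
    rw [e0]
    constructor
    · intro h
      rcases h19 with g | g
      · omega
      · exact g.2
    · exact h19' hc₀

end RAM

/-! ### Sizes -/

namespace RAM

open MapMatching

namespace Par

variable {P : Par} {N M c : ℕ}

theorem mul_low_le {d : ℕ} (hd : d ≤ P.D) : d * P.low N ≤ N :=
  (Nat.mul_le_mul_right _ hd).trans (Nat.mul_div_le _ _)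

theorem size_pow_le_blocks : P.size N M ^ P.E ≤ P.blocks N M :=
  Nat.le_mul_of_pos_left _ (by positivity)

theorem two_pow_le_blocks (hK : 0 < P.K) : 2 ^ P.low N ≤ P.blocks N M :=
  Nat.le_mul_of_pos_right _ (Nat.pow_pos (by unfold size; omega))

theorem blocks_pos (hK : 0 < P.K) : 0 < P.blocks N M :=
  lt_of_lt_of_le (by positivity) (two_pow_le_blocks hK)

theorem batch_pos (hK : 0 < P.K) (hR : 0 < P.R) : 0 < P.batch N M c :=
  lt_min (by positivity) (Nat.pow_pos (blocks_pos hK))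

theorem batch_le : P.batch N M c ≤ 2 ^ (P.G * P.low N) * P.size N M ^ (P.E * P.G) := by
  refine (min_le_right _ _).trans (le_of_eq ?_)
  rw [blocks, mul_pow, ← pow_mul, ← pow_mul, mul_comm (P.low N)]

/-- Since `P.low N` is about `N / P.D`, any power of `2 ^ P.low N` with exponent less than `P.D`
still leaves `P.low N` bits to spare, which is more than the saving `f`. -/
theorem two_pow_mul_low_le {d f : ℕ} (hd : d + 1 ≤ P.D) (hf : f ≤ P.low N) :
    2 ^ (d * P.low N) ≤ 2 ^ (N - f) := by
  have := mul_low_le (N := N) hd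
  rw [Nat.succ_mul] at this
  exact Nat.pow_le_pow_right (by norm_num) (by omega)

theorem batch_mul_two_pow_le {d : ℕ} (hd : P.G + d + 1 ≤ P.D) {f : ℕ} (hf : f ≤ P.low N) :
    P.batch N M c * 2 ^ (d * P.low N) ≤ 2 ^ (N - f) * P.size N M ^ (P.E * P.G) := by
  have h := two_pow_mul_low_le (N := N) hd hf
  rw [Nat.add_mul, pow_add] at h
  calc P.batch N M c * 2 ^ (d * P.low N)
      ≤ 2 ^ (P.G * P.low N) * P.size N M ^ (P.E * P.G) * 2 ^ (d * P.low N) :=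
        Nat.mul_le_mul_right _ batch_le
    _ = 2 ^ (P.G * P.low N) * 2 ^ (d * P.low N) * P.size N M ^ (P.E * P.G) := by ring
    _ ≤ _ := Nat.mul_le_mul_right _ h

/-- Rounding up the number of queries adds one whole batch; this is harmless because a batch is
itself at most `2 ^ (N - P.low N)` times a polynomial. -/
theorem queries_mul_batch_le (hK : 2 ≤ P.K) (hG : P.G + 1 ≤ P.D) :
    P.queries N M c * P.batch N M c ≤ 2 ^ (N - P.low N) * P.size N M ^ (P.E * P.G + 1) := by
  have h1 := batch_mul_two_pow_le (P := P) (N := N) (M := M) (c := c) (d := 0) hG le_rfl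
  rw [Nat.zero_mul, pow_zero, Nat.mul_one] at h1
  have h2 := Nat.div_mul_le_self (2 ^ (N - P.low N)) (P.batch N M c)
  have h3 : 2 ^ (N - P.low N) ≤ 2 ^ (N - P.low N) * P.size N M ^ (P.E * P.G) :=
    Nat.le_mul_of_pos_right _ (Nat.pow_pos (by unfold size; omega))
  have h4 : 2 ^ (N - P.low N) * P.size N M ^ (P.E * P.G) * 2 ≤
      2 ^ (N - P.low N) * P.size N M ^ (P.E * P.G) * P.size N M :=
    Nat.mul_le_mul_left _ (by unfold size; omega)
  rw [queries, Nat.add_mul, Nat.one_mul, pow_succ, ← Nat.mul_assoc]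
  omega

theorem queries_le {f : ℕ} (hf : f ≤ P.low N) : P.queries N M c ≤ 2 * 2 ^ (N - f) := by
  have h1 := Nat.div_le_self (2 ^ (N - P.low N)) (P.batch N M c)
  have h2 : 2 ^ (N - P.low N) ≤ 2 ^ (N - f) := Nat.pow_le_pow_right (by norm_num) (by omega)
  have h3 : 0 < 2 ^ (N - f) := by positivity
  unfold queries
  omega

theorem graphSize_le (hK : 100 ≤ P.K) :
    2 * graphSize (M + 1) (P.blocks N M) ≤ P.blocks N M * P.size N M ^ 2 := by
  have h1 : 2 * (6 * (M + 1) + 6) ≤ P.size N M ^ 2 := by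
    have : P.size N M = N + M + P.K := rfl
    nlinarith
  calc 2 * graphSize (M + 1) (P.blocks N M) = P.blocks N M * (2 * (6 * (M + 1) + 6)) := by
        unfold graphSize; ring
    _ ≤ _ := Nat.mul_le_mul_left _ h1

theorem trajSize_le (hK : 100 ≤ P.K) (hR : 0 < P.R) :
    trajSize (M + 1) (P.batch N M c) ≤ P.batch N M c * P.size N M ^ 2 := by
  have hb := batch_pos (P := P) (N := N) (M := M) (c := c) (by omega) hR
  have h1 : 6 * M + 11 ≤ P.size N M ^ 2 := by
    have : P.size N M = N + M + P.K := rfl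
    nlinarith
  calc trajSize (M + 1) (P.batch N M c)
      = P.batch N M c * (4 * M + 4) + 1 * (2 * M + 7) := by unfold trajSize; ring
    _ ≤ P.batch N M c * (4 * M + 4) + P.batch N M c * (2 * M + 7) :=
        Nat.add_le_add_left (Nat.mul_le_mul_right _ hb) _
    _ = P.batch N M c * (6 * M + 11) := by ring
    _ ≤ _ := Nat.mul_le_mul_left _ h1

/-- Each query saves a factor `2 ^ f` against `p * q`. The number of queries times `q` is `2 ^ (N -
P.low N)`, and `p` is `2 ^ P.low N`, up to polynomials, so all queries take `2 ^ (N - f)` up to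
polynomials. The construction fits because of `α + 1 ≤ P.D`. The exponent `P.b` has enough room for
all polynomial factors and for the constants. -/
theorem le_budget {α C t₀ τ μ p f : ℕ} (hf : f = P.low N / P.D₂) (hK : 100 ≤ P.K) (hC : C ≤ P.K)
    (hR : 0 < P.R) (hα : α + 1 ≤ P.D) (hG : P.G + 1 ≤ P.D)
    (hb : (1 + (P.E + 2) * α) + (P.E + P.E * P.G + 6) + 3 ≤ P.b)
    (hp : p ≤ P.blocks N M * P.size N M ^ 2) (ht₀ : t₀ ≤ C * p ^ α)
    (hτ : τ * 2 ^ f ≤ C * (p * trajSize (M + 1) (P.batch N M c))) (hμ : μ ≤ P.size N M ^ 2) :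
    4 * t₀ + 4 * (2 * t₀ + 2) + P.queries N M c * (4 * τ + 4 * (2 * τ + μ)) < P.budget N M := by
  have hfl : f ≤ P.low N := hf ▸ Nat.div_le_self _ _
  have hlN : P.low N ≤ N := Nat.div_le_self _ _
  have hCn : C ≤ P.size N M := by unfold size; omega
  have hn : 100 ≤ P.size N M := by unfold size; omega
  set n := P.size N M with hndef
  set U := 2 ^ (N - f) with hU
  have hUpos : 0 < U := by positivity
  have h1 : t₀ ≤ n ^ (1 + (P.E + 2) * α) * U := by
    calc t₀ ≤ C * p ^ α := ht₀
      _ ≤ n * (P.blocks N M * n ^ 2) ^ α := Nat.mul_le_mul hCn (Nat.pow_le_pow_left hp _)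
      _ = n ^ (1 + (P.E + 2) * α) * 2 ^ (α * P.low N) := by
          rw [blocks, ← hndef]; ring
      _ ≤ _ := Nat.mul_le_mul_left _ (two_pow_mul_low_le hα hfl)
  have h2 : P.queries N M c * μ ≤ 2 * U * n ^ 2 := Nat.mul_le_mul (queries_le hfl) hμ
  have h3 : P.queries N M c * τ ≤ n ^ (P.E + P.E * P.G + 6) * U := by
    refine Nat.le_of_mul_le_mul_right ?_ (show 0 < 2 ^ f by positivity)
    calc P.queries N M c * τ * 2 ^ f = P.queries N M c * (τ * 2 ^ f) := Nat.mul_assoc _ _ _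
      _ ≤ P.queries N M c * (n * (P.blocks N M * n ^ 2 * (P.batch N M c * n ^ 2))) :=
          Nat.mul_le_mul_left _ (hτ.trans (Nat.mul_le_mul hCn (Nat.mul_le_mul hp
            (trajSize_le hK hR))))
      _ = P.queries N M c * P.batch N M c * (2 ^ P.low N * n ^ (P.E + 5)) := by
          rw [blocks, ← hndef]; ring
      _ ≤ 2 ^ (N - P.low N) * n ^ (P.E * P.G + 1) * (2 ^ P.low N * n ^ (P.E + 5)) :=
          Nat.mul_le_mul_right _ (queries_mul_batch_le (by omega) hG)
      _ = n ^ (P.E + P.E * P.G + 6) * (2 ^ (N - P.low N) * 2 ^ P.low N) := by ring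
      _ = n ^ (P.E + P.E * P.G + 6) * (U * 2 ^ f) := by
          rw [hU, ← pow_add, ← pow_add, Nat.sub_add_cancel hlN, Nat.sub_add_cancel (hfl.trans hlN)]
      _ = _ := (Nat.mul_assoc _ _ _).symm
  obtain ⟨b, hbe⟩ : ∃ b, P.b = b + 1 := ⟨P.b - 1, by omega⟩
  have hpow : ∀ z ≤ b, n ^ z * U ≤ n ^ b * U := fun z hz =>
    Nat.mul_le_mul_right _ (Nat.pow_le_pow_right (by omega) hz)
  have e1 := hpow (1 + (P.E + 2) * α) (by omega)
  have e2 := hpow (P.E + P.E * P.G + 6) (by omega)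
  have e3 := hpow 2 (by omega)
  have e4 := hpow 0 (by omega)
  have e5 : 100 * (n ^ b * U) ≤ P.budget N M := by
    rw [budget, ← hf, ← hndef, hbe, pow_succ, ← hU]
    calc 100 * (n ^ b * U) ≤ n * (n ^ b * U) := Nat.mul_le_mul_right _ hn
      _ = _ := by ring
  have e6 : P.queries N M c * (4 * τ + 4 * (2 * τ + μ)) =
      12 * (P.queries N M c * τ) + 4 * (P.queries N M c * μ) := by ring
  have e7 : 2 * U * n ^ 2 = 2 * (n ^ 2 * U) := by ring
  rw [pow_zero, Nat.one_mul] at e4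
  omega

end Par

end RAM

/-! ### A data structure for map matching answers the queries of a suitable candidate -/

namespace RAM

open MapMatching

variable {P : Par} {N : ℕ}

/-- A number is split into its low `P.low N` bits, the index of a block, and the rest, the index of
a high vector within the batches. Blocks beyond `2 ^ P.low N` repeat earlier ones. The last of the
`φ.length + 1` coordinates is zero on both sides and only makes the dimension positive. -/
theorem yes_iff (hK : 0 < P.K) {φ : SAT.CNF N} {c j : ℕ} :
    Yes P φ c j ↔ ∃ i < P.blocks N φ.length, ∃ u < P.batch N φ.length c, ∀ d < φ.length + 1,
      ¬ (lowBits (SAT.cellsOf (SAT.encode φ)) φ.length (P.low N) i d = true ∧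
        highBits (SAT.cellsOf (SAT.encode φ)) φ.length (P.low N) N
          (j * P.batch N φ.length c) u d = true) := by
  have hlN : P.low N ≤ N := Nat.div_le_self _ _
  have h2 : 0 < 2 ^ P.low N := by positivity
  simp only [lowBits, highBits, decide_eq_true_eq, Yes, Par.trials]
  constructor
  · rintro ⟨u, hu, h⟩
    refine ⟨u % 2 ^ P.low N, (Nat.mod_lt _ h2).trans_le (Par.two_pow_le_blocks hK),
      u / 2 ^ P.low N, Nat.div_lt_of_lt_mul (by rwa [Nat.mul_comm]), fun d _ hd => ?_⟩
    refine h d hd.1.1 ?_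
    have := (SAT.free_add (SAT.cellsOf (SAT.encode φ)) d (u % 2 ^ P.low N)
      (j * P.batch N φ.length c + u / 2 ^ P.low N) hlN).2 ⟨hd.1.2, hd.2.2⟩
    rw [Nat.mod_mod] at this
    convert this using 1
    have e := Nat.mod_add_div u (2 ^ P.low N)
    calc _ = j * (P.batch N φ.length c * 2 ^ P.low N) +
          (u % 2 ^ P.low N + 2 ^ P.low N * (u / 2 ^ P.low N)) := by rw [e]
      _ = _ := by ring
  · rintro ⟨i, -, u, hu, h⟩
    refine ⟨i % 2 ^ P.low N + 2 ^ P.low N * u, ?_, fun d hd hfree => ?_⟩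
    · have h1 := Nat.mod_lt i h2
      have h3 : (u + 1) * 2 ^ P.low N ≤ P.batch N φ.length c * 2 ^ P.low N :=
        Nat.mul_le_mul_right _ hu
      rw [Nat.succ_mul, Nat.mul_comm u] at h3
      omega
    · have e : j * (P.batch N φ.length c * 2 ^ P.low N) + (i % 2 ^ P.low N + 2 ^ P.low N * u) =
          i % 2 ^ P.low N + 2 ^ P.low N * (j * P.batch N φ.length c + u) := by ring
      rw [e, SAT.free_add _ _ _ _ hlN] at hfree
      exact h d (by omega) ⟨⟨hd, hfree.1⟩, hd, hfree.2⟩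

theorem exists_yes (hK : 0 < P.K) (hR : 0 < P.R) {φ : SAT.CNF N} {c : ℕ} (h : SAT.Satisfiable φ) :
    ∃ j < P.queries N φ.length c, Yes P φ c j := by
  obtain ⟨x, hx, hx'⟩ := h.exists_bits
  have hlN : P.low N ≤ N := Nat.div_le_self _ _
  have hT : 0 < P.trials N φ.length c := Nat.mul_pos (Par.batch_pos hK hR) (by positivity)
  refine ⟨x / P.trials N φ.length c, ?_, x % P.trials N φ.length c, Nat.mod_lt _ hT, ?_⟩
  · unfold Par.queries
    refine Nat.lt_succ_of_le ?_
    rw [Par.trials, Nat.mul_comm, ← Nat.div_div_eq_div_mul]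
    refine Nat.div_le_div_right ?_
    refine (Nat.div_lt_of_lt_mul ?_).le
    rwa [← pow_add, Nat.add_sub_cancel' hlN]
  · rw [Nat.mul_comm, Nat.div_add_mod]
    exact hx'

/-- The quotient `a / b` lies between `1` and `3 * T`, so the lengths of `a` and `b` differ by at
most the length of `3 * T`, and one short number forces the other to be short. -/
theorem len_numerator_le {a b : ℤ} {S T : ℕ} {r : ℝ} (hb : 0 < b) (hS : 1 ≤ S)
    (h1 : (S : ℝ) ≤ r) (h2 : r ≤ (a : ℝ) / b) (h3 : (a : ℝ) / b ≤ 2.999 * r) (h4 : r ≤ T) :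
    ∀ u, len a ≤ u ∨ len b ≤ u → len a + len b ≤ 2 * u + len ((3 * T : ℕ) : ℤ) := by
  have hb' : (0 : ℝ) < b := by exact_mod_cast hb
  have hS' : (1 : ℝ) ≤ S := by exact_mod_cast hS
  have hba : b ≤ a := by
    have : (1 : ℝ) ≤ (a : ℝ) / b := by linarith
    rw [le_div_iff₀ hb', one_mul] at this
    exact_mod_cast this
  have hab : a ≤ (3 * T : ℕ) * b := by
    have : (a : ℝ) / b ≤ ((3 * T : ℕ) : ℝ) := by push_cast; linarith
    rw [div_le_iff₀ hb'] at this
    exact_mod_cast this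
  have e1 : len b ≤ len a := len_mono (by omega)
  have e2 : len a ≤ len (((3 * T : ℕ) : ℤ) * b) := len_mono (by
    generalize ((3 * T : ℕ) : ℤ) * b = z at hab; omega)
  have e3 := len_mul_lt ((3 * T : ℕ) : ℤ) b
  intro u hu
  omega

theorem len_aspect_le {M : ℕ} (hK : 200 ≤ P.K) (hE : P.E + 6 ≤ P.K) :
    len ((3 * (scale (M + 1) (P.blocks N M) * (16 * (M + 1) + 81)) : ℕ) : ℤ) ≤
      P.size N M ^ 2 := by
  have hn : P.size N M = N + M + P.K := rfl
  have hlN : P.low N ≤ N := Nat.div_le_self _ _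
  set n := P.size N M with hndef
  have h1 : n < 2 ^ n := Nat.lt_two_pow_self
  have h2 : 300 * (6 * M + 12) * (16 * M + 97) ≤ n ^ 4 := by
    have a1 : 6 * M + 12 ≤ 6 * n := by omega
    have a2 : 16 * M + 97 ≤ 16 * n := by omega
    calc 300 * (6 * M + 12) * (16 * M + 97) ≤ 300 * (6 * n) * (16 * n) :=
          Nat.mul_le_mul (Nat.mul_le_mul_left _ a1) a2
      _ = 28800 * n ^ 2 := by ring
      _ ≤ n ^ 2 * n ^ 2 := Nat.mul_le_mul_right _ (by nlinarith)
      _ = n ^ 4 := by ring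
  have h3 : len ((3 * (scale (M + 1) (P.blocks N M) * (16 * (M + 1) + 81)) : ℕ) : ℤ) ≤
      (n + n * P.E + 4 * n) + 1 := by
    rw [len_le_succ, Int.natAbs_natCast]
    calc 3 * (scale (M + 1) (P.blocks N M) * (16 * (M + 1) + 81))
        = 2 ^ P.low N * n ^ P.E * (300 * (6 * M + 12) * (16 * M + 97)) := by
          rw [scale, graphSize, Par.blocks, ← hndef]; ring
      _ ≤ 2 ^ n * (2 ^ n) ^ P.E * n ^ 4 :=
          Nat.mul_le_mul (Nat.mul_le_mul (Nat.pow_le_pow_right (by norm_num) (by omega))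
            (Nat.pow_le_pow_left h1.le _)) h2
      _ < 2 ^ n * (2 ^ n) ^ P.E * (2 ^ n) ^ 4 :=
          Nat.mul_lt_mul_of_pos_left (Nat.pow_lt_pow_left h1 (by norm_num)) (by positivity)
      _ = _ := by rw [pow_add, pow_add, ← pow_mul, ← pow_mul, Nat.mul_comm 4]
  have h4 : n * (P.E + 6) ≤ n * n := Nat.mul_le_mul_left _ (by omega)
  have e1 : n * (P.E + 6) = n * P.E + 6 * n := by ring
  have e2 : n ^ 2 = n * n := by ring
  omega

/-- This is where the exponent `4` for the coordinates comes from: the scale is `100 * V`, the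
labels are linear in the dimension, and `V` exceeds both the constants and the dimension. -/
theorem scale_mul_le {M : ℕ} (hK : 200 ≤ P.K) (hE : 1 ≤ P.E) :
    scale (M + 1) (P.blocks N M) * (8 * (M + 1) + 40) ≤
      (graphSize (M + 1) (P.blocks N M) + (graphSize (M + 1) (P.blocks N M) - 1)) ^ 4 := by
  have hn : P.size N M = N + M + P.K := rfl
  set V := graphSize (M + 1) (P.blocks N M) with hV
  have hVn : P.size N M ≤ V := by
    calc P.size N M ≤ P.size N M ^ P.E := Nat.le_self_pow (by omega) _
      _ ≤ P.blocks N M := Par.size_pow_le_blocks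
      _ ≤ V := Nat.le_mul_of_pos_right _ (by omega)
  have h1 : 100 * (8 * (M + 1) + 40) ≤ V ^ 3 := by
    calc 100 * (8 * (M + 1) + 40) ≤ 10000 * V := by omega
      _ ≤ V ^ 2 * V := Nat.mul_le_mul_right _ (by nlinarith)
      _ = V ^ 3 := by ring
  calc scale (M + 1) (P.blocks N M) * (8 * (M + 1) + 40)
      = V * (100 * (8 * (M + 1) + 40)) := by rw [scale, ← hV]; ring
    _ ≤ V * V ^ 3 := Nat.mul_le_mul_left _ h1
    _ = V ^ 4 := by ring
    _ ≤ _ := Nat.pow_le_pow_left (by omega) 4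

theorem bounded_scale_mul {S b T : ℕ} {z y : ℤ} (hz : |z| ≤ T) (h : S * T ≤ b) (hy : |y| ≤ b) :
    Bounded b ((S : ℤ) * z, y) := by
  refine ⟨?_, hy⟩
  rw [abs_mul, Nat.abs_cast]
  calc (S : ℤ) * |z| ≤ S * T := by gcongr
    _ ≤ b := by exact_mod_cast h

/-- From `2 ^ (f * D) ≤ Y` it follows that `2 ^ f ≤ Y ^ (1 / D)`, which is at most `Y ^ δ`. -/
theorem mul_rpow_le {Y δ : ℝ} {f D : ℕ} (hD : 1 ≤ D) (hδ : 1 / (D : ℝ) ≤ δ)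
    (hf : (2 : ℝ) ^ (f * D) ≤ Y) : Y ^ (1 - δ) * 2 ^ f ≤ Y := by
  have hD' : (0 : ℝ) < D := by exact_mod_cast hD
  have hY : 1 ≤ Y := le_trans (one_le_pow₀ (by norm_num)) hf
  have hY0 : 0 < Y := by linarith
  have h1 : (2 : ℝ) ^ f ≤ Y ^ (1 / (D : ℝ)) := by
    calc (2 : ℝ) ^ f = (((2 : ℝ) ^ f) ^ D) ^ ((D : ℝ)⁻¹) :=
          (Real.pow_rpow_inv_natCast (by positivity) (by omega)).symm
      _ ≤ Y ^ ((D : ℝ)⁻¹) := by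
          rw [← pow_mul]
          exact Real.rpow_le_rpow (by positivity) hf (by positivity)
      _ = _ := by rw [one_div]
  calc Y ^ (1 - δ) * 2 ^ f ≤ Y ^ (1 - 1 / (D : ℝ)) * Y ^ (1 / (D : ℝ)) := by
        gcongr
    _ = Y := by rw [← Real.rpow_add hY0]; simp

/-- The hypotheses of the data structure hold for the gadgets: planarity, connectedness, coordinates
bounded by the fourth power of the complexity, and the restriction `R` on the sizes. The gap between
`1.0001` and `3` times the scale then turns approximate answers into correct decisions. -/
theorem good_of_dataStructure {prep query : Prog} {C δ : ℝ} {α C₀ : ℕ} {R : ℕ → ℕ → Prop}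
    (hds : ∀ P : GeoGraph, P.IsPlanar → P.graph.Connected →
      (∀ v, Bounded (P.complexity ^ 4) (P.pos v)) →
      ∃ (s₀ : RAM.State) (t₀ : ℕ) (S : Set RAM.State),
        RAM.Runs prep (RAM.State.zero.write 0 P.encode) s₀ t₀ ∧
        (t₀ : ℝ) ≤ C * (P.complexity : ℝ) ^ α ∧
        s₀ ∈ S ∧
        ∀ s ∈ S, ∀ Q : List (ℤ × ℤ), Q ≠ [] →
          (∀ z ∈ Q, Bounded (P.complexity ^ 4) z) → R P.complexity Q.length →
          ∃ s' ∈ S, ∃ t : ℕ,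
            RAM.Runs query (s.write 1 (encodeTraj Q)) s' t ∧
            (t : ℝ) ≤ C * ((P.complexity : ℝ) * (Q.length : ℝ)) ^ (1 - δ) ∧
            0 < s'.reg 1 ∧
            P.matchDist Q ≤ (s'.reg 0 : ℝ) / (s'.reg 1 : ℝ) ∧
            (s'.reg 0 : ℝ) / (s'.reg 1 : ℝ) ≤ 2.999 * P.matchDist Q)
    (hC : C ≤ C₀) (hδ : 1 / (P.D₂ : ℝ) ≤ δ) (hD₂ : 1 ≤ P.D₂) (hK : 200 ≤ P.K) (hC₀ : C₀ ≤ P.K)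
    (hEK : P.E + 6 ≤ P.K) (hE : 1 ≤ P.E)
    (hPR : 0 < P.R) (hα : α + 1 ≤ P.D) (hG : P.G + 1 ≤ P.D)
    (hb : (1 + (P.E + 2) * α) + (P.E + P.E * P.G + 6) + 3 ≤ P.b) {φ : SAT.CNF N} {c : ℕ}
    (hR : R (graphSize (φ.length + 1) (P.blocks N φ.length) +
      (graphSize (φ.length + 1) (P.blocks N φ.length) - 1))
      (trajSize (φ.length + 1) (P.batch N φ.length c))) : Good P φ c prep query := by
  have hA : 0 < P.blocks N φ.length := Par.blocks_pos (by omega)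
  have hVA : P.blocks N φ.length ≤ graphSize (φ.length + 1) (P.blocks N φ.length) :=
    Nat.le_mul_of_pos_right _ (by omega)
  have hs4 := scale_mul_le (P := P) (N := N) (M := φ.length) hK hE
  have hcomp : (graphOf P φ).complexity = graphSize (φ.length + 1) (P.blocks N φ.length) +
      (graphSize (φ.length + 1) (P.blocks N φ.length) - 1) := lineGraph_complexity _ _
  have hlen : ∀ j, (trajOf P φ c j).length = trajSize (φ.length + 1) (P.batch N φ.length c) :=
    fun j => length_gadgetTraj _ _ _ _
  have hp := Par.graphSize_le (P := P) (N := N) (M := φ.length) (by omega)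
  set V := graphSize (φ.length + 1) (P.blocks N φ.length) with hV
  set S₁ := scale (φ.length + 1) (P.blocks N φ.length) with hS₁
  have hS1 : 1 ≤ S₁ := by rw [hS₁, scale, ← hV]; omega
  set p := V + (V - 1) with hpdef
  obtain ⟨s₀, t₀, S, hprep, ht₀, hs₀, hq⟩ := hds (graphOf P φ)
    (by unfold graphOf gadgetGraph; exact lineGraph_isPlanar _ _)
    (by unfold graphOf gadgetGraph; exact lineGraph_connected (hA.trans_le hVA) _) (by
      intro v
      rw [hcomp]
      have hv : (v : ℕ) < V := v.2
      refine bounded_scale_mul (T := 8 * (φ.length + 1) + 40) ?_ hs4 ?_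
      · have := abs_plab_le (φ.length + 1)
          (lowBits (SAT.cellsOf (SAT.encode φ)) φ.length (P.low N)) v
        push_cast at this ⊢
        exact this
      · rw [Nat.abs_cast]
        have : V ≤ p ^ 4 := (show V ≤ p by omega).trans (Nat.le_self_pow (by norm_num) _)
        exact_mod_cast (by omega : (v : ℕ) ≤ p ^ 4))
  have hpq : 2 ^ P.low N ≤ p * trajSize (φ.length + 1) (P.batch N φ.length c) := by
    calc 2 ^ P.low N ≤ p := (Par.two_pow_le_blocks (by omega)).trans (hVA.trans (by omega))
      _ ≤ _ := Nat.le_mul_of_pos_right _ (by unfold trajSize; omega)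
  set Y := p * trajSize (φ.length + 1) (P.batch N φ.length c) with hY
  have hC0 : (0 : ℝ) ≤ C₀ := by positivity
  have hYr : ((C₀ : ℝ) * (Y : ℝ) ^ (1 - δ)) * 2 ^ (P.low N / P.D₂) ≤ C₀ * Y := by
    rw [mul_assoc]
    refine mul_le_mul_of_nonneg_left (mul_rpow_le hD₂ hδ ?_) hC0
    have : 2 ^ (P.low N / P.D₂ * P.D₂) ≤ Y :=
      (Nat.pow_le_pow_right (by norm_num) (Nat.div_mul_le_self _ _)).trans hpq
    exact_mod_cast this
  have hYpos : (0 : ℝ) ≤ (Y : ℝ) ^ (1 - δ) := by positivity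
  set μ := len ((3 * (S₁ * (16 * (φ.length + 1) + 81)) : ℕ) : ℤ) with hμ
  -- The time per query is rounded down to an integer that does not depend on the query, and `μ` is
  -- the length of three times the upper bound for the match distance.
  refine ⟨s₀, t₀, S, ⌊(C₀ : ℝ) * (Y : ℝ) ^ (1 - δ)⌋₊, μ, hprep, hs₀, fun s hs j hj => ?_,
    Par.le_budget (p := p) rfl (by omega) hC₀ hPR hα hG hb (by omega) ?_ ?_
      (len_aspect_le hK hEK)⟩
  · obtain ⟨s', hs', t, hrun, ht, hden, hlo, hhi⟩ := hq s hs (trajOf P φ c j)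
      (by
        rw [← List.length_pos_iff_ne_nil, hlen]
        unfold trajSize; omega)
      (by
        intro z hz
        rw [hcomp]
        obtain ⟨i, -, rfl⟩ := List.mem_map.1 hz
        refine bounded_scale_mul (T := 8 * (φ.length + 1) + 40) ?_ hs4 (by simp)
        have := abs_qlab_le (Nat.succ_pos φ.length) (P.batch N φ.length c)
          (highBits (SAT.cellsOf (SAT.encode φ)) φ.length (P.low N) N
            (j * P.batch N φ.length c)) i
        push_cast at this ⊢
        exact this)
      (by rw [hcomp, hlen]; exact hR)
    have hden' : (0 : ℝ) < s'.reg 1 := by exact_mod_cast hden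
    have hS1' : (1 : ℝ) ≤ S₁ := by exact_mod_cast hS1
    refine ⟨s', hs', t, Nat.le_floor ?_, hrun, ?_, ?_⟩
    · rw [hcomp, hlen] at ht
      refine ht.trans ?_
      have e : (p : ℝ) * (trajSize (φ.length + 1) (P.batch N φ.length c) : ℕ) = (Y : ℝ) := by
        rw [hY]; push_cast; ring
      rw [e]
      exact mul_le_mul_of_nonneg_right hC hYpos
    · rw [yes_iff (by omega)]
      have hthr : (s'.reg 0 < s'.reg 1 * (thr P φ : ℤ)) ↔
          (s'.reg 0 : ℝ) / s'.reg 1 < 3 * (S₁ : ℝ) := by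
        rw [div_lt_iff₀ hden', thr, ← hS₁]
        rw [← Int.cast_lt (R := ℝ)]
        push_cast
        rw [mul_comm]
      rw [hthr]
      constructor
      · intro hlt
        by_contra hno
        have := le_matchDist_gadget (Nat.succ_pos φ.length) hA _ _ hno
        have h2 := this.trans hlo
        linarith
      · intro hy
        have := matchDist_gadget_le (Nat.succ_pos φ.length) _ _ hy
        refine hhi.trans_lt ?_
        have h2 : (graphOf P φ).matchDist (trajOf P φ c j) ≤ 1.0001 * (S₁ : ℝ) := this
        linarith
    · refine len_numerator_le hden hS1 ?_ hlo hhi ?_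
      · exact scale_le_matchDist hA _ _
      · have := matchDist_le_scale (B := P.batch N φ.length c) (Nat.succ_pos φ.length) hA
          (lowBits (SAT.cellsOf (SAT.encode φ)) φ.length (P.low N))
          (highBits (SAT.cellsOf (SAT.encode φ)) φ.length (P.low N) N
            (j * P.batch N φ.length c))
        push_cast at this ⊢
        exact this
  · rw [hcomp] at ht₀
    have : (t₀ : ℝ) ≤ ((C₀ * p ^ α : ℕ) : ℝ) := by
      push_cast
      exact ht₀.trans (mul_le_mul_of_nonneg_right hC (by positivity))
    exact_mod_cast this
  · have h1 : (⌊(C₀ : ℝ) * (Y : ℝ) ^ (1 - δ)⌋₊ : ℝ) ≤ (C₀ : ℝ) * (Y : ℝ) ^ (1 - δ) :=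
      Nat.floor_le (by positivity)
    have h2 : ((⌊(C₀ : ℝ) * (Y : ℝ) ^ (1 - δ)⌋₊ * 2 ^ (P.low N / P.D₂) : ℕ) : ℝ) ≤
        ((C₀ * Y : ℕ) : ℝ) := by
      push_cast
      exact (mul_le_mul_of_nonneg_right h1 (by positivity)).trans hYr
    exact_mod_cast h2

end RAM

/-! ### The choice of a candidate -/

namespace RAM

open MapMatching

/-- A sequence of integers with quotients of at most `1 + 1 / R`. -/
def grid (R c : ℕ) : ℕ := (R + c % R) * 2 ^ (c / R)

/-- Within a run of `R` indices the mantissa `R + c % R` grows by one; at the end of a run it falls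
back from `2 * R - 1` to `R` while the power of two doubles. Either way the quotient is at most `(R
+ 1) / R`. -/
theorem grid_succ {R : ℕ} (hR : 0 < R) (c : ℕ) : R * grid R (c + 1) ≤ (R + 1) * grid R c := by
  have h := Nat.div_add_mod c R
  have hlt := Nat.mod_lt c hR
  unfold grid
  by_cases hr : c % R + 1 < R
  · have e : c + 1 = (c % R + 1) + R * (c / R) := by omega
    have e1 : (c + 1) % R = c % R + 1 := by rw [e, Nat.add_mul_mod_self_left, Nat.mod_eq_of_lt hr]
    have e2 : (c + 1) / R = c / R := by
      rw [e, Nat.add_mul_div_left _ _ hR, Nat.div_eq_of_lt hr, Nat.zero_add]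
    rw [e1, e2, ← Nat.mul_assoc, ← Nat.mul_assoc]
    refine Nat.mul_le_mul_right _ ?_
    have : (R + 1) * (R + c % R) = R * (R + (c % R + 1)) + c % R := by ring
    omega
  · have e : c + 1 = R * (c / R + 1) := by rw [Nat.mul_succ]; omega
    have e1 : (c + 1) % R = 0 := by rw [e, Nat.mul_mod_right]
    have e2 : (c + 1) / R = c / R + 1 := by rw [e, Nat.mul_div_cancel_left _ hR]
    have e3 : c % R = R - 1 := by omega
    rw [e1, e2, e3, pow_succ, ← Nat.mul_assoc, ← Nat.mul_assoc, ← Nat.mul_assoc, Nat.add_zero]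
    obtain ⟨r, rfl⟩ : ∃ r, R = r + 1 := ⟨R - 1, by omega⟩
    rw [Nat.mul_right_comm, Nat.add_sub_cancel]
    exact Nat.mul_le_mul_right _ (by nlinarith)

theorem two_pow_le_grid {R : ℕ} (hR : 0 < R) (c : ℕ) : 2 ^ (c / R) ≤ grid R c :=
  Nat.le_mul_of_pos_left _ (by omega)

theorem exists_grid {R : ℕ} (hR : 0 < R) {x : ℝ} (hx : (R : ℝ) ≤ x) :
    ∃ c, x ≤ grid R c ∧ (R : ℝ) * grid R c ≤ (R + 1) * x := by
  have hex : ∃ c, x ≤ grid R c := by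
    obtain ⟨t, ht⟩ := exists_nat_ge x
    refine ⟨R * t, ht.trans ?_⟩
    have h := two_pow_le_grid hR (R * t)
    rw [Nat.mul_div_cancel_left _ hR] at h
    exact_mod_cast Nat.lt_two_pow_self.le.trans h
  classical
  have hmin := fun m => Nat.find_min hex (m := m)
  have hspec := Nat.find_spec hex
  refine ⟨Nat.find hex, hspec, ?_⟩
  rcases Nat.eq_zero_or_pos (Nat.find hex) with h0 | h0
  · rw [h0]
    have : grid R 0 = R := by simp [grid]
    rw [this]
    have : (0 : ℝ) < R := by exact_mod_cast hR
    nlinarith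
  · have hlt := hmin _ (Nat.sub_lt h0 one_pos)
    rw [not_le] at hlt
    have h := grid_succ hR (Nat.find hex - 1)
    rw [Nat.sub_add_cancel h0] at h
    have h' : (R : ℝ) * grid R (Nat.find hex) ≤ (R + 1) * grid R (Nat.find hex - 1) := by
      exact_mod_cast h
    have : (0 : ℝ) < (R : ℝ) + 1 := by positivity
    nlinarith

variable {P : Par} {N M : ℕ}

/-- The number of vertices of a trajectory is `4 * (M + 1) * B + 2 * M + 7`. Its main term equals
`c₁ * p ^ γ` for the real number `x = c₁ * p ^ γ / (4 * (M + 1))`, and the first grid value above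
`x` serves as batch size `B`. The grid exceeds `x` by a factor of at most `1 + 1 / P.R`, which uses
half of the tolerance `c₂ - c₁`; the other half absorbs the linear term, because `p ^ γ` is at least
quadratic in the size. -/
theorem exists_candidate {γ c₁ c₂ : ℝ} (hγ : 0 < γ) (hc₁ : 0 < c₁)
    (hR : 0 < P.R) (hRc : 2 * c₁ ≤ P.R * (c₂ - c₁)) (hE : 2 ≤ P.E) (hEγ : 2 ≤ P.E * γ)
    (hG : 2 * γ + 1 ≤ P.G) (hK : 100 ≤ P.K) (hKR : 4 * (P.R : ℝ) ≤ c₁ * P.K)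
    (hKc : 14 ≤ P.K * (c₂ - c₁)) (hKc₁ : c₁ ≤ P.K) (hKG : P.R * (P.G * (1 + P.E) + 1) ≤ P.K) :
    ∃ c < P.size N M ^ 2,
      c₁ * ((graphSize (M + 1) (P.blocks N M) + (graphSize (M + 1) (P.blocks N M) - 1) : ℕ) : ℝ) ^ γ
        ≤ (trajSize (M + 1) (P.batch N M c) : ℝ) ∧
      (trajSize (M + 1) (P.batch N M c) : ℝ) ≤
        c₂ * ((graphSize (M + 1) (P.blocks N M) +
          (graphSize (M + 1) (P.blocks N M) - 1) : ℕ) : ℝ) ^ γ := by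
  have hA : 0 < P.blocks N M := Par.blocks_pos (by omega)
  have hVA : P.blocks N M ≤ graphSize (M + 1) (P.blocks N M) := Nat.le_mul_of_pos_right _ (by omega)
  have hp := Par.graphSize_le (P := P) (N := N) (M := M) (by omega)
  set V := graphSize (M + 1) (P.blocks N M) with hV
  have hn : P.size N M = N + M + P.K := rfl
  have hEA : P.size N M ^ P.E ≤ P.blocks N M := Par.size_pow_le_blocks
  have hlN : P.low N ≤ N := Nat.div_le_self _ _
  set n := P.size N M with hndef
  set A := P.blocks N M with hAdef
  set p := V + (V - 1) with hpdef
  have hn1 : 1 ≤ n := by omega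
  have hnR : (1 : ℝ) ≤ n := by exact_mod_cast hn1
  have hnK : (P.K : ℝ) ≤ n := by exact_mod_cast (by omega : P.K ≤ n)
  have hmn : ((M : ℝ) + 1) ≤ n := by exact_mod_cast (by omega : M + 1 ≤ n)
  have hm1 : (1 : ℝ) ≤ (M : ℝ) + 1 := by linarith [(Nat.cast_nonneg M : (0 : ℝ) ≤ M)]
  have hRr : (0 : ℝ) < P.R := by exact_mod_cast hR
  have hcc : 0 < c₂ - c₁ := by
    by_contra h
    have : (P.R : ℝ) * (c₂ - c₁) ≤ 0 := mul_nonpos_of_nonneg_of_nonpos hRr.le (by linarith)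
    linarith
  -- `p ^ γ` is at least quadratic
  have hA1 : (1 : ℝ) ≤ A := by exact_mod_cast hA
  -- The graph has at least `n ^ P.E` blocks, and `2 ≤ P.E * γ`. Repeating blocks serves this
  -- purpose: it makes `p ^ γ` large even if `γ` is tiny or there are few variables.
  have hpn : (n : ℝ) ^ 2 ≤ (p : ℝ) ^ γ := by
    have h1 : (n : ℝ) ^ P.E ≤ p := by exact_mod_cast hEA.trans (hVA.trans (by omega))
    calc (n : ℝ) ^ 2 = (n : ℝ) ^ (2 : ℝ) := by norm_cast
      _ ≤ (n : ℝ) ^ (P.E * γ) := Real.rpow_le_rpow_of_exponent_le hnR hEγ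
      _ = ((n : ℝ) ^ P.E) ^ γ := by rw [Real.rpow_mul (by linarith), Real.rpow_natCast]
      _ ≤ _ := Real.rpow_le_rpow (by positivity) h1 hγ.le
  have hpA : (p : ℝ) ^ γ ≤ (A : ℝ) ^ (2 * γ) := by
    have h1 : p ≤ A ^ 2 := by
      calc p ≤ A * n ^ 2 := by omega
        _ ≤ A * n ^ P.E := Nat.mul_le_mul_left _ (Nat.pow_le_pow_right hn1 hE)
        _ ≤ A * A := Nat.mul_le_mul_left _ hEA
        _ = A ^ 2 := by ring
    calc (p : ℝ) ^ γ ≤ ((A : ℝ) ^ 2) ^ γ :=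
          Real.rpow_le_rpow (by positivity) (by exact_mod_cast h1) hγ.le
      _ = _ := by rw [Real.rpow_mul (by linarith)]; norm_cast
  set y := (p : ℝ) ^ γ with hy
  set x := c₁ * y / (4 * ((M : ℝ) + 1)) with hx
  have h4 : 0 < 4 * ((M : ℝ) + 1) := by linarith
  have hxe : 4 * ((M : ℝ) + 1) * x = c₁ * y := by rw [hx]; field_simp
  have hny : (n : ℝ) * n ≤ y := by rw [← pow_two]; exact hpn
  have hxR : (P.R : ℝ) ≤ x := by
    rw [hx, le_div_iff₀ h4]
    have h5 : c₁ * (n * n) ≤ c₁ * y := mul_le_mul_of_nonneg_left hny hc₁.le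
    have h6 : 4 * (P.R : ℝ) ≤ c₁ * n := hKR.trans (mul_le_mul_of_nonneg_left hnK hc₁.le)
    have h7 : 4 * (P.R : ℝ) * (M + 1) ≤ c₁ * n * n :=
      mul_le_mul h6 hmn (by linarith) (by positivity)
    linarith
  have hx0 : 0 < x := hRr.trans_le hxR
  obtain ⟨c, hc1, hc2⟩ := exists_grid hR hxR
  have hR1 : (1 : ℝ) ≤ P.R := by exact_mod_cast hR
  have hg2 : (grid P.R c : ℝ) ≤ 2 * x := by
    have : (P.R : ℝ) * grid P.R c ≤ P.R * (2 * x) := by nlinarith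
    exact le_of_mul_le_mul_left this hRr
  -- The minimum in the batch size, which keeps all other candidates from becoming too large, does
  -- not take effect here: `p ≤ A ^ 2`, so the grid value is at most `A ^ (2 * γ + 1)`.
  have hcap : grid P.R c ≤ A ^ P.G := by
    have h8 : c₁ ≤ A := by
      refine hKc₁.trans (hnK.trans ?_)
      exact_mod_cast (Nat.le_self_pow (by omega) _).trans hEA
    have h9 : (grid P.R c : ℝ) ≤ (A : ℝ) ^ P.G := by
      calc (grid P.R c : ℝ) ≤ 2 * x := hg2
        _ ≤ 4 * ((M : ℝ) + 1) * x := by nlinarith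
        _ = c₁ * y := hxe
        _ ≤ A * (A : ℝ) ^ (2 * γ) := mul_le_mul h8 hpA (by positivity) (by positivity)
        _ = (A : ℝ) ^ (2 * γ + 1) := by
            rw [Real.rpow_add (by linarith), Real.rpow_one, mul_comm]
        _ ≤ (A : ℝ) ^ (P.G : ℝ) := Real.rpow_le_rpow_of_exponent_le hA1 hG
        _ = _ := Real.rpow_natCast _ _
    exact_mod_cast h9
  have hbatch : P.batch N M c = grid P.R c := min_eq_left hcap
  refine ⟨c, ?_, ?_, ?_⟩
  -- The grid grows at least like `2 ^ (c / P.R)`, whereas the value is at most a power of `2 ^ n`;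
  -- so the index is linear in `n`, and the constant is absorbed by `P.K ≤ n`.
  · have h1 : n < 2 ^ n := Nat.lt_two_pow_self
    have h2 : 2 ^ (c / P.R) ≤ 2 ^ (n * (P.G * (1 + P.E))) := by
      calc 2 ^ (c / P.R) ≤ A ^ P.G := (two_pow_le_grid hR c).trans hcap
        _ ≤ (2 ^ n * (2 ^ n) ^ P.E) ^ P.G := by
            refine Nat.pow_le_pow_left ?_ _
            rw [hAdef, Par.blocks, ← hndef]
            exact Nat.mul_le_mul (Nat.pow_le_pow_right (by norm_num) (by omega))
              (Nat.pow_le_pow_left h1.le _)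
        _ = _ := by rw [← pow_mul, ← pow_add, ← pow_mul]; ring
    have h3 := (Nat.pow_le_pow_iff_right (by norm_num)).1 h2
    have h4 := Nat.div_add_mod c P.R
    have h5 := Nat.mod_lt c hR
    calc c < P.R * (c / P.R + 1) := by rw [Nat.mul_succ]; omega
      _ ≤ P.R * (n * (P.G * (1 + P.E)) + n * 1) := Nat.mul_le_mul_left _ (by omega)
      _ = n * (P.R * (P.G * (1 + P.E) + 1)) := by ring
      _ ≤ n * n := Nat.mul_le_mul_left _ (by omega)
      _ = n ^ 2 := by ring
  · have e : (trajSize (M + 1) (P.batch N M c) : ℝ) =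
        4 * ((M : ℝ) + 1) * grid P.R c + 2 * (M : ℝ) + 7 := by
      rw [hbatch, trajSize]; push_cast; ring
    rw [e, ← hxe]
    have : 4 * ((M : ℝ) + 1) * x ≤ 4 * ((M : ℝ) + 1) * grid P.R c :=
      mul_le_mul_of_nonneg_left hc1 h4.le
    linarith [(Nat.cast_nonneg M : (0 : ℝ) ≤ M)]
  · have e : (trajSize (M + 1) (P.batch N M c) : ℝ) =
        4 * ((M : ℝ) + 1) * grid P.R c + 2 * (M : ℝ) + 7 := by
      rw [hbatch, trajSize]; push_cast; ring
    rw [e]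
    have hy0 : 0 < y := by nlinarith
    -- both error terms are at most half of the tolerance
    have h5 : 4 * ((M : ℝ) + 1) * grid P.R c ≤ c₁ * y + (c₂ - c₁) / 2 * y := by
      have h6 : P.R * (4 * ((M : ℝ) + 1) * grid P.R c) ≤ P.R * (c₁ * y + (c₂ - c₁) / 2 * y) := by
        calc P.R * (4 * ((M : ℝ) + 1) * grid P.R c)
            = 4 * ((M : ℝ) + 1) * (P.R * grid P.R c) := by ring
          _ ≤ 4 * ((M : ℝ) + 1) * ((P.R + 1) * x) := mul_le_mul_of_nonneg_left hc2 h4.le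
          _ = (P.R + 1) * (4 * ((M : ℝ) + 1) * x) := by ring
          _ = P.R * (c₁ * y) + c₁ * y := by rw [hxe]; ring
          _ ≤ P.R * (c₁ * y) + (P.R * (c₂ - c₁) / 2) * y := by
              have := mul_le_mul_of_nonneg_right hRc hy0.le
              linarith
          _ = _ := by ring
      exact le_of_mul_le_mul_left h6 hRr
    have h7 : 7 * ((M : ℝ) + 1) ≤ (c₂ - c₁) / 2 * y := by
      have h8 : 14 ≤ n * (c₂ - c₁) := hKc.trans (mul_le_mul_of_nonneg_right hnK hcc.le)
      have h9 : (c₂ - c₁) * (n * n) ≤ (c₂ - c₁) * y := mul_le_mul_of_nonneg_left hny hcc.le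
      have h10 : 14 * ((M : ℝ) + 1) ≤ n * (c₂ - c₁) * n :=
        mul_le_mul h8 hmn (by linarith) (by positivity)
      linarith
    linarith [(Nat.cast_nonneg M : (0 : ℝ) ≤ M)]

end RAM

/-! ### The running time of the search -/

namespace RAM

open MapMatching

/-- The lengths of numbers that are given to the simulation. -/
def width (n e Z Ks : ℕ) : ℕ := n ^ e + n * Z + Ks + 6

/-- The exponent `e` bounds the indices of loops, but the loops are bounded by numbers computed from
the formula and `c` alone. Their lengths can be estimated in the context with `e = 0`, where the
other two numbers are zero, and this avoids a circular choice. -/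
theorem exists_lens (P : Par) (k : ℕ) (hK : k + 2 ≤ P.K) : ∃ e, ∀ Z Ks N (φ : SAT.CNF N),
    (∀ cl ∈ φ, cl.length ≤ k) →
      len ((P.size N φ.length ^ 2 : ℕ) : ℤ) ≤ P.size N φ.length ^ e ∧
      ∀ c < P.size N φ.length ^ 2,
        Lens P N φ.length c e Z Ks (width (P.size N φ.length) e Z Ks) := by
  have p1 := (Ctx.ncomp_graphLen (Sit.ncomp_dim (P := P) (k := k) (e := 0) (hK := hK))
    Sit.ncomp_blocks).poly
  have p2 := (Ctx.ncomp_trajLen (Sit.ncomp_dim (P := P) (k := k) (e := 0) (hK := hK))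
    Sit.ncomp_batch).poly
  have p3 := (Sit.ncomp_queries (P := P) (k := k) (e := 0) (hK := hK)).poly
  have p4 := (Sit.ncomp_trials (P := P) (k := k) (e := 0) (hK := hK)).poly
  have p5 := (Sit.ncomp_modulus (P := P) (k := k) (e := 0) (hK := hK)).poly
  have p6 := (Sit.ncomp_threshold (P := P) (k := k) (e := 0) (hK := hK)).poly
  have p7 := (Sit.ncomp_budget (P := P) (k := k) (e := 0) (hK := hK)).poly
  obtain ⟨e, he⟩ := Ctx.poly_add p1 (Ctx.poly_add p2 (Ctx.poly_add p3 (Ctx.poly_add p4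
    (Ctx.poly_add p5 (Ctx.poly_add p6 p7)))))
  have l0 : len ((0 : ℕ) : ℤ) = 1 := by decide
  refine ⟨e, fun Z Ks N φ hφ => ?_⟩
  have key : ∀ c, c ≤ P.size N φ.length ^ 2 →
      len (graphLen (φ.length + 1) (P.blocks N φ.length)) +
      (len (trajLen (φ.length + 1) (P.batch N φ.length c)) +
      (len (P.queries N φ.length c) + (len (P.trials N φ.length c) +
      (len ((P.size N φ.length ^ 2 : ℕ) : ℤ) +
      (len ((3 * scale (φ.length + 1) (P.blocks N φ.length) : ℕ) : ℤ) +
      len (P.budget N φ.length)))))) ≤ P.size N φ.length ^ e := fun c hc =>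
    he ⟨N, φ, hφ, c, 0, 0, hc, by rw [l0, pow_zero], by rw [l0, pow_zero]⟩
  have h0 := key 0 (Nat.zero_le _)
  refine ⟨by omega, fun c hc => ?_⟩
  have hc' := key c hc.le
  have hw : P.size N φ.length ^ e ≤ width (P.size N φ.length) e Z Ks + 1 := by unfold width; omega
  refine ⟨hc, by omega, by omega, by omega, by omega, by omega, by omega, by omega, ?_⟩
  -- Each of the three summands is at most `2 ^ (ℓ - 6)`, and `20 * 3 < 2 ^ 6`.
  have h1 : P.budget N φ.length < 2 ^ (P.size N φ.length ^ e + P.size N φ.length * Z + Ks) := by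
    have := natAbs_lt_of_len (z := (P.budget N φ.length : ℤ))
    rw [Int.natAbs_natCast] at this
    exact this.trans_le (Nat.pow_le_pow_right (by norm_num) (by omega))
  have h2 : P.size N φ.length ^ Z ≤ 2 ^ (P.size N φ.length ^ e + P.size N φ.length * Z + Ks) := by
    calc P.size N φ.length ^ Z ≤ (2 ^ P.size N φ.length) ^ Z := Nat.pow_le_pow_left Nat.lt_two_pow_self.le _
      _ = 2 ^ (P.size N φ.length * Z) := (pow_mul _ _ _).symm
      _ ≤ _ := Nat.pow_le_pow_right (by norm_num) (by omega)
  have h3 : Ks < 2 ^ (P.size N φ.length ^ e + P.size N φ.length * Z + Ks) :=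
    Nat.lt_two_pow_self.trans_le (Nat.pow_le_pow_right (by norm_num) (by omega))
  rw [width, pow_add]
  omega

/-- Bounded by a polynomial in the size. -/
def PolyCost (P : Par) (q : ℕ → ℕ → ℕ → ℕ) : Prop :=
  ∃ a z, ∀ N M c, q N M c ≤ a * P.size N M ^ z

/-- Bounded by a polynomial in the size times the time that is aimed at. -/
def Cheap (P : Par) (q : ℕ → ℕ → ℕ → ℕ) : Prop :=
  ∃ a z, ∀ N M c, q N M c ≤ a * P.size N M ^ z * 2 ^ (N - P.low N / P.D₂)

section

variable {P : Par} {q q' : ℕ → ℕ → ℕ → ℕ}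

theorem PolyCost.const (a : ℕ) : PolyCost P fun _ _ _ => a := ⟨a, 0, fun _ _ _ => by simp⟩

theorem PolyCost.size_pow (z : ℕ) : PolyCost P fun N M _ => P.size N M ^ z :=
  ⟨1, z, fun _ _ _ => by simp⟩

theorem PolyCost.mul (h : PolyCost P q) (h' : PolyCost P q') :
    PolyCost P fun N M c => q N M c * q' N M c := by
  obtain ⟨a, z, h⟩ := h
  obtain ⟨a', z', h'⟩ := h'
  refine ⟨a * a', z + z', fun N M c => (Nat.mul_le_mul (h N M c) (h' N M c)).trans (le_of_eq ?_)⟩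
  ring

theorem add_le_of_le {x y a a' z z' n : ℕ} (hn : 0 < n) (hx : x ≤ a * n ^ z)
    (hy : y ≤ a' * n ^ z') : x + y ≤ (a + a') * n ^ (z + z') := by
  have h1 : a * n ^ z ≤ a * n ^ (z + z') :=
    Nat.mul_le_mul_left _ (Nat.pow_le_pow_right hn (by omega))
  have h2 : a' * n ^ z' ≤ a' * n ^ (z + z') :=
    Nat.mul_le_mul_left _ (Nat.pow_le_pow_right hn (by omega))
  rw [Nat.add_mul]
  omega

theorem PolyCost.add (hK : 0 < P.K) (h : PolyCost P q) (h' : PolyCost P q') :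
    PolyCost P fun N M c => q N M c + q' N M c := by
  obtain ⟨a, z, h⟩ := h
  obtain ⟨a', z', h'⟩ := h'
  exact ⟨a + a', z + z', fun N M c => add_le_of_le (by unfold Par.size; omega) (h N M c)
    (h' N M c)⟩

theorem Cheap.add (hK : 0 < P.K) (h : Cheap P q) (h' : Cheap P q') :
    Cheap P fun N M c => q N M c + q' N M c := by
  obtain ⟨a, z, h⟩ := h
  obtain ⟨a', z', h'⟩ := h'
  refine ⟨a + a', z + z', fun N M c => (Nat.add_le_add (h N M c) (h' N M c)).trans ?_⟩
  rw [← Nat.add_mul]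
  exact Nat.mul_le_mul_right _ (add_le_of_le (by unfold Par.size; omega) le_rfl le_rfl)

theorem Cheap.mul (h : Cheap P q) (h' : PolyCost P q') :
    Cheap P fun N M c => q N M c * q' N M c := by
  obtain ⟨a, z, h⟩ := h
  obtain ⟨a', z', h'⟩ := h'
  refine ⟨a * a', z + z', fun N M c => (Nat.mul_le_mul (h N M c) (h' N M c)).trans (le_of_eq ?_)⟩
  ring

theorem PolyCost.mul_cheap (h : PolyCost P q) (h' : Cheap P q') :
    Cheap P fun N M c => q N M c * q' N M c := by
  simpa only [Nat.mul_comm] using h'.mul h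

theorem PolyCost.cheap (h : PolyCost P q) : Cheap P q := by
  obtain ⟨a, z, h⟩ := h
  exact ⟨a, z, fun N M c => (h N M c).trans (Nat.le_mul_of_pos_right _ (by positivity))⟩

theorem Cheap.of_le (h : Cheap P q') (hle : ∀ N M c, q N M c ≤ q' N M c) : Cheap P q := by
  obtain ⟨a, z, h⟩ := h
  exact ⟨a, z, fun N M c => (hle N M c).trans (h N M c)⟩

theorem div_le_low {N : ℕ} : P.low N / P.D₂ ≤ P.low N := Nat.div_le_self _ _

theorem cheap_graphLen (hK : 100 ≤ P.K) (hD : 2 ≤ P.D) :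
    Cheap P fun N M _ => graphLen (M + 1) (P.blocks N M) := by
  refine ⟨2, P.E + 2, fun N M c => ?_⟩
  have h1 := Par.graphSize_le (P := P) (N := N) (M := M) hK
  have h2 := Par.two_pow_mul_low_le (P := P) (N := N) (d := 1) hD div_le_low
  rw [Nat.one_mul] at h2
  have hpos : 0 < graphSize (M + 1) (P.blocks N M) :=
    Nat.mul_pos (Par.blocks_pos (by omega)) (by omega)
  calc graphLen (M + 1) (P.blocks N M) ≤ 2 * (2 * graphSize (M + 1) (P.blocks N M)) := by
        unfold graphLen; omega
    _ ≤ 2 * (P.blocks N M * P.size N M ^ 2) := Nat.mul_le_mul_left _ h1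
    _ = 2 * P.size N M ^ (P.E + 2) * 2 ^ P.low N := by rw [Par.blocks]; ring
    _ ≤ _ := Nat.mul_le_mul_left _ h2

theorem cheap_budget : Cheap P fun N M _ => P.budget N M :=
  ⟨1, P.b, fun N M _ => by rw [Nat.one_mul]; exact le_rfl⟩

theorem cheap_queries : Cheap P fun N M c => P.queries N M c :=
  ⟨2, 0, fun N M c => by simpa using Par.queries_le div_le_low⟩

/-- A single trajectory may be very long and the queries may be very many, but not both: the
estimate has to be made for the product. -/
theorem cheap_queries_mul_trajLen (hK : 100 ≤ P.K) (hR : 0 < P.R) (hG : P.G + 1 ≤ P.D) :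
    Cheap P fun N M c => P.queries N M c * trajLen (M + 1) (P.batch N M c) := by
  refine ⟨3, P.E * P.G + 3, fun N M c => ?_⟩
  have h1 := Par.trajSize_le (P := P) (N := N) (M := M) (c := c) hK hR
  have h2 := Par.queries_mul_batch_le (P := P) (N := N) (M := M) (c := c) (by omega) hG
  have h3 : 2 ^ (N - P.low N) ≤ 2 ^ (N - P.low N / P.D₂) :=
    Nat.pow_le_pow_right (by norm_num) (by have := div_le_low (P := P) (N := N); omega)
  calc P.queries N M c * trajLen (M + 1) (P.batch N M c)
      ≤ P.queries N M c * (3 * (P.batch N M c * P.size N M ^ 2)) := by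
        refine Nat.mul_le_mul_left _ ?_
        have : 0 < trajSize (M + 1) (P.batch N M c) := by unfold trajSize; omega
        unfold trajLen; omega
    _ = P.queries N M c * P.batch N M c * (3 * P.size N M ^ 2) := by ring
    _ ≤ 2 ^ (N - P.low N / P.D₂) * P.size N M ^ (P.E * P.G + 1) * (3 * P.size N M ^ 2) :=
        Nat.mul_le_mul_right _ (h2.trans (Nat.mul_le_mul_right _ h3))
    _ = _ := by ring

/-- Testing the assignments of one query is affordable as a batch has at most `2 ^ (P.G * P.low N)`
elements up to polynomials, and `P.G + 2 ≤ P.D`. Only one query per candidate is tested. -/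
theorem cheap_trials (hG : P.G + 2 ≤ P.D) : Cheap P fun N M c => P.trials N M c := by
  refine ⟨1, P.E * P.G, fun N M c => ?_⟩
  have h := Par.batch_mul_two_pow_le (P := P) (N := N) (M := M) (c := c) (d := 1) hG div_le_low
  rw [Nat.one_mul] at h
  rw [Nat.one_mul, Nat.mul_comm (P.size N M ^ _)]
  exact h

theorem cheap_candCost (hK : 100 ≤ P.K) (hR : 0 < P.R) (hD : 2 ≤ P.D) (hG : P.G + 2 ≤ P.D)
    (e Z Ks : ℕ) :
    Cheap P fun N M c => candCost P N M c e Z Ks (width (P.size N M) e Z Ks) := by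
  have hK0 : 0 < P.K := by omega
  have pc := PolyCost.const (P := P)
  have ps := PolyCost.size_pow (P := P)
  have pw : PolyCost P fun N M _ => width (P.size N M) e Z Ks := by
    have h := (((ps e).add hK0 ((ps 1).mul (pc Z))).add hK0 (pc Ks)).add hK0 (pc 6)
    simpa only [width, pow_one] using h
  have pk : PolyCost P fun N M _ => Ks * (width (P.size N M) e Z Ks + 1) :=
    (pc Ks).mul (pw.add hK0 (pc 1))
  have py : PolyCost P fun N M _ => 6 * P.size N M ^ Z + 12 * P.size N M ^ e :=
    ((pc 6).mul (ps Z)).add hK0 ((pc 12).mul (ps e))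
  have cq := cheap_queries (P := P)
  have cqc : Cheap P fun N M c =>
      P.queries N M c * queryCost P N M c e Z Ks (width (P.size N M) e Z Ks) := by
    have h1 : PolyCost P fun N M _ => 2 * (Ks * (width (P.size N M) e Z Ks + 1)) +
        (6 * P.size N M ^ Z + 12 * P.size N M ^ e) + 40 + 13 * P.size N M ^ e :=
      ((((pc 2).mul pk).add hK0 py).add hK0 (pc 40)).add hK0 ((pc 13).mul (ps e))
    refine ((cq.mul h1).add hK0 ((cheap_queries_mul_trajLen hK hR (by omega)).mul py)).of_le
      fun N M c => le_of_eq ?_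
    rw [queryCost]
    ring
  have one : Cheap P fun _ _ _ => 1 := (pc 1).cheap
  have c1 : Cheap P fun N M _ => 5 * P.size N M ^ Z + 8 * P.size N M ^ e + 40 :=
    ((((pc 5).mul (ps Z)).add hK0 ((pc 8).mul (ps e))).add hK0 (pc 40)).cheap
  have c2 := ((cheap_graphLen hK hD).add hK0 one).mul py
  have c3 := pk.mul_cheap (((((pc 2).mul_cheap (cheap_budget (P := P)))).add hK0
    ((ps Z).add hK0 (pc Ks)).cheap).add hK0 (pc 2).cheap)
  have c5 := ((cheap_trials hG).add hK0 one).mul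
    ((((pc 10).mul (ps Z)).add hK0 ((pc 40).mul (ps e))).add hK0 (pc 40))
  exact (((c1.add hK0 c2).add hK0 c3).add hK0 cqc).add hK0 c5

end

end RAM

/-! ### Choice of the parameters and conclusion -/

open MapMatching RAM in
theorem no_restricted_dataStructure (hSETH : SAT.SETH) {δ γ c₁ c₂ : ℝ} (hδ : 0 < δ) (hγ : 0 < γ)
    (hc₁ : 0 < c₁) (hc : c₁ < c₂) :
    ¬ HasDataStructure 4 (2.999 : ℝ) δ
      (fun p q => c₁ * (p : ℝ) ^ γ ≤ (q : ℝ) ∧ (q : ℝ) ≤ c₂ * (p : ℝ) ^ γ) := by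
  rintro ⟨prep, query, C, α, hds⟩
  have hcc : 0 < c₂ - c₁ := by linarith
  have large : ∀ x y : ℝ, 0 < y → ∃ m : ℕ, ∀ m' : ℕ, m ≤ m' → x ≤ m' * y := by
    intro x y hy
    obtain ⟨m, hm⟩ := exists_nat_ge (x / y)
    rw [div_le_iff₀ hy] at hm
    exact ⟨m, fun m' h => hm.trans (mul_le_mul_of_nonneg_right (by exact_mod_cast h) hy.le)⟩
  obtain ⟨D₁, hD₁⟩ := large 1 δ hδ
  obtain ⟨D₂, hD₂, hD₂0⟩ : ∃ D₂, D₁ ≤ D₂ ∧ 1 ≤ D₂ := ⟨D₁ + 1, by omega, by omega⟩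
  obtain ⟨E₁, hE₁⟩ := large 2 γ hγ
  obtain ⟨E, hE, hE2⟩ : ∃ E, E₁ ≤ E ∧ 2 ≤ E := ⟨E₁ + 2, by omega, by omega⟩
  obtain ⟨G, hG⟩ := exists_nat_ge (2 * γ + 1)
  obtain ⟨R₁, hR₁⟩ := large (2 * c₁) _ hcc
  obtain ⟨R, hR, hR0⟩ : ∃ R, R₁ ≤ R ∧ 0 < R := ⟨R₁ + 1, by omega, by omega⟩
  obtain ⟨C₀, hC₀⟩ := exists_nat_ge C
  obtain ⟨K₁, hK₁⟩ := large (4 * R) _ hc₁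
  obtain ⟨K₂, hK₂⟩ := large 14 _ hcc
  obtain ⟨K₃, hK₃⟩ := exists_nat_ge c₁
  -- The summand `α` makes room for the construction, `G` for the largest trajectories and for the
  -- final test of assignments.
  set D := α + G + 2 with hD
  -- A fraction `1 / D` of the variables is low, and a fraction `1 / D₂` of these is saved, where `1
  -- / D₂ ≤ δ`.
  set ε : ℝ := 1 / ((D : ℝ) * D₂) with hε
  have hDpos : (0 : ℝ) < D := by rw [hD]; positivity
  have hD₂pos : (0 : ℝ) < D₂ := by exact_mod_cast hD₂0
  obtain ⟨k, hk⟩ := hSETH ε (by positivity)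
  apply hk
  -- The clause width `k` is known only after `ε`, so the constant added to the size is chosen last
  -- and dominates everything that has to be small compared with the size.
  obtain ⟨K, hK⟩ : ∃ K, K = k + 2 + 200 + C₀ + (E + 6) + K₁ + K₂ + K₃ +
    R * (G * (1 + E) + 1) := ⟨_, rfl⟩
  set P : Par := ⟨D, D₂, E, G, R, K, (1 + (E + 2) * α) + (E + E * G + 6) + 3⟩ with hP
  have hKP : k + 2 ≤ P.K := by change k + 2 ≤ K; omega
  obtain ⟨e, he⟩ := exists_lens P k hKP
  obtain ⟨kit⟩ := exists_kit P k e hKP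
  obtain ⟨Ks, hKs⟩ := exists_simConst prep query
  have hK0 : 0 < P.K := by omega
  have hK200 : 200 ≤ P.K := by change 200 ≤ K; omega
  obtain ⟨a, z, haz⟩ := cheap_candCost (P := P) (by omega) hR0 (by change 2 ≤ D; omega)
    (by change G + 2 ≤ D; omega) e kit.Z Ks
  have hT : Cheap P fun N M _ => a * P.size N M ^ z * 2 ^ (N - P.low N / P.D₂) :=
    ⟨a, z, fun _ _ _ => le_rfl⟩
  have hps := PolyCost.size_pow (P := P)
  have hpc := PolyCost.const (P := P)
  have htotal := ((((hps 2).mul_cheap (hT.add hK0 ((hpc 12).mul (hps e)).cheap)).add hK0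
    (hps kit.Z).cheap).add hK0 ((hpc 8).mul (hps e)).cheap).add hK0 (hpc 10).cheap
  obtain ⟨a', z', haz'⟩ := htotal
  refine ⟨searchProg kit prep query, 2 * a' * (K : ℝ) ^ z', z', fun N φ hφ => ?_⟩
  have hn : 2 ≤ P.size N φ.length := by unfold Par.size; omega
  obtain ⟨c, hcn, hlo, hhi⟩ := exists_candidate (P := P) (N := N) (M := φ.length) (c₂ := c₂) hγ hc₁
    hR0 (hR₁ R hR) hE2 (hE₁ E hE) hG (by omega)
    ((hK₁ K (by omega)).trans_eq (mul_comm _ _)) (hK₂ K (by omega))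
    (hK₃.trans (by exact_mod_cast (by omega : K₃ ≤ K)))
    (by change R * (G * (1 + E) + 1) ≤ K; omega)
  have hgood : Good P φ c prep query := by
    refine good_of_dataStructure (P := P) (C := C) (δ := δ) (α := α) (C₀ := C₀)
      (R := fun p q => c₁ * (p : ℝ) ^ γ ≤ (q : ℝ) ∧ (q : ℝ) ≤ c₂ * (p : ℝ) ^ γ) hds hC₀ ?_
      hD₂0 hK200 (by change C₀ ≤ K; omega) (by change E + 6 ≤ K; omega)
      (by change 1 ≤ E; omega) hR0 (by change α + 1 ≤ D; omega) (by change G + 1 ≤ D; omega)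
      le_rfl ⟨hlo, hhi⟩
    rw [div_le_iff₀ hD₂pos, mul_comm]
    exact hD₁ D₂ hD₂
  obtain ⟨hlen, hL⟩ := he kit.Z Ks N φ hφ
  obtain ⟨s, t, hrun, ht, hs⟩ := search_run kit hφ hn hL hlen (fun c' _ => haz N φ.length c') hKs
    hcn hgood fun hsat => exists_yes hK0 hR0 hsat
  refine ⟨s, t, hrun, ?_, hs⟩
  have ht' : t ≤ a' * P.size N φ.length ^ z' * 2 ^ (N - P.low N / P.D₂) :=
    ht.trans (haz' N φ.length 0)
  have hf : (P.low N / P.D₂ : ℕ) ≤ N := (Nat.div_le_self _ _).trans (Nat.div_le_self _ _)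
  have hfε : ε * N - 1 ≤ ((P.low N / P.D₂ : ℕ) : ℝ) := by
    have h1 : P.low N / P.D₂ = N / (D * D₂) := Nat.div_div_eq_div_mul _ _ _
    have h2 := Nat.lt_div_mul_add (a := N) (b := D * D₂) (by positivity)
    rw [h1]
    have h3 : (N : ℝ) < (N / (D * D₂) : ℕ) * ((D : ℝ) * D₂) + (D : ℝ) * D₂ := by
      exact_mod_cast h2
    have h4 : ε * N = N / ((D : ℝ) * D₂) := by rw [hε]; ring
    rw [h4, sub_le_iff_le_add, div_le_iff₀ (by positivity)]
    linarith
  -- The saved exponent is `ε * N` rounded down, which costs the factor `2`.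
  have hU : (2 : ℝ) ^ (N - P.low N / P.D₂) ≤ 2 * (2 : ℝ) ^ ((1 - ε) * (N : ℝ)) := by
    rw [← Real.rpow_natCast, Nat.cast_sub hf]
    calc (2 : ℝ) ^ ((N : ℝ) - (P.low N / P.D₂ : ℕ)) ≤ (2 : ℝ) ^ (1 + (1 - ε) * (N : ℝ)) :=
          Real.rpow_le_rpow_of_exponent_le (by norm_num) (by linarith)
      _ = _ := by rw [Real.rpow_add (by norm_num), Real.rpow_one]
  have hsz : (P.size N φ.length : ℝ) ≤ K * ((N : ℝ) + φ.length + 1) := by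
    have : P.size N φ.length ≤ K * (N + φ.length + 1) := by
      change N + φ.length + K ≤ _
      have h1 : 1 * (N + φ.length) ≤ K * (N + φ.length) := Nat.mul_le_mul_right _ hK0
      rw [Nat.mul_succ]
      omega
    exact_mod_cast this
  calc (t : ℝ) ≤ a' * (P.size N φ.length : ℝ) ^ z' * 2 ^ (N - P.low N / P.D₂) := by
        exact_mod_cast ht'
    _ ≤ a' * (K * ((N : ℝ) + φ.length + 1)) ^ z' * (2 * (2 : ℝ) ^ ((1 - ε) * (N : ℝ))) := by
        gcongr
    _ = _ := by rw [mul_pow]; ring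

theorem MapMatching.HasDataStructure.mono {κ : ℕ} {ρ δ : ℝ} {R R' : ℕ → ℕ → Prop}
    (h : MapMatching.HasDataStructure κ ρ δ R) (hR : ∀ p q, R' p q → R p q) :
    MapMatching.HasDataStructure κ ρ δ R' := by
  obtain ⟨prep, query, C, α, h⟩ := h
  refine ⟨prep, query, C, α, fun P h1 h2 h3 => ?_⟩
  obtain ⟨s₀, t₀, S, h4, h5, h6, h7⟩ := h P h1 h2 h3
  exact ⟨s₀, t₀, S, h4, h5, h6, fun s hs Q hQ hb hq => h7 s hs Q hQ hb (hR _ _ hq)⟩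

theorem theorem4 (hSETH : SAT.SETH) :
    ∃ κ : ℕ, ∀ δ : ℝ, 0 < δ →
      (¬ MapMatching.HasDataStructure κ (2.999 : ℝ) δ (fun _ _ => True)) ∧
      ∀ γ c₁ c₂ : ℝ, 0 < γ → 0 < c₁ → c₁ < c₂ →
        ¬ MapMatching.HasDataStructure κ (2.999 : ℝ) δ
          (fun p q => c₁ * (p : ℝ) ^ γ ≤ (q : ℝ) ∧ (q : ℝ) ≤ c₂ * (p : ℝ) ^ γ) :=
  -- Without a restriction on `q` the data structure works in particular for `p ≤ q ≤ 2 * p`.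
  ⟨4, fun _ hδ => ⟨fun h => no_restricted_dataStructure hSETH hδ one_pos one_pos one_lt_two
    (h.mono fun _ _ _ => trivial), fun _ _ _ hγ hc₁ hc =>
      no_restricted_dataStructure hSETH hδ hγ hc₁ hc⟩⟩
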